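/- **Setup.** A signature of length $N$ is an $N$-tuple of integers $\lambda=(\lambda_1\ge\dots\ge\lambda_N)$; $\mathbb{GT}_N$ is the set of them. The Schur function $s_\lambda(x_1,\dots,x_N)$ is the symmetric Laurent polynomial $\det[x_i^{\lambda_j+N-j}]/\det[x_i^{N-j}]$. For a probability measure $\rho_N$ on $\mathbb{GT}_N$ its Schur generating function is $$S_{\rho_N}(x_1,\dots,x_N)=\sum_{\lambda\in\mathbb{GT}_N}\rho_N(\lambda)\,\frac{s_\lambda(x_1,\dots,x_N)}{s_\lambda(1^N)} .$$ Let $\rho=\{\rho_N\}_{N\ge1}$ be a sequence of probability measures, $\rho_N$ on $\mathbb{GT}_N$, such that for every $N$ this series converges uniformly in an open neighborhood of $(1^N)$. Assume that $\rho$ is *appropriate*: there are reals $\{c_k\}_{k\ge1}$, $\{d_{k,l}\}_{k,l\ge1}$ such that * for every $N$, $\log S_{\rho_N}$ is holomorphic in an open complex neighborhood of $(1^N)$; * $\lim_{N\to\infty}\frac1N\,\partial_i^k\log S_{\rho_N}\big|_{\vec x=1}=c_k$ for every index $i$ and every $k\ge1$; * $\lim_{N\to\infty}\partial_i^k\partial_j^l\log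 S_{\rho_N}\big|_{\vec x=1}=d_{k,l}$ for all distinct indices $i\ne j$ and all $k,l\ge1$; * $\lim_{N\to\infty}\partial_{i_1}\cdots\partial_{i_s}\log S_{\rho_N}\big|_{\vec x=1}=0$ whenever at least three of the indices $i_1,\dots,i_s$ are distinct; * the series $$F_\rho(x)=\sum_{k\ge1}\frac{c_k}{(k-1)!}(x-1)^{k-1},\qquad G_\rho(x,y)=\sum_{k,l\ge1}\frac{d_{k,l}}{(k-1)!\,(l-1)!}(x-1)^{k-1}(y-1)^{l-1}$$ converge in open neighborhoods of $1$ and $(1,1)$, respectively. Put $Q_\rho(z,w)=G_\rho(1+z,1+w)+\dfrac1{(z-w)^2}$. For $k_1\ge k_2$ and $\lambda\in\mathbb{GT}_{k_1}$ the Schur branching coefficients $\mathrm{pr}_{k_1\to k_2}(\lambda\to\mu)$, $\mu\in\mathbb{GT}_{k_2}$, are defined by the (finite) expansion $$\frac{s_\lambda(x_1,\dots,x_{k_2},1^{k_1-k_2})}{s_\lambda(1^{k_1})}=\sum_{\mu\in\mathbb{GT}_{k_2}}\mathrm{pr}_{k_1\to k_2}(\lambda\to\mu)\,\frac{s_\mu(x_1,\dots,x_{k_2})}{s_\mu(1^{k_2})}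 .$$ Let $n\ge1$ and let $0<a_1\le a_2\le\dots\le a_n=1$ be fixed reals; $[\,\cdot\,]$ denotes the integer part. For every $N$ consider on $\mathbb{GT}_{[a_1N]}\times\dots\times\mathbb{GT}_{[a_nN]}$ the weights $$\mathrm{Prob}(\lambda^{(1)},\dots,\lambda^{(n)})=\rho_N(\lambda^{(n)})\prod_{i=1}^{n-1}\mathrm{pr}_{[a_{i+1}N]\to[a_iN]}(\lambda^{(i+1)}\to\lambda^{(i)}),$$ and the power sums $p_k^{[a_tN]}=\sum_{i=1}^{[a_tN]}\bigl(\lambda_i^{(t)}+[a_tN]-i\bigr)^k$, $1\le t\le n$, $k\ge1$. **Theorem.** These weights are nonnegative and define a probability measure. All mixed moments of the power sums under it are finite, and the collection of random variables $$\Bigl\{N^{-k}\bigl(p_k^{[a_tN]}-\mathbf E\,p_k^{[a_tN]}\bigr)\Bigr\}_{t=1,\dots,n;\ k\ge1}$$ converges, as $N\to\infty$, in the sense of moments to a Gaussian vector with zero mean, whose covariance is, for all $1\le t_1\le t_2\le n$, all $k_1,k_2\ge1$ and all sufficiently small $\epsilon>0$, $$\lim_{N\to\infty}\frac{\mathrm{cov}\bigl(p_{k_1}^{[a_{t_1}N]},p_{k_2}^{[a_{t_2}N]}\bigr)}{N^{k_1+k_2}}=\frac{a_{t_1}^{k_1}a_{t_2}^{k_2}}{(2\pi\mathbf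 i)^2}\oint_{|z|=\epsilon}\oint_{|w|=2\epsilon}\Bigl(\frac1z+1+\frac{(1+z)F_\rho(1+z)}{a_{t_1}}\Bigr)^{k_1}\Bigl(\frac1w+1+\frac{(1+w)F_\rho(1+w)}{a_{t_2}}\Bigr)^{k_2}Q_\rho(z,w)\,dz\,dw ,$$ where both contours are counter-clockwise. -/

import Mathlib

open MeasureTheory ProbabilityTheory Filter Topology

noncomputable section

namespace SchurCLT

/-- Signatures of length `N`: non-increasing `N`-tuples of integers. -/
def Signature (N : ℕ) : Type := {l : Fin N → ℤ // Antitone l}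

instance (N : ℕ) : CoeFun (Signature N) (fun _ => Fin N → ℤ) := ⟨Subtype.val⟩

instance (N : ℕ) : Countable (Signature N) :=
  inferInstanceAs (Countable {l : Fin N → ℤ // Antitone l})

instance (N : ℕ) : MeasurableSpace (Signature N) := ⊤

instance (N : ℕ) : DiscreteMeasurableSpace (Signature N) := ⟨fun _ => trivial⟩

/-- The alternant `det [x_i ^ (l_j + N - j)]` (indices start from `0`, hence `N - 1 - j`). -/
def alternant {N : ℕ} (l : Fin N → ℤ) (x : Fin N → ℂ) : ℂ :=
  (Matrix.of fun i j : Fin N => x i ^ (l j + N - 1 - (j : ℕ))).det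

/-- The points with nonzero, pairwise distinct coordinates; here the ratio of alternants makes
sense. -/
def regularPoints (N : ℕ) : Set (Fin N → ℂ) := {x | (∀ i, x i ≠ 0) ∧ Function.Injective x}

/-- The Schur function `s_l = det [x_i ^ (l_j + N - j)] / det [x_i ^ (N - j)]`. The ratio is a
Laurent polynomial, so that its value at a point with nonzero but possibly coinciding coordinates
(for instance at `(1, …, 1)`) is the limit of the ratio along regular points. -/
def schur {N : ℕ} (l : Signature N) : (Fin N → ℂ) → ℂ :=
  extendFrom (regularPoints N) fun x => alternant l x / alternant (0 : Fin N → ℤ) x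

/-- The normalized Schur function `s_l (x) / s_l (1, …, 1)`. -/
def normSchur {N : ℕ} (l : Signature N) (x : Fin N → ℂ) : ℂ := schur l x / schur l 1

/-- The Schur generating function of a probability measure on signatures of length `N`. -/
def schurGen {N : ℕ} (ρ : PMF (Signature N)) (x : Fin N → ℂ) : ℂ :=
  ∑' l : Signature N, ((ρ l).toReal : ℂ) * normSchur l x

/-- The series defining the Schur generating function converges uniformly in an open
neighbourhood of `(1, …, 1)`. -/
def HasSchurGen {N : ℕ} (ρ : PMF (Signature N)) : Prop :=
  ∃ U : Set (Fin N → ℂ), IsOpen U ∧ 1 ∈ U ∧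
    SummableUniformlyOn (fun (l : Signature N) x => ((ρ l).toReal : ℂ) * normSchur l x) U

/-- The partial derivative in the variable number `i` (numbered from `0`); it is `0` if there is no
such variable, so that a fixed index makes sense for every `N`. -/
def partialDeriv {N : ℕ} (i : ℕ) (f : (Fin N → ℂ) → ℂ) : (Fin N → ℂ) → ℂ :=
  fun x => fderiv ℂ f x fun j => if (j : ℕ) = i then 1 else 0

/-- The sequence `f_N` of symmetric functions in `N` variables is (CLT-)appropriate with limiting
coefficients `c_k`, `d_{k,l}` (`k, l ≥ 1`). Symmetry is not repeated here, as Schur generating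
functions are symmetric; they also have value `1` at `(1, …, 1)`, so that the principal branch
of the logarithm is the relevant one. -/
structure IsAppropriate (f : ∀ N : ℕ, (Fin N → ℂ) → ℂ) (c : ℕ → ℝ) (d : ℕ → ℕ → ℝ) : Prop where
  log_analytic : ∀ N, 1 ≤ N → AnalyticAt ℂ (fun x => Complex.log (f N x)) 1
  one_index : ∀ i k : ℕ, 1 ≤ k →
    Tendsto (fun N : ℕ => (partialDeriv i)^[k] (fun x => Complex.log (f N x)) 1 / (N : ℂ))
      atTop (𝓝 (c k : ℂ))
  two_indices : ∀ i j k l : ℕ, i ≠ j → 1 ≤ k → 1 ≤ l →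
    Tendsto (fun N : ℕ =>
        (partialDeriv i)^[k] ((partialDeriv j)^[l] (fun x => Complex.log (f N x))) 1)
      atTop (𝓝 (d k l : ℂ))
  many_indices : ∀ I : List ℕ, 3 ≤ I.toFinset.card →
    Tendsto (fun N : ℕ => I.foldr partialDeriv (fun x => Complex.log (f N x)) 1)
      atTop (𝓝 0)
  summable_one : ∃ r : ℝ, 0 < r ∧ ∀ x : ℂ, ‖x - 1‖ < r →
    Summable fun k : ℕ => (c (k + 1) : ℂ) / (k.factorial : ℂ) * (x - 1) ^ k
  summable_two : ∃ r : ℝ, 0 < r ∧ ∀ x y : ℂ, ‖x - 1‖ < r → ‖y - 1‖ < r →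
    Summable fun m : ℕ × ℕ => (d (m.1 + 1) (m.2 + 1) : ℂ) /
      ((m.1.factorial : ℂ) * (m.2.factorial : ℂ)) * (x - 1) ^ m.1 * (y - 1) ^ m.2

/-- `F (x) = ∑_{k ≥ 1} c_k / (k - 1)! (x - 1)^(k - 1)`. -/
def limitF (c : ℕ → ℝ) (x : ℂ) : ℂ :=
  ∑' k : ℕ, (c (k + 1) : ℂ) / (k.factorial : ℂ) * (x - 1) ^ k

/-- `G (x, y) = ∑_{k, l ≥ 1} d_{k,l} / ((k - 1)! (l - 1)!) (x - 1)^(k - 1) (y - 1)^(l - 1)`. -/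
def limitG (d : ℕ → ℕ → ℝ) (x y : ℂ) : ℂ :=
  ∑' m : ℕ × ℕ, (d (m.1 + 1) (m.2 + 1) : ℂ) /
    ((m.1.factorial : ℂ) * (m.2.factorial : ℂ)) * (x - 1) ^ m.1 * (y - 1) ^ m.2

/-- `Q (z, w) = G (1 + z, 1 + w) + 1 / (z - w)^2`. -/
def limitQ (d : ℕ → ℕ → ℝ) (z w : ℂ) : ℂ := limitG d (1 + z) (1 + w) + 1 / (z - w) ^ 2

/-- `(x_1, …, x_m) ↦ (x_1, …, x_m, 1, …, 1)`, with `k` entries, for `m ≤ k`. -/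
def padOne {m : ℕ} (k : ℕ) (x : Fin m → ℂ) : Fin k → ℂ :=
  fun i => if h : (i : ℕ) < m then x ⟨i, h⟩ else 1

/-- The Schur branching coefficients `pr_{k → m} (l → μ)`, `m ≤ k`: the coefficients of the (unique,
finite) expansion of `s_l (x_1, …, x_m, 1, …, 1) / s_l (1, …, 1)` in the normalized Schur
functions `s_μ (x_1, …, x_m) / s_μ (1, …, 1)`. -/
def branching {k : ℕ} (m : ℕ) (l : Signature k) : Signature m →₀ ℝ :=
  Classical.epsilon fun p : Signature m →₀ ℝ =>
    ∀ x : Fin m → ℂ, (∀ i, x i ≠ 0) →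
      normSchur l (padOne k x) = p.sum fun μ r => (r : ℂ) * normSchur μ x

/-- The length `[a_t N]` of the signature on level `t`. -/
def levelSize {n : ℕ} (a : Fin (n + 1) → ℝ) (N : ℕ) (t : Fin (n + 1)) : ℕ := ⌊a t * N⌋₊

/-- Configurations: one signature of length `[a_t N]` for each of the `n + 1` levels. -/
abbrev Config {n : ℕ} (a : Fin (n + 1) → ℝ) (N : ℕ) : Type :=
  ∀ t : Fin (n + 1), Signature (levelSize a N t)

/-- The probability of a configuration: the top level has law `ρ_M`, `M` being the length of the
signature there (so `M = N` if the last `a_t` is `1`); one passes from each level to the one below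
with the Schur branching coefficients. -/
def configProb {n : ℕ} (ρ : ∀ N : ℕ, PMF (Signature N)) (a : Fin (n + 1) → ℝ) (N : ℕ)
    (ω : Config a N) : ℝ :=
  (ρ (levelSize a N (Fin.last n)) (ω (Fin.last n))).toReal *
    ∏ i : Fin n, branching (levelSize a N i.castSucc) (ω i.succ) (ω i.castSucc)

/-- The measure on configurations with the weights `configProb`. -/
def projMeasure {n : ℕ} (ρ : ∀ N : ℕ, PMF (Signature N)) (a : Fin (n + 1) → ℝ) (N : ℕ) :
    Measure (Config a N) :=
  Measure.sum fun ω : Config a N => ENNReal.ofReal (configProb ρ a N ω) • Measure.dirac ω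

/-- The shifted power sum `∑_i (l_i + M - i)^k` of a signature of length `M`
(indices start from `0`, hence `M - 1 - i`). -/
def powerSum {M : ℕ} (k : ℕ) (l : Signature M) : ℝ :=
  ∑ i : Fin M, (((l i + M - 1 - (i : ℕ) : ℤ)) : ℝ) ^ k

/-- The normalized fluctuation `N^(-k) (p_k - E p_k)` of the power sum on level `t`; the index is
`(t, k)` with `k ≥ 1`. -/
def fluctuation {n : ℕ} (ρ : ∀ N : ℕ, PMF (Signature N)) (a : Fin (n + 1) → ℝ) (N : ℕ)
    (q : Fin (n + 1) × ℕ+) (ω : Config a N) : ℝ :=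
  (powerSum q.2 (ω q.1) - ∫ η, powerSum q.2 (η q.1) ∂(projMeasure ρ a N)) / (N : ℝ) ^ (q.2 : ℕ)

/-- The double contour integral, over `|z| = ε` and `|w| = 2 ε`, counter-clockwise. -/
def covIntegral (F : ℂ → ℂ) (Q : ℂ → ℂ → ℂ) (ε a₁ a₂ : ℝ) (k₁ k₂ : ℕ) : ℂ :=
  (a₁ : ℂ) ^ k₁ * (a₂ : ℂ) ^ k₂ / (2 * (Real.pi : ℂ) * Complex.I) ^ 2 *
    ∮ z in C(0, ε), ∮ w in C(0, 2 * ε),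
      (1 / z + 1 + (1 + z) * F (1 + z) / (a₁ : ℂ)) ^ k₁ *
        (1 / w + 1 + (1 + w) * F (1 + w) / (a₂ : ℂ)) ^ k₂ * Q z w

/-- The families `Y_N` of random variables converge in the sense of moments to the family `ξ`:
all mixed moments exist and converge to those of `ξ`. -/
def ConvergesInMoments {ι : Type*} {Ω : ℕ → Type*} {_ : ∀ N, MeasurableSpace (Ω N)}
    (P : ∀ N, Measure (Ω N)) (Y : ∀ N, ι → Ω N → ℝ)
    {Ω' : Type*} {_ : MeasurableSpace Ω'} (P' : Measure Ω') (ξ : ι → Ω' → ℝ) : Prop :=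
  ∀ (s : ℕ) (q : Fin s → ι),
    (∀ N, Integrable (fun ω => ∏ j, Y N (q j) ω) (P N)) ∧
    Integrable (fun ω => ∏ j, ξ (q j) ω) P' ∧
    Tendsto (fun N => ∫ ω, ∏ j, Y N (q j) ω ∂(P N)) atTop (𝓝 (∫ ω, ∏ j, ξ (q j) ω ∂P'))

end SchurCLT

end

open SchurCLT

/-! The alternant of a signature is a signed sum of monomials, and these are joint eigenfunctions of
the Euler operators `x_i ∂_i`. Let `D_k` be the operator `∑ (x_i ∂_i)^k` conjugated by the
Vandermonde product `V`. Then `s_λ / s_λ(1)` is an eigenfunction of `D_k`, with eigenvalue the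
shifted power sum `p_k(λ)` (`sum_iterate_eulerDeriv_vanderPS_mul_taylor_normSchur`). Passing to a
lower level by branching means setting the last variables to `1` (`branching_spec`). A mixed moment
is therefore computed from the Schur generating function `S` by applying the `D_k` of the top level,
restricting to fewer variables, applying the `D_k` of the next level, and so on, and finally
evaluating at `(1, …, 1)` (`sum_mul_chainAvg`).

Only the jet of `S` at `(1, …, 1)` matters, so everything is done with power series in `z_i = x_i -
1`, up to a finite order. This also gives finiteness of the moments: the conditional moments given
the top signature are a linear function of a finite jet of its normalized Schur function, and the
jets sum to the jet of `S` (`hasSum_mul_chainAvg`).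

A symmetric series is written as a polynomial in the power sums `∑ z_i^(j+1)`, a form on which
restriction to fewer variables does nothing. The division by `V` disappears: with `Q = ∏ (X - z_j)`
one has `(a+1) V⁻¹ ∂_i^a V = Q^(a+1)(z_i) / Q'(z_i)`, and `∑ z_i^n Q^(a+1)(z_i) / Q'(z_i)` is a
universal polynomial in the power sums, the number of variables entering as the power sum of order
`0` (`sum_residue_succ_mul_pow`). Hence `D_k (S g) = S · powOp g`, where `powOp` depends only on the
number of variables `μ` and on `W`, the derivative of `log S` (`le_order_sub_evPsum_powOp`).

The asymptotics then become algebra. With a scale `t` inserted, `powOp` is homogeneous of degree `k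
+ 1` in `(t, μ, W)`, so one may take `t = 1/N` and divide `μ` and `W` by `N`. Appropriateness says
that `W/N` is `f(z) + t ∂P`, where `f` tends to the expansion of `F(1+z)` and `P` tends to a
polynomial in the power sums with scalar second derivatives, given by `G`. Modulo `t²` the operator
is a scalar plus `t` times a first order differential operator, and centering removes the scalars
(`exists_centeredPow_eq`). A product of `r` centered power sums thus gives `t^r` times the constant
term of a composition of `r` explicit operators, up to one more factor `t`. In the limit the
commutators of these operators with the derivatives in the power sums are scalars, so the constant
term is a sum over pairings (`constantCoeff_foldr_centeredOp`). Limits are taken by working over the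
ring of convergent sequences (`tendsto_constantCoeff_foldr_centeredPow`).

The pair contraction is the double contour integral expanded term by term (`covIntegral_eq_limCov`).
As a limit of covariances it is a positive semidefinite kernel, so a Gaussian process with this
covariance exists, and its moments are the same sums over pairings (`exists_isGaussianProcess`). -/

noncomputable section

namespace SchurCLT

/-! ### Partial fractions of `Q^(a) / Q` and power sums over the roots of `Q`. -/

section Lagrange

open Polynomial Finset Lagrange

variable {K ι : Type*} [Field K] [Fintype ι] [DecidableEq ι] (z : ι → K)

/-- The coefficients of the partial fraction expansion of `Q^(a) / Q`, where `Q` is the monic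
polynomial with simple roots `z i`. -/
def residue (a : ℕ) (i : ι) : K :=
  eval (z i) (derivative^[a] (nodal univ z)) / eval (z i) (derivative (nodal univ z))

variable {z}

theorem eval_nodal_erase_ne_zero (hz : Function.Injective z) (i : ι) :
    eval (z i) (nodal (univ.erase i) z) ≠ 0 := by
  rw [eval_nodal, prod_ne_zero_iff]
  intro j hj
  exact sub_ne_zero.2 fun h => (mem_erase.1 hj).1 (hz h).symm

theorem eval_derivative_nodal_ne_zero (hz : Function.Injective z) (i : ι) :
    eval (z i) (derivative (nodal univ z)) ≠ 0 := by
  rw [eval_nodal_derivative_eval_node_eq (mem_univ i)]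
  exact eval_nodal_erase_ne_zero hz i

theorem eval_nodal_erase_erase (hz : Function.Injective z) {i j : ι} (hij : i ≠ j) :
    eval (z i) (nodal ((univ.erase i).erase j) z) =
      eval (z i) (derivative (nodal univ z)) / (z i - z j) := by
  rw [eq_div_iff (sub_ne_zero.2 (hz.ne hij)), eval_nodal_derivative_eval_node_eq (mem_univ i),
    nodal_eq_mul_nodal_erase (s := univ.erase i) (mem_erase.2 ⟨hij.symm, mem_univ j⟩)]
  simp [mul_comm]

/-- Lagrange interpolation at the roots: for `a ≥ 1` both sides have degree below the number of
nodes and agree at every node. -/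
theorem iterate_derivative_nodal (hz : Function.Injective z) {a : ℕ} (ha : 1 ≤ a) :
    derivative^[a] (nodal univ z) =
      ∑ j, C (residue z a j) * nodal (univ.erase j) z := by
  refine eq_of_degrees_lt_of_eval_index_eq (univ : Finset ι) hz.injOn ?_ ?_ ?_
  · rcases Nat.eq_zero_or_pos (Fintype.card ι) with h0 | h0
    · have : IsEmpty ι := Fintype.card_eq_zero_iff.1 h0
      obtain ⟨b, rfl⟩ := Nat.exists_eq_add_of_le' ha
      simp [nodal, Function.iterate_succ_apply]
    · refine lt_of_le_of_lt degree_le_natDegree ?_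
      have h := natDegree_iterate_derivative (nodal univ z) a
      rw [natDegree_nodal, card_univ] at h
      rw [card_univ]
      exact_mod_cast lt_of_le_of_lt h (by omega)
  · refine (degree_sum_le _ _).trans_lt ?_
    rcases Nat.eq_zero_or_pos (Fintype.card ι) with h0 | h0
    · have : IsEmpty ι := Fintype.card_eq_zero_iff.1 h0
      simp
    · refine (Finset.sup_lt_iff (by simp)).2 fun j _ => ?_
      refine ((degree_mul_le _ _).trans (add_le_add degree_C_le le_rfl)).trans_lt ?_
      rw [zero_add, degree_nodal, card_erase_of_mem (mem_univ j), card_univ]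
      exact_mod_cast Nat.sub_lt h0 one_pos
  · intro i _
    rw [eval_finsetSum, Finset.sum_eq_single i]
    · rw [eval_mul, eval_C, ← eval_nodal_derivative_eval_node_eq (mem_univ i), residue,
        div_mul_cancel₀ _ (eval_derivative_nodal_ne_zero hz i)]
    · intro j _ hji
      rw [eval_mul, eval_nodal_at_node (mem_erase.2 ⟨hji.symm, mem_univ i⟩), mul_zero]
    · simp

/-- Differentiate the interpolation formula for `Q^(a)` and evaluate at `z i`. The term `j = i`
contributes the derivative of the product over the other nodes; each term `j ≠ i` contributes that
product with one factor removed. -/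
theorem residue_succ (hz : Function.Injective z) {a : ℕ} (ha : 1 ≤ a) (i : ι) :
    residue z (a + 1) i =
      ∑ j ∈ univ.erase i, (residue z a i + residue z a j) / (z i - z j) := by
  have hQ := eval_derivative_nodal_ne_zero hz i
  rw [residue, div_eq_iff hQ, Function.iterate_succ_apply', iterate_derivative_nodal hz ha,
    derivative_sum, eval_finsetSum, ← Finset.add_sum_erase _ _ (mem_univ i), Finset.sum_mul]
  simp only [derivative_C_mul, eval_mul, eval_C]
  rw [derivative_nodal, eval_finsetSum, Finset.mul_sum, ← Finset.sum_add_distrib]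
  refine Finset.sum_congr rfl fun j hj => ?_
  have hij : i ≠ j := (mem_erase.1 hj).1.symm
  rw [eval_nodal_erase_erase hz hij,
    eval_nodal_derivative_eval_node_eq (s := univ.erase j) (mem_erase.2 ⟨hij, mem_univ i⟩),
    erase_right_comm, eval_nodal_erase_erase hz hij]
  ring

/-- Power sums weighted by the residues of `Q^(a + 1) / Q`. -/
theorem sum_residue_succ_mul_pow (hz : Function.Injective z) (a n : ℕ) :
    ∑ i, residue z (a + 2) i * z i ^ n =
      ∑ m ∈ range n, (∑ j, z j ^ m) * ∑ i, residue z (a + 1) i * z i ^ (n - 1 - m)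
      - n * ∑ i, residue z (a + 1) i * z i ^ (n - 1) := by
  have key : ∑ m ∈ range n, (∑ j, z j ^ m) * ∑ i, residue z (a + 1) i * z i ^ (n - 1 - m) =
      ∑ i, ∑ j, residue z (a + 1) i * ∑ m ∈ range n, z j ^ m * z i ^ (n - 1 - m) := by
    simp_rw [Finset.sum_mul_sum, Finset.mul_sum]
    rw [Finset.sum_comm_cycle]
    refine Finset.sum_congr rfl fun i _ => ?_
    rw [Finset.sum_comm]
    exact Finset.sum_congr rfl fun j _ => Finset.sum_congr rfl fun m _ => by ring
  have diag : ∀ i, ∑ m ∈ range n, z i ^ m * z i ^ (n - 1 - m) = n * z i ^ (n - 1) := by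
    intro i
    rw [Finset.sum_congr rfl (g := fun _ => z i ^ (n - 1)), sum_const, card_range, nsmul_eq_mul]
    intro m hm
    rw [← pow_add]
    congr 1
    have := mem_range.1 hm
    omega
  have off : ∀ i, ∀ j ∈ univ.erase i, ∑ m ∈ range n, z j ^ m * z i ^ (n - 1 - m) =
      (z i ^ n - z j ^ n) / (z i - z j) := by
    intro i j hj
    have hij : z i - z j ≠ 0 := sub_ne_zero.2 fun h => (mem_erase.1 hj).1 (hz h).symm
    rw [eq_div_iff hij, ← neg_sub (z j) (z i), mul_neg, geom_sum₂_mul, neg_sub]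
  rw [key]
  simp_rw [fun i : ι => (Finset.add_sum_erase univ (fun j => residue z (a + 1) i *
    ∑ m ∈ range n, z j ^ m * z i ^ (n - 1 - m)) (mem_univ i)).symm, diag]
  rw [Finset.sum_add_distrib, Finset.mul_sum, eq_sub_iff_add_eq, add_comm]
  congr 1
  · exact Finset.sum_congr rfl fun i _ => by ring
  -- The summand carrying `residue j` is rewritten with `i` and `j` exchanged. Together with the
  -- other summand it then forms the difference quotient of `z ↦ z^n`, which is a geometric sum.
  have swap : ∑ i, ∑ j ∈ univ.erase i, residue z (a + 1) j * z i ^ n / (z i - z j) =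
      ∑ i, ∑ j ∈ univ.erase i, residue z (a + 1) i * z j ^ n / (z j - z i) := by
    rw [Finset.sum_comm' (t' := univ) (s' := fun j => univ.erase j)]
    intro i j
    simp [ne_comm]
  calc ∑ i, residue z (a + 2) i * z i ^ n
      = ∑ i, ∑ j ∈ univ.erase i, residue z (a + 1) i * z i ^ n / (z i - z j) +
        ∑ i, ∑ j ∈ univ.erase i, residue z (a + 1) j * z i ^ n / (z i - z j) := by
        rw [← Finset.sum_add_distrib]
        refine Finset.sum_congr rfl fun i _ => ?_
        rw [residue_succ hz (by omega), Finset.sum_mul, ← Finset.sum_add_distrib]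
        exact Finset.sum_congr rfl fun j _ => by ring
    _ = _ := by
        rw [swap, ← Finset.sum_add_distrib]
        refine Finset.sum_congr rfl fun i _ => ?_
        rw [← Finset.sum_add_distrib]
        refine Finset.sum_congr rfl fun j hj => ?_
        rw [off i j hj, show z j - z i = -(z i - z j) by ring, div_neg]
        ring

theorem residue_one (hz : Function.Injective z) (i : ι) : residue z 1 i = 1 :=
  div_self (eval_derivative_nodal_ne_zero hz i)

end Lagrange

/-! ### Operators on polynomials in power sums -/

section Operators

variable {C : Type*} [CommRing C]

/-- The power sums (with scale `t`): `p_0 = μ` and `p_{n+1} = t X_n`. -/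
def scaledPsum (t μ : C) : ℕ → MvPolynomial ℕ C
  | 0 => MvPolynomial.C μ
  | n + 1 => MvPolynomial.C t * MvPolynomial.X n

/-- The sums `∑ i, z_i^n Q^(a+1)(z_i) / Q'(z_i)`, `Q = ∏ i, (X - z_i)`, written in power sums. -/
def residuePoly (t μ : C) : ℕ → ℕ → MvPolynomial ℕ C
  | 0, n => scaledPsum t μ n
  | a + 1, n => ∑ m ∈ Finset.range n, scaledPsum t μ m * residuePoly t μ a (n - 1 - m)
      - MvPolynomial.C t * ((n : MvPolynomial ℕ C) * residuePoly t μ a (n - 1))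

variable (C) in
/-- The derivation on polynomials in `z` and the power sums, the variable `z` being `none`. -/
def optionDeriv : Derivation C (MvPolynomial (Option ℕ) C) (MvPolynomial (Option ℕ) C) :=
  MvPolynomial.mkDerivation C
    (Option.elim · 1 fun j => (j + 1 : MvPolynomial (Option ℕ) C) * MvPolynomial.X none ^ j)

variable (C) in
/-- The derivation that corresponds to the derivative in one variable `z = z_i` of functions of
`z_i` and of the power sums. -/
def totalDeriv : Derivation C (Polynomial (MvPolynomial ℕ C)) (Polynomial (MvPolynomial ℕ C)) :=
  Derivation.mk' ((MvPolynomial.optionEquivLeft C ℕ).toLinearMap ∘ₗ (optionDeriv C).toLinearMap ∘ₗ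
    (MvPolynomial.optionEquivLeft C ℕ).symm.toLinearMap) fun a b => by
    simp [Derivation.leibniz]

theorem totalDeriv_apply (h : Polynomial (MvPolynomial ℕ C)) :
    totalDeriv C h = MvPolynomial.optionEquivLeft C ℕ
      (optionDeriv C ((MvPolynomial.optionEquivLeft C ℕ).symm h)) := rfl

theorem totalDeriv_X : totalDeriv C Polynomial.X = 1 := by
  have h : (MvPolynomial.optionEquivLeft C ℕ).symm Polynomial.X = MvPolynomial.X none := by
    rw [AlgEquiv.symm_apply_eq]; simp
  rw [totalDeriv_apply, h]
  simp [optionDeriv]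

theorem totalDeriv_C_C (c : C) : totalDeriv C (Polynomial.C (MvPolynomial.C c)) = 0 :=
  (totalDeriv C).map_algebraMap c

theorem totalDeriv_C_X (j : ℕ) : totalDeriv C (Polynomial.C (MvPolynomial.X j)) =
    ((j : Polynomial (MvPolynomial ℕ C)) + 1) * Polynomial.X ^ j := by
  have h : (MvPolynomial.optionEquivLeft C ℕ).symm (Polynomial.C (MvPolynomial.X j)) =
      MvPolynomial.X (some j) := by
    rw [AlgEquiv.symm_apply_eq]; simp
  rw [totalDeriv_apply, h]
  simp [optionDeriv]

/-- `e^(-S) ∂^b (e^S g)`, where `t^b` is scaled in and `W = t ∂S`. -/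
def conjDeriv (t : C) (W : Polynomial (MvPolynomial ℕ C)) (g : MvPolynomial ℕ C) :
    ℕ → Polynomial (MvPolynomial ℕ C)
  | 0 => Polynomial.C g
  | b + 1 => Polynomial.C (MvPolynomial.C t) * totalDeriv C (conjDeriv t W g b) +
      W * conjDeriv t W g b

/-- The linear functional `z^n ↦ residuePoly a n`. -/
def residueFun (t μ : C) (a : ℕ) :
    Polynomial (MvPolynomial ℕ C) →ₗ[MvPolynomial ℕ C] MvPolynomial ℕ C :=
  Polynomial.lsum fun n => LinearMap.toSpanSingleton _ _ (residuePoly t μ a n)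

theorem residueFun_C_mul_X_pow (t μ : C) (a n : ℕ) (g : MvPolynomial ℕ C) :
    residueFun t μ a (Polynomial.C g * Polynomial.X ^ n) = g * residuePoly t μ a n := by
  rw [Polynomial.C_mul_X_pow_eq_monomial]
  simp [residueFun]

variable [Algebra ℂ C]

/-- The action of the falling factorial power sum of order `k` on polynomials in power sums. -/
def fallOp (t μ : C) (W : Polynomial (MvPolynomial ℕ C)) (k : ℕ) (g : MvPolynomial ℕ C) :
    MvPolynomial ℕ C :=
  ((k : ℂ) + 1)⁻¹ • ∑ a ∈ Finset.range (k + 1), ((k + 1).choose (a + 1) : ℂ) •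
    residueFun t μ a ((1 + Polynomial.X) ^ k * conjDeriv t W g (k - a))

/-- The action of the power sum of order `k` on polynomials in power sums. -/
def powOp (t μ : C) (W : Polynomial (MvPolynomial ℕ C)) (k : ℕ) (g : MvPolynomial ℕ C) :
    MvPolynomial ℕ C :=
  ∑ j ∈ Finset.range (k + 1), MvPolynomial.C (t ^ (k - j)) *
    ((k.stirlingSecond j : MvPolynomial ℕ C) * fallOp t μ W j g)

end Operators

/-! ### Intertwining with differential operators -/

section Intertwining

variable {M : ℕ}

/-- The symmetric power series given by a polynomial in power sums. -/
def evPsum (M : ℕ) : MvPolynomial ℕ ℂ →ₐ[ℂ] MvPowerSeries (Fin M) ℂ :=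
  MvPolynomial.aeval fun j => ∑ i, MvPowerSeries.X i ^ (j + 1)

/-- Evaluation of polynomials in power sums and the additional variable `z = z_i`. -/
def evPsumVar (i : Fin M) : Polynomial (MvPolynomial ℕ ℂ) →+* MvPowerSeries (Fin M) ℂ :=
  Polynomial.eval₂RingHom (evPsum M : MvPolynomial ℕ ℂ →+* MvPowerSeries (Fin M) ℂ)
    (MvPowerSeries.X i)

theorem evPsumVar_C (i : Fin M) (g : MvPolynomial ℕ ℂ) :
    evPsumVar i (Polynomial.C g) = evPsum M g := by simp [evPsumVar]

theorem evPsumVar_X (i : Fin M) : evPsumVar i Polynomial.X = MvPowerSeries.X i := by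
  simp [evPsumVar]

theorem evPsum_X (j : ℕ) : evPsum M (MvPolynomial.X j) = ∑ i, MvPowerSeries.X i ^ (j + 1) := by
  simp [evPsum]

/-- The chain rule: differentiating `∑ z_l^(j+1)` in `z_i` gives `(j+1) z_i^j`, which is the value
of `totalDeriv` on the variable `X_j`. -/
theorem pderiv_evPsum (i : Fin M) (g : MvPolynomial ℕ ℂ) :
    MvPowerSeries.pderiv ℂ i (evPsum M g) = evPsumVar i (totalDeriv ℂ (Polynomial.C g)) := by
  induction g using MvPolynomial.induction_on with
  | C c =>
    rw [totalDeriv_C_C, map_zero, evPsum, MvPolynomial.aeval_C]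
    exact MvPowerSeries.pderiv_C
  | add p q hp hq => simp only [map_add, hp, hq]
  | mul_X p j hp =>
    have h : MvPowerSeries.pderiv ℂ i (∑ l : Fin M, MvPowerSeries.X l ^ (j + 1)) =
        ((j : MvPowerSeries (Fin M) ℂ) + 1) * MvPowerSeries.X i ^ j := by
      rw [map_sum, Finset.sum_eq_single i]
      · rw [MvPowerSeries.pderiv_pow]; simp
      · intro l _ hl
        rw [MvPowerSeries.pderiv_pow, MvPowerSeries.pderiv_X_of_ne hl, mul_zero]
      · simp
    simp only [map_mul, Derivation.leibniz, smul_eq_mul, map_add, evPsumVar_C, hp, evPsum_X,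
      totalDeriv_C_X, map_pow, evPsumVar_X, map_natCast, map_one, h]

theorem pderiv_evPsumVar (i : Fin M) (h : Polynomial (MvPolynomial ℕ ℂ)) :
    MvPowerSeries.pderiv ℂ i (evPsumVar i h) = evPsumVar i (totalDeriv ℂ h) := by
  induction h using Polynomial.induction_on' with
  | add p q hp hq => simp only [map_add, hp, hq]
  | monomial n g =>
    rw [← Polynomial.C_mul_X_pow_eq_monomial]
    simp only [map_mul, Derivation.leibniz, Derivation.leibniz_pow, smul_eq_mul, map_add,
      evPsumVar_C, pderiv_evPsum, map_pow, evPsumVar_X, totalDeriv_X,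
      MvPowerSeries.pderiv_X_self, nsmul_eq_mul, map_natCast, map_one]

variable (M) in
/-- The Vandermonde product `∏ i < j, (z_i - z_j)`. -/
def vanderPS : MvPowerSeries (Fin M) ℂ :=
  ∏ i : Fin M, ∏ j ∈ Finset.Ioi i, (MvPowerSeries.X i - MvPowerSeries.X j)

theorem X_sub_X_ne_zero {i j : Fin M} (h : i ≠ j) :
    (MvPowerSeries.X i - MvPowerSeries.X j : MvPowerSeries (Fin M) ℂ) ≠ 0 := by
  intro h0
  have := congrArg (MvPowerSeries.pderiv ℂ i) h0
  simp [MvPowerSeries.pderiv_X_of_ne h.symm] at this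

theorem vanderPS_ne_zero : vanderPS M ≠ 0 :=
  Finset.prod_ne_zero_iff.2 fun _ _ => Finset.prod_ne_zero_iff.2 fun _ hj =>
    X_sub_X_ne_zero (Finset.mem_Ioi.1 hj).ne

theorem pderiv_prod_eq_zero {ι : Type*} (s : Finset ι) (f : ι → MvPowerSeries (Fin M) ℂ)
    (i : Fin M) (h : ∀ j ∈ s, MvPowerSeries.pderiv ℂ i (f j) = 0) :
    MvPowerSeries.pderiv ℂ i (∏ j ∈ s, f j) = 0 := by
  classical
  induction s using Finset.induction_on with
  | empty => simp
  | insert a s ha ih =>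
    rw [Finset.prod_insert ha, Derivation.leibniz, h a (Finset.mem_insert_self a s),
      ih fun j hj => h j (Finset.mem_insert_of_mem hj)]
    simp

/-- As a function of `z_i` alone, the Vandermonde product is `∏_{j ≠ i} (z_i - z_j)` up to a factor
constant in `z_i`. Derivatives in `z_i` can therefore be read off from a one-variable polynomial. -/
theorem vanderPS_eq (i : Fin M) : ∃ c, MvPowerSeries.pderiv ℂ i c = 0 ∧
    vanderPS M = c * ∏ j ∈ Finset.univ.erase i, (MvPowerSeries.X i - MvPowerSeries.X j) := by
  classical
  have h1 : ∀ a : Fin M, ∏ b ∈ Finset.Ioi a, (MvPowerSeries.X (R := ℂ) a - MvPowerSeries.X b) =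
      (∏ b ∈ (Finset.Ioi a).filter (fun b => a ≠ i ∧ b ≠ i),
        (MvPowerSeries.X a - MvPowerSeries.X b)) *
      ∏ b ∈ (Finset.Ioi a).filter (fun b => ¬ (a ≠ i ∧ b ≠ i)),
        (MvPowerSeries.X a - MvPowerSeries.X b) := fun a =>
    (Finset.prod_filter_mul_prod_filter_not _ _ _).symm
  have h2 : ∀ a ∈ Finset.univ.erase i, ∏ b ∈ (Finset.Ioi a).filter (fun b => ¬ (a ≠ i ∧ b ≠ i)),
        (MvPowerSeries.X (R := ℂ) a - MvPowerSeries.X b) =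
      if a < i then (MvPowerSeries.X a - MvPowerSeries.X i) else 1 := by
    intro a ha
    have hai := (Finset.mem_erase.1 ha).1
    split_ifs with h
    · rw [← Finset.prod_singleton (fun b => MvPowerSeries.X (R := ℂ) a - MvPowerSeries.X b) i]
      congr 1
      ext b
      simp only [Finset.mem_filter, Finset.mem_Ioi, Finset.mem_singleton, hai, ne_eq,
        not_false_iff, true_and, not_not]
      exact ⟨fun h => h.2, fun h' => ⟨h' ▸ h, h'⟩⟩
    · refine Finset.prod_eq_one fun b hb => ?_
      simp only [Finset.mem_filter, Finset.mem_Ioi, hai, ne_eq,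
        not_false_iff, true_and, not_not] at hb
      exact absurd (hb.2 ▸ hb.1) h
  have h3 : ∏ b ∈ (Finset.Ioi i).filter (fun b => ¬ (i ≠ i ∧ b ≠ i)),
        (MvPowerSeries.X (R := ℂ) i - MvPowerSeries.X b) =
      ∏ a ∈ Finset.univ.erase i, if a < i then 1 else
        (MvPowerSeries.X i - MvPowerSeries.X a) := by
    rw [Finset.prod_ite, Finset.prod_const_one, one_mul]
    refine Finset.prod_congr ?_ fun _ _ => rfl
    ext b
    simp only [ne_eq, not_true, false_and, not_false_iff, Finset.mem_filter, Finset.mem_Ioi,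
      and_true, Finset.mem_erase, Finset.mem_univ, not_lt]
    exact ⟨fun h => ⟨h.ne', h.le⟩, fun h => lt_of_le_of_ne h.2 (Ne.symm h.1)⟩
  -- The constant collects the factors that do not involve `z_i`, and one sign for every `a < i`,
  -- where the Vandermonde factor is `z_a - z_i`.
  refine ⟨(∏ a, ∏ b ∈ (Finset.Ioi a).filter (fun b => a ≠ i ∧ b ≠ i),
        (MvPowerSeries.X a - MvPowerSeries.X b)) * ∏ a ∈ Finset.univ.erase i,
        (if a < i then -1 else 1), ?_, ?_⟩
  · rw [Derivation.leibniz, pderiv_prod_eq_zero, pderiv_prod_eq_zero]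
    · simp
    · intro a _
      refine pderiv_prod_eq_zero _ _ _ fun b hb => ?_
      have := (Finset.mem_filter.1 hb).2
      rw [map_sub, MvPowerSeries.pderiv_X_of_ne this.1, MvPowerSeries.pderiv_X_of_ne this.2,
        sub_zero]
    · intro a _
      split_ifs <;> simp
  · rw [vanderPS, Finset.prod_congr rfl fun a _ => h1 a, Finset.prod_mul_distrib, mul_assoc]
    congr 1
    rw [← Finset.mul_prod_erase _ _ (Finset.mem_univ i), h3, Finset.prod_congr rfl h2,
      ← Finset.prod_mul_distrib, ← Finset.prod_mul_distrib]
    refine Finset.prod_congr rfl fun a _ => ?_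
    split_ifs <;> ring

end Intertwining

/-! ### Conjugation of the Euler operators by the Vandermonde product. -/

section Intertwining

variable {M : ℕ}

theorem evPsum_scaledPsum (n : ℕ) :
    evPsum M (scaledPsum 1 (M : ℂ) n) = ∑ i, MvPowerSeries.X i ^ n := by
  cases n with
  | zero => simp [scaledPsum, evPsum]
  | succ n => simp [scaledPsum, evPsum]

theorem MvPowerSeries_X_injective :
    Function.Injective fun i : Fin M => (MvPowerSeries.X i : MvPowerSeries (Fin M) ℂ) :=
  fun i j hij => by
    by_contra h
    exact X_sub_X_ne_zero h (sub_eq_zero.2 hij)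

/-- The variables, in the field of fractions of power series. -/
def varFrac (i : Fin M) : FractionRing (MvPowerSeries (Fin M) ℂ) :=
  algebraMap (MvPowerSeries (Fin M) ℂ) _ (MvPowerSeries.X i)

theorem algebraMap_frac_injective :
    Function.Injective (algebraMap (MvPowerSeries (Fin M) ℂ)
      (FractionRing (MvPowerSeries (Fin M) ℂ))) :=
  IsFractionRing.injective _ _

theorem varFrac_injective : Function.Injective (varFrac (M := M)) :=
  algebraMap_frac_injective.comp MvPowerSeries_X_injective

/-- `residuePoly` was defined by the recursion of `sum_residue_succ_mul_pow`, with index shifted by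
one; the start is `Q' / Q'`, all of whose residues are `1`. -/
theorem algebraMap_evPsum_residuePoly (a n : ℕ) :
    algebraMap _ (FractionRing (MvPowerSeries (Fin M) ℂ))
      (evPsum M (residuePoly 1 (M : ℂ) a n)) =
    ∑ i, residue varFrac (a + 1) i * varFrac (M := M) i ^ n := by
  induction a generalizing n with
  | zero =>
    simp [residuePoly, evPsum_scaledPsum, residue_one varFrac_injective, varFrac]
  | succ a ih =>
    rw [sum_residue_succ_mul_pow varFrac_injective, residuePoly]
    simp only [map_sub, map_sum, map_mul, ih, evPsum_scaledPsum, map_pow, map_natCast,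
      map_one, one_mul]
    rfl

/-- The coefficients of `∏_{j ≠ i} (X - z_j)` do not involve `z_i`, so `∂_i` of its value at `X =
z_i` is the value of its formal derivative. -/
theorem iterate_pderiv_prod (i : Fin M) (a : ℕ) :
    (MvPowerSeries.pderiv ℂ i)^[a]
      (∏ j ∈ Finset.univ.erase i, (MvPowerSeries.X i - MvPowerSeries.X j)) =
    Polynomial.eval (MvPowerSeries.X i) (Polynomial.derivative^[a]
      (Lagrange.nodal (Finset.univ.erase i) (MvPowerSeries.X (R := ℂ)))) := by
  have key : ∀ a, (MvPowerSeries.pderiv ℂ i).mapCoeffs (Polynomial.derivative^[a]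
      (Lagrange.nodal (Finset.univ.erase i) (MvPowerSeries.X (R := ℂ)))) = 0 := by
    intro a
    induction a with
    | zero =>
      rw [Function.iterate_zero_apply, Lagrange.nodal]
      refine Finset.prod_induction _
        (fun p => (MvPowerSeries.pderiv ℂ i).mapCoeffs p = 0) ?_ ?_ ?_
      · intro p q hp hq
        rw [Derivation.leibniz, hp, hq, smul_zero, smul_zero, add_zero]
      · simp
      · intro j hj
        rw [map_sub, Derivation.mapCoeffs_X, Derivation.mapCoeffs_C,
          MvPowerSeries.pderiv_X_of_ne (Finset.mem_erase.1 hj).1]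
        simp
    | succ a ih =>
      refine PolynomialModule.ext (Finsupp.ext fun n => ?_)
      have h := congrArg (fun p => PolynomialModule.coeff p (n + 1)) ih
      simp only [Derivation.mapCoeffs_apply] at h
      rw [Function.iterate_succ_apply', Derivation.mapCoeffs_apply, Polynomial.coeff_derivative]
      have h' : (MvPowerSeries.pderiv ℂ i) ((Polynomial.derivative^[a]
        (Lagrange.nodal (Finset.univ.erase i) (MvPowerSeries.X (R := ℂ)))).coeff (n + 1)) = 0 := h
      rw [Derivation.leibniz, h']
      have : (MvPowerSeries.pderiv ℂ i) ((n : MvPowerSeries (Fin M) ℂ) + 1) = 0 := by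
        simp
      rw [this]
      simp
  induction a with
  | zero => simp [Lagrange.nodal, Polynomial.eval_prod]
  | succ a ih =>
    rw [Function.iterate_succ_apply', ih, Derivation.apply_eval_eq, key,
      MvPowerSeries.pderiv_X_self, Function.iterate_succ_apply']
    simp

theorem iterate_derivative_X_sub_C_mul {A : Type*} [CommRing A] (c : A) (q : Polynomial A)
    (a : ℕ) : Polynomial.derivative^[a + 1] ((Polynomial.X - Polynomial.C c) * q) =
      (Polynomial.X - Polynomial.C c) * Polynomial.derivative^[a + 1] q +
        ((a : Polynomial A) + 1) * Polynomial.derivative^[a] q := by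
  induction a with
  | zero => simp [add_comm]
  | succ a ih =>
    rw [Function.iterate_succ_apply', ih]
    simp only [Polynomial.derivative_add, Polynomial.derivative_mul, Polynomial.derivative_sub,
      Polynomial.derivative_X, Polynomial.derivative_C, Polynomial.derivative_natCast,
      Polynomial.derivative_one, Function.iterate_succ_apply']
    push_cast
    ring

/-- Write `Q = (X - z_i) q`. Then `Q^(a+1)(z_i) = (a+1) q^(a)(z_i)`, while `V` is `q(z_i)` times a
factor killed by `∂_i`; dividing gives the residue. -/
theorem algebraMap_iterate_pderiv_vanderPS (i : Fin M) (a : ℕ) :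
    ((a : FractionRing (MvPowerSeries (Fin M) ℂ)) + 1) *
      algebraMap _ _ ((MvPowerSeries.pderiv ℂ i)^[a] (vanderPS M)) =
    algebraMap _ _ (vanderPS M) * residue varFrac (a + 1) i := by
  obtain ⟨c, hc, hV⟩ := vanderPS_eq i
  have h1 : ∀ b, (MvPowerSeries.pderiv ℂ i)^[b] (vanderPS M) = c * (MvPowerSeries.pderiv ℂ i)^[b]
      (∏ j ∈ Finset.univ.erase i, (MvPowerSeries.X i - MvPowerSeries.X j)) := by
    intro b
    induction b with
    | zero => exact hV
    | succ b ih =>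
      rw [Function.iterate_succ_apply', ih, Derivation.leibniz, hc, smul_zero, add_zero,
        Function.iterate_succ_apply', smul_eq_mul]
  have hmap : ∀ b, algebraMap _ (FractionRing (MvPowerSeries (Fin M) ℂ))
      (Polynomial.eval (MvPowerSeries.X i) (Polynomial.derivative^[b]
        (Lagrange.nodal (Finset.univ.erase i) (MvPowerSeries.X (R := ℂ))))) =
      Polynomial.eval (varFrac i) (Polynomial.derivative^[b]
        (Lagrange.nodal (Finset.univ.erase i) varFrac)) := by
    intro b
    have : Lagrange.nodal (Finset.univ.erase i) varFrac = (Lagrange.nodal (Finset.univ.erase i)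
        (MvPowerSeries.X (R := ℂ))).map
          (algebraMap _ (FractionRing (MvPowerSeries (Fin M) ℂ))) := by
      simp [Lagrange.nodal, Polynomial.map_prod, varFrac]
    rw [this, Polynomial.iterate_derivative_map, varFrac, Polynomial.eval_map_apply]
  have h2 : Polynomial.eval (varFrac i) (Polynomial.derivative^[a + 1]
      (Lagrange.nodal Finset.univ (varFrac (M := M)))) =
      (a + 1) * Polynomial.eval (varFrac i) (Polynomial.derivative^[a]
        (Lagrange.nodal (Finset.univ.erase i) varFrac)) := by
    rw [Lagrange.nodal_eq_mul_nodal_erase (Finset.mem_univ i), iterate_derivative_X_sub_C_mul]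
    simp
  have h3 := eval_derivative_nodal_ne_zero (varFrac_injective (M := M)) i
  have h4 : algebraMap _ (FractionRing (MvPowerSeries (Fin M) ℂ)) (vanderPS M) =
      algebraMap _ _ c * Polynomial.eval (varFrac i) (Polynomial.derivative
        (Lagrange.nodal Finset.univ (varFrac (M := M)))) := by
    rw [Lagrange.eval_nodal_derivative_eval_node_eq (Finset.mem_univ i)]
    have := hmap 0
    simp only [Function.iterate_zero_apply] at this
    rw [← this, ← map_mul, hV, Lagrange.eval_nodal]
  rw [residue, h2, h4, h1, iterate_pderiv_prod, map_mul, hmap]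
  field_simp

/-- Here the division by `V` is eliminated: the symmetric combination on the left is divisible by
`V`, and the quotient is an explicit polynomial in the power sums. The identity is checked in the
fraction field, where the residues live. -/
theorem sum_iterate_pderiv_vanderPS_mul (a : ℕ) (h : Polynomial (MvPolynomial ℕ ℂ)) :
    ((a : MvPowerSeries (Fin M) ℂ) + 1) *
      ∑ i, (MvPowerSeries.pderiv ℂ i)^[a] (vanderPS M) * evPsumVar i h =
    vanderPS M * evPsum M (residueFun 1 (M : ℂ) a h) := by
  induction h using Polynomial.induction_on' with
  | add p q hp hq => simp only [map_add, mul_add, Finset.sum_add_distrib, hp, hq]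
  | monomial n g =>
    apply algebraMap_frac_injective
    rw [← Polynomial.C_mul_X_pow_eq_monomial, residueFun_C_mul_X_pow]
    simp only [map_mul, algebraMap_evPsum_residuePoly, map_sum, evPsumVar_C, map_pow, evPsumVar_X,
      map_add, map_natCast, map_one]
    rw [Finset.mul_sum, Finset.mul_sum, Finset.mul_sum]
    refine Finset.sum_congr rfl fun i _ => ?_
    rw [← mul_assoc, algebraMap_iterate_pderiv_vanderPS, ← varFrac]
    ring

theorem le_order_pderiv (i : Fin M) (f : MvPowerSeries (Fin M) ℂ) {n : ℕ}
    (h : (n : ℕ∞) ≤ f.order) : ((n - 1 : ℕ) : ℕ∞) ≤ (MvPowerSeries.pderiv ℂ i f).order := by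
  refine MvPowerSeries.le_order fun d hd => ?_
  rw [MvPowerSeries.coeff_pderiv, MvPowerSeries.coeff_of_lt_order, zero_mul]
  refine lt_of_lt_of_le ?_ h
  rw [map_add, Finsupp.degree_single]
  have : d.degree < n - 1 := by exact_mod_cast hd
  exact_mod_cast (by omega : d.degree + 1 < n)

theorem le_order_iterate_pderiv (i : Fin M) (f : MvPowerSeries (Fin M) ℂ) {n : ℕ} (a : ℕ)
    (h : (n : ℕ∞) ≤ f.order) :
    ((n - a : ℕ) : ℕ∞) ≤ ((MvPowerSeries.pderiv ℂ i)^[a] f).order := by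
  induction a with
  | zero => simpa using h
  | succ a ih =>
    rw [Function.iterate_succ_apply', Nat.sub_add_eq]
    exact le_order_pderiv i _ ih

theorem le_order_add {f g : MvPowerSeries (Fin M) ℂ} {n : ℕ∞} (hf : n ≤ f.order)
    (hg : n ≤ g.order) : n ≤ (f + g).order :=
  (le_min hf hg).trans MvPowerSeries.min_order_le_add

theorem le_order_sub {f g : MvPowerSeries (Fin M) ℂ} {n : ℕ∞} (hf : n ≤ f.order)
    (hg : n ≤ g.order) : n ≤ (f - g).order := by
  rw [sub_eq_add_neg]
  exact le_order_add hf (by rwa [MvPowerSeries.order_neg])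

theorem le_order_mul_left {f : MvPowerSeries (Fin M) ℂ} {n : ℕ∞} (hf : n ≤ f.order)
    (g : MvPowerSeries (Fin M) ℂ) : n ≤ (g * f).order := by
  rw [MvPowerSeries.order_mul]
  exact hf.trans le_add_self

theorem le_order_mul_right {f : MvPowerSeries (Fin M) ℂ} {n : ℕ∞} (hf : n ≤ f.order)
    (g : MvPowerSeries (Fin M) ℂ) : n ≤ (f * g).order := by
  rw [mul_comm]
  exact le_order_mul_left hf g

theorem le_order_sum {ι : Type*} {s : Finset ι} {f : ι → MvPowerSeries (Fin M) ℂ} {n : ℕ∞}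
    (hf : ∀ i ∈ s, n ≤ (f i).order) : n ≤ (∑ i ∈ s, f i).order :=
  Finset.sum_induction _ (fun g : MvPowerSeries (Fin M) ℂ => n ≤ g.order) (fun _ _ => le_order_add) (by simp) hf

/-- If `∂Θ = ΘW` held exactly, then `∂^b (Θ g) = Θ · conjDeriv b` by the product rule. The defect of
the equation costs at most one order for each derivative. -/
theorem le_order_iterate_pderiv_sub (i : Fin M) (Θ : MvPowerSeries (Fin M) ℂ)
    (W : Polynomial (MvPolynomial ℕ ℂ)) (g : MvPolynomial ℕ ℂ) {n : ℕ}
    (h : (n : ℕ∞) ≤ (MvPowerSeries.pderiv ℂ i Θ - Θ * evPsumVar i W).order) (b : ℕ) :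
    ((n - b : ℕ) : ℕ∞) ≤ ((MvPowerSeries.pderiv ℂ i)^[b] (Θ * evPsum M g) -
      Θ * evPsumVar i (conjDeriv 1 W g b)).order := by
  induction b with
  | zero => simp [conjDeriv, evPsumVar_C]
  | succ b ih =>
    have e : (MvPowerSeries.pderiv ℂ i)^[b + 1] (Θ * evPsum M g) -
        Θ * evPsumVar i (conjDeriv 1 W g (b + 1)) =
        MvPowerSeries.pderiv ℂ i ((MvPowerSeries.pderiv ℂ i)^[b] (Θ * evPsum M g) -
          Θ * evPsumVar i (conjDeriv 1 W g b)) +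
        (MvPowerSeries.pderiv ℂ i Θ - Θ * evPsumVar i W) * evPsumVar i (conjDeriv 1 W g b) := by
      rw [Function.iterate_succ_apply', conjDeriv, map_sub, Derivation.leibniz, pderiv_evPsumVar]
      simp only [map_one, one_mul, map_add, map_mul, smul_eq_mul]
      ring
    rw [e]
    refine le_order_add ?_ (le_order_mul_right (le_trans ?_ h) _)
    · rw [Nat.sub_add_eq]
      exact le_order_pderiv i _ ih
    · exact_mod_cast Nat.sub_le _ _

theorem iterate_derivation_mul {A : Type*} [CommRing A] [Algebra ℂ A] (D : Derivation ℂ A A)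
    (f g : A) (k : ℕ) : D^[k] (f * g) =
      ∑ a ∈ Finset.range (k + 1), (k.choose a : A) * (D^[a] f * D^[k - a] g) := by
  induction k with
  | zero => simp
  | succ k ih =>
    rw [Function.iterate_succ_apply', ih, map_sum]
    have h1 : ∀ a ∈ Finset.range (k + 1), D ((k.choose a : A) * (D^[a] f * D^[k - a] g)) =
        (k.choose a : A) * (D^[a + 1] f * D^[k - a] g) +
          (k.choose a : A) * (D^[a] f * D^[k + 1 - a] g) := by
      intro a ha
      have : k + 1 - a = (k - a) + 1 := by have := Finset.mem_range.1 ha; omega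
      rw [this, Function.iterate_succ_apply', Function.iterate_succ_apply', Derivation.leibniz,
        Derivation.map_natCast, Derivation.leibniz]
      simp only [smul_eq_mul, mul_zero]
      ring
    rw [Finset.sum_congr rfl h1, Finset.sum_add_distrib,
      Finset.sum_range_succ' _ (k + 1), Finset.sum_range_succ (fun a => (k.choose a : A) *
        (D^[a + 1] f * D^[k - a] g)),
      Finset.sum_range_succ' (fun a => (k.choose a : A) * (D^[a] f * D^[k + 1 - a] g)) k,
      Finset.sum_range_succ (fun a => ((k + 1).choose (a + 1) : A) *
        (D^[a + 1] f * D^[k + 1 - (a + 1)] g))]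
    simp only [Nat.choose_succ_succ, Nat.cast_add, add_mul, Finset.sum_add_distrib,
      Nat.succ_sub_succ, Nat.choose_self, Nat.choose_succ_self, Nat.choose_zero_right, tsub_self,
      Nat.cast_one, Nat.cast_zero, tsub_zero]
    ring

/-- The Euler operator `x_i ∂_i` in the variables `x_i = 1 + z_i`. -/
def eulerDeriv (i : Fin M) : Derivation ℂ (MvPowerSeries (Fin M) ℂ) (MvPowerSeries (Fin M) ℂ) :=
  (1 + MvPowerSeries.X i : MvPowerSeries (Fin M) ℂ) • MvPowerSeries.pderiv ℂ i

theorem eulerDeriv_apply (i : Fin M) (f : MvPowerSeries (Fin M) ℂ) :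
    eulerDeriv i f = (1 + MvPowerSeries.X i) * MvPowerSeries.pderiv ℂ i f := rfl

theorem eulerDeriv_pow_mul (i : Fin M) (j : ℕ) (f : MvPowerSeries (Fin M) ℂ) :
    eulerDeriv i ((1 + MvPowerSeries.X i) ^ j * f) =
      (j : MvPowerSeries (Fin M) ℂ) * ((1 + MvPowerSeries.X i) ^ j * f) +
        (1 + MvPowerSeries.X i) ^ (j + 1) * MvPowerSeries.pderiv ℂ i f := by
  rw [eulerDeriv_apply, Derivation.leibniz, MvPowerSeries.pderiv_pow, map_add,
    MvPowerSeries.pderiv_one, MvPowerSeries.pderiv_X_self]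
  cases j with
  | zero => simp
  | succ j => simp only [smul_eq_mul, Nat.add_sub_cancel, Nat.cast_add, Nat.cast_one]; ring

/-- The classical expansion `(x∂)^k = ∑ S(k, j) x^j ∂^j`, by the recursion of the Stirling numbers
of the second kind. -/
theorem iterate_eulerDeriv (i : Fin M) (k : ℕ) (f : MvPowerSeries (Fin M) ℂ) :
    (eulerDeriv i)^[k] f = ∑ j ∈ Finset.range (k + 1), (k.stirlingSecond j : MvPowerSeries _ ℂ) *
      ((1 + MvPowerSeries.X i) ^ j * (MvPowerSeries.pderiv ℂ i)^[j] f) := by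
  induction k with
  | zero => simp
  | succ k ih =>
    rw [Function.iterate_succ_apply', ih, map_sum]
    have h1 : ∀ j ∈ Finset.range (k + 1), eulerDeriv i
        ((k.stirlingSecond j : MvPowerSeries (Fin M) ℂ) *
          ((1 + MvPowerSeries.X i) ^ j * (MvPowerSeries.pderiv ℂ i)^[j] f)) =
        (j * k.stirlingSecond j : MvPowerSeries (Fin M) ℂ) *
          ((1 + MvPowerSeries.X i) ^ j * (MvPowerSeries.pderiv ℂ i)^[j] f) +
        (k.stirlingSecond j : MvPowerSeries (Fin M) ℂ) *
          ((1 + MvPowerSeries.X i) ^ (j + 1) * (MvPowerSeries.pderiv ℂ i)^[j + 1] f) := by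
      intro j _
      rw [Derivation.leibniz, Derivation.map_natCast, eulerDeriv_pow_mul,
        Function.iterate_succ_apply']
      simp only [smul_eq_mul, mul_zero, add_zero]
      ring
    rw [Finset.sum_congr rfl h1, Finset.sum_add_distrib, Finset.sum_range_succ' _ (k + 1),
      Finset.sum_range_succ' (fun j => (j * k.stirlingSecond j : MvPowerSeries (Fin M) ℂ) * _)]
    simp only [Nat.stirlingSecond_succ_succ, Nat.stirlingSecond_succ_zero, Nat.cast_zero, zero_mul,
      add_zero, Nat.cast_add, Nat.cast_mul, add_mul, Finset.sum_add_distrib, Nat.cast_one]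
    congr 1
    rw [Finset.sum_range_succ _ k, Finset.sum_range_succ _ k,
      Nat.stirlingSecond_eq_zero_of_lt (Nat.lt_succ_self k)]
    simp

/-- Leibniz for `∂^j (V · Θ g)` gives weights `choose j a`; the factor `a + 1` between `∂^a V` and
the residues turns them into `choose (j+1) (a+1) / (j+1)`, the weights in `fallOp`. -/
theorem vanderPS_mul_evPsum_fallOp (W : Polynomial (MvPolynomial ℕ ℂ)) (g : MvPolynomial ℕ ℂ)
    (j : ℕ) : vanderPS M * evPsum M (fallOp 1 (M : ℂ) W j g) =
      ∑ a ∈ Finset.range (j + 1), (j.choose a : MvPowerSeries (Fin M) ℂ) *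
        ∑ i, (MvPowerSeries.pderiv ℂ i)^[a] (vanderPS M) *
          ((1 + MvPowerSeries.X i) ^ j * evPsumVar i (conjDeriv 1 W g (j - a))) := by
  rw [fallOp, map_smul, map_sum, Finset.smul_sum, Finset.mul_sum]
  refine Finset.sum_congr rfl fun a _ => ?_
  rw [map_smul, smul_smul, mul_smul_comm, ← sum_iterate_pderiv_vanderPS_mul]
  simp only [map_mul, map_pow, map_add, map_one, evPsumVar_X]
  rw [MvPowerSeries.smul_eq_C_mul, ← mul_assoc]
  congr 1
  have h : ((j : ℂ) + 1)⁻¹ * ((j + 1).choose (a + 1) : ℂ) * ((a : ℂ) + 1) = (j.choose a : ℂ) := by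
    have h1 := Nat.add_one_mul_choose_eq j a
    have h2 : ((j : ℂ) + 1) * (j.choose a : ℂ) = ((j + 1).choose (a + 1) : ℂ) * ((a : ℂ) + 1) := by
      exact_mod_cast h1
    rw [mul_assoc, ← h2, inv_mul_cancel_left₀ (Nat.cast_add_one_ne_zero j)]
  rw [← map_natCast (MvPowerSeries.C (σ := Fin M) (R := ℂ)) (j.choose a), ← h]
  simp only [map_mul, map_add, map_natCast, map_one]

/-- The Euler operators applied to `V Θ g` act on `g` by `powOp`, where `∂ Θ = Θ W`. -/
theorem le_order_sub_evPsum_powOp {Θ e T : MvPowerSeries (Fin M) ℂ}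
    {W : Polynomial (MvPolynomial ℕ ℂ)} (g : MvPolynomial ℕ ℂ) {n : ℕ}
    (h : ∀ i, (n : ℕ∞) ≤ (MvPowerSeries.pderiv ℂ i Θ - Θ * evPsumVar i W).order)
    (he : (n : ℕ∞) ≤ e.order) (k : ℕ)
    (hT : vanderPS M * T = ∑ i, (eulerDeriv i)^[k] (vanderPS M * (Θ * evPsum M g + e))) :
    ((n - k : ℕ) : ℕ∞) ≤ (T - Θ * evPsum M (powOp 1 (M : ℂ) W k g)).order := by
  obtain ⟨d, hd⟩ : ∃ d : ℕ, (vanderPS M).order = d :=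
    ⟨_, (MvPowerSeries.ne_zero_iff_order_finite.1 vanderPS_ne_zero).symm⟩
  set E : Fin M → ℕ → MvPowerSeries (Fin M) ℂ := fun i b =>
    (MvPowerSeries.pderiv ℂ i)^[b] (Θ * evPsum M g + e) - Θ * evPsumVar i (conjDeriv 1 W g b)
    with hE
  have hEo : ∀ i b, ((n - b : ℕ) : ℕ∞) ≤ (E i b).order := by
    intro i b
    have : E i b = ((MvPowerSeries.pderiv ℂ i)^[b] (Θ * evPsum M g) -
        Θ * evPsumVar i (conjDeriv 1 W g b)) + (MvPowerSeries.pderiv ℂ i)^[b] e := by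
      rw [hE]
      simp only [iterate_map_add]
      ring
    rw [this]
    exact le_order_add (le_order_iterate_pderiv_sub i Θ W g (h i) b)
      (le_order_iterate_pderiv i e b he)
  -- After the Stirling and Leibniz expansions the exact parts match the terms of `powOp` one by
  -- one, so that only the errors `E` remain.
  have key : vanderPS M * (T - Θ * evPsum M (powOp 1 (M : ℂ) W k g)) =
      ∑ j ∈ Finset.range (k + 1), ∑ i, ∑ a ∈ Finset.range (j + 1),
        ((k.stirlingSecond j * j.choose a : MvPowerSeries (Fin M) ℂ) *
          (1 + MvPowerSeries.X i) ^ j) *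
          ((MvPowerSeries.pderiv ℂ i)^[a] (vanderPS M) * E i (j - a)) := by
    have h1 : vanderPS M * (Θ * evPsum M (powOp 1 (M : ℂ) W k g)) =
        ∑ j ∈ Finset.range (k + 1), ∑ i, ∑ a ∈ Finset.range (j + 1),
        ((k.stirlingSecond j * j.choose a : MvPowerSeries (Fin M) ℂ) *
          (1 + MvPowerSeries.X i) ^ j) *
          ((MvPowerSeries.pderiv ℂ i)^[a] (vanderPS M) *
            (Θ * evPsumVar i (conjDeriv 1 W g (j - a)))) := by
      rw [powOp, map_sum, Finset.mul_sum, Finset.mul_sum]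
      refine Finset.sum_congr rfl fun j _ => ?_
      have : vanderPS M * (Θ * evPsum M (MvPolynomial.C (1 ^ (k - j)) *
          ((k.stirlingSecond j : MvPolynomial ℕ ℂ) * fallOp 1 (M : ℂ) W j g))) =
          Θ * (k.stirlingSecond j : MvPowerSeries (Fin M) ℂ) *
            (vanderPS M * evPsum M (fallOp 1 (M : ℂ) W j g)) := by
        simp only [one_pow, map_one, one_mul, map_mul, map_natCast]
        ring
      rw [this, vanderPS_mul_evPsum_fallOp, Finset.sum_comm, Finset.mul_sum]
      refine Finset.sum_congr rfl fun a _ => ?_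
      rw [Finset.mul_sum, Finset.mul_sum]
      exact Finset.sum_congr rfl fun i _ => by ring
    rw [mul_sub, hT, h1]
    simp only [iterate_eulerDeriv]
    rw [Finset.sum_comm, ← Finset.sum_sub_distrib]
    refine Finset.sum_congr rfl fun j _ => ?_
    rw [← Finset.sum_sub_distrib]
    refine Finset.sum_congr rfl fun i _ => ?_
    rw [iterate_derivation_mul, Finset.mul_sum, Finset.mul_sum, ← Finset.sum_sub_distrib]
    refine Finset.sum_congr rfl fun a _ => ?_
    rw [hE]
    ring
  -- Of the `j ≤ k` derivatives, `a` lower the order of `V` and `j - a` lower the order of the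
  -- error, so at most `k` orders are lost in total. Since orders add in a product, the order of `V`
  -- can be subtracted again.
  have hord : ((d + n - k : ℕ) : ℕ∞) ≤
      (vanderPS M * (T - Θ * evPsum M (powOp 1 (M : ℂ) W k g))).order := by
    rw [key]
    refine le_order_sum fun j hj => le_order_sum fun i _ => le_order_sum fun a ha =>
      le_order_mul_left ?_ _
    have hj' := Finset.mem_range.1 hj
    have ha' := Finset.mem_range.1 ha
    rw [MvPowerSeries.order_mul]
    refine le_trans ?_ (add_le_add (le_order_iterate_pderiv i _ a hd.ge) (hEo i (j - a)))
    exact_mod_cast (by omega : d + n - k ≤ (d - a) + (n - (j - a)))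
  rw [MvPowerSeries.order_mul, hd] at hord
  rcases le_total n k with hnk | hnk
  · simp [Nat.sub_eq_zero_of_le hnk]
  · rw [Nat.add_sub_assoc hnk, Nat.cast_add] at hord
    exact (ENat.add_le_add_iff_left (ENat.natCast_ne_top d)).1 hord

end Intertwining

/-! ### Taylor series at `(1, …, 1)` -/

section Taylor

variable {M : ℕ}

theorem AnalyticAt.partialDeriv {f : (Fin M → ℂ) → ℂ} {x : Fin M → ℂ} (hf : AnalyticAt ℂ f x)
    (i : ℕ) : AnalyticAt ℂ (partialDeriv i f) x :=
  ((ContinuousLinearMap.apply ℂ ℂ fun j : Fin M => if (j : ℕ) = i then (1 : ℂ) else 0).analyticAt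
    _).comp hf.fderiv

theorem partialDeriv_congr {f g : (Fin M → ℂ) → ℂ} {x : Fin M → ℂ} (h : f =ᶠ[𝓝 x] g) (i : ℕ) :
    partialDeriv i f =ᶠ[𝓝 x] partialDeriv i g :=
  (h.fderiv (𝕜 := ℂ)).mono fun y hy => by simp [partialDeriv, hy]

theorem analyticAt_foldr {f : (Fin M → ℂ) → ℂ} {x : Fin M → ℂ} (hf : AnalyticAt ℂ f x)
    (L : List ℕ) : AnalyticAt ℂ (L.foldr partialDeriv f) x := by
  induction L with
  | nil => exact hf
  | cons i L ih => exact AnalyticAt.partialDeriv ih i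

theorem foldr_congr {f g : (Fin M → ℂ) → ℂ} {x : Fin M → ℂ} (h : f =ᶠ[𝓝 x] g) (L : List ℕ) :
    L.foldr partialDeriv f =ᶠ[𝓝 x] L.foldr partialDeriv g := by
  induction L with
  | nil => exact h
  | cons i L ih => exact partialDeriv_congr ih i

theorem partialDeriv_comm {f : (Fin M → ℂ) → ℂ} {x : Fin M → ℂ} (hf : AnalyticAt ℂ f x)
    (i j : ℕ) : partialDeriv i (partialDeriv j f) =ᶠ[𝓝 x] partialDeriv j (partialDeriv i f) := by
  filter_upwards [hf.eventually_analyticAt] with y hy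
  have h2 : ∀ u v : Fin M → ℂ, fderiv ℂ (fun z => fderiv ℂ f z v) y u =
      fderiv ℂ (fderiv ℂ f) y u v := by
    intro u v
    have := (hy.fderiv.differentiableAt.hasFDerivAt.clm_apply (hasFDerivAt_const v y)).fderiv
    rw [this]
    simp
  have hs : IsSymmSndFDerivAt ℂ f y :=
    (hy.contDiffAt (n := 2)).isSymmSndFDerivAt (by simp)
  exact (h2 _ _).trans ((hs _ _).trans (h2 _ _).symm)

/-- Mixed partial derivatives of analytic functions commute, so an iterated derivative depends only
on the multiset of indices, that is, on an exponent vector. -/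
theorem foldr_perm {f : (Fin M → ℂ) → ℂ} {x : Fin M → ℂ} (hf : AnalyticAt ℂ f x)
    {L L' : List ℕ} (h : L.Perm L') :
    L.foldr partialDeriv f =ᶠ[𝓝 x] L'.foldr partialDeriv f := by
  induction h with
  | nil => rfl
  | cons i _ ih => exact partialDeriv_congr ih i
  | swap i j L => exact partialDeriv_comm (analyticAt_foldr hf L) j i
  | trans _ _ h1 h2 => exact h1.trans h2

theorem partialDeriv_add {f g : (Fin M → ℂ) → ℂ} {x : Fin M → ℂ} (hf : AnalyticAt ℂ f x)
    (hg : AnalyticAt ℂ g x) (i : ℕ) : partialDeriv i (fun y => f y + g y) =ᶠ[𝓝 x]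
      fun y => partialDeriv i f y + partialDeriv i g y := by
  filter_upwards [hf.eventually_analyticAt, hg.eventually_analyticAt] with y hy hy'
  have := fderiv_fun_add hy.differentiableAt hy'.differentiableAt
  simp [partialDeriv, this]

theorem partialDeriv_mul {f g : (Fin M → ℂ) → ℂ} {x : Fin M → ℂ} (hf : AnalyticAt ℂ f x)
    (hg : AnalyticAt ℂ g x) (i : ℕ) : partialDeriv i (fun y => f y * g y) =ᶠ[𝓝 x]
      fun y => f y * partialDeriv i g y + g y * partialDeriv i f y := by
  filter_upwards [hf.eventually_analyticAt, hg.eventually_analyticAt] with y hy hy'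
  have := fderiv_fun_mul hy.differentiableAt hy'.differentiableAt
  simp [partialDeriv, this]

/-- The Taylor series at `(1, …, 1)`, in the variables `z_i = x_i - 1`. -/
def taylor (f : (Fin M → ℂ) → ℂ) : MvPowerSeries (Fin M) ℂ := fun α =>
  (∏ i, ((α i).factorial : ℂ))⁻¹ *
    ((Finsupp.toMultiset α).toList.map Fin.val).foldr partialDeriv f 1

theorem coeff_taylor (f : (Fin M → ℂ) → ℂ) (α : Fin M →₀ ℕ) :
    MvPowerSeries.coeff α (taylor f) = (∏ i, ((α i).factorial : ℂ))⁻¹ *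
      ((Finsupp.toMultiset α).toList.map Fin.val).foldr partialDeriv f 1 := rfl

theorem foldr_eq_coeff_taylor {f : (Fin M → ℂ) → ℂ} (hf : AnalyticAt ℂ f 1) (α : Fin M →₀ ℕ)
    (L : List (Fin M)) (h : (L : Multiset (Fin M)) = Finsupp.toMultiset α) :
    (L.map Fin.val).foldr partialDeriv f 1 =
      (∏ i, ((α i).factorial : ℂ)) * MvPowerSeries.coeff α (taylor f) := by
  have h0 : (∏ i, ((α i).factorial : ℂ)) ≠ 0 :=
    Finset.prod_ne_zero_iff.2 fun i _ => Nat.cast_ne_zero.2 (Nat.factorial_ne_zero _)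
  rw [coeff_taylor, mul_inv_cancel_left₀ h0]
  refine (foldr_perm hf (List.Perm.map _ ?_)).eq_of_nhds
  rw [← Multiset.coe_eq_coe, h, Multiset.coe_toList]

theorem taylor_congr {f g : (Fin M → ℂ) → ℂ} (h : f =ᶠ[𝓝 1] g) : taylor f = taylor g := by
  ext α
  rw [coeff_taylor, coeff_taylor, (foldr_congr h _).eq_of_nhds]

theorem pderiv_taylor {f : (Fin M → ℂ) → ℂ} (hf : AnalyticAt ℂ f 1) (i : Fin M) :
    MvPowerSeries.pderiv ℂ i (taylor f) = taylor (partialDeriv (i : ℕ) f) := by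
  ext α
  have h := foldr_eq_coeff_taylor hf (α + Finsupp.single i 1)
    ((Finsupp.toMultiset α).toList ++ [i]) (by
      rw [← Multiset.coe_add, Multiset.coe_toList, map_add, Finsupp.toMultiset_single]
      simp)
  rw [List.map_append, List.foldr_append] at h
  have h0 : (∏ i, ((α i).factorial : ℂ)) ≠ 0 :=
    Finset.prod_ne_zero_iff.2 fun i _ => Nat.cast_ne_zero.2 (Nat.factorial_ne_zero _)
  have h1 : ∏ j, (((α + Finsupp.single i 1 : Fin M →₀ ℕ) j).factorial : ℂ) =
      (∏ j, ((α j).factorial : ℂ)) * (α i + 1) := by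
    rw [← Finset.mul_prod_erase _ _ (Finset.mem_univ i),
      ← Finset.mul_prod_erase _ (fun j => ((α j).factorial : ℂ)) (Finset.mem_univ i)]
    rw [Finset.prod_congr rfl (g := fun j => ((α j).factorial : ℂ))]
    · simp [Nat.factorial_succ]; ring
    · intro j hj
      simp [Finsupp.single_eq_of_ne (Finset.mem_erase.1 hj).1]
  rw [MvPowerSeries.coeff_pderiv, coeff_taylor (partialDeriv (i : ℕ) f)]
  simp only [List.map_cons, List.map_nil, List.foldr_cons, List.foldr_nil] at h
  rw [h, h1]
  field_simp

theorem constantCoeff_taylor (f : (Fin M → ℂ) → ℂ) :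
    MvPowerSeries.constantCoeff (taylor f) = f 1 := by
  rw [← MvPowerSeries.coeff_zero_eq_constantCoeff_apply, coeff_taylor]
  simp

/-- Power series are equal to degree `n + 1` if their values at `0` agree, and their derivatives
are equal to degree `n`. -/
theorem coeff_eq_of_pderiv {F G : MvPowerSeries (Fin M) ℂ}
    (hc : MvPowerSeries.constantCoeff F = MvPowerSeries.constantCoeff G) {n : ℕ}
    (h : ∀ i, ∀ α : Fin M →₀ ℕ, α.degree < n → MvPowerSeries.coeff α (MvPowerSeries.pderiv ℂ i F) =
      MvPowerSeries.coeff α (MvPowerSeries.pderiv ℂ i G))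
    (α : Fin M →₀ ℕ) (hα : α.degree < n + 1) :
    MvPowerSeries.coeff α F = MvPowerSeries.coeff α G := by
  by_cases h0 : α = 0
  · rw [h0, MvPowerSeries.coeff_zero_eq_constantCoeff_apply,
      MvPowerSeries.coeff_zero_eq_constantCoeff_apply, hc]
  obtain ⟨i, hi⟩ := Finsupp.ne_iff.1 h0
  have hle : Finsupp.single i 1 ≤ α := by
    rw [Finsupp.single_le_iff]
    exact Nat.one_le_iff_ne_zero.2 hi
  obtain ⟨β, rfl⟩ := exists_add_of_le hle
  rw [map_add, Finsupp.degree_single] at hα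
  have := h i β (by omega)
  rw [MvPowerSeries.coeff_pderiv, MvPowerSeries.coeff_pderiv] at this
  rw [add_comm]
  exact mul_right_cancel₀ (Nat.cast_add_one_ne_zero _) this

/-- Induction on the degree through `coeff_eq_of_pderiv`: both sides have the same constant term,
and their derivatives are instances of the same statement in lower degree. The functions vary in the
induction. Products and restrictions are treated in the same way. -/
theorem taylor_add {f g : (Fin M → ℂ) → ℂ} (hf : AnalyticAt ℂ f 1) (hg : AnalyticAt ℂ g 1) :
    taylor (fun x => f x + g x) = taylor f + taylor g := by
  have key : ∀ n : ℕ, ∀ f g : (Fin M → ℂ) → ℂ, AnalyticAt ℂ f 1 → AnalyticAt ℂ g 1 →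
      ∀ α : Fin M →₀ ℕ, α.degree < n → MvPowerSeries.coeff α (taylor fun x => f x + g x) =
        MvPowerSeries.coeff α (taylor f + taylor g) := by
    intro n
    induction n with
    | zero => intro _ _ _ _ _ h; omega
    | succ n ih =>
      intro f g hf hg
      refine coeff_eq_of_pderiv (by simp [constantCoeff_taylor]) fun i α hα => ?_
      rw [pderiv_taylor (hf.fun_add hg), map_add, pderiv_taylor hf, pderiv_taylor hg,
        taylor_congr (partialDeriv_add hf hg i)]
      exact ih _ _ (AnalyticAt.partialDeriv hf i) (AnalyticAt.partialDeriv hg i) α hα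
  ext α
  exact key _ f g hf hg α (Nat.lt_succ_self _)

theorem taylor_mul {f g : (Fin M → ℂ) → ℂ} (hf : AnalyticAt ℂ f 1) (hg : AnalyticAt ℂ g 1) :
    taylor (fun x => f x * g x) = taylor f * taylor g := by
  have key : ∀ n : ℕ, ∀ f g : (Fin M → ℂ) → ℂ, AnalyticAt ℂ f 1 → AnalyticAt ℂ g 1 →
      ∀ α : Fin M →₀ ℕ, α.degree < n → MvPowerSeries.coeff α (taylor fun x => f x * g x) =
        MvPowerSeries.coeff α (taylor f * taylor g) := by
    intro n
    induction n with
    | zero => intro _ _ _ _ _ h; omega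
    | succ n ih =>
      intro f g hf hg
      have hf' := AnalyticAt.partialDeriv hf
      have hg' := AnalyticAt.partialDeriv hg
      refine coeff_eq_of_pderiv (by simp [constantCoeff_taylor]) fun i α hα => ?_
      rw [pderiv_taylor (hf.fun_mul hg), Derivation.leibniz, pderiv_taylor hf, pderiv_taylor hg,
        taylor_congr (partialDeriv_mul hf hg i),
        taylor_add (hf.fun_mul (hg' i)) (hg.fun_mul (hf' i)), map_add, map_add,
        ih _ _ hf (hg' i) α hα, ih _ _ hg (hf' i) α hα, smul_eq_mul, smul_eq_mul]
  ext α
  exact key _ f g hf hg α (Nat.lt_succ_self _)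

theorem taylor_const (c : ℂ) : taylor (fun _ : Fin M → ℂ => c) = MvPowerSeries.C c := by
  refine MvPowerSeries.pderiv.ext (fun i => ?_) (by simp [constantCoeff_taylor])
  have h : ∀ j : ℕ, partialDeriv j (fun _ : Fin M → ℂ => c) = fun _ => 0 := by
    intro j; funext x; simp [partialDeriv]
  rw [pderiv_taylor analyticAt_const, MvPowerSeries.pderiv_C, h]
  ext α
  rw [coeff_taylor, MvPowerSeries.coeff_zero]
  have : ∀ L : List ℕ, L.foldr partialDeriv (fun _ : Fin M → ℂ => (0 : ℂ)) = fun _ => 0 := by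
    intro L
    induction L with
    | nil => rfl
    | cons i L ih => rw [List.foldr_cons, ih]; funext x; simp [partialDeriv]
  rw [this, mul_zero]

theorem analyticAt_apply (j : Fin M) (x : Fin M → ℂ) :
    AnalyticAt ℂ (fun x : Fin M → ℂ => x j) x :=
  (ContinuousLinearMap.proj (R := ℂ) (φ := fun _ : Fin M => ℂ) j).analyticAt x

theorem taylor_apply (j : Fin M) :
    taylor (fun x : Fin M → ℂ => x j) = 1 + MvPowerSeries.X j := by
  refine MvPowerSeries.pderiv.ext (fun i => ?_) (by simp [constantCoeff_taylor])
  have h : partialDeriv (i : ℕ) (fun x : Fin M → ℂ => x j) = fun _ => if j = i then 1 else 0 := by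
    funext x
    have : fderiv ℂ (fun x : Fin M → ℂ => x j) x =
        ContinuousLinearMap.proj (R := ℂ) (φ := fun _ : Fin M => ℂ) j :=
      (ContinuousLinearMap.proj (R := ℂ) (φ := fun _ : Fin M => ℂ) j).hasFDerivAt.fderiv
    simp [partialDeriv, this, Fin.ext_iff]
  rw [pderiv_taylor (analyticAt_apply j 1), h, taylor_const, map_add, MvPowerSeries.pderiv_one,
    zero_add]
  split_ifs with hji
  · subst hji; simp
  · rw [MvPowerSeries.pderiv_X_of_ne hji, map_zero]

theorem taylor_const_mul (c : ℂ) {f : (Fin M → ℂ) → ℂ} (hf : AnalyticAt ℂ f 1) :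
    taylor (fun x => c * f x) = c • taylor f := by
  rw [taylor_mul analyticAt_const hf, taylor_const, MvPowerSeries.smul_eq_C_mul]

theorem taylor_sub {f g : (Fin M → ℂ) → ℂ} (hf : AnalyticAt ℂ f 1) (hg : AnalyticAt ℂ g 1) :
    taylor (fun x => f x - g x) = taylor f - taylor g := by
  have h := taylor_add hf (analyticAt_const (v := (-1 : ℂ)) |>.fun_mul hg)
  rw [taylor_const_mul _ hg] at h
  simpa [sub_eq_add_neg] using h

theorem taylor_sum {ι : Type*} (s : Finset ι) {f : ι → (Fin M → ℂ) → ℂ}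
    (hf : ∀ i ∈ s, AnalyticAt ℂ (f i) 1) :
    taylor (fun x => ∑ i ∈ s, f i x) = ∑ i ∈ s, taylor (f i) := by
  classical
  induction s using Finset.induction_on with
  | empty => simpa using taylor_const (M := M) 0
  | insert a s ha ih =>
    have h1 := hf a (Finset.mem_insert_self a s)
    have h2 : ∀ i ∈ s, AnalyticAt ℂ (f i) 1 := fun i hi => hf i (Finset.mem_insert_of_mem hi)
    simp only [Finset.sum_insert ha]
    rw [taylor_add h1 (Finset.analyticAt_fun_sum s h2), ih h2]

theorem taylor_prod {ι : Type*} (s : Finset ι) {f : ι → (Fin M → ℂ) → ℂ}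
    (hf : ∀ i ∈ s, AnalyticAt ℂ (f i) 1) :
    taylor (fun x => ∏ i ∈ s, f i x) = ∏ i ∈ s, taylor (f i) := by
  classical
  induction s using Finset.induction_on with
  | empty => simpa using taylor_const (M := M) 1
  | insert a s ha ih =>
    have h1 := hf a (Finset.mem_insert_self a s)
    have h2 : ∀ i ∈ s, AnalyticAt ℂ (f i) 1 := fun i hi => hf i (Finset.mem_insert_of_mem hi)
    simp only [Finset.prod_insert ha]
    rw [taylor_mul h1 (Finset.analyticAt_fun_prod s h2), ih h2]

end Taylor

/-! ### Restriction to fewer variables -/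

section Restriction

variable {m k : ℕ}

/-- The linear part of `x ↦ Function.extend e x 1`. -/
def extendLin (e : Fin m ↪ Fin k) : (Fin m → ℂ) →L[ℂ] (Fin k → ℂ) :=
  open Classical in ContinuousLinearMap.pi fun j =>
    if h : ∃ i, e i = j then ContinuousLinearMap.proj h.choose else 0

theorem hasFDerivAt_extend (e : Fin m ↪ Fin k) (x : Fin m → ℂ) :
    HasFDerivAt (fun x : Fin m → ℂ => Function.extend e x (1 : Fin k → ℂ)) (extendLin e) x := by
  classical
  rw [hasFDerivAt_pi']
  intro j
  by_cases h : ∃ i, e i = j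
  · have h1 : (ContinuousLinearMap.proj (R := ℂ) (φ := fun _ : Fin k => ℂ) j).comp (extendLin e) =
        ContinuousLinearMap.proj h.choose := by
      ext v; simp [extendLin, h]
    have h2 : (fun x : Fin m → ℂ => Function.extend e x (1 : Fin k → ℂ) j) =
        fun x => x h.choose := by
      funext x; simp [Function.extend, h]
    rw [h1, h2]
    exact (ContinuousLinearMap.proj (R := ℂ) (φ := fun _ : Fin m => ℂ) h.choose).hasFDerivAt
  · have h1 : (ContinuousLinearMap.proj (R := ℂ) (φ := fun _ : Fin k => ℂ) j).comp (extendLin e) =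
        0 := by
      ext v; simp [extendLin, h]
    have h2 : (fun x : Fin m → ℂ => Function.extend e x (1 : Fin k → ℂ) j) = fun x => 1 := by
      funext x; simp [Function.extend, h]
    rw [h1, h2]
    exact hasFDerivAt_const _ _

theorem extendLin_single (e : Fin m ↪ Fin k) (i : Fin m) :
    extendLin e (fun j => if (j : ℕ) = i then 1 else 0) =
      fun j : Fin k => if (j : ℕ) = (e i : ℕ) then 1 else 0 := by
  classical
  funext j
  by_cases h : ∃ i, e i = j
  · obtain ⟨i', rfl⟩ := h
    have h : ∃ i, e i = e i' := ⟨i', rfl⟩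
    have h2 : h.choose = i' := e.injective h.choose_spec
    simp [extendLin, ← Fin.ext_iff]
  · have : j ≠ e i := fun h' => h ⟨i, h'.symm⟩
    simp [extendLin, h, ← Fin.ext_iff, this]

theorem extend_one (e : Fin m ↪ Fin k) :
    Function.extend e (1 : Fin m → ℂ) (1 : Fin k → ℂ) = 1 := by
  funext j
  by_cases h : ∃ i, e i = j
  · simp [Function.extend, h]
  · simp [Function.extend, h]

theorem analyticAt_comp_extend (e : Fin m ↪ Fin k) {f : (Fin k → ℂ) → ℂ} (hf : AnalyticAt ℂ f 1) :
    AnalyticAt ℂ (fun x => f (Function.extend e x 1)) 1 := by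
  refine AnalyticAt.fun_comp (by rwa [extend_one]) ?_
  have : (fun x : Fin m → ℂ => Function.extend e x (1 : Fin k → ℂ)) =
      fun x => extendLin e x + (Function.extend e 0 1) := by
    funext x j
    by_cases h : ∃ i, e i = j
    · simp [Function.extend, h, extendLin]
    · simp [Function.extend, h, extendLin]
  rw [this]
  exact (extendLin e).analyticAt _ |>.fun_add analyticAt_const

theorem partialDeriv_comp_extend (e : Fin m ↪ Fin k) {f : (Fin k → ℂ) → ℂ} (hf : AnalyticAt ℂ f 1)
    (i : Fin m) : partialDeriv i (fun x => f (Function.extend e x 1)) =ᶠ[𝓝 1]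
      fun x => partialDeriv (e i) f (Function.extend e x 1) := by
  have hc : Tendsto (fun x : Fin m → ℂ => Function.extend e x (1 : Fin k → ℂ)) (𝓝 1) (𝓝 1) := by
    have := (hasFDerivAt_extend e 1).continuousAt.tendsto
    rwa [extend_one] at this
  filter_upwards [hc.eventually hf.eventually_analyticAt] with x hx
  have := (hx.differentiableAt.hasFDerivAt.comp x (hasFDerivAt_extend e x)).fderiv
  simp only [partialDeriv]
  rw [show (fun x => f (Function.extend e x 1)) = f ∘ fun x => Function.extend e x 1 from rfl,
    this, ContinuousLinearMap.comp_apply, extendLin_single]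

theorem pderiv_killCompl (e : Fin m ↪ Fin k) (F : MvPowerSeries (Fin k) ℂ) (i : Fin m) :
    MvPowerSeries.pderiv ℂ i (MvPowerSeries.killCompl e F) =
      MvPowerSeries.killCompl e (MvPowerSeries.pderiv ℂ (e i) F) := by
  ext α
  simp only [MvPowerSeries.coeff_pderiv, MvPowerSeries.coeff_killCompl]
  rw [Finsupp.embDomain_add, Finsupp.embDomain_single, Finsupp.embDomain_apply_self]

/-- Setting the variables outside the range of `e` to `1` is setting the corresponding `z_j` to `0`,
which is `killCompl`. General embeddings are allowed, so that permutations of the variables are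
covered too. -/
theorem taylor_comp_extend (e : Fin m ↪ Fin k) {f : (Fin k → ℂ) → ℂ} (hf : AnalyticAt ℂ f 1) :
    taylor (fun x => f (Function.extend e x 1)) = MvPowerSeries.killCompl e (taylor f) := by
  have key : ∀ n : ℕ, ∀ f : (Fin k → ℂ) → ℂ, AnalyticAt ℂ f 1 → ∀ α : Fin m →₀ ℕ, α.degree < n →
      MvPowerSeries.coeff α (taylor fun x => f (Function.extend e x 1)) =
        MvPowerSeries.coeff α (MvPowerSeries.killCompl e (taylor f)) := by
    intro n
    induction n with
    | zero => intro _ _ _ h; omega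
    | succ n ih =>
      intro f hf
      refine coeff_eq_of_pderiv ?_ fun i α hα => ?_
      · rw [constantCoeff_taylor, extend_one, ← MvPowerSeries.coeff_zero_eq_constantCoeff_apply,
          MvPowerSeries.coeff_killCompl, Finsupp.embDomain_zero,
          MvPowerSeries.coeff_zero_eq_constantCoeff_apply, constantCoeff_taylor]
      · rw [pderiv_taylor (analyticAt_comp_extend e hf), pderiv_killCompl, pderiv_taylor hf,
          taylor_congr (partialDeriv_comp_extend e hf i)]
        exact ih _ (AnalyticAt.partialDeriv hf _) α hα
  ext α
  exact key _ f hf α (Nat.lt_succ_self _)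

theorem padOne_eq_extend (h : m ≤ k) (x : Fin m → ℂ) :
    padOne k x = Function.extend (Fin.castLEEmb h) x 1 := by
  funext j
  by_cases hj : (j : ℕ) < m
  · have : j = Fin.castLEEmb h ⟨j, hj⟩ := Fin.ext rfl
    rw [this, (Fin.castLEEmb h).injective.extend_apply]
    simp [padOne, hj]
  · rw [Function.extend_apply']
    · simp [padOne, hj]
    · rintro ⟨i, rfl⟩
      exact hj i.2

theorem taylor_comp_padOne (h : m ≤ k) {f : (Fin k → ℂ) → ℂ} (hf : AnalyticAt ℂ f 1) :
    taylor (fun x : Fin m → ℂ => f (padOne k x)) = MvPowerSeries.killCompl (Fin.castLEEmb h) (taylor f) := by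
  simpa only [padOne_eq_extend h] using taylor_comp_extend (Fin.castLEEmb h) hf

theorem le_order_killCompl (e : Fin m ↪ Fin k) {F : MvPowerSeries (Fin k) ℂ} {n : ℕ}
    (h : (n : ℕ∞) ≤ F.order) : (n : ℕ∞) ≤ (MvPowerSeries.killCompl e F).order := by
  refine MvPowerSeries.le_order fun α hα => ?_
  rw [MvPowerSeries.coeff_killCompl]
  refine MvPowerSeries.coeff_of_lt_order (lt_of_lt_of_le ?_ h)
  have : (Finsupp.embDomain e α).degree = α.degree := by
    rw [Finsupp.embDomain_eq_mapDomain, Finsupp.degree_mapDomain]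
  rwa [this]

theorem killCompl_evPsum (e : Fin m ↪ Fin k) (g : MvPolynomial ℕ ℂ) :
    MvPowerSeries.killCompl e (evPsum k g) = evPsum m g := by
  classical
  have : (MvPowerSeries.killCompl e).comp (evPsum k) = evPsum m := by
    refine MvPolynomial.algHom_ext fun j => ?_
    rw [AlgHom.comp_apply, evPsum_X, evPsum_X, map_sum]
    rw [← Finset.sum_subset (Finset.subset_univ (Finset.univ.map e)), Finset.sum_map]
    · simp
    · intro i _ hi
      rw [map_pow, MvPowerSeries.killCompl_X_eq_zero (by simpa using hi), zero_pow (by omega)]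
  exact DFunLike.congr_fun this g

theorem killCompl_evPsumVar (e : Fin m ↪ Fin k) (i : Fin m) (h : Polynomial (MvPolynomial ℕ ℂ)) :
    MvPowerSeries.killCompl e (evPsumVar (e i) h) = evPsumVar i h := by
  induction h using Polynomial.induction_on' with
  | add p q hp hq => simp only [map_add, hp, hq]
  | monomial n g =>
    rw [← Polynomial.C_mul_X_pow_eq_monomial]
    simp only [map_mul, evPsumVar_C, map_pow, evPsumVar_X, killCompl_evPsum,
      MvPowerSeries.killCompl_X]

/-- A permutation is an embedding, so this is the restriction lemma for `σ.symm`, where no variable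
is killed. -/
theorem coeff_taylor_of_symm {f : (Fin m → ℂ) → ℂ} (hf : AnalyticAt ℂ f 1) (σ : Equiv.Perm (Fin m))
    (hs : (fun x => f (x ∘ σ)) =ᶠ[𝓝 1] f) (α : Fin m →₀ ℕ) :
    MvPowerSeries.coeff (α.mapDomain σ) (taylor f) = MvPowerSeries.coeff α (taylor f) := by
  have h1 := taylor_comp_extend σ.symm.toEmbedding hf
  have h2 : (fun x => f (Function.extend σ.symm.toEmbedding x 1)) = fun x => f (x ∘ σ) := by
    funext x
    congr 1
    funext j
    simp
  rw [h2, taylor_congr hs] at h1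
  have h3 := congrArg (MvPowerSeries.coeff (α.mapDomain σ)) h1
  rw [MvPowerSeries.coeff_killCompl, Finsupp.embDomain_eq_mapDomain, ← Finsupp.mapDomain_comp] at h3
  rw [h3]
  congr 1
  have : (σ.symm.toEmbedding ∘ σ) = id := by funext x; simp
  rw [this, Finsupp.mapDomain_id]

/-- The differential equation `∂S = S ∂(log S)` on the level of Taylor series. It is the only way in
which the logarithm enters the calculus of operators. -/
theorem pderiv_taylor_exp {f l : (Fin m → ℂ) → ℂ} (hl : AnalyticAt ℂ l 1)
    (h : f =ᶠ[𝓝 1] fun x => Complex.exp (l x)) (i : Fin m) :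
    MvPowerSeries.pderiv ℂ i (taylor f) = taylor f * MvPowerSeries.pderiv ℂ i (taylor l) := by
  have he : AnalyticAt ℂ (fun x => Complex.exp (l x)) 1 := hl.cexp'
  rw [taylor_congr h, pderiv_taylor he, pderiv_taylor hl,
    ← taylor_mul he (AnalyticAt.partialDeriv hl _)]
  refine taylor_congr ?_
  filter_upwards [hl.eventually_analyticAt] with x hx
  simp only [partialDeriv]
  rw [(hx.differentiableAt.hasFDerivAt.cexp).fderiv]
  simp

end Restriction

/-! ### Derivatives of uniform limits -/

section UniformLimits

variable {M : ℕ}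

/-- Cauchy's estimate on the complex line through `x` in a direction of norm at most `1`: a disc of
radius `R / 4` around a point of the half ball stays inside the ball. -/
theorem norm_fderiv_le_of_ball {h : (Fin M → ℂ) → ℂ} {x₀ : Fin M → ℂ} {R ε : ℝ} (hR : 0 < R)
    (hd : DifferentiableOn ℂ h (Metric.ball x₀ R)) (hε : ∀ x ∈ Metric.ball x₀ R, ‖h x‖ ≤ ε)
    {x : Fin M → ℂ} (hx : x ∈ Metric.ball x₀ (R / 2)) : ‖fderiv ℂ h x‖ ≤ ε / (R / 4) := by
  have hmem : ∀ v : Fin M → ℂ, ‖v‖ ≤ 1 → ∀ s : ℂ, ‖s‖ ≤ R / 4 → x + s • v ∈ Metric.ball x₀ R := by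
    intro v hv s hs
    rw [Metric.mem_ball] at hx ⊢
    calc dist (x + s • v) x₀ ≤ dist (x + s • v) x + dist x x₀ := dist_triangle _ _ _
      _ < R / 4 * 1 + R / 2 := by
        refine add_lt_add_of_le_of_lt ?_ hx
        rw [dist_eq_norm, add_sub_cancel_left, norm_smul]
        exact mul_le_mul hs hv (norm_nonneg _) (by positivity)
      _ ≤ R := by linarith
  have hε0 : 0 ≤ ε := (norm_nonneg _).trans (hε x₀ (Metric.mem_ball_self hR))
  refine ContinuousLinearMap.opNorm_le_of_unit_norm (𝕜 := ℂ) (by positivity) fun v hv => ?_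
  have hg : ∀ s : ℂ, ‖s‖ ≤ R / 4 →
      HasDerivAt (fun s : ℂ => h (x + s • v)) (fderiv ℂ h (x + s • v) v) s := by
    intro s hs
    have h1 : HasDerivAt (fun s : ℂ => x + s • v) v s := by
      simpa using ((hasDerivAt_id s).smul_const v).const_add x
    exact ((hd.differentiableAt (Metric.isOpen_ball.mem_nhds (hmem v hv.le s hs))).hasFDerivAt.comp_hasDerivAt
      s h1)
  have h0 := hg 0 (by simpa using by positivity)
  have := Complex.norm_deriv_le_of_forall_mem_sphere_norm_le (c := 0) (R := R / 4) (C := ε)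
    (f := fun s : ℂ => h (x + s • v)) (by positivity) ?_ ?_
  · rw [h0.deriv] at this
    simpa using this
  · refine DifferentiableOn.diffContOnCl fun s hs => ?_
    rw [closure_ball _ (by positivity)] at hs
    exact (hg s (by simpa using hs)).differentiableAt.differentiableWithinAt
  · intro s hs
    exact hε _ (hmem v hv.le s (by simpa using hs.le))

/-- By Cauchy's estimate the derivatives are uniformly Cauchy on the half ball; a uniform limit of
derivatives is the derivative of the limit. -/
theorem tendstoUniformlyOn_partialDeriv {ι : Type*} {l : Filter ι} [l.NeBot]
    {F : ι → (Fin M → ℂ) → ℂ} {g : (Fin M → ℂ) → ℂ} {x₀ : Fin M → ℂ} {R : ℝ} (hR : 0 < R)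
    (hF : ∀ s, DifferentiableOn ℂ (F s) (Metric.ball x₀ R))
    (h : TendstoUniformlyOn F g l (Metric.ball x₀ R)) (i : ℕ) :
    TendstoUniformlyOn (fun s => partialDeriv i (F s)) (partialDeriv i g) l
      (Metric.ball x₀ (R / 2)) := by
  have hsub : Metric.ball x₀ (R / 2) ⊆ Metric.ball x₀ R := Metric.ball_subset_ball (by linarith)
  have hc : UniformCauchySeqOn (fun s => fderiv ℂ (F s)) l (Metric.ball x₀ (R / 2)) := by
    intro u hu
    obtain ⟨ε, hε, hεu⟩ := Metric.mem_uniformity_dist.1 hu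
    have h1 := h.uniformCauchySeqOn _ (Metric.dist_mem_uniformity (ε := ε * (R / 8)) (by positivity))
    refine h1.mono fun p hp x hx => hεu ?_
    have hd1 := fun p => (hF p).differentiableAt (Metric.isOpen_ball.mem_nhds (hsub hx))
    rw [dist_eq_norm, ← fderiv_sub (hd1 _) (hd1 _)]
    refine lt_of_le_of_lt (norm_fderiv_le_of_ball (ε := ε * (R / 8)) hR ((hF _).sub (hF _)) ?_ hx) ?_
    · intro y hy
      have := hp y hy
      rw [Set.mem_ofPred_eq, dist_eq_norm] at this
      exact this.le
    · rw [div_lt_iff₀ (by positivity)]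
      nlinarith [mul_pos hε hR]
  have hlim : ∀ x ∈ Metric.ball x₀ (R / 2), ∃ y, Tendsto (fun s => fderiv ℂ (F s) x) l (𝓝 y) :=
    fun x hx => cauchy_map_iff_exists_tendsto.1 (hc.cauchy_map hx)
  choose! g' hg' using hlim
  have hu : TendstoUniformlyOn (fun s => fderiv ℂ (F s)) g' l (Metric.ball x₀ (R / 2)) :=
    hc.tendstoUniformlyOn_of_tendsto hg'
  have hder : ∀ x ∈ Metric.ball x₀ (R / 2), HasFDerivAt g (g' x) x := fun x hx =>
    hasFDerivAt_of_tendstoUniformlyOn Metric.isOpen_ball hu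
      (fun s y hy => ((hF s).differentiableAt
        (Metric.isOpen_ball.mem_nhds (hsub hy))).hasFDerivAt)
      (fun y hy => h.tendsto_at (hsub hy)) hx
  have h2 := (ContinuousLinearMap.apply ℂ ℂ
    (fun j : Fin M => if (j : ℕ) = i then (1 : ℂ) else 0)).uniformContinuous.comp_tendstoUniformlyOn hu
  refine h2.congr_right fun x hx => ?_
  simp [partialDeriv, (hder x hx).fderiv]

theorem tendsto_foldr_partialDeriv {ι : Type*} {l : Filter ι} [l.NeBot] (L : List ℕ) :
    ∀ {F : ι → (Fin M → ℂ) → ℂ} {g : (Fin M → ℂ) → ℂ} {x₀ : Fin M → ℂ} {R : ℝ}, 0 < R →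
    (∀ s, AnalyticOnNhd ℂ (F s) (Metric.ball x₀ R)) →
    TendstoUniformlyOn F g l (Metric.ball x₀ R) →
    Tendsto (fun s => L.foldr partialDeriv (F s) x₀) l (𝓝 (L.foldr partialDeriv g x₀)) := by
  -- The last entry of the list is differentiated first, so the list is peeled from its end; every
  -- derivative halves the radius.
  induction L using List.reverseRecOn with
  | nil =>
    intro F g x₀ R hR _ h
    exact h.tendsto_at (Metric.mem_ball_self hR)
  | append_singleton L i ih =>
    intro F g x₀ R hR hF h
    simp only [List.foldr_append, List.foldr_cons, List.foldr_nil]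
    refine ih (half_pos hR) (fun s x hx => ?_)
      (tendstoUniformlyOn_partialDeriv hR (fun s => (hF s).differentiableOn) h i)
    exact AnalyticAt.partialDeriv (hF s x (Metric.ball_subset_ball (by linarith) hx)) i

/-- The partial sums converge uniformly on `U` and the terms are analytic on `V`; a ball in the
intersection serves both purposes. -/
theorem hasSum_coeff_taylor {ι : Type*} {f : ι → (Fin M → ℂ) → ℂ} {U V : Set (Fin M → ℂ)}
    (hU : IsOpen U) (h1 : 1 ∈ U) (hs : SummableUniformlyOn f U) (hV : V ∈ 𝓝 1)
    (hf : ∀ i, AnalyticOnNhd ℂ (f i) V) (α : Fin M →₀ ℕ) :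
    HasSum (fun i => MvPowerSeries.coeff α (taylor (f i)))
      (MvPowerSeries.coeff α (taylor fun x => ∑' i, f i x)) := by
  obtain ⟨R, hR, hsub⟩ := Metric.mem_nhds_iff.1 (inter_mem (hU.mem_nhds h1) hV)
  have hunif := (hasSumUniformlyOn_iff_tendstoUniformlyOn.1 hs.hasSumUniformlyOn).mono
    (hsub.trans Set.inter_subset_left)
  have hfa : ∀ i, AnalyticOnNhd ℂ (f i) (Metric.ball 1 R) := fun i =>
    (hf i).mono (hsub.trans Set.inter_subset_right)
  have := tendsto_foldr_partialDeriv ((Finsupp.toMultiset α).toList.map Fin.val) hR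
    (fun s => Finset.analyticOnNhd_fun_sum s fun i _ => hfa i) hunif
  have h2 := this.const_mul (∏ i, ((α i).factorial : ℂ))⁻¹
  rw [HasSum]
  refine h2.congr fun s => ?_
  rw [← coeff_taylor, taylor_sum s fun i _ => hfa i 1 (Metric.mem_ball_self hR), map_sum]

end UniformLimits

/-! ### Schur functions and Gelfand–Tsetlin patterns -/

section Schur

/-- The sequences that interlace with `l`. -/
def interlacing {N : ℕ} (l : Fin (N + 1) → ℤ) : Finset (Fin N → ℤ) :=
  Fintype.piFinset fun j => Finset.Icc (l j.succ) (l j.castSucc)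

/-- The sum over Gelfand–Tsetlin patterns with top row `l`. -/
def gtSum : ∀ N : ℕ, (Fin N → ℤ) → (Fin N → ℂ) → ℂ
  | 0, _, _ => 1
  | N + 1, l, x => ∑ μ ∈ interlacing l,
      gtSum N μ (fun i => x i.castSucc) * x (Fin.last N) ^ (∑ j, l j - ∑ j, μ j)

/-- The number of Gelfand–Tsetlin patterns with top row `l`. -/
def gtCount : ∀ N : ℕ, (Fin N → ℤ) → ℕ
  | 0, _ => 1
  | N + 1, l => ∑ μ ∈ interlacing l, gtCount N μ

theorem gtSum_one : ∀ (N : ℕ) (l : Fin N → ℤ), gtSum N l 1 = gtCount N l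
  | 0, _ => by simp [gtSum, gtCount]
  | N + 1, l => by
    simp only [gtSum, gtCount, Nat.cast_sum, Pi.one_apply, one_zpow, mul_one]
    exact Finset.sum_congr rfl fun μ _ => gtSum_one N μ

theorem mem_interlacing {N : ℕ} {l : Fin (N + 1) → ℤ} {μ : Fin N → ℤ} :
    μ ∈ interlacing l ↔ ∀ j, l j.succ ≤ μ j ∧ μ j ≤ l j.castSucc := by
  simp [interlacing, Fintype.mem_piFinset]

theorem antitone_of_mem_interlacing {N : ℕ} {l : Fin (N + 1) → ℤ} (hl : Antitone l) {μ : Fin N → ℤ}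
    (h : μ ∈ interlacing l) : Antitone μ := by
  rw [mem_interlacing] at h
  intro i j hij
  rcases hij.eq_or_lt with rfl | hij
  · exact le_rfl
  · refine (h j).2.trans (le_trans (hl ?_) (h i).1)
    rw [Fin.le_def]
    simpa using Nat.succ_le_of_lt hij

theorem gtCount_pos : ∀ (N : ℕ) (l : Fin N → ℤ), Antitone l → 0 < gtCount N l
  | 0, _, _ => by simp [gtCount]
  | N + 1, l, hl => by
    refine Finset.sum_pos (fun μ hμ => gtCount_pos N μ (antitone_of_mem_interlacing hl hμ))
      ⟨fun j => l j.castSucc, mem_interlacing.2 fun j => ⟨hl ?_, le_rfl⟩⟩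
    rw [Fin.le_def]; simp

theorem analyticAt_gtSum : ∀ (N : ℕ) (l : Fin N → ℤ) (x : Fin N → ℂ), (∀ i, x i ≠ 0) →
    AnalyticAt ℂ (gtSum N l) x
  | 0, _, _, _ => analyticAt_const
  | N + 1, l, x, hx => by
    refine Finset.analyticAt_fun_sum _ fun μ _ => AnalyticAt.fun_mul ?_ ?_
    · refine AnalyticAt.comp (g := gtSum N μ) (analyticAt_gtSum N μ _ fun i => hx _) ?_
      exact analyticAt_pi_iff.2 fun i => analyticAt_apply i.castSucc x
    · exact (analyticAt_apply (Fin.last N) x).zpow (hx _)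

/-- The telescoping geometric sum. It produces the interval between consecutive parts of `l`, hence
the interlacing condition. -/
theorem sub_mul_sum_Icc_zpow {x y : ℂ} (hx : x ≠ 0) (hy : y ≠ 0) (a b s : ℤ) (hab : a ≤ b) :
    (x - y) * ∑ m ∈ Finset.Icc a b, x ^ (m + s) * y ^ (b - m) =
      x ^ (b + s + 1) - y ^ (b - a + 1) * x ^ (a + s) := by
  obtain ⟨n, rfl⟩ := Int.le.dest hab
  induction n with
  | zero =>
    simp only [Nat.cast_zero, add_zero, Finset.Icc_self, Finset.sum_singleton, sub_self, zpow_zero,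
      mul_one, zero_add, zpow_one, zpow_add_one₀ hx]
    ring
  | succ n ih =>
    have h1 : Finset.Icc a (a + (n + 1 : ℕ)) = insert (a + (n + 1 : ℕ)) (Finset.Icc a (a + n)) := by
      ext m; simp; omega
    have h2 : ∑ m ∈ Finset.Icc a (a + n), x ^ (m + s) * y ^ (a + ((n + 1 : ℕ) : ℤ) - m) =
        y * ∑ m ∈ Finset.Icc a (a + n), x ^ (m + s) * y ^ (a + (n : ℤ) - m) := by
      rw [Finset.mul_sum]
      refine Finset.sum_congr rfl fun m _ => ?_
      rw [show a + ((n + 1 : ℕ) : ℤ) - m = (a + (n : ℤ) - m) + 1 by push_cast; ring,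
        zpow_add_one₀ hy]
      ring
    rw [h1, Finset.sum_insert (by simp), h2, mul_add,
      show (x - y) * (y * ∑ m ∈ Finset.Icc a (a + n), x ^ (m + s) * y ^ (a + (n : ℤ) - m)) =
        y * ((x - y) * ∑ m ∈ Finset.Icc a (a + n), x ^ (m + s) * y ^ (a + (n : ℤ) - m)) by ring,
      ih (by omega)]
    have e1 : a + ((n + 1 : ℕ) : ℤ) + s = a + n + s + 1 := by push_cast; ring
    have e2 : a + ((n + 1 : ℕ) : ℤ) - a + 1 = (a + n - a + 1) + 1 := by push_cast; ring
    rw [e1, e2, zpow_add_one₀ hx (a + n + s + 1), zpow_add_one₀ hy (a + n - a + 1), sub_self,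
      zpow_zero]
    ring

/-- The branching rule for alternants. Column operations clear the last row but for one entry; every
remaining entry of row `i` is divisible by `x_i - y`, with a geometric sum over an interval as
quotient. -/
theorem alternant_succ {N : ℕ} {l : Fin (N + 1) → ℤ} (hl : Antitone l) {x : Fin (N + 1) → ℂ}
    (hx : ∀ i, x i ≠ 0) : alternant l x = (∏ i : Fin N, (x i.castSucc - x (Fin.last N))) *
      ∑ μ ∈ interlacing l, alternant μ (fun i => x i.castSucc) *
        x (Fin.last N) ^ (∑ j, l j - ∑ j, μ j) := by
  set y := x (Fin.last N) with hy
  have hy0 : y ≠ 0 := hx _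
  set A : Matrix (Fin (N + 1)) (Fin (N + 1)) ℂ :=
    Matrix.of fun i j => x i ^ (l j + (N + 1 : ℕ) - 1 - (j : ℕ)) with hA
  set c : Fin N → ℂ := fun j => y ^ (l j.castSucc - l j.succ + 1) with hc
  -- Right multiplication by the unipotent matrix `U` subtracts from every column except the last a
  -- multiple of the next one. The factor `c j` is the ratio of the two entries in the last row, so
  -- these entries cancel.
  set U : Matrix (Fin (N + 1)) (Fin (N + 1)) ℂ := Matrix.of fun i =>
    Fin.lastCases (if i = Fin.last N then 1 else 0)
      (fun j => (if i = j.castSucc then 1 else 0) - (if i = j.succ then c j else 0)) with hU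
  have hdet : U.det = 1 := by
    rw [Matrix.det_of_isLowerTriangular]
    · rw [Fin.prod_univ_castSucc]
      simp [hU, Fin.ext_iff]
    · intro i j hij
      rw [OrderDual.toDual_lt_toDual] at hij
      revert hij
      refine Fin.lastCases ?_ (fun j => ?_) j
      · intro hij; simp [hU, hij.ne]
      · intro hij
        have h1 : i ≠ j.castSucc := hij.ne
        have h2 : i ≠ j.succ := (hij.trans (Fin.castSucc_lt_succ)).ne
        simp [hU, h1, h2]
  have hAU1 : ∀ i (j : Fin N), (A * U) i j.castSucc = A i j.castSucc - A i j.succ * c j := by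
    intro i j
    simp [Matrix.mul_apply, hU, mul_sub, Finset.sum_sub_distrib]
  have hAU2 : ∀ i, (A * U) i (Fin.last N) = A i (Fin.last N) := by
    intro i; simp [Matrix.mul_apply, hU]
  have hentry : ∀ i (j : Fin N), (A * U) i j.castSucc = (x i - y) *
      ∑ m ∈ Finset.Icc (l j.succ) (l j.castSucc),
        x i ^ (m + (N - 1 - (j : ℕ))) * y ^ (l j.castSucc - m) := by
    intro i j
    rw [sub_mul_sum_Icc_zpow (hx i) hy0 _ _ _ (hl (Fin.castSucc_lt_succ).le), hAU1]
    simp only [hA, hc, Matrix.of_apply, Fin.val_castSucc, Fin.val_succ]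
    rw [mul_comm (y ^ _)]
    congr 2
    · push_cast; ring
    · congr 1; push_cast; ring
  have hlast : ∀ j : Fin N, (A * U) (Fin.last N) j.castSucc = 0 := by
    intro j; rw [hentry, ← hy, sub_self, zero_mul]
  have h1 : alternant l x = (A * U).det := by
    rw [Matrix.det_mul, hdet, mul_one]; rfl
  have h2 : (A * U).det = y ^ l (Fin.last N) *
      ((A * U).submatrix Fin.castSucc Fin.castSucc).det := by
    rw [Matrix.det_succ_row _ (Fin.last N), Fin.sum_univ_castSucc]
    simp only [hlast, mul_zero, zero_mul, Finset.sum_const_zero, zero_add, hAU2]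
    have : A (Fin.last N) (Fin.last N) = y ^ l (Fin.last N) := by
      simp only [hA, hy, Matrix.of_apply, Fin.val_last]
      congr 1; push_cast; ring
    rw [this, Fin.succAbove_last, ← two_mul, pow_mul]
    simp
  have h3 : ((A * U).submatrix Fin.castSucc Fin.castSucc).det =
      (∏ i : Fin N, (x i.castSucc - y)) * (Matrix.of fun i j : Fin N =>
        ∑ m ∈ Finset.Icc (l j.succ) (l j.castSucc),
        x i.castSucc ^ (m + (N - 1 - (j : ℕ))) * y ^ (l j.castSucc - m)).det := by
    rw [← Matrix.det_mul_column]
    congr 1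
    ext i j
    rw [Matrix.submatrix_apply, hentry]
    rfl
  -- Multilinearity in the columns: choosing one exponent from the interval of each column is
  -- choosing an interlacing sequence.
  have h4 : (Matrix.of fun i j : Fin N => ∑ m ∈ Finset.Icc (l j.succ) (l j.castSucc),
        x i.castSucc ^ (m + (N - 1 - (j : ℕ))) * y ^ (l j.castSucc - m)).det =
      ∑ μ ∈ interlacing l, (Matrix.of fun i j : Fin N =>
        x i.castSucc ^ (μ j + (N - 1 - (j : ℕ))) * y ^ (l j.castSucc - μ j)).det := by
    rw [← Matrix.det_transpose]
    have := (Matrix.detRowAlternating (n := Fin N) (R := ℂ)).toMultilinearMap.map_sum_finset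
      (fun (j : Fin N) (m : ℤ) => fun i : Fin N =>
        x i.castSucc ^ (m + (N - 1 - (j : ℕ))) * y ^ (l j.castSucc - m))
      (fun j => Finset.Icc (l j.succ) (l j.castSucc))
    refine Eq.trans ?_ (this.trans (Finset.sum_congr rfl fun μ _ => ?_))
    · change Matrix.det _ = Matrix.det _
      congr 1
      ext j i
      simp [Matrix.transpose_apply]
    · rw [← Matrix.det_transpose]
      rfl
  rw [h1, h2, h3, h4, mul_left_comm, Finset.mul_sum]
  congr 1
  refine Finset.sum_congr rfl fun μ _ => ?_
  have h5 := Matrix.det_mul_row (fun j : Fin N => y ^ (l j.castSucc - μ j))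
    (Matrix.of fun i j : Fin N => x i.castSucc ^ (μ j + N - 1 - (j : ℕ)))
  have h6 : (Matrix.of fun i j : Fin N =>
        x i.castSucc ^ (μ j + (N - 1 - (j : ℕ))) * y ^ (l j.castSucc - μ j)).det =
      (∏ j : Fin N, y ^ (l j.castSucc - μ j)) * alternant μ fun i => x i.castSucc := by
    rw [alternant, ← h5]
    congr 1
    ext i j
    simp only [Matrix.of_apply]
    rw [mul_comm]
    congr 2
    ring
  have h7 : ∀ s : Finset (Fin N), ∏ j ∈ s, y ^ (l j.castSucc - μ j) =
      y ^ (∑ j ∈ s, (l j.castSucc - μ j)) := by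
    intro s
    induction s using Finset.induction_on with
    | empty => simp
    | insert a s ha ih => rw [Finset.prod_insert ha, Finset.sum_insert ha, zpow_add₀ hy0, ih]
  rw [h6, h7, ← mul_assoc, ← zpow_add₀ hy0, mul_comm]
  congr 2
  rw [Fin.sum_univ_castSucc (f := l), Finset.sum_sub_distrib]
  ring

theorem interlacing_zero (N : ℕ) : interlacing (0 : Fin (N + 1) → ℤ) = {0} := by
  ext μ
  simp only [mem_interlacing, Finset.mem_singleton, Pi.zero_apply, funext_iff]
  exact forall_congr' fun j => by omega

theorem alternant_zero_succ {N : ℕ} {x : Fin (N + 1) → ℂ} (hx : ∀ i, x i ≠ 0) :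
    alternant (0 : Fin (N + 1) → ℤ) x = (∏ i : Fin N, (x i.castSucc - x (Fin.last N))) *
      alternant (0 : Fin N → ℤ) (fun i => x i.castSucc) := by
  rw [alternant_succ (fun _ _ _ => le_rfl) hx, interlacing_zero]
  simp

/-- The branching rules for `l` and for `0` have the same factor `∏ (x_i - y)`, so the recursion of
`gtSum` comes out. The identity holds at all points with nonzero coordinates, coinciding ones
included, which identifies the continuous extension of the ratio. -/
theorem alternant_eq_gtSum_mul : ∀ (N : ℕ) (l : Fin N → ℤ), Antitone l → ∀ x : Fin N → ℂ,
    (∀ i, x i ≠ 0) → alternant l x = gtSum N l x * alternant (0 : Fin N → ℤ) x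
  | 0, l, _, x, _ => by simp [alternant, gtSum]
  | N + 1, l, hl, x, hx => by
    rw [alternant_succ hl hx, alternant_zero_succ hx, gtSum, mul_left_comm, Finset.sum_mul]
    congr 1
    refine Finset.sum_congr rfl fun μ hμ => ?_
    rw [alternant_eq_gtSum_mul N μ (antitone_of_mem_interlacing hl hμ) _ fun i => hx _]
    ring

theorem alternant_zero_eq_prod : ∀ (N : ℕ) (x : Fin N → ℂ), (∀ i, x i ≠ 0) →
    alternant (0 : Fin N → ℤ) x = ∏ i, ∏ j ∈ Finset.Ioi i, (x i - x j)
  | 0, x, _ => by simp [alternant]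
  | N + 1, x, hx => by
    rw [alternant_zero_succ hx, alternant_zero_eq_prod N _ fun i => hx _, Fin.prod_univ_castSucc]
    have h1 : Finset.Ioi (Fin.last N) = ∅ :=
      Finset.eq_empty_of_forall_notMem fun j hj => (Finset.mem_Ioi.1 hj).not_ge (Fin.le_last j)
    rw [h1, Finset.prod_empty, mul_one, ← Finset.prod_mul_distrib]
    refine Finset.prod_congr rfl fun i _ => ?_
    have h2 : Finset.Ioi i.castSucc = insert (Fin.last N) ((Finset.Ioi i).map Fin.castSuccEmb) := by
      ext j
      refine Fin.lastCases ?_ (fun j => ?_) j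
      · simp [Fin.castSucc_lt_last]
      · simp [Fin.le_last]
    rw [h2, Finset.prod_insert (by simp), Finset.prod_map]
    rfl

theorem alternant_zero_ne_zero {N : ℕ} {x : Fin N → ℂ} (hx : x ∈ regularPoints N) :
    alternant (0 : Fin N → ℤ) x ≠ 0 := by
  rw [alternant_zero_eq_prod N x hx.1]
  refine Finset.prod_ne_zero_iff.2 fun i _ => Finset.prod_ne_zero_iff.2 fun j hj => ?_
  exact sub_ne_zero.2 fun h => (Finset.mem_Ioi.1 hj).ne (hx.2 h)

theorem mem_closure_regularPoints {N : ℕ} {x : Fin N → ℂ} (hx : ∀ i, x i ≠ 0) :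
    x ∈ closure (regularPoints N) := by
  have hc : ∀ i : Fin N, Tendsto (fun s : ℂ => x i + s * (i : ℕ)) (𝓝[≠] 0) (𝓝 (x i)) := by
    intro i
    have : Continuous fun s : ℂ => x i + s * (i : ℕ) := by fun_prop
    have h := this.tendsto 0
    simp only [zero_mul, add_zero] at h
    exact h.mono_left nhdsWithin_le_nhds
  -- Moving the coordinate number `i` by `s * i` separates coinciding coordinates for every `s ≠ 0`,
  -- and for small `s` it keeps distinct coordinates distinct and nonzero ones nonzero.
  refine mem_closure_of_tendsto (f := fun s : ℂ => fun i => x i + s * (i : ℕ)) (b := 𝓝[≠] 0)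
    (tendsto_pi_nhds.2 hc) ?_
  have h1 : ∀ i : Fin N, ∀ᶠ s : ℂ in 𝓝[≠] 0, x i + s * (i : ℕ) ≠ 0 := fun i =>
    (hc i).eventually_ne (hx i)
  have h2 : ∀ i j : Fin N, i ≠ j → ∀ᶠ s : ℂ in 𝓝[≠] 0,
      x i + s * (i : ℕ) ≠ x j + s * (j : ℕ) := by
    intro i j hij
    by_cases h : x i = x j
    · filter_upwards [self_mem_nhdsWithin] with s hs
      rw [h]
      intro h'
      have := mul_left_cancel₀ hs (add_left_cancel h')
      exact hij (Fin.ext (by exact_mod_cast this))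
    · exact (((hc i).sub (hc j)).eventually_ne (sub_ne_zero.2 h)).mono fun s hs => sub_ne_zero.1 hs
  filter_upwards [eventually_all.2 h1, eventually_all.2 fun i => eventually_all.2 fun j =>
    eventually_all.2 (h2 i j)] with s hs1 hs2
  refine ⟨hs1, fun i j hij => ?_⟩
  by_contra hne
  exact hs2 i j hne hij

theorem schur_eq_gtSum {N : ℕ} (l : Signature N) {x : Fin N → ℂ} (hx : ∀ i, x i ≠ 0) :
    schur l x = gtSum N l x := by
  refine extendFrom_eq (mem_closure_regularPoints hx) ?_
  refine Tendsto.congr' ?_ ((analyticAt_gtSum N l x hx).continuousAt.tendsto.mono_left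
    nhdsWithin_le_nhds)
  filter_upwards [self_mem_nhdsWithin] with y hy
  rw [alternant_eq_gtSum_mul N l l.2 y hy.1, mul_div_cancel_right₀ _ (alternant_zero_ne_zero hy)]

theorem eventually_forall_ne_zero {N : ℕ} {x : Fin N → ℂ} (hx : ∀ i, x i ≠ 0) :
    ∀ᶠ y in 𝓝 x, ∀ i, y i ≠ 0 :=
  eventually_all.2 fun i => ((continuous_apply i).tendsto x).eventually_ne (hx i)

theorem analyticAt_schur {N : ℕ} (l : Signature N) {x : Fin N → ℂ} (hx : ∀ i, x i ≠ 0) :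
    AnalyticAt ℂ (schur l) x :=
  (analyticAt_gtSum N l x hx).congr ((eventually_forall_ne_zero hx).mono fun _ hy =>
    (schur_eq_gtSum l hy).symm)

theorem analyticAt_normSchur {N : ℕ} (l : Signature N) {x : Fin N → ℂ} (hx : ∀ i, x i ≠ 0) :
    AnalyticAt ℂ (normSchur l) x :=
  (analyticAt_schur l hx).fun_div analyticAt_const (by
    rw [schur_eq_gtSum l (x := 1) (by simp), gtSum_one]
    exact Nat.cast_ne_zero.2 (gtCount_pos N l l.2).ne')

theorem schur_one {N : ℕ} (l : Signature N) : schur l 1 = gtCount N l := by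
  rw [schur_eq_gtSum l (by simp), gtSum_one]

theorem schur_one_ne_zero {N : ℕ} (l : Signature N) : schur l 1 ≠ 0 := by
  rw [schur_one]
  exact Nat.cast_ne_zero.2 (gtCount_pos N l l.2).ne'

theorem normSchur_one {N : ℕ} (l : Signature N) : normSchur l 1 = 1 :=
  div_self (schur_one_ne_zero l)

theorem alternant_comp_perm {N : ℕ} (l : Fin N → ℤ) (x : Fin N → ℂ) (σ : Equiv.Perm (Fin N)) :
    alternant l (x ∘ σ) = Equiv.Perm.sign σ * alternant l x :=
  Matrix.det_permute σ (Matrix.of fun i j : Fin N => x i ^ (l j + N - 1 - (j : ℕ)))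

/-- At regular points both alternants change by the sign of `σ`; continuity extends the symmetry to
coinciding coordinates. -/
theorem schur_comp_perm {N : ℕ} (l : Signature N) {x : Fin N → ℂ} (hx : ∀ i, x i ≠ 0)
    (σ : Equiv.Perm (Fin N)) : schur l (x ∘ σ) = schur l x := by
  have : (𝓝[regularPoints N] x).NeBot :=
    mem_closure_iff_nhdsWithin_neBot.1 (mem_closure_regularPoints hx)
  have hcont : Continuous fun y : Fin N → ℂ => y ∘ σ :=
    continuous_pi fun i => continuous_apply (σ i)
  have h1 : Tendsto (fun y => schur l (y ∘ σ)) (𝓝[regularPoints N] x) (𝓝 (schur l (x ∘ σ))) :=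
    ((analyticAt_schur l (x := x ∘ σ) fun i => hx _).continuousAt.tendsto.comp
      (hcont.tendsto x)).mono_left nhdsWithin_le_nhds
  have h2 : Tendsto (schur l) (𝓝[regularPoints N] x) (𝓝 (schur l x)) :=
    (analyticAt_schur l hx).continuousAt.tendsto.mono_left nhdsWithin_le_nhds
  refine tendsto_nhds_unique (h1.congr' ?_) h2
  filter_upwards [self_mem_nhdsWithin] with y hy
  have hy' : ∀ i, (y ∘ σ) i ≠ 0 := fun i => hy.1 _
  rw [schur_eq_gtSum l hy.1, schur_eq_gtSum l hy']
  refine mul_right_cancel₀ (b := alternant (0 : Fin N → ℤ) (y ∘ σ)) ?_ ?_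
  · exact alternant_zero_ne_zero ⟨hy', hy.2.comp σ.injective⟩
  · rw [← alternant_eq_gtSum_mul N l l.2 _ hy', alternant_comp_perm, alternant_comp_perm,
      alternant_eq_gtSum_mul N l l.2 _ hy.1]
    ring

theorem normSchur_comp_perm {N : ℕ} (l : Signature N) {x : Fin N → ℂ} (hx : ∀ i, x i ≠ 0)
    (σ : Equiv.Perm (Fin N)) : normSchur l (x ∘ σ) = normSchur l x := by
  rw [normSchur, normSchur, schur_comp_perm l hx]

end Schur

/-! ### Alternants as eigenfunctions -/

section Eigen

variable {M : ℕ}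

theorem analyticAt_monomial (e : Fin M → ℤ) {x : Fin M → ℂ} (hx : ∀ i, x i ≠ 0) :
    AnalyticAt ℂ (fun x : Fin M → ℂ => ∏ i, x i ^ e i) x :=
  Finset.analyticAt_fun_prod _ fun i _ => (analyticAt_apply i x).zpow (hx i)

theorem mul_partialDeriv_monomial (e : Fin M → ℤ) {x : Fin M → ℂ} (hx : ∀ i, x i ≠ 0) (i : Fin M) :
    x i * partialDeriv i (fun x : Fin M → ℂ => ∏ i, x i ^ e i) x = e i * ∏ i, x i ^ e i := by
  have h1 : ∀ j ∈ Finset.univ, HasFDerivAt (fun x : Fin M → ℂ => x j ^ e j)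
      (((e j : ℂ) * x j ^ (e j - 1)) • ContinuousLinearMap.proj (R := ℂ) (φ := fun _ : Fin M => ℂ) j)
      x := fun j _ => HasDerivAt.comp_hasFDerivAt (h₂ := fun z : ℂ => z ^ e j) x
        (hasDerivAt_zpow (e j) (x j) (Or.inl (hx j)))
        (ContinuousLinearMap.proj (R := ℂ) (φ := fun _ : Fin M => ℂ) j).hasFDerivAt
  rw [partialDeriv, (HasFDerivAt.finsetProd h1).fderiv]
  simp only [_root_.sum_apply, _root_.smul_apply, smul_eq_mul,
    ContinuousLinearMap.proj_apply, ← Fin.ext_iff, mul_ite, mul_one, mul_zero]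
  rw [Finset.sum_ite_eq' Finset.univ i, if_pos (Finset.mem_univ i),
    ← Finset.mul_prod_erase Finset.univ (fun i => x i ^ e i) (Finset.mem_univ i), zpow_sub_one₀ (hx i)]
  field_simp [hx i]

theorem eulerDeriv_taylor_monomial (e : Fin M → ℤ) (i : Fin M) :
    eulerDeriv i (taylor fun x : Fin M → ℂ => ∏ i, x i ^ e i) =
      (e i : ℂ) • taylor fun x : Fin M → ℂ => ∏ i, x i ^ e i := by
  have h1 : AnalyticAt ℂ (fun x : Fin M → ℂ => ∏ i, x i ^ e i) 1 :=
    analyticAt_monomial e (by simp)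
  rw [eulerDeriv_apply, pderiv_taylor h1, ← taylor_apply, ← taylor_mul (analyticAt_apply i 1)
    (AnalyticAt.partialDeriv h1 i), ← taylor_const_mul _ h1]
  refine taylor_congr ?_
  filter_upwards [eventually_forall_ne_zero (x := (1 : Fin M → ℂ)) (by simp)] with x hx
  exact mul_partialDeriv_monomial e hx i

theorem iterate_eulerDeriv_taylor_monomial (e : Fin M → ℤ) (i : Fin M) (k : ℕ) :
    (eulerDeriv i)^[k] (taylor fun x : Fin M → ℂ => ∏ i, x i ^ e i) =
      ((e i : ℂ) ^ k) • taylor fun x : Fin M → ℂ => ∏ i, x i ^ e i := by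
  induction k with
  | zero => simp
  | succ k ih =>
    rw [Function.iterate_succ_apply', ih, Derivation.map_smul, eulerDeriv_taylor_monomial, smul_smul,
      pow_succ]

theorem alternant_eq_sum (l : Fin M → ℤ) (x : Fin M → ℂ) : alternant l x =
    ∑ σ : Equiv.Perm (Fin M), ((Equiv.Perm.sign σ : ℤ) : ℂ) *
      ∏ i, x i ^ (l (σ i) + M - 1 - ((σ i : Fin M) : ℕ)) := by
  rw [alternant, ← Matrix.det_transpose, Matrix.det_apply']
  rfl

theorem analyticAt_alternant (l : Fin M → ℤ) : AnalyticAt ℂ (alternant l) 1 := by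
  rw [show alternant l = _ from funext (alternant_eq_sum l)]
  exact Finset.analyticAt_fun_sum _ fun σ _ => analyticAt_const.fun_mul
    (analyticAt_monomial _ (by simp))

theorem iterate_eulerDeriv_smul (i : Fin M) (k : ℕ) (c : ℂ) (f : MvPowerSeries (Fin M) ℂ) :
    (eulerDeriv i)^[k] (c • f) = c • (eulerDeriv i)^[k] f :=
  (Function.Semiconj.iterate_right (f := fun f => c • f)
    (fun f => ((eulerDeriv i).map_smul _ f).symm) k f).symm

theorem iterate_eulerDeriv_sum {ι : Type*} (s : Finset ι) (i : Fin M) (k : ℕ)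
    (f : ι → MvPowerSeries (Fin M) ℂ) :
    (eulerDeriv i)^[k] (∑ j ∈ s, f j) = ∑ j ∈ s, (eulerDeriv i)^[k] (f j) := by
  induction k with
  | zero => rfl
  | succ k ih => simp only [Function.iterate_succ_apply', ih, map_sum]

/-- Each monomial of the alternant has as exponents a permutation of the shifted parts of `l`, so
every one of them is an eigenfunction with the same eigenvalue. -/
theorem sum_iterate_eulerDeriv_taylor_alternant (l : Fin M → ℤ) (k : ℕ) :
    ∑ i, (eulerDeriv i)^[k] (taylor (alternant l)) =
      (∑ i, ((l i + M - 1 - (i : ℕ) : ℤ) : ℂ) ^ k) • taylor (alternant l) := by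
  rw [show alternant l = _ from funext (alternant_eq_sum l)]
  have ha : ∀ e : Fin M → ℤ, AnalyticAt ℂ (fun x : Fin M → ℂ => ∏ i, x i ^ e i) 1 :=
    fun e => analyticAt_monomial e (by simp)
  rw [taylor_sum _ fun σ _ => analyticAt_const.fun_mul (ha _), Finset.smul_sum]
  simp only [taylor_const_mul _ (ha _), iterate_eulerDeriv_sum, iterate_eulerDeriv_smul,
    iterate_eulerDeriv_taylor_monomial]
  rw [Finset.sum_comm]
  refine Finset.sum_congr rfl fun σ _ => ?_
  rw [← Finset.smul_sum, ← Finset.sum_smul, smul_comm]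
  congr 1
  exact Equiv.sum_comp σ fun i => (((l i + M - 1 - (i : ℕ) : ℤ)) : ℂ) ^ k

theorem taylor_alternant_zero : taylor (alternant (0 : Fin M → ℤ)) = vanderPS M := by
  have h : alternant (0 : Fin M → ℤ) =ᶠ[𝓝 1] fun x => ∏ i, ∏ j ∈ Finset.Ioi i, (x i - x j) := by
    filter_upwards [eventually_forall_ne_zero (x := (1 : Fin M → ℂ)) (by simp)] with x hx
    exact alternant_zero_eq_prod M x hx
  have ha : ∀ i j : Fin M, AnalyticAt ℂ (fun x : Fin M → ℂ => x i - x j) 1 := fun i j =>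
    (analyticAt_apply i 1).fun_sub (analyticAt_apply j 1)
  rw [taylor_congr h, taylor_prod _ fun i _ => Finset.analyticAt_fun_prod _ fun j _ => ha i j]
  refine Finset.prod_congr rfl fun i _ => ?_
  rw [taylor_prod _ fun j _ => ha i j]
  refine Finset.prod_congr rfl fun j _ => ?_
  rw [taylor_sub (analyticAt_apply i 1) (analyticAt_apply j 1), taylor_apply, taylor_apply]
  ring

/-- `V` times the normalized Schur function is a constant multiple of the alternant. This is the
eigenvalue relation that turns moments into operators. -/
theorem sum_iterate_eulerDeriv_vanderPS_mul_taylor_normSchur (l : Signature M) (k : ℕ) :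
    ∑ i, (eulerDeriv i)^[k] (vanderPS M * taylor (normSchur l)) =
      ((powerSum k l : ℝ) : ℂ) • (vanderPS M * taylor (normSchur l)) := by
  have h1 : vanderPS M * taylor (normSchur l) = (schur l 1)⁻¹ • taylor (alternant l) := by
    have hn : normSchur l = fun x => (schur l 1)⁻¹ * schur l x := by
      funext x; rw [normSchur, div_eq_inv_mul]
    have hs := analyticAt_schur l (x := (1 : Fin M → ℂ)) (by simp)
    rw [hn, taylor_const_mul _ hs, mul_smul_comm, ← taylor_alternant_zero,
      ← taylor_mul (analyticAt_alternant _) hs]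
    congr 1
    refine taylor_congr ?_
    filter_upwards [eventually_forall_ne_zero (x := (1 : Fin M → ℂ)) (by simp)] with x hx
    rw [schur_eq_gtSum l hx, alternant_eq_gtSum_mul M l l.2 x hx, mul_comm]
  have h2 : ((powerSum k l : ℝ) : ℂ) = ∑ i, ((l i + M - 1 - (i : ℕ) : ℤ) : ℂ) ^ k := by
    rw [powerSum]; push_cast; rfl
  simp only [h1, h2, iterate_eulerDeriv_smul]
  rw [← Finset.smul_sum, sum_iterate_eulerDeriv_taylor_alternant, smul_comm]

end Eigen

/-! ### Branching coefficients -/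

section Branching

theorem normSchur_eq_gtSum {N : ℕ} (l : Signature N) {x : Fin N → ℂ} (hx : ∀ i, x i ≠ 0) :
    normSchur l x = gtSum N l x / gtCount N l := by
  rw [normSchur, schur_one, schur_eq_gtSum l hx]

theorem padOne_ne_zero {m k : ℕ} {x : Fin m → ℂ} (hx : ∀ i, x i ≠ 0) (i : Fin k) :
    padOne k x i ≠ 0 := by
  unfold padOne
  split_ifs
  · exact hx _
  · exact one_ne_zero

theorem padOne_self {m : ℕ} (x : Fin m → ℂ) : padOne m x = x := by
  funext i; simp [padOne]

theorem padOne_one {m k : ℕ} : padOne k (1 : Fin m → ℂ) = 1 := by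
  funext i; simp [padOne]

theorem padOne_padOne {m j k : ℕ} (hmj : m ≤ j) (x : Fin m → ℂ) :
    padOne k (padOne j x) = padOne k x := by
  funext i
  simp only [padOne]
  split_ifs with h1 h2 h3
  · rfl
  · rfl
  · omega
  · rfl

theorem normSchur_padOne_succ {N : ℕ} (l : Signature (N + 1)) {x : Fin N → ℂ}
    (hx : ∀ i, x i ≠ 0) : normSchur l (padOne (N + 1) x) = ∑ μ ∈ (interlacing l).attach,
      ((gtCount N μ / gtCount (N + 1) l : ℝ) : ℂ) *
        normSchur ⟨μ, antitone_of_mem_interlacing l.2 μ.2⟩ x := by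
  rw [normSchur_eq_gtSum l (padOne_ne_zero hx), gtSum, Finset.sum_div, ← Finset.sum_attach]
  refine Finset.sum_congr rfl fun μ _ => ?_
  have h1 : (fun i : Fin N => padOne (N + 1) x i.castSucc) = x := by
    funext i; simp [padOne]
  have h2 : padOne (N + 1) x (Fin.last N) = 1 := by simp [padOne]
  have h3 : (gtCount N μ : ℂ) ≠ 0 :=
    Nat.cast_ne_zero.2 (gtCount_pos N μ (antitone_of_mem_interlacing l.2 μ.2)).ne'
  have h4 : normSchur ⟨μ, antitone_of_mem_interlacing l.2 μ.2⟩ x = gtSum N μ x / gtCount N μ :=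
    normSchur_eq_gtSum _ hx
  rw [h1, h2, one_zpow, mul_one, h4]
  push_cast
  field_simp

theorem sum_ofReal_mul_eq {N : ℕ} (p : Signature N →₀ ℝ) (f : Signature N → ℂ) :
    (p.sum fun μ r => (r : ℂ) * f μ) = Finsupp.linearCombination ℝ f p := by
  simp [Finsupp.linearCombination_apply, Complex.real_smul]

/-- Variables are set to `1` one at a time. Each step has the explicit weights `gtCount μ / gtCount
l`, so the composed weights are nonnegative. -/
theorem exists_branching (m d : ℕ) (l : Signature (m + d)) : ∃ p : Signature m →₀ ℝ,
    (∀ μ, 0 ≤ p μ) ∧ ∀ x : Fin m → ℂ, (∀ i, x i ≠ 0) →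
      normSchur l (padOne (m + d) x) = p.sum fun μ r => (r : ℂ) * normSchur μ x := by
  classical
  induction d with
  | zero =>
    refine ⟨Finsupp.single l 1, fun μ => ?_, fun x _ => ?_⟩
    · exact (Finsupp.single_nonneg.2 zero_le_one) μ
    · rw [Finsupp.sum_single_index (by simp)]
      simp [padOne_self]
  | succ d ih =>
    choose P hP0 hP using ih
    refine ⟨∑ μ ∈ (interlacing l).attach, (gtCount (m + d) μ / gtCount (m + d + 1) l : ℝ) •
      P ⟨μ, antitone_of_mem_interlacing l.2 μ.2⟩, fun μ => ?_, fun x hx => ?_⟩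
    · rw [Finsupp.finsetSum_apply]
      exact Finset.sum_nonneg fun ν _ => mul_nonneg (by positivity) (hP0 _ _)
    · have h1 := normSchur_padOne_succ l (x := padOne (m + d) x) (padOne_ne_zero hx)
      have h2 : padOne (m + d + 1) (padOne (m + d) x) = padOne (m + d + 1) x :=
        padOne_padOne (by omega) x
      replace h1 := (congrArg (normSchur (N := m + d + 1) l) h2).symm.trans h1
      change normSchur l (padOne (m + d + 1) x) = _
      rw [h1, sum_ofReal_mul_eq, map_sum]
      refine Finset.sum_congr rfl fun μ _ => ?_
      rw [map_smul, ← Complex.real_smul]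
      exact congrArg _ ((hP _ x hx).trans (sum_ofReal_mul_eq _ _))

/-- The characters of the torus. -/
def torusChar {N : ℕ} (e : Fin N → ℤ) : (Fin N → ℂˣ) →* ℂ where
  toFun u := ((∏ i, u i ^ e i : ℂˣ) : ℂ)
  map_one' := by simp
  map_mul' u v := by simp [mul_zpow, Finset.prod_mul_distrib]

/-- The exponent number `i` is recovered from the value at the point whose coordinate `i` is `2` and
whose other coordinates are `1`. -/
theorem torusChar_injective {N : ℕ} : Function.Injective (torusChar (N := N)) := by
  intro e f h
  funext i
  have h1 := DFunLike.congr_fun h (Function.update (1 : Fin N → ℂˣ) i (Units.mk0 (2 : ℂ) two_ne_zero))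
  have h2 : ∀ e : Fin N → ℤ,
      torusChar e (Function.update (1 : Fin N → ℂˣ) i (Units.mk0 (2 : ℂ) two_ne_zero)) = (2 : ℂ) ^ e i := by
    intro e
    change ((∏ j, _ : ℂˣ) : ℂ) = _
    rw [Finset.prod_eq_single i]
    · simp
    · intro j _ hj
      simp [Function.update_of_ne hj]
    · simp
  rw [h2, h2] at h1
  have h3 : ((2 : ℝ) ^ e i) = (2 : ℝ) ^ f i := by
    simpa [norm_zpow] using congrArg norm h1
  exact zpow_right_injective₀ (by norm_num) (by norm_num) h3

/-- Shifted signatures are strictly decreasing, so no nontrivial permutation of one is again a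
shifted signature. Hence the monomials in the expansions of different alternants are all different.
-/
theorem shifted_comp_injective {N : ℕ} {l μ : Signature N} {σ : Equiv.Perm (Fin N)}
    (h : ∀ i, μ (σ i) + N - 1 - ((σ i : Fin N) : ℕ) = l i + N - 1 - (i : ℕ)) : σ = 1 ∧ μ = l := by
  have hanti : ∀ ν : Signature N, StrictAnti fun i : Fin N => ν i + N - 1 - (i : ℕ) := by
    intro ν i j hij
    have h1 := ν.2 hij.le
    have h2 : (i : ℕ) < j := hij
    show ν j + N - 1 - (j : ℕ) < ν i + N - 1 - (i : ℕ)
    have h3 : ν j ≤ ν i := h1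
    omega
  have hσ : StrictMono σ := by
    intro i j hij
    have := hanti l hij
    simp only [← h] at this
    exact (hanti μ).lt_iff_gt.1 this
  have h1 : σ = 1 := by
    have : (hσ.orderIsoOfSurjective σ σ.surjective) = OrderIso.refl _ := Subsingleton.elim _ _
    ext i
    exact congrArg Fin.val (DFunLike.congr_fun this i)
  refine ⟨h1, Subtype.ext (funext fun i => ?_)⟩
  have := h i
  rw [h1] at this
  simp only [Equiv.Perm.coe_one, id] at this
  change μ i = l i
  omega

/-- Linear independence of characters kills every coefficient of the expansion into monomials; the
coefficient at the unpermuted exponent of `l` is `p l`. -/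
theorem eq_zero_of_sum_alternant {N : ℕ} (p : Signature N →₀ ℂ)
    (h : ∀ x : Fin N → ℂ, (∀ i, x i ≠ 0) → (p.sum fun μ r => r * alternant μ x) = 0) : p = 0 := by
  classical
  set T : (Fin N → ℤ) →₀ ℂ := ∑ μ ∈ p.support, ∑ σ : Equiv.Perm (Fin N),
    Finsupp.single (fun i => μ (σ i) + N - 1 - ((σ i : Fin N) : ℕ))
      (p μ * ((Equiv.Perm.sign σ : ℤ) : ℂ)) with hT
  have hli : LinearIndependent ℂ fun e : Fin N → ℤ => (torusChar e : (Fin N → ℂˣ) → ℂ) :=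
    (linearIndependent_monoidHom (Fin N → ℂˣ) ℂ).comp torusChar torusChar_injective
  have hT0 : T = 0 := by
    refine linearIndependent_iff.1 hli T ?_
    funext u
    rw [hT]
    simp only [map_sum, Finsupp.linearCombination_single, Finset.sum_apply, Pi.smul_apply,
      Pi.zero_apply, smul_eq_mul]
    rw [← h (fun i => u i) fun i => (u i).ne_zero, Finsupp.sum]
    refine Finset.sum_congr rfl fun μ _ => ?_
    rw [alternant_eq_sum, Finset.mul_sum]
    refine Finset.sum_congr rfl fun σ _ => ?_
    rw [mul_assoc]
    congr 2
    simp [torusChar]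
  ext l
  have h1 := DFunLike.congr_fun hT0 (fun i => l i + N - 1 - (i : ℕ))
  rw [hT, Finsupp.finsetSum_apply] at h1
  simp only [Finsupp.finsetSum_apply] at h1
  by_contra hl
  rw [Finsupp.coe_zero, Pi.zero_apply] at hl h1
  rw [Finset.sum_eq_single l, Finset.sum_eq_single 1] at h1
  · simp at h1
    exact hl h1
  · intro σ _ hσ
    refine Finsupp.single_eq_of_ne fun h' => hσ ?_
    exact (shifted_comp_injective (l := l) (μ := l) (σ := σ) fun i => (congrFun h' i).symm).1
  · simp
  · intro μ _ hμ
    refine Finset.sum_eq_zero fun σ _ => Finsupp.single_eq_of_ne fun h' => hμ ?_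
    exact (shifted_comp_injective (l := l) (μ := μ) (σ := σ) fun i => (congrFun h' i).symm).2
  · intro h'
    exact absurd (Finsupp.mem_support_iff.2 hl) h'

/-- Multiplying by the Vandermonde product turns the difference of the two expansions into a
vanishing combination of alternants. -/
theorem expansion_unique {N : ℕ} {p q : Signature N →₀ ℝ}
    (h : ∀ x : Fin N → ℂ, (∀ i, x i ≠ 0) → (p.sum fun μ r => (r : ℂ) * normSchur μ x) =
      q.sum fun μ r => (r : ℂ) * normSchur μ x) : p = q := by
  classical
  rw [← sub_eq_zero]
  set D := p - q with hD
  have h1 : (Finsupp.onFinset D.support (fun μ => (D μ : ℂ) / gtCount N μ) fun μ hμ => by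
      rw [Finsupp.mem_support_iff]
      rintro h0
      simp [h0] at hμ) = (0 : Signature N →₀ ℂ) := by
    refine eq_zero_of_sum_alternant _ fun x hx => ?_
    rw [Finsupp.onFinset_sum _ (by simp)]
    have h2 := h x hx
    rw [sum_ofReal_mul_eq, sum_ofReal_mul_eq, ← sub_eq_zero, ← map_sub, ← hD,
      ← sum_ofReal_mul_eq, Finsupp.sum] at h2
    rw [← mul_zero (alternant (0 : Fin N → ℤ) x), ← h2, Finset.mul_sum]
    refine Finset.sum_congr rfl fun μ _ => ?_
    rw [alternant_eq_gtSum_mul N μ μ.2 x hx, normSchur_eq_gtSum μ hx]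
    ring
  ext μ
  have h2 := DFunLike.congr_fun h1 μ
  rw [Finsupp.onFinset_apply, Finsupp.coe_zero, Pi.zero_apply, div_eq_zero_iff] at h2
  rcases h2 with h2 | h2
  · exact_mod_cast h2
  · exact absurd h2 (Nat.cast_ne_zero.2 (gtCount_pos N μ μ.2).ne')

theorem branching_spec {m k : ℕ} (hmk : m ≤ k) (l : Signature k) : ∀ x : Fin m → ℂ,
    (∀ i, x i ≠ 0) → normSchur l (padOne k x) =
      (branching m l).sum fun μ r => (r : ℂ) * normSchur μ x := by
  obtain ⟨d, rfl⟩ := Nat.exists_eq_add_of_le hmk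
  obtain ⟨p, _, hp⟩ := exists_branching m d l
  exact Classical.epsilon_spec (p := fun p : Signature m →₀ ℝ => ∀ x : Fin m → ℂ,
    (∀ i, x i ≠ 0) → normSchur l (padOne (m + d) x) = p.sum fun μ r => (r : ℂ) * normSchur μ x)
    ⟨p, hp⟩

/-- The chosen expansion coincides, by uniqueness, with the one built from pattern counts. -/
theorem branching_nonneg {m k : ℕ} (hmk : m ≤ k) (l : Signature k) (μ : Signature m) :
    0 ≤ branching m l μ := by
  obtain ⟨d, rfl⟩ := Nat.exists_eq_add_of_le hmk
  obtain ⟨p, hp0, hp⟩ := exists_branching m d l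
  have : branching m l = p := expansion_unique fun x hx => by
    rw [← branching_spec hmk l x hx, hp x hx]
  rw [this]
  exact hp0 μ

theorem branching_sum {m k : ℕ} (hmk : m ≤ k) (l : Signature k) :
    ((branching m l).sum fun _ r => r) = 1 := by
  have := branching_spec hmk l 1 (by simp)
  rw [padOne_one, normSchur_one] at this
  simp only [normSchur_one, mul_one, Finsupp.sum] at this
  rw [Finsupp.sum]
  exact_mod_cast this.symm

end Branching

/-! ### Markov chains of signatures -/

section Chain

/-- The weights of the Markov chain with the branching coefficients as transition probabilities,
started on the last level. -/
def chainWeight {n : ℕ} (s : Fin (n + 1) → ℕ) (ρ : Signature (s (Fin.last n)) → ℝ)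
    (ω : ∀ t, Signature (s t)) : ℝ :=
  ρ (ω (Fin.last n)) * ∏ i : Fin n, branching (s i.castSucc) (ω i.succ) (ω i.castSucc)

/-- The conditional expectation of `∏ h_t (ω_t)` given the signature on the last level. -/
def chainAvg : ∀ (n : ℕ) (s : Fin (n + 1) → ℕ), (∀ t, Signature (s t) → ℝ) →
    Signature (s (Fin.last n)) → ℝ
  | 0, _, h, l => h 0 l
  | n + 1, s, h, l => h (Fin.last (n + 1)) l *
      (branching (s (Fin.last n).castSucc) l).sum fun μ r =>
        r * chainAvg n (fun t => s t.castSucc) (fun t => h t.castSucc) μ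

theorem chainWeight_nonneg {n : ℕ} {s : Fin (n + 1) → ℕ} (hs : Monotone s)
    {ρ : Signature (s (Fin.last n)) → ℝ} (hρ : ∀ l, 0 ≤ ρ l) (ω : ∀ t, Signature (s t)) :
    0 ≤ chainWeight s ρ ω :=
  mul_nonneg (hρ _) (Finset.prod_nonneg fun _ _ =>
    branching_nonneg (hs (Fin.castSucc_lt_succ).le) _ _)

theorem chainWeight_snoc {n : ℕ} (s : Fin (n + 2) → ℕ) (ρ : Signature (s (Fin.last (n + 1))) → ℝ)
    (l : Signature (s (Fin.last (n + 1)))) (ω : ∀ t : Fin (n + 1), Signature (s t.castSucc)) :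
    chainWeight s ρ (Fin.snoc (α := fun t => Signature (s t)) ω l) =
      ρ l * chainWeight (fun t => s t.castSucc) (branching (s (Fin.last n).castSucc) l) ω := by
  have h1 : ∀ i : Fin n, branching (s i.castSucc.castSucc)
      (Fin.snoc (α := fun t => Signature (s t)) ω l i.castSucc.succ)
      (Fin.snoc (α := fun t => Signature (s t)) ω l i.castSucc.castSucc) =
      branching (s i.castSucc.castSucc) (ω i.succ) (ω i.castSucc) := by
    intro i
    rw [Fin.snoc_castSucc]
    have := Fin.snoc_castSucc (α := fun t => Signature (s t)) l ω i.succ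
    exact congrArg (fun z => (branching (s i.castSucc.castSucc) z) (ω i.castSucc)) this
  have h2 : branching (s (Fin.last n).castSucc)
      (Fin.snoc (α := fun t => Signature (s t)) ω l (Fin.last n).succ)
      (Fin.snoc (α := fun t => Signature (s t)) ω l (Fin.last n).castSucc) =
      branching (s (Fin.last n).castSucc) l (ω (Fin.last n)) := by
    rw [Fin.snoc_castSucc]
    have := Fin.snoc_last (α := fun t => Signature (s t)) l ω
    exact congrArg (fun z => (branching (s (Fin.last n).castSucc) z) (ω (Fin.last n))) this
  rw [chainWeight, chainWeight, Fin.prod_univ_castSucc, h2, Finset.prod_congr rfl fun i _ => h1 i,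
    Fin.snoc_last]
  ring

theorem prod_snoc {n : ℕ} (s : Fin (n + 2) → ℕ) (h : ∀ t, Signature (s t) → ℝ)
    (l : Signature (s (Fin.last (n + 1)))) (ω : ∀ t : Fin (n + 1), Signature (s t.castSucc)) :
    ∏ t, h t (Fin.snoc (α := fun t => Signature (s t)) ω l t) =
      h (Fin.last (n + 1)) l * ∏ t : Fin (n + 1), h t.castSucc (ω t) := by
  rw [Fin.prod_univ_castSucc, Fin.snoc_last, mul_comm]
  simp only [Fin.snoc_castSucc]

/-- Fubini, with the last level split off. Absolute summability on configurations is assumed here;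
for nonnegative functions it is supplied by `summable_chainWeight`. -/
theorem hasSum_chainAvg (n : ℕ) : ∀ (s : Fin (n + 1) → ℕ) (ρ : Signature (s (Fin.last n)) → ℝ)
    (h : ∀ t, Signature (s t) → ℝ),
    Summable (fun ω : ∀ t, Signature (s t) => chainWeight s ρ ω * ∏ t, h t (ω t)) →
    HasSum (fun l => ρ l * chainAvg n s h l)
      (∑' ω : ∀ t, Signature (s t), chainWeight s ρ ω * ∏ t, h t (ω t)) := by
  induction n with
  | zero =>
    intro s ρ h hs
    have := (Equiv.hasSum_iff (Equiv.piUnique fun t : Fin 1 => Signature (s t)).symm).2 hs.hasSum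
    refine this.congr_fun ?_ |> fun h => h
    intro l
    simp [chainWeight, chainAvg]
    rfl
  | succ n ih =>
    intro s ρ h hs
    have h1 := (Equiv.hasSum_iff (Fin.snocEquiv fun t => Signature (s t))).2 hs.hasSum
    refine h1.prod_fiberwise fun l => ?_
    simp only [Function.comp_def, Fin.snocEquiv, Equiv.coe_fn_mk, chainWeight_snoc, prod_snoc]
    have h2 := h1.summable.prod_factor l
    simp only [Function.comp_def, Fin.snocEquiv, Equiv.coe_fn_mk, chainWeight_snoc, prod_snoc] at h2
    have h3 : ∀ ω : ∀ t : Fin (n + 1), Signature (s t.castSucc),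
        ρ l * chainWeight (fun t => s t.castSucc) (branching (s (Fin.last n).castSucc) l) ω *
          (h (Fin.last (n + 1)) l * ∏ t : Fin (n + 1), h t.castSucc (ω t)) =
        (ρ l * h (Fin.last (n + 1)) l) *
          (chainWeight (fun t => s t.castSucc) (branching (s (Fin.last n).castSucc) l) ω *
            ∏ t : Fin (n + 1), h t.castSucc (ω t)) := fun ω => by ring
    simp only [h3] at h2 ⊢
    rw [chainAvg, ← mul_assoc]
    -- If the prefactor vanishes, the sum over the fibre need not converge by itself, but both sides
    -- are zero.
    by_cases h0 : ρ l * h (Fin.last (n + 1)) l = 0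
    · simp only [h0, zero_mul]
      exact hasSum_zero
    · rw [summable_mul_left_iff h0] at h2
      have h4 := ih _ _ _ h2
      refine HasSum.mul_left _ ?_
      have h5 : HasSum (fun μ => (branching (s (Fin.last n).castSucc) l) μ *
          chainAvg n (fun t => s t.castSucc) (fun t => h t.castSucc) μ)
          ((branching (s (Fin.last n).castSucc) l).sum fun μ r =>
            r * chainAvg n (fun t => s t.castSucc) (fun t => h t.castSucc) μ) :=
        hasSum_sum_of_ne_finset_zero fun μ hμ => by
          rw [Finsupp.notMem_support_iff.1 hμ, zero_mul]
      rw [h5.unique h4]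
      exact h2.hasSum

/-- Tonelli: for nonnegative functions the fibrewise sums are the conditional expectations, and each
of these is a finite sum of branching coefficients. -/
theorem summable_chainWeight (n : ℕ) : ∀ (s : Fin (n + 1) → ℕ) (_ : Monotone s)
    (ρ : Signature (s (Fin.last n)) → ℝ) (_ : ∀ l, 0 ≤ ρ l)
    (h : ∀ t, Signature (s t) → ℝ) (_ : ∀ t l, 0 ≤ h t l),
    Summable (fun l => ρ l * chainAvg n s h l) →
    Summable (fun ω : ∀ t, Signature (s t) => chainWeight s ρ ω * ∏ t, h t (ω t)) := by
  induction n with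
  | zero =>
    intro s _ ρ _ h _ hs
    rw [← Equiv.summable_iff (Equiv.piUnique fun t : Fin 1 => Signature (s t)).symm]
    refine hs.congr ?_
    intro l
    simp [chainWeight, chainAvg]
    rfl
  | succ n ih =>
    intro s hs ρ hρ h hh hsum
    have hs' : Monotone fun t : Fin (n + 1) => s t.castSucc := fun _ _ hij => hs (by simpa using hij)
    have hb : ∀ l μ, 0 ≤ branching (s (Fin.last n).castSucc) (k := s (Fin.last (n + 1))) l μ :=
      fun l μ => branching_nonneg (hs (Fin.le_last _)) l μ
    have hfib : ∀ l : Signature (s (Fin.last (n + 1))),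
        Summable fun ω : ∀ t : Fin (n + 1), Signature (s t.castSucc) =>
          chainWeight (fun t => s t.castSucc) (branching (s (Fin.last n).castSucc) l) ω *
            ∏ t : Fin (n + 1), h t.castSucc (ω t) := fun l =>
      ih _ hs' _ (hb l) _ (fun _ _ => hh _ _) (summable_of_ne_finset_zero
        (s := (branching (s (Fin.last n).castSucc) l).support) fun μ hμ => by
          rw [Finsupp.notMem_support_iff.1 hμ, zero_mul])
    have h3 : ∀ (l : Signature (s (Fin.last (n + 1))))
        (ω : ∀ t : Fin (n + 1), Signature (s t.castSucc)),
        ρ l * chainWeight (fun t => s t.castSucc) (branching (s (Fin.last n).castSucc) l) ω *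
          (h (Fin.last (n + 1)) l * ∏ t : Fin (n + 1), h t.castSucc (ω t)) =
        (ρ l * h (Fin.last (n + 1)) l) *
          (chainWeight (fun t => s t.castSucc) (branching (s (Fin.last n).castSucc) l) ω *
            ∏ t : Fin (n + 1), h t.castSucc (ω t)) := fun l ω => by ring
    rw [← Equiv.summable_iff (Fin.snocEquiv fun t => Signature (s t))]
    rw [summable_prod_of_nonneg]
    · constructor
      · intro l
        simp only [Function.comp_def, Fin.snocEquiv, Equiv.coe_fn_mk, chainWeight_snoc, prod_snoc, h3]
        exact (hfib l).mul_left _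
      · refine hsum.congr fun l => ?_
        simp only [Function.comp_def, Fin.snocEquiv, Equiv.coe_fn_mk, chainWeight_snoc, prod_snoc, h3]
        rw [tsum_mul_left, ← (hasSum_chainAvg n _ _ _ (hfib l)).tsum_eq, chainAvg, ← mul_assoc]
        congr 1
        exact (tsum_eq_sum fun μ hμ => by
          simp [Finsupp.notMem_support_iff.1 hμ]).symm
    · intro ω
      exact mul_nonneg (chainWeight_nonneg hs hρ _) (Finset.prod_nonneg fun t _ => hh _ _)

end Chain

/-! ### Discrete measures -/

section DiscreteMeasures

variable {Ω : Type*} [MeasurableSpace Ω]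

theorem integrable_sum_dirac [DiscreteMeasurableSpace Ω] {w f : Ω → ℝ} (hw : ∀ ω, 0 ≤ w ω) (h : Summable fun ω => w ω * f ω) :
    Integrable f (Measure.sum fun ω => ENNReal.ofReal (w ω) • Measure.dirac ω) := by
  refine ⟨Measurable.of_discrete.aestronglyMeasurable, ?_⟩
  rw [HasFiniteIntegral, lintegral_sum_measure]
  have h1 : ∀ ω, ∫⁻ x, ‖f x‖ₑ ∂(ENNReal.ofReal (w ω) • Measure.dirac ω) =
      ENNReal.ofReal |w ω * f ω| := by
    intro ω
    rw [lintegral_smul_measure, lintegral_dirac' _ Measurable.of_discrete, abs_mul,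
      abs_of_nonneg (hw ω), ENNReal.ofReal_mul (hw ω), Real.enorm_eq_ofReal_abs]
    rfl
  simp only [h1]
  exact (h.abs.tsum_ofReal_ne_top).lt_top

theorem integral_sum_dirac [DiscreteMeasurableSpace Ω] {w f : Ω → ℝ} (hw : ∀ ω, 0 ≤ w ω) (h : Summable fun ω => w ω * f ω) :
    ∫ ω, f ω ∂(Measure.sum fun ω => ENNReal.ofReal (w ω) • Measure.dirac ω) = ∑' ω, w ω * f ω := by
  rw [← (hasSum_integral_measure (integrable_sum_dirac hw h)).tsum_eq]
  refine tsum_congr fun ω => ?_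
  rw [integral_smul_measure, integral_dirac, ENNReal.toReal_ofReal (hw ω), smul_eq_mul]

theorem isProbabilityMeasure_sum_dirac {w : Ω → ℝ} (hw : ∀ ω, 0 ≤ w ω) (h : HasSum w 1) :
    IsProbabilityMeasure (Measure.sum fun ω => ENNReal.ofReal (w ω) • Measure.dirac ω) := by
  constructor
  rw [Measure.sum_apply _ MeasurableSet.univ]
  simp only [Measure.smul_apply, measure_univ, smul_eq_mul, mul_one]
  rw [← ENNReal.ofReal_tsum_of_nonneg hw h.summable, h.tsum_eq, ENNReal.ofReal_one]

end DiscreteMeasures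

/-! ### The measure on configurations. -/

section ProjMeasure

theorem chainAvg_one : ∀ (n : ℕ) (s : Fin (n + 1) → ℕ) (_ : Monotone s)
    (l : Signature (s (Fin.last n))), chainAvg n s (fun _ _ => 1) l = 1
  | 0, _, _, _ => rfl
  | n + 1, s, hs, l => by
    rw [chainAvg, one_mul]
    simp only [chainAvg_one n (fun t => s t.castSucc) fun _ _ hij => hs (by simpa using hij), mul_one]
    exact branching_sum (hs (Fin.le_last _)) l

theorem hasSum_chainWeight {n : ℕ} {s : Fin (n + 1) → ℕ} (hs : Monotone s)
    {ρ : Signature (s (Fin.last n)) → ℝ} (hρ : ∀ l, 0 ≤ ρ l) (h : HasSum ρ 1) :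
    HasSum (chainWeight s ρ) 1 := by
  have h1 : HasSum (fun l => ρ l * chainAvg n s (fun _ _ => 1) l) 1 := by
    simpa only [chainAvg_one n s hs, mul_one] using h
  have h2 := summable_chainWeight n s hs ρ hρ (fun _ _ => 1) (fun _ _ => zero_le_one) h1.summable
  have h3 := (hasSum_chainAvg n s ρ (fun _ _ => 1) h2).unique h1
  have h4 := h2.hasSum
  rw [h3] at h4
  simpa only [Finset.prod_const_one, mul_one] using h4

theorem hasSum_pmf_toReal {α : Type*} (p : PMF α) : HasSum (fun x => (p x).toReal) 1 := by
  have h : Summable fun x => (p x).toReal := ENNReal.summable_toReal p.tsum_coe_ne_top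
  have h2 := ENNReal.tsum_toReal_eq (f := p) p.apply_ne_top
  rw [p.tsum_coe, ENNReal.toReal_one] at h2
  rw [h2]
  exact h.hasSum

variable {n : ℕ} (ρ : ∀ N : ℕ, PMF (Signature N)) {a : Fin (n + 1) → ℝ}

theorem levelSize_mono (ha : Monotone a) (N : ℕ) : Monotone (levelSize a N) := fun _ _ hij =>
  Nat.floor_mono (mul_le_mul_of_nonneg_right (ha hij) (Nat.cast_nonneg N))

theorem configProb_nonneg (ha : Monotone a) (N : ℕ) (ω : Config a N) : 0 ≤ configProb ρ a N ω :=
  chainWeight_nonneg (levelSize_mono ha N) (fun _ => ENNReal.toReal_nonneg) ω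

theorem hasSum_configProb_mul (ha : Monotone a) (N : ℕ)
    (h : ∀ t, Signature (levelSize a N t) → ℝ) (hh : ∀ t l, 0 ≤ h t l)
    (hs : Summable fun l => (ρ _ l).toReal * chainAvg n (levelSize a N) h l) :
    Summable fun ω : Config a N => configProb ρ a N ω * ∏ t, h t (ω t) :=
  summable_chainWeight n (levelSize a N) (levelSize_mono ha N) _ (fun _ => ENNReal.toReal_nonneg) h hh
    hs

theorem hasSum_configProb (ha : Monotone a) (N : ℕ) : HasSum (configProb ρ a N) 1 :=
  hasSum_chainWeight (levelSize_mono ha N) (fun _ => ENNReal.toReal_nonneg) (hasSum_pmf_toReal _)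

theorem isProbabilityMeasure_projMeasure (ha : Monotone a) (N : ℕ) :
    IsProbabilityMeasure (projMeasure ρ a N) :=
  isProbabilityMeasure_sum_dirac (configProb_nonneg ρ ha N) (hasSum_configProb ρ ha N)

/-- Products over the levels are integrable and have the expected mean, provided that the
conditional expectations of their squares are summable. -/
theorem integral_projMeasure_prod (ha : Monotone a) (N : ℕ)
    (h : ∀ t, Signature (levelSize a N t) → ℝ)
    (hs : Summable fun l => (ρ _ l).toReal * chainAvg n (levelSize a N) (fun t l => h t l ^ 2) l) :
    Integrable (fun ω => ∏ t, h t (ω t)) (projMeasure ρ a N) ∧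
    HasSum (fun l => (ρ _ l).toReal * chainAvg n (levelSize a N) h l)
      (∫ ω, ∏ t, h t (ω t) ∂(projMeasure ρ a N)) := by
  have h1 := hasSum_configProb_mul ρ ha N (fun t l => h t l ^ 2) (fun _ _ => sq_nonneg _) hs
  have h2 : Summable fun ω : Config a N => configProb ρ a N ω * ∏ t, h t (ω t) := by
    -- The inequality `|x| ≤ 1 + x²` bounds the product by terms that are already known to be
    -- summable.
    refine Summable.of_norm_bounded (((hasSum_configProb ρ ha N).summable.add h1)) fun ω => ?_
    rw [norm_mul, Real.norm_of_nonneg (configProb_nonneg ρ ha N ω), Finset.prod_pow,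
      Real.norm_eq_abs]
    nlinarith [configProb_nonneg ρ ha N ω, sq_abs (∏ t, h t (ω t)),
      sq_nonneg (|∏ t, h t (ω t)| - 1), abs_nonneg (∏ t, h t (ω t)),
      mul_nonneg (configProb_nonneg ρ ha N ω) (sq_nonneg (|∏ t, h t (ω t)| - 1)),
      mul_nonneg (configProb_nonneg ρ ha N ω) (sq_nonneg (|∏ t, h t (ω t)|))]
  refine ⟨integrable_sum_dirac (configProb_nonneg ρ ha N) h2, ?_⟩
  rw [projMeasure, integral_sum_dirac (configProb_nonneg ρ ha N) h2]
  exact hasSum_chainAvg n (levelSize a N) _ _ h2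

end ProjMeasure

/-! ### Moments along the chain in terms of operators -/

section ChainMoments

/-- The composition of the operators `powOp k - e`, the first element of the list being the
outermost one. -/
def applyOps (M : ℕ) (W : Polynomial (MvPolynomial ℕ ℂ)) (J : List (ℕ × ℝ)) (g : MvPolynomial ℕ ℂ) :
    MvPolynomial ℕ ℂ :=
  J.foldr (fun p g => powOp 1 (M : ℂ) W p.1 g - ((p.2 : ℝ) : ℂ) • g) g

/-- The product of the `p_k (l) - e`. -/
def centeredProd {M : ℕ} (J : List (ℕ × ℝ)) (l : Signature M) : ℝ :=
  (J.map fun p => powerSum p.1 l - p.2).prod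

/-- The eigenvalue relation for finite mixtures: the Euler operators multiply each weight by the
corresponding power sum. -/
theorem powerSum_mul_vanderPS {M : ℕ} (F : Finset (Signature M)) (c : Signature M → ℂ) (k : ℕ) :
    vanderPS M * ∑ l ∈ F, (c l * (powerSum k l : ℝ)) • taylor (normSchur l) =
      ∑ i, (eulerDeriv i)^[k] (vanderPS M * ∑ l ∈ F, c l • taylor (normSchur l)) := by
  simp only [Finset.mul_sum, iterate_eulerDeriv_sum, mul_smul_comm, iterate_eulerDeriv_smul]
  rw [Finset.sum_comm]
  refine Finset.sum_congr rfl fun l _ => ?_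
  rw [← Finset.smul_sum, sum_iterate_eulerDeriv_vanderPS_mul_taylor_normSchur, smul_smul]

/-- A finite mixture whose series agrees with `Θ g` to order `K` can be pushed through the operators
one at a time: the weights get multiplied by `p_k - e`, and agreement is lost by at most `k` orders
per factor. -/
theorem le_order_applyOps {M : ℕ} {W : Polynomial (MvPolynomial ℕ ℂ)}
    {Θ : MvPowerSeries (Fin M) ℂ} {K : ℕ}
    (hΘ : ∀ i, (K : ℕ∞) ≤ (MvPowerSeries.pderiv ℂ i Θ - Θ * evPsumVar i W).order)
    (F : Finset (Signature M)) (c : Signature M → ℂ) (g : MvPolynomial ℕ ℂ)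
    (hc : (K : ℕ∞) ≤ (∑ l ∈ F, c l • taylor (normSchur l) - Θ * evPsum M g).order)
    (J : List (ℕ × ℝ)) : ((K - (J.map Prod.fst).sum : ℕ) : ℕ∞) ≤
      (∑ l ∈ F, (c l * (centeredProd J l : ℝ)) • taylor (normSchur l) -
        Θ * evPsum M (applyOps M W J g)).order := by
  induction J with
  | nil => simpa [centeredProd, applyOps] using hc
  | cons p J ih =>
    obtain ⟨k, e⟩ := p
    set K' := K - (J.map Prod.fst).sum with hK'
    have hle : (K' : ℕ∞) ≤ K := by exact_mod_cast Nat.sub_le _ _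
    have h1 := le_order_sub_evPsum_powOp (applyOps M W J g) (fun i => hle.trans (hΘ i)) ih k
      (T := ∑ l ∈ F, (c l * (centeredProd J l : ℝ) * (powerSum k l : ℝ)) • taylor (normSchur l))
      (by rw [powerSum_mul_vanderPS, add_sub_cancel])
    have h2 : K - (((k, e) :: J).map Prod.fst).sum = K' - k := by
      simp only [List.map_cons, List.sum_cons]; omega
    have h3 : ∑ l ∈ F, (c l * (centeredProd ((k, e) :: J) l : ℝ)) • taylor (normSchur l) -
        Θ * evPsum M (applyOps M W ((k, e) :: J) g) =
        (∑ l ∈ F, (c l * (centeredProd J l : ℝ) * (powerSum k l : ℝ)) • taylor (normSchur l) -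
          Θ * evPsum M (powOp 1 (M : ℂ) W k (applyOps M W J g))) -
        MvPowerSeries.C (e : ℂ) * (∑ l ∈ F, (c l * (centeredProd J l : ℝ)) • taylor (normSchur l) -
          Θ * evPsum M (applyOps M W J g)) := by
      have h4 : applyOps M W ((k, e) :: J) g =
          powOp 1 (M : ℂ) W k (applyOps M W J g) - (e : ℂ) • applyOps M W J g := rfl
      have h5 : ∀ l : Signature M, (c l * (centeredProd ((k, e) :: J) l : ℝ)) • taylor (normSchur l) =
          (c l * (centeredProd J l : ℝ) * (powerSum k l : ℝ)) • taylor (normSchur l) -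
          MvPowerSeries.C (e : ℂ) * ((c l * (centeredProd J l : ℝ)) • taylor (normSchur l)) := by
        intro l
        rw [← MvPowerSeries.smul_eq_C_mul, smul_smul, ← sub_smul, centeredProd, List.map_cons,
          List.prod_cons, ← centeredProd]
        congr 1
        push_cast
        ring
      rw [h4, map_sub, map_smul, Finset.sum_congr rfl fun l _ => h5 l, Finset.sum_sub_distrib,
        ← Finset.mul_sum, MvPowerSeries.smul_eq_C_mul]
      ring
    rw [h2, h3]
    exact le_order_sub h1 (le_order_mul_left (le_trans (by exact_mod_cast Nat.sub_le _ _) ih) _)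

/-- The composition of the operators on all levels, the smallest level being the outermost one. -/
def chainOps : ∀ (n : ℕ) (_ : Fin (n + 1) → ℕ) (_ : Polynomial (MvPolynomial ℕ ℂ))
    (_ : Fin (n + 1) → List (ℕ × ℝ)), MvPolynomial ℕ ℂ → MvPolynomial ℕ ℂ
  | 0, s, W, J, g => applyOps (s 0) W (J 0) g
  | n + 1, s, W, J, g => chainOps n (fun t => s t.castSucc) W (fun t => J t.castSucc)
      (applyOps (s (Fin.last (n + 1))) W (J (Fin.last (n + 1))) g)

theorem constantCoeff_evPsum {M : ℕ} (g : MvPolynomial ℕ ℂ) :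
    MvPowerSeries.constantCoeff (evPsum M g) = MvPolynomial.constantCoeff g := by
  induction g using MvPolynomial.induction_on with
  | C c =>
    rw [evPsum, MvPolynomial.aeval_C, MvPolynomial.constantCoeff_C]
    exact MvPowerSeries.constantCoeff_C c
  | add p q hp hq => simp only [map_add, hp, hq]
  | mul_X p j hp => simp [map_mul, hp, evPsum_X]

theorem constantCoeff_killCompl {m k : ℕ} (e : Fin m ↪ Fin k) (F : MvPowerSeries (Fin k) ℂ) :
    MvPowerSeries.constantCoeff (MvPowerSeries.killCompl e F) = MvPowerSeries.constantCoeff F := by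
  rw [← MvPowerSeries.coeff_zero_eq_constantCoeff_apply, MvPowerSeries.coeff_killCompl,
    Finsupp.embDomain_zero, MvPowerSeries.coeff_zero_eq_constantCoeff_apply]

theorem constantCoeff_eq_zero_of_le_order {m K : ℕ} {F : MvPowerSeries (Fin m) ℂ} (hK : 0 < K)
    (h : (K : ℕ∞) ≤ F.order) : MvPowerSeries.constantCoeff F = 0 := by
  rw [← MvPowerSeries.coeff_zero_eq_constantCoeff_apply]
  refine MvPowerSeries.coeff_of_lt_order (lt_of_lt_of_le ?_ h)
  rw [map_zero]
  exact_mod_cast hK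

/-- Branching on the level of series: killing variables sends a normalized Schur series to the
mixture with the branching weights. -/
theorem taylor_normSchur_padOne {m k : ℕ} (hmk : m ≤ k) (l : Signature k) :
    MvPowerSeries.killCompl (Fin.castLEEmb hmk) (taylor (normSchur l)) =
      ∑ μ ∈ (branching m l).support, ((branching m l μ : ℝ) : ℂ) • taylor (normSchur μ) := by
  have ha : ∀ {N : ℕ} (l : Signature N), AnalyticAt ℂ (normSchur l) 1 :=
    fun l => analyticAt_normSchur l (by simp)
  rw [← taylor_comp_padOne hmk (ha l)]
  simp only [← taylor_const_mul _ (ha _)]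
  rw [← taylor_sum _ fun μ _ => analyticAt_const.fun_mul (ha μ)]
  refine taylor_congr ?_
  filter_upwards [eventually_forall_ne_zero (x := (1 : Fin m → ℂ)) (by simp)] with x hx
  exact branching_spec hmk l x hx

/-- Descends through the levels: apply the operators of the top level, kill the surplus variables,
continue. Restriction leaves polynomials in power sums and `W` unchanged, so the same symbols serve
on every level. The strict bound by `K` leaves the constant term valid at the end. -/
theorem sum_mul_chainAvg (n : ℕ) : ∀ (s : Fin (n + 1) → ℕ) (_ : Monotone s)
    (J : Fin (n + 1) → List (ℕ × ℝ)) (K : ℕ) (W : Polynomial (MvPolynomial ℕ ℂ))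
    (Θ : MvPowerSeries (Fin (s (Fin.last n))) ℂ)
    (_ : ∀ i, (K : ℕ∞) ≤ (MvPowerSeries.pderiv ℂ i Θ - Θ * evPsumVar i W).order)
    (F : Finset (Signature (s (Fin.last n)))) (c : Signature (s (Fin.last n)) → ℂ)
    (g : MvPolynomial ℕ ℂ)
    (_ : (K : ℕ∞) ≤ (∑ l ∈ F, c l • taylor (normSchur l) - Θ * evPsum _ g).order)
    (_ : ∑ t, ((J t).map Prod.fst).sum < K),
    ∑ l ∈ F, c l * ((chainAvg n s (fun t => centeredProd (J t)) l : ℝ) : ℂ) =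
      MvPowerSeries.constantCoeff Θ * MvPolynomial.constantCoeff (chainOps n s W J g) := by
  induction n with
  | zero =>
    intro s _ J K W Θ hΘ F c g hc hK
    have h1 := le_order_applyOps hΘ F c g hc (J (Fin.last 0))
    have h2 := constantCoeff_eq_zero_of_le_order (by
      rw [Fin.sum_univ_one] at hK
      exact Nat.sub_pos_of_lt hK) h1
    rw [map_sub, sub_eq_zero, map_mul, constantCoeff_evPsum, map_sum] at h2
    rw [chainOps]
    refine Eq.trans ?_ h2
    refine Finset.sum_congr rfl fun l _ => ?_
    rw [MvPowerSeries.smul_eq_C_mul, map_mul, constantCoeff_taylor, normSchur_one, mul_one,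
      MvPowerSeries.constantCoeff_C]
    rfl
  | succ n ih =>
    intro s hs J K W Θ hΘ F c g hc hK
    classical
    have hle : s (Fin.last n).castSucc ≤ s (Fin.last (n + 1)) := hs (Fin.le_last _)
    rw [Fin.sum_univ_castSucc] at hK
    set K' := K - ((J (Fin.last (n + 1))).map Prod.fst).sum with hK'
    have hKK : (K' : ℕ∞) ≤ K := by exact_mod_cast Nat.sub_le _ _
    have h1 := le_order_killCompl (Fin.castLEEmb hle)
      (le_order_applyOps hΘ F c g hc (J (Fin.last (n + 1))))
    rw [map_sub, map_mul, killCompl_evPsum, map_sum] at h1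
    set F' : Finset (Signature (s (Fin.last n).castSucc)) :=
      F.biUnion fun l => (branching (s (Fin.last n).castSucc) l).support with hF'
    -- The weights on the next level: the old ones, multiplied by the power sums of the top level
    -- and transported by the branching coefficients.
    set c' : Signature (s (Fin.last n).castSucc) → ℂ := fun μ =>
      ∑ l ∈ F, (c l * (centeredProd (J (Fin.last (n + 1))) l : ℝ)) *
        ((branching (s (Fin.last n).castSucc) l μ : ℝ) : ℂ) with hc'
    have hsub : ∀ l ∈ F, (branching (s (Fin.last n).castSucc) l).support ⊆ F' :=
      fun l hl => Finset.subset_biUnion_of_mem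
        (fun l => (branching (s (Fin.last n).castSucc) l).support) hl
    have h2 : ∑ l ∈ F, MvPowerSeries.killCompl (Fin.castLEEmb hle)
        ((c l * (centeredProd (J (Fin.last (n + 1))) l : ℝ)) • taylor (normSchur l)) =
        ∑ μ ∈ F', c' μ • taylor (normSchur μ) := by
      simp only [hc', Finset.sum_smul]
      rw [Finset.sum_comm]
      refine Finset.sum_congr rfl fun l hl => ?_
      rw [map_smul, taylor_normSchur_padOne hle, Finset.smul_sum]
      simp only [smul_smul]
      refine Finset.sum_subset (hsub l hl) fun μ _ hμ => ?_
      rw [Finsupp.notMem_support_iff.1 hμ]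
      simp
    rw [h2] at h1
    have h3 := ih (fun t => s t.castSucc) (fun _ _ hij => hs (by simpa using hij))
      (fun t => J t.castSucc) K' W (MvPowerSeries.killCompl (Fin.castLEEmb hle) Θ) (fun i => by
        rw [pderiv_killCompl, ← killCompl_evPsumVar (Fin.castLEEmb hle), ← map_mul, ← map_sub]
        exact le_order_killCompl _ (hKK.trans (hΘ _))) F' c' _ h1 (by omega)
    rw [constantCoeff_killCompl] at h3
    rw [chainOps, ← h3]
    simp only [hc', Finset.sum_mul]
    rw [Finset.sum_comm]
    refine Finset.sum_congr rfl fun l hl => ?_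
    rw [chainAvg]
    push_cast
    rw [Finsupp.sum, ← mul_assoc, Complex.ofReal_sum, Finset.mul_sum]
    refine (Finset.sum_subset (hsub l hl) fun μ _ hμ => ?_).trans (Finset.sum_congr rfl fun μ _ => ?_)
    · rw [Finsupp.notMem_support_iff.1 hμ]
      simp
    · push_cast
      ring

/-- If `Θ` is the mixture of the Taylor series of normalized Schur functions with weights `ρ`, then
the moments along the chain are given by the operators applied to `1`. -/
theorem hasSum_mul_chainAvg {n : ℕ} {s : Fin (n + 1) → ℕ} (hs : Monotone s)
    (J : Fin (n + 1) → List (ℕ × ℝ)) {K : ℕ} {W : Polynomial (MvPolynomial ℕ ℂ)}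
    {Θ : MvPowerSeries (Fin (s (Fin.last n))) ℂ}
    (hΘ : ∀ i, (K : ℕ∞) ≤ (MvPowerSeries.pderiv ℂ i Θ - Θ * evPsumVar i W).order)
    (hK : ∑ t, ((J t).map Prod.fst).sum < K) (ρ : Signature (s (Fin.last n)) → ℝ)
    (hρ : ∀ α, HasSum (fun l => (ρ l : ℂ) * MvPowerSeries.coeff α (taylor (normSchur l)))
      (MvPowerSeries.coeff α Θ)) :
    HasSum (fun l => ((ρ l * chainAvg n s (fun t => centeredProd (J t)) l : ℝ) : ℂ))
      (MvPowerSeries.constantCoeff Θ * MvPolynomial.constantCoeff (chainOps n s W J 1)) := by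
  classical
  set H : Signature (s (Fin.last n)) → ℂ :=
    fun l => ((chainAvg n s (fun t => centeredProd (J t)) l : ℝ) : ℂ) with hH
  have hfin : {α : Fin (s (Fin.last n)) →₀ ℕ | α.degree < K}.Finite :=
    (Finsupp.finite_of_degree_le K).subset fun α hα => by
      simpa using le_of_lt (by simpa using hα)
  set D := hfin.toFinset with hD
  set v : Signature (s (Fin.last n)) → D → ℂ :=
    fun l α => MvPowerSeries.coeff α.1 (taylor (normSchur l)) with hv
  have hcoef : ∀ (p : Signature (s (Fin.last n)) →₀ ℂ) (α : D),
      Finsupp.linearCombination ℂ v p α =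
        MvPowerSeries.coeff α.1 (∑ l ∈ p.support, p l • taylor (normSchur l)) := by
    intro p α
    rw [Finsupp.linearCombination_apply, Finsupp.sum, Finset.sum_apply, map_sum]
    rfl
  -- If a finite mixture has zero jet below degree `K`, then its total conditional moment is zero:
  -- this is the finite formula with `Θ = 1`, `W = 0` and `g = 0`. So the conditional moment `H`
  -- factors through the jet map `v`.
  have hker : Finsupp.linearCombination ℂ H ∈
      (LinearMap.ker (Finsupp.linearCombination ℂ v)).dualAnnihilator := by
    rw [Submodule.mem_dualAnnihilator]
    intro p hp
    rw [LinearMap.mem_ker] at hp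
    have h1 := sum_mul_chainAvg n s hs J K 0 1 (fun i => by simp) p.support p 0 (by
      rw [map_zero, mul_zero, sub_zero]
      refine MvPowerSeries.le_order fun α hα => ?_
      have h2 := hcoef p ⟨α, by simpa [hD] using hα⟩
      rw [hp] at h2
      exact h2.symm) hK
    rw [Finsupp.linearCombination_apply, Finsupp.sum]
    simp only [smul_eq_mul]
    rw [h1]
    have h3 : ∀ (n : ℕ) (s : Fin (n + 1) → ℕ) (J : Fin (n + 1) → List (ℕ × ℝ)),
        chainOps n s 0 J 0 = 0 := by
      have h4 : ∀ (M : ℕ) (J : List (ℕ × ℝ)), applyOps M 0 J 0 = 0 := by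
        intro M J
        induction J with
        | nil => rfl
        | cons p J ih =>
          change powOp 1 (M : ℂ) 0 p.1 (applyOps M 0 J 0) - ((p.2 : ℝ) : ℂ) • applyOps M 0 J 0 = 0
          rw [ih]
          have h5 : ∀ b, conjDeriv (1 : ℂ) 0 0 b = 0 := by
            intro b
            induction b with
            | zero => simp [conjDeriv]
            | succ b ih => simp [conjDeriv, ih]
          simp [powOp, fallOp, h5]
      intro n
      induction n with
      | zero => intro s J; exact h4 _ _
      | succ n ih => intro s J; rw [chainOps, h4, ih]
    rw [h3, map_zero, mul_zero]
  rw [← LinearMap.range_dualMap_eq_dualAnnihilator_ker] at hker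
  obtain ⟨Λ, hΛ⟩ := hker
  have hΛv : ∀ p, Λ (Finsupp.linearCombination ℂ v p) = Finsupp.linearCombination ℂ H p :=
    fun p => DFunLike.congr_fun hΛ p
  set θ : D → ℂ := fun α => MvPowerSeries.coeff α.1 Θ with hθ
  have hsumv : HasSum (fun l => (ρ l : ℂ) • v l) θ := Pi.hasSum.2 fun α => hρ α.1
  -- The jets lie in a finite-dimensional space, so `Λ` is continuous, and convergence of the Taylor
  -- coefficients becomes convergence of the moments. No estimate on the size of the power sums is
  -- needed.
  have hcont : Continuous Λ := Λ.continuous_of_finiteDimensional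
  have h1 : HasSum (fun l => Λ ((ρ l : ℂ) • v l)) (Λ θ) :=
    hsumv.map Λ.toAddMonoidHom hcont
  -- The range of the jet map is a closed subspace, so the limiting jet is also the jet of a finite
  -- mixture `p`. The finite formula applied to `p`, now with the actual `Θ` and `W`, gives the
  -- value of the sum.
  have hmem : θ ∈ LinearMap.range (Finsupp.linearCombination ℂ v) := by
    refine (Submodule.closed_of_finiteDimensional
      (LinearMap.range (Finsupp.linearCombination ℂ v))).mem_of_tendsto hsumv
      (Eventually.of_forall fun t => Submodule.sum_mem _ fun l _ => Submodule.smul_mem _ _ ?_)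
    exact ⟨Finsupp.single l 1, by simp⟩
  obtain ⟨p, hp⟩ := hmem
  have h2 := sum_mul_chainAvg n s hs J K W Θ hΘ p.support p 1 (by
    rw [map_one, mul_one]
    refine MvPowerSeries.le_order fun α hα => ?_
    have h2 := hcoef p ⟨α, by simpa [hD] using hα⟩
    rw [hp] at h2
    rw [map_sub, ← h2, hθ, sub_self]) hK
  have h3 : Λ θ = MvPowerSeries.constantCoeff Θ * MvPolynomial.constantCoeff (chainOps n s W J 1) := by
    rw [← h2, ← hp, hΛv, Finsupp.linearCombination_apply, Finsupp.sum]
    rfl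
  rw [← h3]
  refine h1.congr_fun ?_
  intro l
  have h4 := hΛv (Finsupp.single l 1)
  rw [Finsupp.linearCombination_single, Finsupp.linearCombination_single, one_smul, one_smul] at h4
  rw [map_smul, h4, smul_eq_mul]
  push_cast
  rfl

end ChainMoments

/-! ### Symmetric power series in terms of power sums -/

section PowerSums

/-- The augmented monomial symmetric function `∑ z_{i_1}^{k_1} ⋯ z_{i_r}^{k_r}` (over distinct
indices), written in power sums. -/
def monoSymm (C : Type*) [CommRing C] : ∀ r : ℕ, (Fin r → ℕ) → MvPolynomial ℕ C
  | 0, _ => 1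
  | r + 1, k => MvPolynomial.X (k 0 - 1) * monoSymm C r (fun j => k j.succ) -
      ∑ j, monoSymm C r (Function.update (fun j => k j.succ) j (k j.succ + k 0))

/-- In the product of a power sum with a sum over distinct indices, the new index is either distinct
from the others, which is the wanted term, or equal to one of them, whose exponent then increases by
`k 0`. -/
theorem evPsum_monoSymm {M : ℕ} (r : ℕ) : ∀ k : Fin r → ℕ, (∀ j, 1 ≤ k j) →
    evPsum M (monoSymm ℂ r k) = ∑ i : Fin r → Fin M, open Classical in
      if Function.Injective i then ∏ j, (MvPowerSeries.X (i j) : MvPowerSeries (Fin M) ℂ) ^ k j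
      else 0 := by
  classical
  induction r with
  | zero =>
    intro k _
    rw [monoSymm, map_one, Fintype.sum_unique, if_pos (Function.injective_of_subsingleton _)]
    simp
  | succ r ih =>
    intro k hk
    set k' : Fin r → ℕ := fun j => k j.succ with hk'
    have h1 : ∀ j, ∀ l, 1 ≤ Function.update k' j (k' j + k 0) l := by
      intro j l
      by_cases h : l = j
      · subst h; simp only [Function.update_self, hk']; have := hk l.succ; omega
      · rw [Function.update_of_ne h]; exact hk _
    have h2 : k 0 - 1 + 1 = k 0 := Nat.sub_add_cancel (hk 0)
    rw [monoSymm, map_sub, map_mul, evPsum_X, map_sum, h2, ih k' fun j => hk _,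
      Finset.sum_congr rfl fun j _ => ih _ (h1 j),
      ← (Fin.consEquiv fun _ : Fin (r + 1) => Fin M).sum_comp, Fintype.sum_prod_type_right,
      Finset.sum_comm (γ := Fin r), Finset.mul_sum, ← Finset.sum_sub_distrib]
    refine Finset.sum_congr rfl fun i _ => ?_
    have h3 : ∀ i0 : Fin M, Function.Injective (Fin.consEquiv (fun _ : Fin (r + 1) => Fin M) (i0, i)) ↔
        i0 ∉ Set.range i ∧ Function.Injective i := fun i0 => Fin.cons_injective_iff
    simp only [h3]
    simp only [Fin.consEquiv_apply, Fin.prod_univ_succ, Fin.cons_zero, Fin.cons_succ]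
    by_cases hi : Function.Injective i
    · simp only [hi, and_true, if_true]
      have h4 : ∀ j, ∏ l, (MvPowerSeries.X (i l) : MvPowerSeries (Fin M) ℂ) ^
          Function.update k' j (k' j + k 0) l =
          MvPowerSeries.X (i j) ^ k 0 * ∏ l, MvPowerSeries.X (i l) ^ k' l := by
        intro j
        rw [← Finset.mul_prod_erase _ _ (Finset.mem_univ j),
          ← Finset.mul_prod_erase _ (fun l => (MvPowerSeries.X (i l) : MvPowerSeries (Fin M) ℂ) ^ k' l)
          (Finset.mem_univ j), Function.update_self, pow_add,
          Finset.prod_congr rfl fun l hl => by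
            rw [Function.update_of_ne (Finset.ne_of_mem_erase hl)]]
        ring
      simp only [← Finset.sum_mul, h4]
      rw [← sub_mul, ← Finset.sum_filter, ← Finset.sum_mul]
      congr 1
      rw [sub_eq_iff_eq_add]
      refine (Finset.sum_filter_add_sum_filter_not Finset.univ (fun i0 => i0 ∉ Set.range i)
        fun i0 => (MvPowerSeries.X i0 : MvPowerSeries (Fin M) ℂ) ^ k 0).symm.trans ?_
      congr 1
      rw [show (Finset.univ.filter fun i0 => ¬ i0 ∉ Set.range i) = Finset.univ.map ⟨i, hi⟩ by
        ext; simp, Finset.sum_map]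
      rfl
    · simp [hi]

/-- The coefficient of `z_1^{k_1} ⋯ z_r^{k_r}`. -/
def symmCoeff {M : ℕ} (f : (Fin M → ℂ) → ℂ) (r : ℕ) (k : Fin r → ℕ) : ℂ :=
  (∏ j, ((k j).factorial : ℂ))⁻¹ *
    ((List.finRange r).flatMap fun j => List.replicate (k j) (j : ℕ)).foldr partialDeriv f 1

/-- The polynomial in power sums with given coefficients, up to degree `K`. -/
def psumRep {C : Type*} [CommRing C] [Algebra ℂ C] (K : ℕ) (φ : ∀ r, (Fin r → ℕ) → C) :
    MvPolynomial ℕ C :=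
  ∑ r ∈ Finset.range (K + 1), ((r.factorial : ℂ)⁻¹) •
    ∑ k ∈ Fintype.piFinset fun _ : Fin r => Finset.Icc 1 K, MvPolynomial.C (φ r k) * monoSymm C r k

/-- Symmetry of a power series. -/
def IsSymmSeries {M : ℕ} (F : MvPowerSeries (Fin M) ℂ) : Prop :=
  ∀ (σ : Equiv.Perm (Fin M)) (α : Fin M →₀ ℕ),
    MvPowerSeries.coeff (α.mapDomain σ) F = MvPowerSeries.coeff α F

/-- A permutation carries the distinct indices `i j` to the first `r` indices, and the series is
symmetric. Thus the coefficients depend on a list of exponents only, which makes sense independently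
of the number of variables. -/
theorem coeff_eq_symmCoeff {M : ℕ} {f : (Fin M → ℂ) → ℂ} (hf : AnalyticAt ℂ f 1)
    (hs : IsSymmSeries (taylor f)) {r : ℕ} (k : Fin r → ℕ) (i : Fin r → Fin M)
    (hi : Function.Injective i) :
    MvPowerSeries.coeff (∑ j, Finsupp.single (i j) (k j)) (taylor f) = symmCoeff f r k := by
  classical
  have hr : r ≤ M := by simpa using Fintype.card_le_of_injective i hi
  obtain ⟨σ, hσ⟩ := Equiv.Perm.exists_smul_eq_embedding (Fin.castLEEmb hr) ⟨i, hi⟩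
  have hσ' : ∀ j, σ (Fin.castLE hr j) = i j := fun j => DFunLike.congr_fun hσ j
  have h1 := hs σ (∑ j, Finsupp.single (Fin.castLE hr j) (k j))
  rw [Finsupp.mapDomain_finsetSum] at h1
  simp only [Finsupp.mapDomain_single, hσ'] at h1
  rw [h1]
  set α : Fin M →₀ ℕ := ∑ j, Finsupp.single (Fin.castLE hr j) (k j) with hα
  have h2 := foldr_eq_coeff_taylor hf α
    ((List.finRange r).flatMap fun j => List.replicate (k j) (Fin.castLE hr j)) (by
      rw [hα, map_sum, ← Multiset.coe_bind]
      simp only [Finsupp.toMultiset_single, Multiset.nsmul_singleton]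
      rfl)
  have h3 : ((List.finRange r).flatMap fun j => List.replicate (k j) (Fin.castLE hr j)).map Fin.val =
      (List.finRange r).flatMap fun j => List.replicate (k j) (j : ℕ) := by
    rw [List.map_flatMap]
    simp
  have h4 : ∏ l, ((α l).factorial : ℂ) = ∏ j, ((k j).factorial : ℂ) := by
    have h5 : ∀ j, α (Fin.castLE hr j) = k j := by
      intro j
      rw [hα, Finsupp.finsetSum_apply, Finset.sum_eq_single j]
      · simp
      · intro l _ hl
        exact Finsupp.single_eq_of_ne fun h => hl (Fin.castLE_injective hr h).symm
      · simp
    rw [← Finset.prod_subset (Finset.subset_univ (Finset.univ.map (Fin.castLEEmb hr))),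
      Finset.prod_map]
    · exact Finset.prod_congr rfl fun j _ => by rw [Fin.castLEEmb_apply, h5]
    · intro l _ hl
      have : α l = 0 := by
        rw [hα, Finsupp.finsetSum_apply]
        refine Finset.sum_eq_zero fun j _ => Finsupp.single_eq_of_ne fun h => hl ?_
        rw [h]
        exact Finset.mem_map_of_mem (Fin.castLEEmb hr) (Finset.mem_univ j)
      simp [this]
  rw [symmCoeff, ← h3, h2, h4, inv_mul_cancel_left₀]
  exact Finset.prod_ne_zero_iff.2 fun j _ => Nat.cast_ne_zero.2 (Nat.factorial_ne_zero _)

theorem prod_X_pow_eq_monomial {M : ℕ} {ι : Type*} (s : Finset ι) (i : ι → Fin M) (k : ι → ℕ) :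
    ∏ j ∈ s, (MvPowerSeries.X (i j) : MvPowerSeries (Fin M) ℂ) ^ k j =
      MvPowerSeries.monomial (∑ j ∈ s, Finsupp.single (i j) (k j)) 1 := by
  classical
  induction s using Finset.induction_on with
  | empty => simp
  | insert a s ha ih =>
    rw [Finset.prod_insert ha, Finset.sum_insert ha, ih, MvPowerSeries.X_pow_eq,
      MvPowerSeries.monomial_mul_monomial, one_mul]

theorem eq_sum_single_iff {M r : ℕ} (α : Fin M →₀ ℕ) (i : Fin r → Fin M)
    (hi : Function.Injective i) (k : Fin r → ℕ) (hk : ∀ j, 1 ≤ k j) :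
    α = ∑ j, Finsupp.single (i j) (k j) ↔ Set.range i = α.support ∧ ∀ j, k j = α (i j) := by
  classical
  have h1 : ∀ l, (∑ j, Finsupp.single (i j) (k j)) (i l) = k l := by
    intro l
    rw [Finsupp.finsetSum_apply, Finset.sum_eq_single l]
    · simp
    · intro j _ hj
      exact Finsupp.single_eq_of_ne fun h => hj (hi h).symm
    · simp
  have h2 : ∀ m, m ∉ Set.range i → (∑ j, Finsupp.single (i j) (k j)) m = 0 := by
    intro m hm
    rw [Finsupp.finsetSum_apply]
    exact Finset.sum_eq_zero fun j _ => Finsupp.single_eq_of_ne fun h => hm ⟨j, h.symm⟩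
  constructor
  · rintro rfl
    refine ⟨?_, fun j => (h1 j).symm⟩
    ext m
    rw [Finset.mem_coe, Finsupp.mem_support_iff]
    constructor
    · rintro ⟨l, rfl⟩
      rw [h1]
      exact (Nat.one_le_iff_ne_zero.1 (hk l))
    · intro hm
      by_contra h
      exact hm (h2 m h)
  · rintro ⟨hr, hk'⟩
    ext m
    by_cases hm : m ∈ Set.range i
    · obtain ⟨l, rfl⟩ := hm
      rw [h1, hk']
    · rw [h2 m hm]
      rw [hr, Finset.mem_coe, Finsupp.notMem_support_iff] at hm
      exact hm

/-- The pairs `(k, i)` producing `α` are the enumerations of its support, `r!` in number; this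
cancels the `1 / r!` in `psumRep`. The degree bound keeps all exponents below `K`. -/
theorem card_enumerations {M K r : ℕ} (α : Fin M →₀ ℕ) (hα : α.degree ≤ K) : open Classical in
    (∑ k ∈ Fintype.piFinset fun _ : Fin r => Finset.Icc 1 K, ∑ i : Fin r → Fin M,
      if Function.Injective i ∧ α = ∑ j, Finsupp.single (i j) (k j) then (1 : ℂ) else 0) =
      if r = α.support.card then (r.factorial : ℂ) else 0 := by
  classical
  have hle : ∀ m, α m ≤ K := fun m => (Finsupp.le_degree m α).trans hα
  rw [Finset.sum_comm]
  have h1 : ∀ i : Fin r → Fin M, (∑ k ∈ Fintype.piFinset fun _ : Fin r => Finset.Icc 1 K,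
      if Function.Injective i ∧ α = ∑ j, Finsupp.single (i j) (k j) then (1 : ℂ) else 0) =
      if Function.Injective i ∧ Set.range i = α.support then 1 else 0 := by
    intro i
    by_cases h : Function.Injective i ∧ Set.range i = α.support
    · rw [if_pos h, Finset.sum_eq_single fun j => α (i j)]
      · refine if_pos ⟨h.1, (eq_sum_single_iff α i h.1 _ fun j => ?_).2 ⟨h.2, fun _ => rfl⟩⟩
        have : i j ∈ (α.support : Set (Fin M)) := h.2 ▸ ⟨j, rfl⟩
        exact Nat.one_le_iff_ne_zero.2 (Finsupp.mem_support_iff.1 this)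
      · intro k hk hne
        refine if_neg fun h' => hne (funext fun j => ?_)
        refine ((eq_sum_single_iff α i h.1 k fun j => ?_).1 h'.2).2 j
        exact (Finset.mem_Icc.1 (Fintype.mem_piFinset.1 hk j)).1
      · intro h'
        refine absurd (Fintype.mem_piFinset.2 fun j => Finset.mem_Icc.2 ⟨?_, hle _⟩) h'
        have : i j ∈ (α.support : Set (Fin M)) := h.2 ▸ ⟨j, rfl⟩
        exact Nat.one_le_iff_ne_zero.2 (Finsupp.mem_support_iff.1 this)
    · rw [if_neg h]
      refine Finset.sum_eq_zero fun k hk => if_neg fun h' => h ⟨h'.1, ?_⟩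
      exact ((eq_sum_single_iff α i h'.1 k fun j =>
        (Finset.mem_Icc.1 (Fintype.mem_piFinset.1 hk j)).1).1 h'.2).1
  rw [Finset.sum_congr rfl fun i _ => h1 i, Finset.sum_boole]
  split_ifs with h
  · subst h
    rw [← Fintype.card_subtype]
    have e : {i : Fin α.support.card → Fin M // Function.Injective i ∧ Set.range i = α.support} ≃
        (Fin α.support.card ≃ α.support) :=
      { toFun := fun i => (Equiv.ofInjective i.1 i.2.1).trans (Equiv.setCongr i.2.2)
        invFun := fun e => ⟨fun j => e j, Subtype.val_injective.comp e.injective, by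
          ext m
          constructor
          · rintro ⟨j, rfl⟩; exact (e j).2
          · intro hm; exact ⟨e.symm ⟨m, hm⟩, by simp⟩⟩
        left_inv := fun i => by ext; rfl
        right_inv := fun e => by ext; rfl }
    rw [Fintype.card_congr e, Fintype.card_equiv (Finset.equivFin α.support).symm, Fintype.card_fin]
  · rw [Finset.filter_eq_empty_iff.2]
    · simp
    · rintro i _ ⟨hi, hr⟩
      apply h
      have := Set.ncard_coe_finset α.support
      rw [← hr, ← Set.image_univ, Set.ncard_image_of_injective _ hi, Set.ncard_univ] at this
      simpa using this

/-- Sort the monomials of a symmetric series by the number of variables occurring in them. Up to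
degree `K`, at most `K` variables occur, each with exponent at most `K`. -/
theorem le_order_taylor_sub_evPsum {M : ℕ} {f : (Fin M → ℂ) → ℂ} (hf : AnalyticAt ℂ f 1)
    (hs : IsSymmSeries (taylor f)) (K : ℕ) :
    ((K + 1 : ℕ) : ℕ∞) ≤ (taylor f - evPsum M (psumRep K (symmCoeff f))).order := by
  classical
  refine MvPowerSeries.le_order fun α hα => ?_
  have hα' : α.degree ≤ K := Nat.lt_succ_iff.1 (by exact_mod_cast hα)
  rw [map_sub, sub_eq_zero, psumRep]
  simp only [map_sum, map_smul, map_mul]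
  have hC : ∀ z : ℂ, evPsum M (MvPolynomial.C z) = MvPowerSeries.C z := fun z =>
    MvPolynomial.aeval_C _ _
  have h1 : ∀ r ∈ Finset.range (K + 1),
      ((r.factorial : ℂ)⁻¹) • ∑ k ∈ Fintype.piFinset fun _ : Fin r => Finset.Icc 1 K,
        MvPowerSeries.coeff α (evPsum M (MvPolynomial.C (symmCoeff f r k)) *
          evPsum M (monoSymm ℂ r k)) =
      if r = α.support.card then MvPowerSeries.coeff α (taylor f) else 0 := by
    intro r _
    have h2 : ∀ k ∈ Fintype.piFinset fun _ : Fin r => Finset.Icc 1 K,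
        MvPowerSeries.coeff α (evPsum M (MvPolynomial.C (symmCoeff f r k)) *
          evPsum M (monoSymm ℂ r k)) = MvPowerSeries.coeff α (taylor f) * ∑ i : Fin r → Fin M,
          if Function.Injective i ∧ α = ∑ j, Finsupp.single (i j) (k j) then (1 : ℂ) else 0 := by
      intro k hk
      have hk1 : ∀ j, 1 ≤ k j := fun j => (Finset.mem_Icc.1 (Fintype.mem_piFinset.1 hk j)).1
      rw [hC, MvPowerSeries.coeff_C_mul, evPsum_monoSymm r k hk1, map_sum, Finset.mul_sum,
        Finset.mul_sum]
      refine Finset.sum_congr rfl fun i _ => ?_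
      by_cases hi : Function.Injective i
      · rw [if_pos hi, prod_X_pow_eq_monomial, MvPowerSeries.coeff_monomial]
        by_cases h : α = ∑ j, Finsupp.single (i j) (k j)
        · rw [if_pos h, if_pos ⟨hi, h⟩, h, coeff_eq_symmCoeff hf hs k i hi]
        · rw [if_neg h, if_neg fun h' => h h'.2, mul_zero, mul_zero]
      · rw [if_neg hi, if_neg fun h' => hi h'.1, map_zero, mul_zero, mul_zero]
    rw [Finset.sum_congr rfl h2, ← Finset.mul_sum, card_enumerations α hα']
    split_ifs
    · rw [smul_eq_mul, mul_left_comm, inv_mul_cancel₀ (Nat.cast_ne_zero.2 (Nat.factorial_ne_zero _)),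
        mul_one]
    · simp
  rw [Finset.sum_congr rfl h1, Finset.sum_ite_eq' , if_pos]
  rw [Finset.mem_range, Nat.lt_succ_iff]
  refine le_trans ?_ hα'
  rw [Finsupp.degree, Finset.card_eq_sum_ones]
  exact Finset.sum_le_sum fun i hi => Nat.one_le_iff_ne_zero.2 (Finsupp.mem_support_iff.1 hi)

end PowerSums

/-! ### Naturality, linearity and homogeneity of the operators -/

section Naturality

variable {C C' : Type*} [CommRing C] [CommRing C']

/-- On functions of the power sums alone, `totalDeriv` is `∑ (j+1) z^j ∂/∂X_j`. This form also shows
that it commutes with a change of coefficient ring. -/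
theorem coeff_totalDeriv_C (g : MvPolynomial ℕ C) (j : ℕ) :
    (totalDeriv C (Polynomial.C g)).coeff j =
      ((j : MvPolynomial ℕ C) + 1) * MvPolynomial.pderiv j g := by
  induction g using MvPolynomial.induction_on with
  | C c => rw [totalDeriv_C_C, MvPolynomial.pderiv_C]; simp
  | add p q hp hq => simp only [map_add, Polynomial.coeff_add, hp, hq]; ring
  | mul_X p i hp =>
    rw [map_mul, Derivation.leibniz, Polynomial.coeff_add, smul_eq_mul, smul_eq_mul,
      Polynomial.coeff_C_mul, Polynomial.coeff_C_mul, hp, totalDeriv_C_X, Derivation.leibniz,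
      smul_eq_mul, smul_eq_mul]
    have h : (((i : Polynomial (MvPolynomial ℕ C)) + 1) * Polynomial.X ^ i).coeff j =
        ((j : MvPolynomial ℕ C) + 1) * MvPolynomial.pderiv j (MvPolynomial.X i) := by
      rw [show ((i : Polynomial (MvPolynomial ℕ C)) + 1) = Polynomial.C ((i : MvPolynomial ℕ C) + 1) by
        simp, Polynomial.coeff_C_mul, Polynomial.coeff_X_pow, MvPolynomial.pderiv_X, Pi.single_apply]
      by_cases hij : j = i
      · subst hij; simp
      · simp [hij, Ne.symm hij]
    rw [h]
    ring

/-- Naturality in the ring of scalars. One computation over convergent sequences can then be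
specialized to a single `N`, to the limit, or to the quotient by `t²`. -/
theorem totalDeriv_map (π : C →+* C') (h : Polynomial (MvPolynomial ℕ C)) :
    (totalDeriv C h).map (MvPolynomial.map π) = totalDeriv C' (h.map (MvPolynomial.map π)) := by
  induction h using Polynomial.induction_on' with
  | add p q hp hq => simp only [map_add, Polynomial.map_add, hp, hq]
  | monomial n g =>
    have h1 : (totalDeriv C (Polynomial.C g)).map (MvPolynomial.map π) =
        totalDeriv C' (Polynomial.C (MvPolynomial.map π g)) := by
      ext1 j
      rw [Polynomial.coeff_map, coeff_totalDeriv_C, coeff_totalDeriv_C, map_mul,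
        MvPolynomial.pderiv_map]
      simp
    rw [← Polynomial.C_mul_X_pow_eq_monomial]
    simp only [Derivation.leibniz, Derivation.leibniz_pow, smul_eq_mul, totalDeriv_X, h1,
      Polynomial.map_add, Polynomial.map_mul, Polynomial.map_pow, Polynomial.map_C, Polynomial.map_X,
      nsmul_eq_mul, Polynomial.map_natCast, Polynomial.map_one]

theorem scaledPsum_map (π : C →+* C') (t μ : C) (n : ℕ) :
    MvPolynomial.map π (scaledPsum t μ n) = scaledPsum (π t) (π μ) n := by
  cases n <;> simp [scaledPsum]

theorem residuePoly_map (π : C →+* C') (t μ : C) (a : ℕ) : ∀ n : ℕ,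
    MvPolynomial.map π (residuePoly t μ a n) = residuePoly (π t) (π μ) a n := by
  induction a with
  | zero => exact scaledPsum_map π t μ
  | succ a ih => intro n; simp [residuePoly, ih, scaledPsum_map]

theorem residueFun_map (π : C →+* C') (t μ : C) (a : ℕ) (h : Polynomial (MvPolynomial ℕ C)) :
    MvPolynomial.map π (residueFun t μ a h) =
      residueFun (π t) (π μ) a (h.map (MvPolynomial.map π)) := by
  induction h using Polynomial.induction_on' with
  | add p q hp hq => simp only [map_add, Polynomial.map_add, hp, hq]
  | monomial n g =>
    rw [← Polynomial.C_mul_X_pow_eq_monomial, residueFun_C_mul_X_pow, Polynomial.map_mul,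
      Polynomial.map_pow, Polynomial.map_C, Polynomial.map_X, residueFun_C_mul_X_pow, map_mul,
      residuePoly_map]

theorem conjDeriv_map (π : C →+* C') (t : C) (W : Polynomial (MvPolynomial ℕ C))
    (g : MvPolynomial ℕ C) (b : ℕ) : (conjDeriv t W g b).map (MvPolynomial.map π) =
      conjDeriv (π t) (W.map (MvPolynomial.map π)) (MvPolynomial.map π g) b := by
  induction b with
  | zero => simp [conjDeriv]
  | succ b ih => simp [conjDeriv, ih, totalDeriv_map]

theorem scaledPsum_mul (c t μ : C) (n : ℕ) :
    scaledPsum (c * t) (c * μ) n = MvPolynomial.C c * scaledPsum t μ n := by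
  cases n <;> simp [scaledPsum, mul_assoc]

theorem residuePoly_mul (c t μ : C) (a : ℕ) : ∀ n : ℕ,
    residuePoly (c * t) (c * μ) a n = MvPolynomial.C c ^ (a + 1) * residuePoly t μ a n := by
  induction a with
  | zero => intro n; simp [residuePoly, scaledPsum_mul]
  | succ a ih =>
    intro n
    simp only [residuePoly, ih, scaledPsum_mul, mul_sub, Finset.mul_sum, map_mul]
    refine congrArg₂ _ (Finset.sum_congr rfl fun m _ => by ring) (by ring)

theorem residueFun_mul (c t μ : C) (a : ℕ) (h : Polynomial (MvPolynomial ℕ C)) :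
    residueFun (c * t) (c * μ) a h = MvPolynomial.C c ^ (a + 1) * residueFun t μ a h := by
  induction h using Polynomial.induction_on' with
  | add p q hp hq => simp only [map_add, hp, hq, mul_add]
  | monomial n g =>
    rw [← Polynomial.C_mul_X_pow_eq_monomial, residueFun_C_mul_X_pow, residueFun_C_mul_X_pow,
      residuePoly_mul]
    ring

theorem totalDeriv_C_C_mul (c : C) (h : Polynomial (MvPolynomial ℕ C)) :
    totalDeriv C (Polynomial.C (MvPolynomial.C c) * h) =
      Polynomial.C (MvPolynomial.C c) * totalDeriv C h := by
  rw [Derivation.leibniz, totalDeriv_C_C, smul_zero, add_zero, smul_eq_mul]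

theorem conjDeriv_mul (c t : C) (W : Polynomial (MvPolynomial ℕ C))
    (g : MvPolynomial ℕ C) (b : ℕ) :
    conjDeriv (c * t) (Polynomial.C (MvPolynomial.C c) * W) g b =
      Polynomial.C (MvPolynomial.C c) ^ b * conjDeriv t W g b := by
  induction b with
  | zero => simp [conjDeriv]
  | succ b ih =>
    simp only [conjDeriv, ih, map_mul]
    rw [← Polynomial.C_pow, ← MvPolynomial.C_pow, totalDeriv_C_C_mul, pow_succ]
    simp only [map_pow]
    ring

theorem conjDeriv_add (t : C) (W : Polynomial (MvPolynomial ℕ C)) (g g' : MvPolynomial ℕ C) (b : ℕ) :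
    conjDeriv t W (g + g') b = conjDeriv t W g b + conjDeriv t W g' b := by
  induction b with
  | zero => simp [conjDeriv]
  | succ b ih => simp only [conjDeriv, ih, map_add]; ring

theorem conjDeriv_C_mul (t : C) (W : Polynomial (MvPolynomial ℕ C)) (c : C) (g : MvPolynomial ℕ C)
    (b : ℕ) : conjDeriv t W (MvPolynomial.C c * g) b =
      Polynomial.C (MvPolynomial.C c) * conjDeriv t W g b := by
  induction b with
  | zero => simp [conjDeriv]
  | succ b ih => simp only [conjDeriv, ih, totalDeriv_C_C_mul]; ring

theorem residueFun_C_mul (t μ : C) (a : ℕ) (g : MvPolynomial ℕ C)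
    (h : Polynomial (MvPolynomial ℕ C)) :
    residueFun t μ a (Polynomial.C g * h) = g * residueFun t μ a h := by
  rw [← Polynomial.smul_eq_C_mul, map_smul, smul_eq_mul]

theorem monoSymm_map (π : C →+* C') (r : ℕ) : ∀ k : Fin r → ℕ,
    MvPolynomial.map π (monoSymm C r k) = monoSymm C' r k := by
  induction r with
  | zero => intro k; simp [monoSymm]
  | succ r ih => intro k; simp [monoSymm, ih]

variable [Algebra ℂ C] [Algebra ℂ C']

theorem map_algHom_smul (π : C →ₐ[ℂ] C') (c : ℂ) (g : MvPolynomial ℕ C) :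
    MvPolynomial.map (π : C →+* C') (c • g) = c • MvPolynomial.map (π : C →+* C') g := by
  ext m
  rw [MvPolynomial.coeff_map, MvPolynomial.coeff_smul, MvPolynomial.coeff_smul,
    MvPolynomial.coeff_map]
  exact map_smul π c _

theorem fallOp_map (π : C →ₐ[ℂ] C') (t μ : C) (W : Polynomial (MvPolynomial ℕ C)) (k : ℕ)
    (g : MvPolynomial ℕ C) : MvPolynomial.map (π : C →+* C') (fallOp t μ W k g) =
      fallOp (π t) (π μ) (W.map (MvPolynomial.map (π : C →+* C'))) k
        (MvPolynomial.map (π : C →+* C') g) := by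
  simp only [fallOp, map_algHom_smul, map_sum, residueFun_map, Polynomial.map_mul,
    Polynomial.map_pow, Polynomial.map_add, Polynomial.map_one, Polynomial.map_X, conjDeriv_map]
  rfl

theorem powOp_map (π : C →ₐ[ℂ] C') (t μ : C) (W : Polynomial (MvPolynomial ℕ C)) (k : ℕ)
    (g : MvPolynomial ℕ C) : MvPolynomial.map (π : C →+* C') (powOp t μ W k g) =
      powOp (π t) (π μ) (W.map (MvPolynomial.map (π : C →+* C'))) k
        (MvPolynomial.map (π : C →+* C') g) := by
  simp only [powOp, map_sum, map_mul, fallOp_map, map_natCast, MvPolynomial.map_C]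
  simp

theorem fallOp_mul (c t μ : C) (W : Polynomial (MvPolynomial ℕ C)) (k : ℕ) (g : MvPolynomial ℕ C) :
    fallOp (c * t) (c * μ) (Polynomial.C (MvPolynomial.C c) * W) k g =
      MvPolynomial.C c ^ (k + 1) * fallOp t μ W k g := by
  simp only [fallOp, mul_smul_comm, Finset.mul_sum]
  congr 1
  refine Finset.sum_congr rfl fun a ha => ?_
  have h : k + 1 = (a + 1) + (k - a) := by have := Finset.mem_range.1 ha; omega
  have h' : (MvPolynomial.C c : MvPolynomial ℕ C) ^ (k + 1) =
      MvPolynomial.C c ^ (a + 1) * MvPolynomial.C c ^ (k - a) := by rw [← pow_add, ← h]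
  rw [conjDeriv_mul, mul_left_comm, ← Polynomial.C_pow, residueFun_C_mul, residueFun_mul, h']
  congr 1
  ring

/-- Every term is homogeneous of degree `k + 1`: a functional of index `a` has degree `a + 1` in
`(t, μ)`, `b` conjugated derivatives have degree `b`, and `t^(k-j)` fills up the lower Stirling
terms. -/
theorem powOp_mul (c t μ : C) (W : Polynomial (MvPolynomial ℕ C)) (k : ℕ) (g : MvPolynomial ℕ C) :
    powOp (c * t) (c * μ) (Polynomial.C (MvPolynomial.C c) * W) k g =
      MvPolynomial.C c ^ (k + 1) * powOp t μ W k g := by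
  simp only [powOp, fallOp_mul, Finset.mul_sum]
  refine Finset.sum_congr rfl fun j hj => ?_
  have h : k + 1 = (k - j) + (j + 1) := by have := Finset.mem_range.1 hj; omega
  rw [h, pow_add, mul_pow]
  simp only [MvPolynomial.C_mul, MvPolynomial.C_pow]
  ring

theorem fallOp_add (t μ : C) (W : Polynomial (MvPolynomial ℕ C)) (k : ℕ) (g g' : MvPolynomial ℕ C) :
    fallOp t μ W k (g + g') = fallOp t μ W k g + fallOp t μ W k g' := by
  simp only [fallOp, conjDeriv_add, mul_add, map_add, smul_add, Finset.sum_add_distrib]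

theorem powOp_add (t μ : C) (W : Polynomial (MvPolynomial ℕ C)) (k : ℕ) (g g' : MvPolynomial ℕ C) :
    powOp t μ W k (g + g') = powOp t μ W k g + powOp t μ W k g' := by
  simp only [powOp, fallOp_add, mul_add, Finset.sum_add_distrib]

theorem fallOp_C_mul (t μ : C) (W : Polynomial (MvPolynomial ℕ C)) (k : ℕ) (c : C)
    (g : MvPolynomial ℕ C) :
    fallOp t μ W k (MvPolynomial.C c * g) = MvPolynomial.C c * fallOp t μ W k g := by
  simp only [fallOp, conjDeriv_C_mul, mul_smul_comm, Finset.mul_sum]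
  congr 1
  refine Finset.sum_congr rfl fun a _ => ?_
  rw [mul_left_comm, residueFun_C_mul]

theorem powOp_C_mul (t μ : C) (W : Polynomial (MvPolynomial ℕ C)) (k : ℕ) (c : C)
    (g : MvPolynomial ℕ C) :
    powOp t μ W k (MvPolynomial.C c * g) = MvPolynomial.C c * powOp t μ W k g := by
  simp only [powOp, fallOp_C_mul, Finset.mul_sum]
  exact Finset.sum_congr rfl fun j _ => by ring

theorem psumRep_map (π : C →ₐ[ℂ] C') (K : ℕ) (φ : ∀ r, (Fin r → ℕ) → C) :
    MvPolynomial.map (π : C →+* C') (psumRep K φ) = psumRep K fun r k => π (φ r k) := by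
  simp only [psumRep, map_sum, map_algHom_smul, map_mul, MvPolynomial.map_C, monoSymm_map]
  rfl

theorem psumRep_mul (c : C) (K : ℕ) (φ : ∀ r, (Fin r → ℕ) → C) :
    psumRep K (fun r k => c * φ r k) = MvPolynomial.C c * psumRep K φ := by
  simp only [psumRep, Finset.mul_sum, mul_smul_comm, MvPolynomial.C_mul, mul_assoc]

end Naturality

/-! ### First order expansion -/

section FirstOrder

variable {C : Type*} [CommRing C]

/-- The first order term of the action of the power sum of order `k`. -/
def firstOp (B : ℕ) (Φ : Polynomial C) (P : MvPolynomial ℕ C) (k : ℕ) (g : MvPolynomial ℕ C) :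
    MvPolynomial ℕ C :=
  (∑ j ∈ Finset.range B, MvPolynomial.C (Φ.coeff (j + 1 + k)) * MvPolynomial.X j) * g +
    ∑ j ∈ Finset.range k, MvPolynomial.C (((j : C) + 1) * Φ.coeff (k - 1 - j)) *
      (MvPolynomial.pderiv j g + MvPolynomial.pderiv j P * g)

/-- `firstOp`, centered. -/
def centeredOp (B : ℕ) (Φ : Polynomial C) (P : MvPolynomial ℕ C) (k : ℕ) (g : MvPolynomial ℕ C) :
    MvPolynomial ℕ C :=
  firstOp B Φ P k g -
    MvPolynomial.C (MvPolynomial.constantCoeff (firstOp B Φ P k 1)) * g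

theorem firstOp_map {C' : Type*} [CommRing C'] (π : C →+* C') (B : ℕ) (Φ : Polynomial C)
    (P : MvPolynomial ℕ C) (k : ℕ) (g : MvPolynomial ℕ C) :
    MvPolynomial.map π (firstOp B Φ P k g) =
      firstOp B (Φ.map π) (MvPolynomial.map π P) k (MvPolynomial.map π g) := by
  simp [firstOp, MvPolynomial.pderiv_map]

theorem centeredOp_map {C' : Type*} [CommRing C'] (π : C →+* C') (B : ℕ) (Φ : Polynomial C)
    (P : MvPolynomial ℕ C) (k : ℕ) (g : MvPolynomial ℕ C) :
    MvPolynomial.map π (centeredOp B Φ P k g) =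
      centeredOp B (Φ.map π) (MvPolynomial.map π P) k (MvPolynomial.map π g) := by
  have h : MvPolynomial.constantCoeff (firstOp B (Φ.map π) (MvPolynomial.map π P) k 1) =
      π (MvPolynomial.constantCoeff (firstOp B Φ P k 1)) := by
    rw [← MvPolynomial.constantCoeff_map, firstOp_map, map_one]
  rw [centeredOp, centeredOp, map_sub, map_mul, firstOp_map, MvPolynomial.map_C, h]

/-- The polynomial whose coefficients occur in `firstOp`. -/
def symbolPoly (μ : C) (f : Polynomial C) (k : ℕ) : Polynomial C :=
  ((1 + Polynomial.X) * (Polynomial.C μ + Polynomial.X * f)) ^ k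

theorem symbolPoly_map {C' : Type*} [CommRing C'] (π : C →+* C') (μ : C) (f : Polynomial C) (k : ℕ) :
    (symbolPoly μ f k).map π = symbolPoly (π μ) (f.map π) k := by
  simp [symbolPoly]

end FirstOrder

/-! ### Expansion of the operators modulo `t²`. -/

section SquareZero

variable {C : Type*} [CommRing C] {t : C}

theorem C_mul_C_of_sq_zero (ht : t * t = 0) (x : MvPolynomial ℕ C) :
    MvPolynomial.C t * (MvPolynomial.C t * x) = 0 := by
  rw [← mul_assoc, ← MvPolynomial.C_mul, ht, map_zero, zero_mul]

/-- All power sums other than `p_0 = μ` carry a factor `t`, so at most one of the `a + 1` factors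
differs from `μ`, which accounts for `(a + 1) μ^a`. The other corrections of order `t` are scalars
`s n`, which centering will remove. -/
theorem residuePoly_of_sq_zero (ht : t * t = 0) (μ : C) (a : ℕ) : ∃ s : ℕ → C, ∀ n : ℕ,
    residuePoly t μ a n = MvPolynomial.C (if n = a then μ ^ (a + 1) else 0) +
      MvPolynomial.C t * (MvPolynomial.C (s n) +
        if a < n then MvPolynomial.C (((a : C) + 1) * μ ^ a) * MvPolynomial.X (n - a - 1) else 0) := by
  induction a with
  | zero =>
    refine ⟨fun _ => 0, fun n => ?_⟩
    cases n with
    | zero => simp [residuePoly, scaledPsum]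
    | succ n => simp [residuePoly, scaledPsum]
  | succ a ih =>
    obtain ⟨s, hs⟩ := ih
    refine ⟨fun n => (if 0 < n then μ * s (n - 1) else 0) -
      n * (if n - 1 = a then μ ^ (a + 1) else 0), fun n => ?_⟩
    rw [residuePoly]
    cases n with
    | zero => simp
    | succ n =>
      have h1 : MvPolynomial.C t * (((n + 1 : ℕ) : MvPolynomial ℕ C) *
          residuePoly t μ a (n + 1 - 1)) = MvPolynomial.C t * (((n + 1 : ℕ) : MvPolynomial ℕ C) *
          MvPolynomial.C (if n = a then μ ^ (a + 1) else 0)) := by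
        rw [Nat.add_sub_cancel, hs, mul_add, mul_add, mul_left_comm (_ : MvPolynomial ℕ C)
          (MvPolynomial.C t), C_mul_C_of_sq_zero ht, add_zero]
      have h2 : ∀ m ∈ Finset.range n, scaledPsum t μ (m + 1) * residuePoly t μ a (n + 1 - 1 - (m + 1)) =
          MvPolynomial.C t * (MvPolynomial.X m *
            MvPolynomial.C (if n - (m + 1) = a then μ ^ (a + 1) else 0)) := by
        intro m _
        rw [Nat.add_sub_cancel, hs, scaledPsum, mul_assoc, mul_add (MvPolynomial.X m), mul_add,
          mul_left_comm (MvPolynomial.X m) (MvPolynomial.C t), C_mul_C_of_sq_zero ht, add_zero]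
      rw [Finset.sum_range_succ', Finset.sum_congr rfl h2, ← Finset.mul_sum, h1]
      have h3 : (∑ m ∈ Finset.range n, (MvPolynomial.X m : MvPolynomial ℕ C) *
          MvPolynomial.C (if n - (m + 1) = a then μ ^ (a + 1) else 0)) =
          if a < n then MvPolynomial.C (μ ^ (a + 1)) * MvPolynomial.X (n - a - 1) else 0 := by
        split_ifs with h
        · rw [Finset.sum_eq_single (n - a - 1)]
          · rw [if_pos (by omega), mul_comm]
          · intro m hm hne
            have := Finset.mem_range.1 hm
            rw [if_neg (by omega), map_zero, mul_zero]
          · intro h'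
            exact absurd (Finset.mem_range.2 (by omega)) h'
        · refine Finset.sum_eq_zero fun m hm => ?_
          have := Finset.mem_range.1 hm
          rw [if_neg (by omega), map_zero, mul_zero]
      rw [h3, Nat.add_sub_cancel, Nat.sub_zero, hs, scaledPsum]
      have h4 : (if n + 1 = a + 1 then μ ^ (a + 1 + 1) else 0) =
          μ * (if n = a then μ ^ (a + 1) else 0) := by
        by_cases h : n = a
        · rw [if_pos h, if_pos (by omega), pow_succ' μ (a + 1)]
        · rw [if_neg h, if_neg (by omega), mul_zero]
      have h5 : n + 1 - (a + 1) - 1 = n - a - 1 := by omega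
      rw [h4]
      simp only [Nat.add_sub_cancel, Nat.succ_pos, if_true, h5, Nat.add_lt_add_iff_right]
      generalize (if n = a then μ ^ (a + 1) else 0) = z
      by_cases h6 : a < n
      · simp only [h6, if_true]
        push_cast
        simp only [map_mul, map_add, map_one, map_pow, map_natCast, map_sub]
        ring
      · simp only [h6, if_false, map_mul, map_natCast, map_sub]
        ring

theorem totalDeriv_map_C (p : Polynomial C) :
    totalDeriv C (p.map MvPolynomial.C) = (Polynomial.derivative p).map MvPolynomial.C := by
  induction p using Polynomial.induction_on' with
  | add p q hp hq => simp only [Polynomial.map_add, map_add, hp, hq]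
  | monomial n c =>
    rw [← Polynomial.C_mul_X_pow_eq_monomial]
    simp only [Polynomial.map_mul, Polynomial.map_pow, Polynomial.map_C, Polynomial.map_X,
      totalDeriv_C_C_mul, Derivation.leibniz_pow, totalDeriv_X, Polynomial.derivative_mul,
      Polynomial.derivative_C, zero_mul, zero_add, Polynomial.derivative_X_pow]
    simp

/-- At first order either one of the `b` factors acts nontrivially on `g`, by differentiating it or
by multiplying it with `D`, or a derivative falls on a power of `f`. The latter gives a polynomial
`q` with scalar coefficients, independent of `g`. -/
theorem conjDeriv_of_sq_zero (ht : t * t = 0) (f : Polynomial C) (D : Polynomial (MvPolynomial ℕ C))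
    (b : ℕ) : ∃ q : Polynomial C, ∀ g : MvPolynomial ℕ C,
      conjDeriv t (f.map MvPolynomial.C + Polynomial.C (MvPolynomial.C t) * D) g b =
        (f ^ b).map MvPolynomial.C * Polynomial.C g + Polynomial.C (MvPolynomial.C t) *
          (q.map MvPolynomial.C * Polynomial.C g + (((b : Polynomial C) * f ^ (b - 1)).map
            MvPolynomial.C) * (totalDeriv C (Polynomial.C g) + D * Polynomial.C g)) := by
  induction b with
  | zero => exact ⟨0, fun g => by simp [conjDeriv]⟩
  | succ b ih =>
    obtain ⟨q, hq⟩ := ih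
    refine ⟨Polynomial.derivative (f ^ b) + f * q, fun g => ?_⟩
    have hT : ∀ x : Polynomial (MvPolynomial ℕ C),
        Polynomial.C (MvPolynomial.C t) * (Polynomial.C (MvPolynomial.C t) * x) = 0 := by
      intro x
      rw [← mul_assoc, ← Polynomial.C_mul, ← MvPolynomial.C_mul, ht, map_zero, map_zero, zero_mul]
    have hb : f * ((b : Polynomial C) * f ^ (b - 1)) = (b : Polynomial C) * f ^ b := by
      cases b with
      | zero => simp
      | succ b => simp only [Nat.add_sub_cancel]; ring
    have hb' : f.map MvPolynomial.C * ((b : Polynomial C) * f ^ (b - 1)).map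
        (MvPolynomial.C : C →+* MvPolynomial ℕ C) =
        ((b : Polynomial C) * f ^ b).map MvPolynomial.C := by
      rw [← Polynomial.map_mul, hb]
    rw [conjDeriv, hq, map_add, totalDeriv_C_C_mul, mul_add (Polynomial.C (MvPolynomial.C t)), hT,
      add_zero, Derivation.leibniz, totalDeriv_map_C, smul_eq_mul, smul_eq_mul, add_mul,
      mul_add (Polynomial.C (MvPolynomial.C t) * D), mul_assoc (Polynomial.C (MvPolynomial.C t)) D,
      mul_assoc (Polynomial.C (MvPolynomial.C t)) D,
      mul_left_comm D (Polynomial.C (MvPolynomial.C t)), hT, add_zero, Nat.add_sub_cancel]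
    simp only [Polynomial.map_add, Polynomial.map_mul, Polynomial.map_pow, Polynomial.map_natCast]
      at hb' ⊢
    push_cast
    linear_combination (Polynomial.C (MvPolynomial.C t) * (totalDeriv C (Polynomial.C g) +
      D * Polynomial.C g)) * hb'

theorem residueFun_map_C_of_sq_zero (ht : t * t = 0) (μ : C) (a : ℕ) (p : Polynomial C) {B : ℕ}
    (hB : p.natDegree ≤ B) : ∃ s : C, residueFun t μ a (p.map MvPolynomial.C) =
      MvPolynomial.C (p.coeff a * μ ^ (a + 1)) + MvPolynomial.C t * (MvPolynomial.C s +
        ∑ j ∈ Finset.range B, MvPolynomial.C (((a : C) + 1) * μ ^ a * p.coeff (j + 1 + a)) *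
          MvPolynomial.X j) := by
  obtain ⟨s, hs⟩ := residuePoly_of_sq_zero ht μ a
  have h1 : residueFun t μ a (p.map MvPolynomial.C) =
      ∑ n ∈ Finset.range (a + 1 + B), MvPolynomial.C (p.coeff n) * residuePoly t μ a n := by
    rw [residueFun, Polynomial.lsum_apply, Polynomial.sum_over_range' _ (by simp) (a + 1 + B)]
    · simp
    · refine lt_of_le_of_lt (Polynomial.natDegree_map_le) ?_
      omega
  refine ⟨∑ n ∈ Finset.range (a + 1 + B), p.coeff n * s n, ?_⟩
  rw [h1]
  simp only [hs, mul_add, Finset.sum_add_distrib, map_sum, Finset.mul_sum]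
  refine congrArg₂ (· + ·) ?_ (congrArg₂ (· + ·) ?_ ?_)
  · rw [Finset.sum_eq_single a]
    · rw [if_pos rfl, map_mul]
    · intro n _ hn; rw [if_neg hn, map_zero, mul_zero]
    · intro h; exact absurd (Finset.mem_range.2 (by omega)) h
  · exact Finset.sum_congr rfl fun n _ => by rw [map_mul]; ring
  · rw [Finset.sum_range_add, Finset.sum_eq_zero, zero_add]
    · refine Finset.sum_congr rfl fun j _ => ?_
      rw [if_pos (by omega), show a + 1 + j - a - 1 = j by omega, show a + 1 + j = j + 1 + a by omega]
      simp only [map_mul]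
      ring
    · intro n hn
      have := Finset.mem_range.1 hn
      rw [if_neg (by omega), mul_zero, mul_zero]

/-- Behind a factor `t` only the leading part of the functional survives, and this is extraction of
the coefficient of `z^a`. -/
theorem C_mul_residueFun_of_sq_zero (ht : t * t = 0) (μ : C) (a : ℕ)
    (h : Polynomial (MvPolynomial ℕ C)) : MvPolynomial.C t * residueFun t μ a h =
      MvPolynomial.C t * (MvPolynomial.C (μ ^ (a + 1)) * h.coeff a) := by
  obtain ⟨s, hs⟩ := residuePoly_of_sq_zero ht μ a
  induction h using Polynomial.induction_on' with
  | add p q hp hq => simp only [map_add, Polynomial.coeff_add, mul_add, hp, hq]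
  | monomial n g =>
    rw [← Polynomial.C_mul_X_pow_eq_monomial, residueFun_C_mul_X_pow, hs, mul_add g, mul_add,
      mul_left_comm g (MvPolynomial.C t), C_mul_C_of_sq_zero ht, add_zero,
      Polynomial.coeff_C_mul_X_pow]
    by_cases h : n = a
    · subst h; rw [if_pos rfl, if_pos rfl]; ring
    · rw [if_neg h, if_neg (Ne.symm h), map_zero, mul_zero, mul_zero, mul_zero,
        mul_zero]

theorem coeff_symbolPoly (μ : C) (f : Polynomial C) (k n : ℕ) :
    (symbolPoly μ f k).coeff n = ∑ a ∈ Finset.range (k + 1), (k.choose a : C) * μ ^ a *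
      (if k - a ≤ n then ((1 + Polynomial.X) ^ k * f ^ (k - a)).coeff (n - (k - a)) else 0) := by
  rw [symbolPoly, mul_pow, add_pow (Polynomial.C μ), Finset.mul_sum, Polynomial.finsetSum_coeff]
  refine Finset.sum_congr rfl fun a _ => ?_
  rw [show (1 + Polynomial.X) ^ k * (Polynomial.C μ ^ a * (Polynomial.X * f) ^ (k - a) *
      (k.choose a : Polynomial C)) = Polynomial.C ((k.choose a : C) * μ ^ a) *
      (((1 + Polynomial.X) ^ k * f ^ (k - a)) * Polynomial.X ^ (k - a)) by
    rw [map_mul, map_pow, map_natCast, mul_pow]; ring,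
    Polynomial.coeff_C_mul, Polynomial.coeff_mul_X_pow']

variable [Algebra ℂ C]

/-- With `G = μ/z + t ∑ X_j z^(-j-2)`, and up to scalars at order `t`, the operator is to first
order the coefficient of `z⁻¹` in `(1+z)^k (G + W + t∂)^(k+1) / (k+1)`. Varying `G` gives the
multiplications by `X_j`, and varying the rest gives the derivatives `∂_j` and `∂_j P`. Both come
with coefficients of `((1+z)(μ/z + f))^k`, which is `z^(-k)` times `symbolPoly`. -/
theorem fallOp_of_sq_zero (ht : t * t = 0) (μ : C) (f : Polynomial C) (P : MvPolynomial ℕ C)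
    (k : ℕ) {B : ℕ} (hB : k + k * f.natDegree ≤ B) : ∃ h s : C, ∀ g : MvPolynomial ℕ C,
      fallOp t μ (f.map MvPolynomial.C + Polynomial.C (MvPolynomial.C t) *
        totalDeriv C (Polynomial.C P)) k g =
      MvPolynomial.C h * g + MvPolynomial.C t * (MvPolynomial.C s * g +
        firstOp B (symbolPoly μ f k) P k g) := by
  set w : ℕ → C := fun a => algebraMap ℂ C (((k : ℂ) + 1)⁻¹ * ((k + 1).choose (a + 1) : ℂ)) with hw
  have hk : (k : ℂ) + 1 ≠ 0 := Nat.cast_add_one_ne_zero k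
  -- Varying one factor `G` in the term `a` brings a factor `a + 1`, varying one of the others
  -- brings `k - a`; the weights then become `choose k a` and `choose k (a + 1)`, as in the binomial
  -- expansion of `symbolPoly`.
  have hw1 : ∀ a, w a * ((a : C) + 1) = (k.choose a : C) := by
    intro a
    have h1 : ((k : ℂ) + 1)⁻¹ * ((k + 1).choose (a + 1) : ℂ) * ((a : ℂ) + 1) = (k.choose a : ℂ) := by
      have h2 : ((k : ℂ) + 1) * (k.choose a : ℂ) = ((k + 1).choose (a + 1) : ℂ) * ((a : ℂ) + 1) := by
        exact_mod_cast Nat.add_one_mul_choose_eq k a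
      rw [mul_assoc, ← h2, inv_mul_cancel_left₀ hk]
    have := congrArg (algebraMap ℂ C) h1
    simpa [hw] using this
  have hw2 : ∀ a ≤ k, w a * ((k - a : ℕ) : C) = (k.choose (a + 1) : C) := by
    intro a ha
    have h1 : ((k : ℂ) + 1)⁻¹ * ((k + 1).choose (a + 1) : ℂ) * ((k - a : ℕ) : ℂ) =
        (k.choose (a + 1) : ℂ) := by
      have h2 : (k + 1).choose (a + 1) * (k - a) = (k + 1) * k.choose (a + 1) := by
        have h3 := Nat.choose_succ_right_eq (k + 1) (a + 1)
        have h4 := Nat.add_one_mul_choose_eq k (a + 1)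
        rw [show k + 1 - (a + 1) = k - a by omega] at h3
        rw [← h3, ← h4]
      have h2' : ((k + 1).choose (a + 1) : ℂ) * ((k - a : ℕ) : ℂ) =
          ((k : ℂ) + 1) * (k.choose (a + 1) : ℂ) := by exact_mod_cast h2
      rw [mul_assoc, h2', inv_mul_cancel_left₀ hk]
    have := congrArg (algebraMap ℂ C) h1
    simpa [hw] using this
  choose q hq using fun a => conjDeriv_of_sq_zero ht f (totalDeriv C (Polynomial.C P)) (k - a)
  have hdeg : ∀ a, ((1 + Polynomial.X) ^ k * f ^ (k - a)).natDegree ≤ B := by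
    intro a
    refine Polynomial.natDegree_mul_le.trans (le_trans (add_le_add ?_ ?_) hB)
    · refine Polynomial.natDegree_pow_le.trans ?_
      have : (1 + Polynomial.X : Polynomial C).natDegree ≤ 1 :=
        Polynomial.natDegree_add_le_of_degree_le (by simp) Polynomial.natDegree_X_le
      nlinarith
    · exact Polynomial.natDegree_pow_le.trans (Nat.mul_le_mul_right _ (Nat.sub_le k a))
  choose s hs using fun a => residueFun_map_C_of_sq_zero ht μ a _ (hdeg a)
  refine ⟨∑ a ∈ Finset.range (k + 1), w a * (((1 + Polynomial.X) ^ k * f ^ (k - a)).coeff a *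
      μ ^ (a + 1)),
    ∑ a ∈ Finset.range (k + 1), w a * (s a + μ ^ (a + 1) * ((1 + Polynomial.X) ^ k * q a).coeff a),
    fun g => ?_⟩
  set E : ℕ → MvPolynomial ℕ C := fun j => MvPolynomial.pderiv j g + MvPolynomial.pderiv j P * g
    with hE
  have hE' : ∀ j, (totalDeriv C (Polynomial.C g) + totalDeriv C (Polynomial.C P) *
      Polynomial.C g).coeff j = ((j : MvPolynomial ℕ C) + 1) * E j := by
    intro j
    rw [Polynomial.coeff_add, Polynomial.coeff_mul_C, coeff_totalDeriv_C, coeff_totalDeriv_C]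
    ring
  have hterm : ∀ a ∈ Finset.range (k + 1), ((k : ℂ) + 1)⁻¹ • ((k + 1).choose (a + 1) : ℂ) •
      residueFun t μ a ((1 + Polynomial.X) ^ k * conjDeriv t (f.map MvPolynomial.C +
        Polynomial.C (MvPolynomial.C t) * totalDeriv C (Polynomial.C P)) g (k - a)) =
      MvPolynomial.C (w a * (((1 + Polynomial.X) ^ k * f ^ (k - a)).coeff a * μ ^ (a + 1))) * g +
      MvPolynomial.C t * (MvPolynomial.C (w a * (s a + μ ^ (a + 1) *
        ((1 + Polynomial.X) ^ k * q a).coeff a)) * g +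
        ((∑ j ∈ Finset.range B, MvPolynomial.C ((k.choose a : C) * μ ^ a *
          ((1 + Polynomial.X) ^ k * f ^ (k - a)).coeff (j + 1 + a)) * MvPolynomial.X j) * g +
        ∑ j ∈ Finset.range k, MvPolynomial.C (((j : C) + 1) * ((k.choose (a + 1) : C) *
          μ ^ (a + 1) * (if j ≤ a then ((1 + Polynomial.X) ^ k * f ^ (k - (a + 1))).coeff (a - j)
            else 0))) * E j)) := by
    intro a ha
    have hak : a ≤ k := Nat.lt_succ_iff.1 (Finset.mem_range.1 ha)
    have h1 : ∀ x : MvPolynomial ℕ C, ((k : ℂ) + 1)⁻¹ • ((k + 1).choose (a + 1) : ℂ) • x =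
        MvPolynomial.C (w a) * x := by
      intro x
      rw [smul_smul, hw, Algebra.smul_def]
      rfl
    have hX : (1 + Polynomial.X : Polynomial (MvPolynomial ℕ C)) ^ k =
        ((1 + Polynomial.X : Polynomial C) ^ k).map MvPolynomial.C := by simp
    rw [h1, hq, hX, mul_add, ← mul_assoc, ← Polynomial.map_mul, mul_comm _ (Polynomial.C g), map_add,
      residueFun_C_mul, hs, mul_left_comm _ (Polynomial.C (MvPolynomial.C t)), residueFun_C_mul,
      C_mul_residueFun_of_sq_zero ht, mul_add (Polynomial.map _ _), ← mul_assoc (Polynomial.map _ _),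
      ← mul_assoc (Polynomial.map _ _), ← Polynomial.map_mul, ← Polynomial.map_mul,
      Polynomial.coeff_add, Polynomial.coeff_mul_C, Polynomial.coeff_map]
    have h2 : (((1 + Polynomial.X) ^ k * (((k - a : ℕ) : Polynomial C) * f ^ (k - a - 1))).map
        MvPolynomial.C * (totalDeriv C (Polynomial.C g) + totalDeriv C (Polynomial.C P) *
        Polynomial.C g)).coeff a = ∑ j ∈ Finset.range k, MvPolynomial.C (((j : C) + 1) *
          (((k - a : ℕ) : C) * (if j ≤ a then
            ((1 + Polynomial.X) ^ k * f ^ (k - (a + 1))).coeff (a - j) else 0))) * E j := by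
      rw [mul_comm, Polynomial.coeff_mul, Finset.Nat.sum_antidiagonal_eq_sum_range_succ_mk]
      have h3 : ∀ j, (((1 + Polynomial.X) ^ k * (((k - a : ℕ) : Polynomial C) *
          f ^ (k - a - 1))).map (MvPolynomial.C : C →+* MvPolynomial ℕ C)).coeff j =
          MvPolynomial.C (((k - a : ℕ) : C) *
            ((1 + Polynomial.X) ^ k * f ^ (k - (a + 1))).coeff j) := by
        intro j
        rw [Polynomial.coeff_map, Nat.sub_sub, mul_left_comm, ← Polynomial.C_eq_natCast,
          Polynomial.coeff_C_mul]
      simp only [h3, hE']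
      rcases hak.eq_or_lt with rfl | hlt
      · simp
      · rw [← Finset.sum_subset (Finset.range_subset_range.2 (Nat.succ_le_of_lt hlt))]
        · refine Finset.sum_congr rfl fun j hj => ?_
          rw [if_pos (Nat.lt_succ_iff.1 (Finset.mem_range.1 hj))]
          simp only [map_mul, map_add, map_natCast, map_one]
          ring
        · intro j _ hj
          rw [if_neg fun h => hj (Finset.mem_range.2 (Nat.lt_succ_of_le h)), mul_zero, mul_zero,
            map_zero, zero_mul]
    rw [h2, ← hw1, ← hw2 a hak]
    simp only [mul_add, add_mul, Finset.mul_sum, Finset.sum_mul, map_mul, map_add]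
    have h4 : ∀ x y z u v x' y' z' u' v' : MvPolynomial ℕ C, x = x' → y = y' → z = z' → u = u' →
        v = v' → x + (y + z) + (u + v) = x' + (y' + u' + (z' + v')) := by
      rintro x y z u v _ _ _ _ _ rfl rfl rfl rfl rfl; ring
    refine h4 _ _ _ _ _ _ _ _ _ _ ?_ ?_ ?_ ?_ ?_
    · ring
    · ring
    · exact Finset.sum_congr rfl fun j _ => by ring
    · ring
    · exact Finset.sum_congr rfl fun j _ => by ring
  rw [fallOp, Finset.smul_sum, Finset.sum_congr rfl hterm, Finset.sum_add_distrib, ← Finset.mul_sum,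
    Finset.sum_add_distrib, Finset.sum_add_distrib, map_sum, map_sum, Finset.sum_mul, Finset.sum_mul,
    firstOp]
  congr 3
  congr 1
  · rw [← Finset.sum_mul, Finset.sum_comm]
    congr 1
    refine Finset.sum_congr rfl fun j _ => ?_
    rw [← Finset.sum_mul, ← map_sum, coeff_symbolPoly]
    congr 2
    refine Finset.sum_congr rfl fun a ha => ?_
    have hak : a ≤ k := Nat.lt_succ_iff.1 (Finset.mem_range.1 ha)
    rw [if_pos (by omega), show j + 1 + k - (k - a) = j + 1 + a by omega]
  · rw [Finset.sum_comm]
    refine Finset.sum_congr rfl fun j hj => ?_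
    have hjk := Finset.mem_range.1 hj
    rw [← Finset.sum_mul, ← map_sum, coeff_symbolPoly, ← Finset.mul_sum]
    congr 3
    -- The derivative terms carry `choose k (a + 1)`, so the sum is shifted by one. The term dropped
    -- at the start vanishes because `k > k - 1 - j`, the one at the end because `choose k (k + 1) =
    -- 0`.
    rw [Finset.sum_range_succ' (fun a => (k.choose a : C) * μ ^ a * _) k, Finset.sum_range_succ]
    rw [Nat.choose_succ_self, Nat.cast_zero, zero_mul, zero_mul, add_zero,
      if_neg (show ¬ (k - 0 ≤ k - 1 - j) by omega), mul_zero, add_zero]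
    refine Finset.sum_congr rfl fun a ha => ?_
    have hak := Finset.mem_range.1 ha
    congr 1
    by_cases h : j ≤ a
    · rw [if_pos h, if_pos (by omega), show k - 1 - j - (k - (a + 1)) = a - j by omega]
    · rw [if_neg h, if_neg (by omega)]

/-- Modulo `t²` only two Stirling terms survive: `j = k`, and `j = k - 1` with its factor `t`. The
second one contributes a scalar only. -/
theorem powOp_of_sq_zero (ht : t * t = 0) (μ : C) (f : Polynomial C) (P : MvPolynomial ℕ C)
    (k : ℕ) {B : ℕ} (hB : k + k * f.natDegree ≤ B) : ∃ h s : C, ∀ g : MvPolynomial ℕ C,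
      powOp t μ (f.map MvPolynomial.C + Polynomial.C (MvPolynomial.C t) *
        totalDeriv C (Polynomial.C P)) k g =
      MvPolynomial.C h * g + MvPolynomial.C t * (MvPolynomial.C s * g +
        firstOp B (symbolPoly μ f k) P k g) := by
  obtain ⟨h, s, hs⟩ := fallOp_of_sq_zero ht μ f P k hB
  cases k with
  | zero =>
    refine ⟨h, s, fun g => ?_⟩
    rw [← hs, powOp]
    simp
  | succ k =>
    obtain ⟨h', s', hs'⟩ := fallOp_of_sq_zero ht μ f P k (B := k + k * f.natDegree) le_rfl
    refine ⟨h, s + (k + 1).stirlingSecond k * h', fun g => ?_⟩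
    rw [powOp, Finset.sum_range_succ, Finset.sum_range_succ, Finset.sum_eq_zero]
    · rw [hs, hs', Nat.stirlingSecond_self, Nat.sub_self, show k + 1 - k = 1 by omega]
      simp only [pow_zero, map_one, one_mul, Nat.cast_one, pow_one, zero_add, mul_add, map_add,
        map_mul, map_natCast, mul_left_comm (_ : MvPolynomial ℕ C) (MvPolynomial.C t),
        C_mul_C_of_sq_zero ht, add_zero]
      ring
    · intro j hj
      have := Finset.mem_range.1 hj
      obtain ⟨i, hi⟩ := Nat.exists_eq_add_of_le (show 2 ≤ k + 1 - j by omega)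
      rw [hi, pow_add, pow_two, ht, zero_mul, map_zero, zero_mul]

/-- The scalars `h` and `s` cancel between `g` and `1`; what remains is divisible by `t`. This is
why centered power sums are smaller by one power of `N`. -/
theorem powOp_sub_of_sq_zero (ht : t * t = 0) (μ : C) (f : Polynomial C) (P : MvPolynomial ℕ C)
    (k : ℕ) {B : ℕ} (hB : k + k * f.natDegree ≤ B) (W : Polynomial (MvPolynomial ℕ C))
    (hW : W = f.map MvPolynomial.C + Polynomial.C (MvPolynomial.C t) *
      totalDeriv C (Polynomial.C P)) (g : MvPolynomial ℕ C) :
      powOp t μ W k g - MvPolynomial.C (MvPolynomial.constantCoeff (powOp t μ W k 1)) * g =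
      MvPolynomial.C t * centeredOp B (symbolPoly μ f k) P k g := by
  obtain ⟨h, s, hs⟩ := powOp_of_sq_zero ht μ f P k hB
  rw [hW, hs, hs, centeredOp]
  simp only [map_add, map_mul, MvPolynomial.constantCoeff_C, mul_one]
  ring

end SquareZero

/-! ### Convergent sequences -/

section Sequences

/-- The algebra of convergent complex sequences. -/
def convSeq : Subalgebra ℂ (ℕ → ℂ) where
  carrier := {u | ∃ l, Tendsto u atTop (𝓝 l)}
  mul_mem' := fun ⟨_, h⟩ ⟨_, h'⟩ => ⟨_, h.mul h'⟩
  add_mem' := fun ⟨_, h⟩ ⟨_, h'⟩ => ⟨_, h.add h'⟩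
  algebraMap_mem' := fun c => ⟨c, tendsto_const_nhds⟩

/-- The limit of a convergent sequence. -/
def seqLim : convSeq →ₐ[ℂ] ℂ where
  toFun u := u.2.choose
  map_one' := tendsto_nhds_unique (1 : convSeq).2.choose_spec tendsto_const_nhds
  map_zero' := tendsto_nhds_unique (0 : convSeq).2.choose_spec tendsto_const_nhds
  map_mul' u v := tendsto_nhds_unique (u * v).2.choose_spec
    (u.2.choose_spec.mul v.2.choose_spec)
  map_add' u v := tendsto_nhds_unique (u + v).2.choose_spec
    (u.2.choose_spec.add v.2.choose_spec)
  commutes' c := tendsto_nhds_unique (algebraMap ℂ convSeq c).2.choose_spec tendsto_const_nhds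

/-- The term number `N` of a convergent sequence. -/
def seqEval (N : ℕ) : convSeq →ₐ[ℂ] ℂ := (Pi.evalAlgHom ℂ (fun _ : ℕ => ℂ) N).comp convSeq.val

theorem tendsto_seqEval (u : convSeq) : Tendsto (fun N => seqEval N u) atTop (𝓝 (seqLim u)) :=
  u.2.choose_spec

/-- The convergent sequence with given terms. -/
def mkSeq {u : ℕ → ℂ} {l : ℂ} (h : Tendsto u atTop (𝓝 l)) : convSeq := ⟨u, l, h⟩

theorem seqLim_mkSeq {u : ℕ → ℂ} {l : ℂ} (h : Tendsto u atTop (𝓝 l)) : seqLim (mkSeq h) = l :=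
  tendsto_nhds_unique (tendsto_seqEval (mkSeq h)) h

end Sequences

/-! ### Compositions of centered operators -/

section Composition

variable {C : Type*} [CommRing C]

theorem centeredOp_add (B : ℕ) (Φ : Polynomial C) (P : MvPolynomial ℕ C) (k : ℕ)
    (g g' : MvPolynomial ℕ C) :
    centeredOp B Φ P k (g + g') = centeredOp B Φ P k g + centeredOp B Φ P k g' := by
  simp only [centeredOp, firstOp, map_add, mul_add, Finset.sum_add_distrib]
  ring

theorem centeredOp_C_mul (B : ℕ) (Φ : Polynomial C) (P : MvPolynomial ℕ C) (k : ℕ) (c : C)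
    (g : MvPolynomial ℕ C) :
    centeredOp B Φ P k (MvPolynomial.C c * g) = MvPolynomial.C c * centeredOp B Φ P k g := by
  simp only [centeredOp, firstOp, MvPolynomial.pderiv_C_mul, mul_sub,
    mul_add (MvPolynomial.C c), Finset.mul_sum (a := MvPolynomial.C c)]
  refine congrArg₂ (· - ·) (congrArg₂ (· + ·) ?_ ?_) ?_
  · ring
  · exact Finset.sum_congr rfl fun j _ => by ring
  · ring

theorem centeredOp_sum {ι : Type*} (s : Finset ι) (B : ℕ) (Φ : Polynomial C) (P : MvPolynomial ℕ C)
    (k : ℕ) (g : ι → MvPolynomial ℕ C) :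
    centeredOp B Φ P k (∑ i ∈ s, g i) = ∑ i ∈ s, centeredOp B Φ P k (g i) := by
  classical
  induction s using Finset.induction_on with
  | empty => simpa using centeredOp_C_mul B Φ P k 0 0
  | insert a s ha ih => rw [Finset.sum_insert ha, Finset.sum_insert ha, centeredOp_add, ih]

theorem foldr_centeredOp_map {C' : Type*} [CommRing C'] (π : C →+* C') {ι : Type*} (B : ℕ)
    (Φ : ι → Polynomial C) (P : MvPolynomial ℕ C) (k : ι → ℕ) (L : List ι) :
    MvPolynomial.map π (L.foldr (fun i => centeredOp B (Φ i) P (k i)) 1) =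
      L.foldr (fun i => centeredOp B ((Φ i).map π) (MvPolynomial.map π P) (k i)) 1 := by
  induction L with
  | nil => simp
  | cons i L ih => rw [List.foldr_cons, centeredOp_map, ih, List.foldr_cons]

variable [Algebra ℂ C]

/-- The operator of the power sum of order `k`, centered. -/
def centeredPow (t μ : C) (W : Polynomial (MvPolynomial ℕ C)) (k : ℕ) (g : MvPolynomial ℕ C) :
    MvPolynomial ℕ C :=
  powOp t μ W k g - MvPolynomial.C (MvPolynomial.constantCoeff (powOp t μ W k 1)) * g

theorem centeredPow_map {C' : Type*} [CommRing C'] [Algebra ℂ C'] (π : C →ₐ[ℂ] C') (t μ : C)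
    (W : Polynomial (MvPolynomial ℕ C)) (k : ℕ) (g : MvPolynomial ℕ C) :
    MvPolynomial.map (π : C →+* C') (centeredPow t μ W k g) =
      centeredPow (π t) (π μ) (W.map (MvPolynomial.map (π : C →+* C'))) k
        (MvPolynomial.map (π : C →+* C') g) := by
  have h := powOp_map π t μ W k 1
  rw [map_one] at h
  rw [centeredPow, centeredPow, ← h, MvPolynomial.constantCoeff_map, map_sub, map_mul, powOp_map,
    MvPolynomial.map_C]

theorem centeredPow_mul (c t μ : C) (W : Polynomial (MvPolynomial ℕ C)) (k : ℕ)
    (g : MvPolynomial ℕ C) :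
    centeredPow (c * t) (c * μ) (Polynomial.C (MvPolynomial.C c) * W) k g =
      MvPolynomial.C (c ^ (k + 1)) * centeredPow t μ W k g := by
  simp only [centeredPow, powOp_mul, map_mul, map_pow, MvPolynomial.constantCoeff_C]
  ring

theorem centeredPow_add (t μ : C) (W : Polynomial (MvPolynomial ℕ C)) (k : ℕ)
    (g g' : MvPolynomial ℕ C) :
    centeredPow t μ W k (g + g') = centeredPow t μ W k g + centeredPow t μ W k g' := by
  simp only [centeredPow, powOp_add]; ring

theorem centeredPow_C_mul (t μ : C) (W : Polynomial (MvPolynomial ℕ C)) (k : ℕ) (c : C)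
    (g : MvPolynomial ℕ C) :
    centeredPow t μ W k (MvPolynomial.C c * g) = MvPolynomial.C c * centeredPow t μ W k g := by
  simp only [centeredPow, powOp_C_mul]; ring

/-- The computation with `t² = 0` takes place in the quotient ring; lifting it back leaves an error
in the ideal generated by `t²`. -/
theorem exists_centeredPow_eq (t μ : C) (f : Polynomial C) (P : MvPolynomial ℕ C)
    (k : ℕ) {B : ℕ} (hB : k + k * f.natDegree ≤ B) {W : Polynomial (MvPolynomial ℕ C)}
    (hW : W = f.map MvPolynomial.C + Polynomial.C (MvPolynomial.C t) *
      totalDeriv C (Polynomial.C P)) (g : MvPolynomial ℕ C) : ∃ r,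
    centeredPow t μ W k g = MvPolynomial.C t * centeredOp B (symbolPoly μ f k) P k g +
      MvPolynomial.C (t * t) * r := by
  set I : Ideal C := Ideal.span {t * t} with hI
  set π : C →ₐ[ℂ] C ⧸ I := Ideal.Quotient.mkₐ ℂ I with hπ
  have ht : π t * π t = 0 := by
    rw [← map_mul]
    exact Ideal.Quotient.eq_zero_iff_mem.2 (Ideal.mem_span_singleton_self _)
  have h1 := powOp_sub_of_sq_zero ht (π μ) (f.map (π : C →+* C ⧸ I))
    (MvPolynomial.map (π : C →+* C ⧸ I) P) k (B := B)
    (le_trans (Nat.add_le_add_left (Nat.mul_le_mul_left _ Polynomial.natDegree_map_le) _) hB)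
    (W.map (MvPolynomial.map (π : C →+* C ⧸ I))) (by
      rw [hW, Polynomial.map_add, Polynomial.map_mul, totalDeriv_map, Polynomial.map_map,
        Polynomial.map_map, Polynomial.map_C, Polynomial.map_C, MvPolynomial.map_C]
      congr 2
      ext x
      simp) (MvPolynomial.map (π : C →+* C ⧸ I) g)
  have h2 : MvPolynomial.map (π : C →+* C ⧸ I) (centeredPow t μ W k g -
      MvPolynomial.C t * centeredOp B (symbolPoly μ f k) P k g) = 0 := by
    rw [map_sub, centeredPow_map, map_mul, centeredOp_map, MvPolynomial.map_C, symbolPoly_map,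
      sub_eq_zero]
    exact h1
  have h3 : centeredPow t μ W k g - MvPolynomial.C t * centeredOp B (symbolPoly μ f k) P k g ∈
      I.map (MvPolynomial.C : C →+* MvPolynomial ℕ C) := by
    have h4 : RingHom.ker (π : C →+* C ⧸ I) = I := Ideal.mk_ker
    rw [← h4, ← MvPolynomial.ker_map]
    exact h2
  rw [hI, Ideal.map_span, Set.image_singleton, Ideal.mem_span_singleton] at h3
  obtain ⟨r, hr⟩ := h3
  exact ⟨r, by rw [← hr]; ring⟩

/-- Each centered operator contributes exactly one factor `t` to leading order, and the leading
terms compose. -/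
theorem exists_foldr_centeredPow_eq {ι : Type*} (t : C) (μ : ι → C) (k : ι → ℕ) (f : Polynomial C)
    (P : MvPolynomial ℕ C) {B : ℕ} (hB : ∀ i, k i + k i * f.natDegree ≤ B)
    {W : Polynomial (MvPolynomial ℕ C)}
    (hW : W = f.map MvPolynomial.C + Polynomial.C (MvPolynomial.C t) *
      totalDeriv C (Polynomial.C P)) (L : List ι) : ∃ r,
    L.foldr (fun i => centeredPow t (μ i) W (k i)) 1 = MvPolynomial.C (t ^ L.length) *
      L.foldr (fun i => centeredOp B (symbolPoly (μ i) f (k i)) P (k i)) 1 +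
      MvPolynomial.C (t ^ (L.length + 1)) * r := by
  induction L with
  | nil => exact ⟨0, by simp⟩
  | cons i L ih =>
    obtain ⟨r, hr⟩ := ih
    obtain ⟨r1, h1⟩ := exists_centeredPow_eq t (μ i) f P (k i) (hB i) hW
      (L.foldr (fun i => centeredOp B (symbolPoly (μ i) f (k i)) P (k i)) 1)
    obtain ⟨r2, h2⟩ := exists_centeredPow_eq t (μ i) f P (k i) (hB i) hW r
    refine ⟨r1 + centeredOp B (symbolPoly (μ i) f (k i)) P (k i) r + MvPolynomial.C t * r2, ?_⟩
    rw [List.foldr_cons, hr, centeredPow_add, centeredPow_C_mul, centeredPow_C_mul, h1, h2,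
      List.foldr_cons, List.length_cons]
    simp only [map_pow, map_mul]
    ring

/-- Rescaling of compositions of centered operators. -/
theorem foldr_centeredPow_scale {ι : Type*} (c t : C) (μ : ι → C) (k : ι → ℕ)
    (W : Polynomial (MvPolynomial ℕ C)) (L : List ι) :
    L.foldr (fun i => centeredPow (c * t) (c * μ i) (Polynomial.C (MvPolynomial.C c) * W) (k i)) 1 =
      MvPolynomial.C (c ^ (L.map fun i => k i + 1).sum) *
        L.foldr (fun i => centeredPow t (μ i) W (k i)) 1 := by
  induction L with
  | nil => simp
  | cons i L ih =>
    rw [List.foldr_cons, ih, centeredPow_C_mul, centeredPow_mul, List.foldr_cons, List.map_cons,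
      List.sum_cons, pow_add c (k i + 1)]
    simp only [map_mul]
    ring

theorem foldr_centeredPow_map {C' : Type*} [CommRing C'] [Algebra ℂ C'] (π : C →ₐ[ℂ] C')
    {ι : Type*} (t : C) (μ : ι → C) (k : ι → ℕ) (W : Polynomial (MvPolynomial ℕ C)) (L : List ι) :
    MvPolynomial.map (π : C →+* C') (L.foldr (fun i => centeredPow t (μ i) W (k i)) 1) =
      L.foldr (fun i => centeredPow (π t) (π (μ i)) (W.map (MvPolynomial.map (π : C →+* C')))
        (k i)) 1 := by
  induction L with
  | nil => simp
  | cons i L ih => rw [List.foldr_cons, centeredPow_map, ih, List.foldr_cons]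

end Composition

/-! ### Wick's formula -/

section Wick

/-- The sum over all pairings of the elements of the list. -/
def wick {R ι : Type*} [CommRing R] (K : ι → ι → R) : List ι → R
  | [] => 1
  | q :: L => ∑ i : Fin L.length, K q (L.get i) * wick K (L.eraseIdx i)
termination_by L => L.length
decreasing_by
  have := i.2
  simp only [List.length_cons]
  rw [List.length_eraseIdx_of_lt i.2]
  omega

variable {R ι : Type*} [CommRing R]

/-- The commutator with `∂_j` is a scalar: multiplication by `X_j` contributes its coefficient and
multiplication by `∂_i P` contributes a second derivative of `P`. The bound `j < B` ensures that
`X_j` occurs in the sum. -/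
theorem pderiv_centeredOp {B : ℕ} (Φ : Polynomial R) {P : MvPolynomial ℕ R} {s : ℕ → ℕ → R}
    (hs : ∀ i j, MvPolynomial.pderiv i (MvPolynomial.pderiv j P) = MvPolynomial.C (s i j)) (k : ℕ)
    {j : ℕ} (hj : j < B) (g : MvPolynomial ℕ R) :
    MvPolynomial.pderiv j (centeredOp B Φ P k g) = centeredOp B Φ P k (MvPolynomial.pderiv j g) +
      MvPolynomial.C (Φ.coeff (j + 1 + k) +
        ∑ i ∈ Finset.range k, ((i : R) + 1) * Φ.coeff (k - 1 - i) * s j i) * g := by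
  have h1 : ∀ i, MvPolynomial.pderiv j (MvPolynomial.pderiv i g) =
      MvPolynomial.pderiv i (MvPolynomial.pderiv j g) := by
    intro i
    have : ⁅MvPolynomial.pderiv (R := R) j, MvPolynomial.pderiv (R := R) i⁆ = 0 := by
      refine MvPolynomial.derivation_ext fun l => ?_
      rw [Derivation.commutator_apply]
      simp [MvPolynomial.pderiv_X, Pi.single_apply, apply_ite]
    have h2 := DFunLike.congr_fun this g
    rw [Derivation.commutator_apply] at h2
    exact sub_eq_zero.1 h2
  have h3 : MvPolynomial.pderiv j (∑ i ∈ Finset.range B, MvPolynomial.C (Φ.coeff (i + 1 + k)) *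
      MvPolynomial.X i) = MvPolynomial.C (Φ.coeff (j + 1 + k)) := by
    rw [map_sum, Finset.sum_eq_single j]
    · simp [Derivation.leibniz]
    · intro i _ hi
      simp [Derivation.leibniz, MvPolynomial.pderiv_X_of_ne hi]
    · intro h; exact absurd (Finset.mem_range.2 hj) h
  rw [centeredOp, centeredOp]
  generalize MvPolynomial.constantCoeff (firstOp B Φ P k 1) = m
  rw [firstOp, firstOp]
  set A := ∑ i ∈ Finset.range B, MvPolynomial.C (Φ.coeff (i + 1 + k)) *
      (MvPolynomial.X i : MvPolynomial ℕ R) with hA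
  have h4 : MvPolynomial.pderiv j (∑ i ∈ Finset.range k,
      MvPolynomial.C (((i : R) + 1) * Φ.coeff (k - 1 - i)) *
      (MvPolynomial.pderiv i g + MvPolynomial.pderiv i P * g)) =
      ∑ i ∈ Finset.range k, MvPolynomial.C (((i : R) + 1) * Φ.coeff (k - 1 - i)) *
      (MvPolynomial.pderiv i (MvPolynomial.pderiv j g) +
        MvPolynomial.pderiv i P * MvPolynomial.pderiv j g) +
      MvPolynomial.C (∑ i ∈ Finset.range k, ((i : R) + 1) * Φ.coeff (k - 1 - i) * s j i) * g := by
    rw [map_sum, map_sum, Finset.sum_mul, ← Finset.sum_add_distrib]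
    refine Finset.sum_congr rfl fun i _ => ?_
    rw [MvPolynomial.pderiv_C_mul, map_add, h1, Derivation.leibniz, hs, smul_eq_mul, smul_eq_mul,
      map_mul MvPolynomial.C _ (s j i)]
    ring
  rw [map_sub, map_add, h4, MvPolynomial.pderiv_C_mul, Derivation.leibniz, h3, smul_eq_mul,
    smul_eq_mul, map_add]
  ring

/-- At the origin the linear forms vanish, and the terms with `∂_j P` are exactly what centering
subtracts, so only derivatives of `g` are left. -/
theorem constantCoeff_centeredOp (B : ℕ) (Φ : Polynomial R) (P : MvPolynomial ℕ R) (k : ℕ)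
    (g : MvPolynomial ℕ R) : MvPolynomial.constantCoeff (centeredOp B Φ P k g) =
      ∑ j ∈ Finset.range k, ((j : R) + 1) * Φ.coeff (k - 1 - j) *
        MvPolynomial.constantCoeff (MvPolynomial.pderiv j g) := by
  have h1 : ∀ g : MvPolynomial ℕ R, MvPolynomial.constantCoeff (firstOp B Φ P k g) =
      ∑ j ∈ Finset.range k, ((j : R) + 1) * Φ.coeff (k - 1 - j) *
        (MvPolynomial.constantCoeff (MvPolynomial.pderiv j g) +
          MvPolynomial.constantCoeff (MvPolynomial.pderiv j P) * MvPolynomial.constantCoeff g) := by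
    intro g
    simp [firstOp]
  have h2 : ∀ j, MvPolynomial.pderiv j (1 : MvPolynomial ℕ R) = 0 := fun j =>
    Derivation.map_one_eq_zero _
  rw [centeredOp, map_sub, map_mul, h1, h1, MvPolynomial.constantCoeff_C, Finset.sum_mul,
    ← Finset.sum_sub_distrib]
  refine Finset.sum_congr rfl fun j _ => ?_
  rw [h2, map_zero, map_one]
  ring

/-- Wick's formula: the outermost operator acts at the origin as a derivative, and moving it through
the remaining operators contracts it with one of them each time. -/
theorem constantCoeff_foldr_centeredOp {B : ℕ} (Φ : ι → Polynomial R) {P : MvPolynomial ℕ R}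
    {s : ℕ → ℕ → R}
    (hs : ∀ i j, MvPolynomial.pderiv i (MvPolynomial.pderiv j P) = MvPolynomial.C (s i j)) {k : ι → ℕ}
    (hk : ∀ i, k i ≤ B) : ∀ L : List ι,
    MvPolynomial.constantCoeff (L.foldr (fun i => centeredOp B (Φ i) P (k i)) 1) =
      wick (fun q q' => ∑ j ∈ Finset.range (k q), ((j : R) + 1) * (Φ q).coeff (k q - 1 - j) *
        ((Φ q').coeff (j + 1 + k q') + ∑ i ∈ Finset.range (k q'),
          ((i : R) + 1) * (Φ q').coeff (k q' - 1 - i) * s j i)) L := by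
  set u : ι → ℕ → R := fun q' j => (Φ q').coeff (j + 1 + k q') + ∑ i ∈ Finset.range (k q'),
          ((i : R) + 1) * (Φ q').coeff (k q' - 1 - i) * s j i with hu
  -- The derivation rule for a composition whose commutators with `∂_j` are scalars; the derivative
  -- of the initial `1` is zero.
  have hd : ∀ (L : List ι) (j : ℕ), j < B → MvPolynomial.pderiv j
      (L.foldr (fun i => centeredOp B (Φ i) P (k i)) 1) = ∑ i : Fin L.length,
        MvPolynomial.C (u (L.get i) j) *
          (L.eraseIdx i).foldr (fun i => centeredOp B (Φ i) P (k i)) 1 := by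
    intro L j hj
    induction L with
    | nil => simp
    | cons q L ih =>
      rw [List.foldr_cons, pderiv_centeredOp (Φ q) hs (k q) hj, ih, centeredOp_sum]
      refine Eq.trans ?_ (Fin.sum_univ_succ (n := L.length) (fun i =>
        MvPolynomial.C (u ((q :: L).get i) j) * ((q :: L).eraseIdx i).foldr
          (fun i => centeredOp B (Φ i) P (k i)) 1)).symm
      rw [add_comm]
      refine congrArg₂ (· + ·) rfl ?_
      refine Finset.sum_congr rfl fun i _ => ?_
      rw [centeredOp_C_mul]
      rfl
  intro L
  induction hn : L.length using Nat.strong_induction_on generalizing L with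
  | _ n ih =>
  cases L with
  | nil => simp [wick]
  | cons q L =>
    rw [List.foldr_cons, constantCoeff_centeredOp, wick]
    have h1 : ∀ j ∈ Finset.range (k q), ((j : R) + 1) * (Φ q).coeff (k q - 1 - j) *
        MvPolynomial.constantCoeff (MvPolynomial.pderiv j
          (L.foldr (fun i => centeredOp B (Φ i) P (k i)) 1)) =
        ∑ i : Fin L.length, ((j : R) + 1) * (Φ q).coeff (k q - 1 - j) * (u (L.get i) j *
          wick (fun q q' => ∑ j ∈ Finset.range (k q), ((j : R) + 1) * (Φ q).coeff (k q - 1 - j) *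
            u q' j) (L.eraseIdx i)) := by
      intro j hj
      rw [hd L j ((Finset.mem_range.1 hj).trans_le (hk q)), map_sum, Finset.mul_sum]
      refine Finset.sum_congr rfl fun i _ => ?_
      rw [map_mul, MvPolynomial.constantCoeff_C, ih _ ?_ (L.eraseIdx i) rfl]
      rw [← hn, List.length_eraseIdx_of_lt i.2, List.length_cons]
      omega
    rw [Finset.sum_congr rfl h1, Finset.sum_comm]
    refine Finset.sum_congr rfl fun i _ => ?_
    rw [Finset.sum_mul]
    exact Finset.sum_congr rfl fun j _ => by rw [mul_assoc (((j : R) + 1) * _)]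

end Wick

/-! ### The Taylor series of a Schur generating function -/

section SchurGen

variable {M : ℕ} {ρ : PMF (Signature M)}

theorem schurGen_one (ρ : PMF (Signature M)) : schurGen ρ 1 = 1 := by
  have h := Complex.hasSum_ofReal.2 (hasSum_pmf_toReal ρ)
  simpa [schurGen, normSchur_one] using h.tsum_eq

theorem continuousAt_schurGen (h : HasSchurGen ρ) : ContinuousAt (schurGen ρ) 1 := by
  obtain ⟨U, hU, h1, hs⟩ := h
  have hV := eventually_forall_ne_zero (x := (1 : Fin M → ℂ)) (by simp)
  obtain ⟨V, hVs, hVo, hV1⟩ := mem_nhds_iff.1 hV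
  have hunif := (hasSumUniformlyOn_iff_tendstoUniformlyOn.1 hs.hasSumUniformlyOn).mono
    (Set.inter_subset_left (t := V))
  have hc : ContinuousOn (schurGen ρ) (U ∩ V) := by
    refine hunif.continuousOn (Frequently.of_forall fun s => ?_)
    refine continuousOn_finsetSum _ fun l _ x hx => ?_
    exact (continuousAt_const.mul (analyticAt_normSchur l (hVs hx.2)).continuousAt).continuousWithinAt
  exact hc.continuousAt ((hU.inter hVo).mem_nhds ⟨h1, hV1⟩)

theorem schurGen_eventuallyEq_exp_log (h : HasSchurGen ρ) :
    schurGen ρ =ᶠ[𝓝 1] fun x => Complex.exp (Complex.log (schurGen ρ x)) := by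
  have h1 : ∀ᶠ x in 𝓝 (1 : Fin M → ℂ), schurGen ρ x ≠ 0 :=
    (continuousAt_schurGen h).eventually_ne (by rw [schurGen_one]; exact one_ne_zero)
  filter_upwards [h1] with x hx
  rw [Complex.exp_log hx]

theorem schurGen_comp_perm (ρ : PMF (Signature M)) (σ : Equiv.Perm (Fin M)) :
    (fun x => schurGen ρ (x ∘ σ)) =ᶠ[𝓝 1] schurGen ρ := by
  filter_upwards [eventually_forall_ne_zero (x := (1 : Fin M → ℂ)) (by simp)] with x hx
  exact tsum_congr fun l => by rw [normSchur_comp_perm l hx σ]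

theorem hasSum_coeff_taylor_schurGen (h : HasSchurGen ρ) (α : Fin M →₀ ℕ) :
    HasSum (fun l => (((ρ l).toReal : ℝ) : ℂ) * MvPowerSeries.coeff α (taylor (normSchur l)))
      (MvPowerSeries.coeff α (taylor (schurGen ρ))) := by
  obtain ⟨U, hU, h1, hs⟩ := h
  have hV := eventually_forall_ne_zero (x := (1 : Fin M → ℂ)) (by simp)
  have h2 := hasSum_coeff_taylor hU h1 hs hV
    (fun l x hx => analyticAt_const.fun_mul (analyticAt_normSchur l hx)) α
  refine h2.congr_fun fun l => ?_
  rw [taylor_const_mul _ (analyticAt_normSchur l (by simp))]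
  rfl

variable (ρ) in
/-- The logarithm of the Schur generating function. -/
def logGen (x : Fin M → ℂ) : ℂ := Complex.log (schurGen ρ x)

theorem logGen_one (ρ : PMF (Signature M)) : logGen ρ 1 = 0 := by
  rw [logGen, schurGen_one, Complex.log_one]

variable (ρ) in
/-- The logarithm of the Schur generating function as a polynomial in power sums, up to degree
`K`. -/
def logPoly (K : ℕ) : MvPolynomial ℕ ℂ := psumRep K (symmCoeff (logGen ρ))

theorem isSymmSeries_taylor_logGen (hl : AnalyticAt ℂ (logGen ρ) 1) :
    IsSymmSeries (taylor (logGen ρ)) := by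
  intro σ α
  refine coeff_taylor_of_symm hl σ ?_ α
  filter_upwards [schurGen_comp_perm ρ σ] with x hx
  exact congrArg Complex.log hx

/-- The relation `∂S = S ∂(log S)`, with the logarithm replaced by its truncation to a polynomial in
power sums; one order is spent on the derivative. -/
theorem le_order_pderiv_taylor_schurGen (h : HasSchurGen ρ) (hl : AnalyticAt ℂ (logGen ρ) 1)
    (K : ℕ) (i : Fin M) : (K : ℕ∞) ≤ (MvPowerSeries.pderiv ℂ i (taylor (schurGen ρ)) -
      taylor (schurGen ρ) *
        evPsumVar i (totalDeriv ℂ (Polynomial.C (logPoly ρ K)))).order := by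
  rw [pderiv_taylor_exp hl (schurGen_eventuallyEq_exp_log h), ← pderiv_evPsum, ← mul_sub, ← map_sub]
  exact le_order_mul_left (le_order_pderiv i _
    (le_order_taylor_sub_evPsum hl (isSymmSeries_taylor_logGen hl) K)) _

end SchurGen

/-! ### Moments of power sums -/

section Moments

theorem chainOps_eq_foldr (n : ℕ) : ∀ (s : Fin (n + 1) → ℕ) (W : Polynomial (MvPolynomial ℕ ℂ))
    (J : Fin (n + 1) → List (ℕ × ℝ)) (g : MvPolynomial ℕ ℂ), chainOps n s W J g =
      (List.finRange (n + 1)).foldr (fun t => applyOps (s t) W (J t)) g := by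
  induction n with
  | zero => intro s W J g; simp [chainOps, List.finRange_succ]
  | succ n ih =>
    intro s W J g
    rw [chainOps, ih, List.finRange_succ_last (n := n + 1), List.foldr_append, List.foldr_map]
    rfl

/-- The list, sorted by levels. -/
def levelSort {n : ℕ} {β : Type*} (L : List (Fin (n + 1) × β)) : List (Fin (n + 1) × β) :=
  (List.finRange (n + 1)).flatMap fun t => L.filter fun q => q.1 = t

theorem levelSort_perm {n : ℕ} {β : Type*} (L : List (Fin (n + 1) × β)) :
    (levelSort L).Perm L := by
  classical
  rw [List.perm_iff_count]
  intro q
  rw [levelSort, List.count_flatMap]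
  have h1 : ∀ t, (List.count q ∘ fun t => L.filter fun q => q.1 = t) t =
      if q.1 = t then L.count q else 0 := by
    intro t
    by_cases h : q.1 = t
    · rw [if_pos h, Function.comp_apply, List.count_filter (by simpa using h)]
    · rw [if_neg h, Function.comp_apply, List.count_eq_zero]
      simp [h]
  rw [funext h1, ← List.ofFn_eq_map, List.sum_ofFn, Finset.sum_ite_eq, if_pos (Finset.mem_univ _)]

theorem levelSort_pairwise {n : ℕ} {β : Type*} (L : List (Fin (n + 1) × β)) :
    (levelSort L).Pairwise fun q q' => q.1 ≤ q'.1 := by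
  rw [levelSort, List.pairwise_flatMap]
  constructor
  · intro t _
    refine List.Pairwise.imp_of_mem ?_ (List.pairwise_of_forall (R := fun _ _ => True) (by simp))
    intro x y hx hy _
    have h1 := (List.mem_filter.1 hx).2
    have h2 := (List.mem_filter.1 hy).2
    simp only [decide_eq_true_eq] at h1 h2
    rw [h1, h2]
  · refine (List.pairwise_lt_finRange (n + 1)).imp fun {t t'} ht x hx y hy => ?_
    have h1 := (List.mem_filter.1 hx).2
    have h2 := (List.mem_filter.1 hy).2
    simp only [decide_eq_true_eq] at h1 h2
    rw [h1, h2]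
    exact ht.le

variable {n : ℕ} {ρ : ∀ N : ℕ, PMF (Signature N)} {a : Fin (n + 1) → ℝ} {N : ℕ}

/-- Moments of products of power sums, in terms of operators. -/
theorem integral_prod_centeredProd (ha : Monotone a)
    (hg : HasSchurGen (ρ (levelSize a N (Fin.last n))))
    (hl : AnalyticAt ℂ (logGen (ρ (levelSize a N (Fin.last n)))) 1)
    (J : Fin (n + 1) → List (ℕ × ℝ)) {K : ℕ} (hK : ∑ t, ((J t).map Prod.fst).sum < K) :
    Integrable (fun ω => ∏ t, centeredProd (J t) (ω t)) (projMeasure ρ a N) ∧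
    ((∫ ω, ∏ t, centeredProd (J t) (ω t) ∂(projMeasure ρ a N) : ℝ) : ℂ) =
      MvPolynomial.constantCoeff (chainOps n (levelSize a N)
        (totalDeriv ℂ (Polynomial.C (logPoly (ρ (levelSize a N (Fin.last n))) K))) J 1) := by
  have hsum : ∀ (J : Fin (n + 1) → List (ℕ × ℝ)) {K : ℕ} (_ : ∑ t, ((J t).map Prod.fst).sum < K),
      HasSum (fun l => (((ρ (levelSize a N (Fin.last n)) l).toReal *
        chainAvg n (levelSize a N) (fun t => centeredProd (J t)) l : ℝ) : ℂ))
      (MvPolynomial.constantCoeff (chainOps n (levelSize a N)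
        (totalDeriv ℂ (Polynomial.C (logPoly (ρ (levelSize a N (Fin.last n))) K))) J 1)) := by
    intro J K hK
    have h := hasSum_mul_chainAvg (levelSize_mono ha N) J
      (fun i => le_order_pderiv_taylor_schurGen hg hl K i) hK
      (fun l => (ρ (levelSize a N (Fin.last n)) l).toReal) (hasSum_coeff_taylor_schurGen hg)
    rwa [constantCoeff_taylor, schurGen_one, one_mul] at h
  -- Doubling every list turns the product into its square, so the moment formula itself supplies
  -- the second moments needed for integrability.
  have h2 : Summable fun l => (ρ (levelSize a N (Fin.last n)) l).toReal *
      chainAvg n (levelSize a N) (fun t l => centeredProd (J t) l ^ 2) l := by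
    have h3 := (hsum (fun t => J t ++ J t) (lt_add_one _)).summable
    rw [Complex.summable_ofReal] at h3
    refine h3.congr fun l => ?_
    congr 2
    funext t l
    simp [centeredProd, pow_two]
  obtain ⟨h4, h5⟩ := integral_projMeasure_prod ρ ha N (fun t => centeredProd (J t)) h2
  exact ⟨h4, (Complex.hasSum_ofReal.2 h5).unique (hsum J hK)⟩

theorem prod_centeredProd_filter (L : List (Fin (n + 1) × ℕ)) (e : Fin (n + 1) × ℕ → ℝ)
    (ω : Config a N) :
    ∏ t, centeredProd ((L.filter fun q => q.1 = t).map fun q => (q.2, e q)) (ω t) =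
      (L.map fun q => powerSum q.2 (ω q.1) - e q).prod := by
  rw [← ((levelSort_perm L).map _).prod_eq, levelSort, List.map_flatMap, List.flatMap_def, List.prod_flatten, List.map_map,
    ← List.ofFn_eq_map, List.prod_ofFn]
  refine Finset.prod_congr rfl fun t _ => ?_
  rw [centeredProd, List.map_map]
  congr 1
  refine List.map_congr_left fun q hq => ?_
  have h := (List.mem_filter.1 hq).2
  simp only [decide_eq_true_eq] at h
  subst h
  rfl

/-- The composition over levels is one composition along the sorted list, the lowest level being
outermost and hence applied last. -/
theorem chainOps_filter (s : Fin (n + 1) → ℕ) (W : Polynomial (MvPolynomial ℕ ℂ))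
    (L : List (Fin (n + 1) × ℕ)) (e : Fin (n + 1) × ℕ → ℝ) (g : MvPolynomial ℕ ℂ) :
    chainOps n s W (fun t => (L.filter fun q => q.1 = t).map fun q => (q.2, e q)) g =
      (levelSort L).foldr (fun q g => powOp 1 (s q.1 : ℂ) W q.2 g - ((e q : ℝ) : ℂ) • g) g := by
  rw [chainOps_eq_foldr, levelSort, List.foldr_flatMap]
  congr 1
  funext t g
  rw [applyOps, List.foldr_map]
  refine List.foldr_ext _ _ _ fun q hq g => ?_
  have h := (List.mem_filter.1 hq).2
  simp only [decide_eq_true_eq] at h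
  subst h
  rfl

theorem sum_filter_levels (L : List (Fin (n + 1) × ℕ)) (e : Fin (n + 1) × ℕ → ℝ) :
    ∑ t, (((L.filter fun q => q.1 = t).map fun q => (q.2, e q)).map Prod.fst).sum =
      (L.map Prod.snd).sum := by
  rw [← ((levelSort_perm L).map _).sum_eq, levelSort, List.map_flatMap, List.flatMap_def, List.sum_flatten, List.map_map,
    ← List.ofFn_eq_map, List.sum_ofFn]
  refine Finset.sum_congr rfl fun t _ => ?_
  rw [List.map_map]
  rfl

/-- The mixed central moments of power sums, in terms of operators. -/
theorem integral_prod_powerSum_sub (ha : Monotone a)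
    (hg : HasSchurGen (ρ (levelSize a N (Fin.last n))))
    (hl : AnalyticAt ℂ (logGen (ρ (levelSize a N (Fin.last n)))) 1)
    (L : List (Fin (n + 1) × ℕ)) {K : ℕ} (hK : (L.map Prod.snd).sum < K) :
    Integrable (fun ω : Config a N => (L.map fun q => powerSum q.2 (ω q.1) -
      ∫ η, powerSum q.2 (η q.1) ∂(projMeasure ρ a N)).prod) (projMeasure ρ a N) ∧
    ((∫ ω, (L.map fun q => powerSum q.2 (ω q.1) -
      ∫ η, powerSum q.2 (η q.1) ∂(projMeasure ρ a N)).prod ∂(projMeasure ρ a N) : ℝ) : ℂ) =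
      MvPolynomial.constantCoeff ((levelSort L).foldr (fun q => centeredPow 1
        (levelSize a N q.1 : ℂ)
        (totalDeriv ℂ (Polynomial.C (logPoly (ρ (levelSize a N (Fin.last n))) K))) q.2) 1) := by
  set W := totalDeriv ℂ (Polynomial.C (logPoly (ρ (levelSize a N (Fin.last n))) K)) with hW
  have h1 : ∀ (L : List (Fin (n + 1) × ℕ)) (e : Fin (n + 1) × ℕ → ℝ), (L.map Prod.snd).sum < K →
      Integrable (fun ω : Config a N => (L.map fun q => powerSum q.2 (ω q.1) - e q).prod)
        (projMeasure ρ a N) ∧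
      ((∫ ω, (L.map fun q => powerSum q.2 (ω q.1) - e q).prod ∂(projMeasure ρ a N) : ℝ) : ℂ) =
      MvPolynomial.constantCoeff ((levelSort L).foldr (fun q g =>
        powOp 1 (levelSize a N q.1 : ℂ) W q.2 g - ((e q : ℝ) : ℂ) • g) 1) := by
    intro L e hL
    have h := integral_prod_centeredProd ha hg hl
      (fun t => (L.filter fun q => q.1 = t).map fun q => (q.2, e q)) (K := K)
      (by rwa [sum_filter_levels])
    rw [chainOps_filter] at h
    simpa only [prod_centeredProd_filter] using h
  obtain ⟨h2, h3⟩ := h1 L (fun q => ∫ η, powerSum q.2 (η q.1) ∂(projMeasure ρ a N)) hK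
  refine ⟨h2, h3.trans ?_⟩
  congr 1
  refine List.foldr_ext _ _ _ fun q hq g => ?_
  have hqL : q ∈ L := (levelSort_perm L).mem_iff.1 hq
  -- The formula for the single factor `q` without centering identifies the expectation with the
  -- constant term that `centeredPow` subtracts.
  have h4 := (h1 [q] (fun _ => 0) (lt_of_le_of_lt (by
    simpa using List.single_le_sum (l := L.map Prod.snd) (by simp) _ (List.mem_map_of_mem hqL)) hK)).2
  have h5 : levelSort [q] = [q] := List.perm_singleton.1 (levelSort_perm [q])
  rw [h5] at h4
  simp only [List.map_cons, List.map_nil, List.prod_cons, List.prod_nil, mul_one, sub_zero,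
    List.foldr_cons, List.foldr_nil, Complex.ofReal_zero, zero_smul] at h4
  rw [centeredPow, ← h4, MvPolynomial.smul_eq_C_mul]

end Moments

/-! ### Gaussian processes and Wick's formula -/

section Gaussian

open scoped InnerProductSpace

/-- A positive semidefinite kernel is the Gram matrix of finitely supported vectors. -/
theorem exists_finsupp_gram {ι : Type} [Countable ι] [Nonempty ι] {K : ι → ι → ℝ}
    (hsymm : ∀ i j, K i j = K j i)
    (hpos : ∀ x : ι →₀ ℝ, 0 ≤ x.sum fun i a => x.sum fun j b => a * b * K i j) :
    ∃ (I : Type) (v : ι → I →₀ ℝ), ∀ i j, (v i).sum (fun l a => a * v j l) = K i j := by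
  set k : Matrix ι ι (ℝ →L[ℝ] ℝ) := Matrix.of fun i j => K i j • ContinuousLinearMap.id ℝ ℝ with hk
  have hps : k.PosSemidef := by
    have h := (RKHS.posSemidef_tfae (K := k)).out 0 2
    refine h.2 ⟨?_, fun x => ?_⟩
    · refine Matrix.IsHermitian.ext fun i j => ?_
      have h1 : star (1 : ℝ →L[ℝ] ℝ) = 1 := star_one _
      rw [hk, Matrix.of_apply, Matrix.of_apply, hsymm i j, star_smul]
      exact congrArg _ h1
    · refine (hpos x).trans_eq ?_
      rw [RCLike.re_to_real]
      refine Finsupp.sum_congr fun i _ => Finsupp.sum_congr fun j _ => ?_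
      simp [hk, hsymm i j]
      ring
  have : Fact k.PosSemidef := ⟨hps⟩
  set H := RKHS.OfKernel k
  set f : ι → H := fun i => RKHS.kerFun H i 1 with hf
  have hff : ∀ i j, ⟪f i, f j⟫_ℝ = K i j := by
    intro i j
    rw [hf, ← RKHS.kernel_inner, RKHS.OfKernel.kernel_ofKernel]
    simp [hk, hsymm i j]
  -- The kernel functions of the reproducing kernel Hilbert space have the prescribed inner
  -- products. Enumerated as a sequence they can be orthonormalized by Gram–Schmidt; dependent
  -- vectors become zero and are discarded. Each kernel function is then a finite combination of the
  -- rest.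
  obtain ⟨g, hg⟩ := exists_surjective_nat ι
  set e := InnerProductSpace.gramSchmidtNormed ℝ (f ∘ g) with he
  have ho := InnerProductSpace.gramSchmidtNormed_orthonormal' (𝕜 := ℝ) (f ∘ g)
  set e' : {i | e i ≠ 0} → H := fun i => e i with he'
  have hspan : ∀ i, ∃ c : {i | e i ≠ 0} →₀ ℝ, Finsupp.linearCombination ℝ e' c = f i := by
    intro i
    suffices h : f i ∈ Submodule.span ℝ (Set.range e') from
      Finsupp.mem_span_range_iff_exists_finsupp.1 h
    have h1 : Set.range e ⊆ Submodule.span ℝ (Set.range e') := by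
      rintro _ ⟨m, rfl⟩
      by_cases h : e m = 0
      · rw [h]; exact Submodule.zero_mem _
      · exact Submodule.subset_span ⟨⟨m, h⟩, rfl⟩
    refine Submodule.span_le.2 h1 ?_
    rw [he, InnerProductSpace.span_gramSchmidtNormed_range, InnerProductSpace.span_gramSchmidt,
      Set.range_comp, hg.range_eq, Set.image_univ]
    exact Submodule.subset_span ⟨i, rfl⟩
  choose v hv using hspan
  refine ⟨_, v, fun i j => ?_⟩
  rw [← hff, ← hv, ← hv, ho.inner_finsupp_eq_sum_left]
  rfl

/-- The moments are the derivatives at `0` of `exp (t²/2)`, a solution of `y' = t y`;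
differentiating this equation `n` times gives the recursion. For `n = 0` the truncated index `n - 1`
does no harm because of the factor `n`. -/
theorem integral_pow_gaussianReal (n : ℕ) :
    ∫ x, x ^ (n + 1) ∂(gaussianReal 0 1) = n * ∫ x, x ^ (n - 1) ∂(gaussianReal 0 1) := by
  have h1 : ∀ n : ℕ, ∫ x, x ^ n ∂(gaussianReal 0 1) =
      iteratedDeriv n (fun t : ℝ => Real.exp (t ^ 2 / 2)) 0 := by
    intro n
    have h := iteratedDeriv_mgf_zero (X := fun x : ℝ => x) (μ := gaussianReal 0 1) (by simp) n
    rw [mgf_fun_id_gaussianReal] at h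
    simpa using h.symm
  have hs : ContDiff ℝ ⊤ (fun t : ℝ => Real.exp (t ^ 2 / 2)) := by fun_prop
  have hd : deriv (fun t : ℝ => Real.exp (t ^ 2 / 2)) = fun t => t * Real.exp (t ^ 2 / 2) := by
    funext t
    rw [_root_.deriv_exp (by fun_prop)]
    simp
    ring
  have h2 : ∀ n t, iteratedDeriv (n + 1) (fun t : ℝ => Real.exp (t ^ 2 / 2)) t =
      t * iteratedDeriv n (fun t : ℝ => Real.exp (t ^ 2 / 2)) t +
        n * iteratedDeriv (n - 1) (fun t : ℝ => Real.exp (t ^ 2 / 2)) t := by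
    intro n
    induction n with
    | zero => intro t; simp [iteratedDeriv_one, hd]
    | succ n ih =>
      intro t
      have hdn : ∀ m, Differentiable ℝ (iteratedDeriv m fun t : ℝ => Real.exp (t ^ 2 / 2)) :=
        fun m => hs.differentiable_iteratedDeriv m (WithTop.coe_lt_top _)
      rw [iteratedDeriv_succ, funext ih, deriv_fun_add (differentiableAt_fun_id.fun_mul (hdn n t))
        ((hdn (n - 1) t).const_mul _), deriv_fun_mul differentiableAt_fun_id (hdn n t),
        deriv_const_mul _ (hdn (n - 1) t), ← iteratedDeriv_succ, ← iteratedDeriv_succ, deriv_id'']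
      cases n with
      | zero => simp [iteratedDeriv_one, hd]; ring
      | succ n =>
        simp only [Nat.add_sub_cancel] at ih ⊢
        push_cast at ih ⊢
        linear_combination t * ih t
  rw [h1, h1, h2]
  simp

variable {I : Type}

/-- Independent standard Gaussian variables. -/
def gaussianSpace (I : Type) : Measure (I → ℝ) := Measure.infinitePi fun _ : I => gaussianReal 0 1

instance : IsProbabilityMeasure (gaussianSpace I) := by unfold gaussianSpace; infer_instance

theorem iIndepFun_eval_gaussianSpace :
    iIndepFun (fun (i : I) (ω : I → ℝ) => ω i) (gaussianSpace I) :=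
  iIndepFun_infinitePi (X := fun _ x => x) fun _ => measurable_id

theorem map_eval_gaussianSpace (i : I) :
    (gaussianSpace I).map (fun ω => ω i) = gaussianReal 0 1 :=
  Measure.infinitePi_map_eval (fun _ => gaussianReal 0 1) i

theorem isGaussianProcess_gaussianSpace :
    IsGaussianProcess (fun (i : I) (ω : I → ℝ) => ω i) (gaussianSpace I) := by
  refine ⟨fun J => ?_⟩
  refine iIndepFun.hasGaussianLaw (X := fun (i : J) (ω : I → ℝ) => ω i) (fun i => ⟨?_⟩)
    (iIndepFun_eval_gaussianSpace.precomp Subtype.val_injective)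
  rw [map_eval_gaussianSpace]
  infer_instance

theorem integrable_eval_pow_gaussianSpace (i : I) (m : ℕ) :
    Integrable (fun ω : I → ℝ => ω i ^ m) (gaussianSpace I) := by
  have h : Integrable (fun x : ℝ => x ^ m) (gaussianReal 0 1) :=
    integrable_pow_of_mem_interior_integrableExpSet (X := fun x : ℝ => x) (by simp) m
  rw [← map_eval_gaussianSpace i] at h
  exact (integrable_map_measure (measurable_id.pow_const m).aestronglyMeasurable
    (measurable_pi_apply i).aemeasurable).1 h

theorem integrable_pow_mul_pow {Ω : Type*} [MeasurableSpace Ω] {P : Measure Ω} {f g : Ω → ℝ}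
    (hf : ∀ m : ℕ, Integrable (fun ω => f ω ^ m) P) (hg : ∀ m : ℕ, Integrable (fun ω => g ω ^ m) P)
    (i j : ℕ) : Integrable (fun ω => f ω ^ i * g ω ^ j) P := by
  refine ((hf (i * 2)).add (hg (j * 2))).mono'
    ((hf i).aestronglyMeasurable.mul (hg j).aestronglyMeasurable) (Eventually.of_forall fun ω => ?_)
  simp only [Pi.add_apply, pow_mul]
  rw [norm_mul, Real.norm_eq_abs, Real.norm_eq_abs]
  nlinarith [sq_nonneg (|f ω ^ i| - |g ω ^ j|), sq_abs (f ω ^ i), sq_abs (g ω ^ j),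
    sq_nonneg (f ω ^ i), sq_nonneg (g ω ^ j)]

/-- Functions all of whose powers are integrable are closed under sums and products, so the
induction is run for all powers at once. -/
theorem integrable_eval_mvPolynomial (p : MvPolynomial I ℝ) :
    Integrable (fun ω => MvPolynomial.eval ω p) (gaussianSpace I) := by
  have h : ∀ m : ℕ, Integrable (fun ω => MvPolynomial.eval ω p ^ m) (gaussianSpace I) := by
    induction p using MvPolynomial.induction_on with
    | C c => intro m; simp
    | add p q hp hq =>
      intro m
      simp only [map_add, add_pow]
      exact integrable_finsetSum _ fun i _ => (integrable_pow_mul_pow hp hq _ _).mul_const _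
    | mul_X p i hp =>
      intro m
      simp only [map_mul, MvPolynomial.eval_X, mul_pow]
      exact integrable_pow_mul_pow hp (integrable_eval_pow_gaussianSpace i) _ _
  simpa using h 1

theorem integral_eval_monomial (α : I →₀ ℕ) :
    ∫ ω, MvPolynomial.eval ω (MvPolynomial.monomial α (1 : ℝ)) ∂(gaussianSpace I) =
      α.prod fun _ m => ∫ x, x ^ m ∂(gaussianReal 0 1) := by
  have h1 : ∀ ω : I → ℝ, MvPolynomial.eval ω (MvPolynomial.monomial α (1 : ℝ)) =
      ∏ i : α.support, ω i ^ α i := by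
    intro ω
    rw [MvPolynomial.eval_monomial, one_mul, Finsupp.prod, ← Finset.prod_coe_sort]
  simp only [h1]
  have h2 := (iIndepFun_eval_gaussianSpace (I := I)).precomp
    (g := fun i : α.support => (i : I)) Subtype.val_injective
  have h3 := iIndepFun.integral_fun_prod_comp (X := fun (i : α.support) (ω : I → ℝ) => ω i)
    (f := fun i x => x ^ α i) h2 (fun i => (measurable_pi_apply (i : I)).aemeasurable)
    (fun i => (measurable_id.pow_const _).aestronglyMeasurable)
  refine h3.trans ?_
  rw [Finsupp.prod, ← Finset.prod_coe_sort α.support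
    (fun i => ∫ x, x ^ α i ∂(gaussianReal 0 1))]
  refine Finset.prod_congr rfl fun i _ => ?_
  rw [← map_eval_gaussianSpace (i : I)]
  have hm : AEStronglyMeasurable (fun x : ℝ => x ^ α i)
      ((gaussianSpace I).map fun ω => ω (i : I)) := (measurable_id.pow_const _).aestronglyMeasurable
  exact (integral_map (measurable_pi_apply (i : I)).aemeasurable hm).symm

/-- Gaussian integration by parts. On monomials independence reduces it to the moment recursion in
one variable. -/
theorem integral_eval_X_mul (i : I) (p : MvPolynomial I ℝ) :
    ∫ ω, MvPolynomial.eval ω (MvPolynomial.X i * p) ∂(gaussianSpace I) =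
      ∫ ω, MvPolynomial.eval ω (MvPolynomial.pderiv i p) ∂(gaussianSpace I) := by
  classical
  induction p using MvPolynomial.induction_on' with
  | add p q hp hq =>
    simp only [mul_add, map_add]
    rw [integral_add (integrable_eval_mvPolynomial _) (integrable_eval_mvPolynomial _),
      integral_add (integrable_eval_mvPolynomial _) (integrable_eval_mvPolynomial _), hp, hq]
  | monomial α c =>
    have h1 : (MvPolynomial.X i * MvPolynomial.monomial α c : MvPolynomial I ℝ) =
        MvPolynomial.C c * MvPolynomial.monomial (α + Finsupp.single i 1) 1 := by
      rw [MvPolynomial.X, MvPolynomial.monomial_mul, MvPolynomial.C_mul_monomial, add_comm]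
      simp
    have h2 : (MvPolynomial.pderiv i (MvPolynomial.monomial α c) : MvPolynomial I ℝ) =
        MvPolynomial.C (c * α i) * MvPolynomial.monomial (α - Finsupp.single i 1) 1 := by
      rw [MvPolynomial.pderiv_monomial, MvPolynomial.C_mul_monomial, mul_one]
    rw [h1, h2]
    simp only [map_mul, MvPolynomial.eval_C, integral_const_mul]
    rw [integral_eval_monomial, integral_eval_monomial, mul_assoc]
    congr 1
    set T := insert i α.support with hT
    set w : ℕ → ℝ := fun m => ∫ x, x ^ m ∂(gaussianReal 0 1) with hw
    have hw0 : w 0 = 1 := by simp [hw]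
    rw [Finsupp.prod_of_support_subset (s := T) _ (fun j hj => by
        by_cases h : j = i
        · simp [hT, h]
        · rw [Finsupp.mem_support_iff, Finsupp.add_apply, Finsupp.single_eq_of_ne h] at hj
          simp [hT, h]
          simpa using hj) _ (fun _ _ => hw0),
      Finsupp.prod_of_support_subset (s := T) _ (fun j hj => by
        refine Finset.mem_insert_of_mem ?_
        rw [Finsupp.mem_support_iff, Finsupp.tsub_apply] at hj
        rw [Finsupp.mem_support_iff]
        omega) _ (fun _ _ => hw0),
      ← Finset.mul_prod_erase T (fun j => w ((α + Finsupp.single i 1 : I →₀ ℕ) j))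
        (Finset.mem_insert_self i _),
      ← Finset.mul_prod_erase T (fun j => w ((α - Finsupp.single i 1 : I →₀ ℕ) j))
        (Finset.mem_insert_self i _), ← mul_assoc]
    congr 1
    · simpa using integral_pow_gaussianReal (α i)
    · refine Finset.prod_congr rfl fun j hj => ?_
      have h : j ≠ i := Finset.ne_of_mem_erase hj
      simp [h]

/-- Wick's formula for linear forms in independent Gaussian variables. -/
theorem integral_prod_linear {ι : Type*} (v : ι → I →₀ ℝ) (L : List ι) :
    ∫ ω, (L.map fun q => (v q).sum fun i a => a * ω i).prod ∂(gaussianSpace I) =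
      wick (fun q q' => (v q).sum fun i a => a * v q' i) L := by
  set ℓ : ι → MvPolynomial I ℝ := fun q => (v q).sum fun i a => MvPolynomial.C a * MvPolynomial.X i
    with hℓ
  have hev : ∀ ω q, MvPolynomial.eval ω (ℓ q) = (v q).sum fun i a => a * ω i := by
    intro ω q
    simp [hℓ, Finsupp.sum]
  have hev' : ∀ (L : List ι) ω, (L.map fun q => (v q).sum fun i a => a * ω i).prod =
      MvPolynomial.eval ω (L.map ℓ).prod := by
    intro L ω
    rw [map_list_prod, List.map_map]
    congr 1
    exact List.map_congr_left fun q _ => (hev ω q).symm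
  have hd : ∀ i q, MvPolynomial.pderiv i (ℓ q) = MvPolynomial.C (v q i) := by
    intro i q
    classical
    change MvPolynomial.pderiv i (∑ l ∈ (v q).support, MvPolynomial.C (v q l) * MvPolynomial.X l) = _
    rw [map_sum]
    simp only [MvPolynomial.pderiv_C_mul, MvPolynomial.pderiv_X, Pi.single_apply]
    simp only [mul_ite, mul_one, mul_zero]
    rw [Finset.sum_ite_eq' ]
    split_ifs with h
    · rfl
    · rw [Finsupp.notMem_support_iff.1 h, map_zero]
  -- The derivative of a product of linear forms, written in the shape of the recursion for `wick`.
  have hdL : ∀ (i : I) (L : List ι), MvPolynomial.pderiv i (L.map ℓ).prod =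
      ∑ j : Fin L.length, MvPolynomial.C (v (L.get j) i) * ((L.eraseIdx j).map ℓ).prod := by
    intro i L
    induction L with
    | nil => simp
    | cons q L ih =>
      refine Eq.trans ?_ (Fin.sum_univ_succ (n := L.length) (fun j =>
        MvPolynomial.C (v ((q :: L).get j) i) * (((q :: L).eraseIdx j).map ℓ).prod)).symm
      rw [List.map_cons, List.prod_cons, Derivation.leibniz, ih, hd, smul_eq_mul, smul_eq_mul,
        add_comm, Finset.mul_sum]
      refine congrArg₂ (· + ·) (mul_comm _ _) (Finset.sum_congr rfl fun j _ => ?_)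
      simp only [List.get_eq_getElem, Fin.val_succ, List.getElem_cons_succ, List.eraseIdx_cons_succ,
        List.map_cons, List.prod_cons]
      ring
  induction hn : L.length using Nat.strong_induction_on generalizing L with
  | _ n ih =>
  cases L with
  | nil => simp [wick]
  | cons q L =>
    rw [wick]
    simp only [hev']
    have h1 : ∀ ω, MvPolynomial.eval ω (((q :: L).map ℓ).prod) = ∑ i ∈ (v q).support,
        v q i * MvPolynomial.eval ω (MvPolynomial.X i * (L.map ℓ).prod) := by
      intro ω
      rw [List.map_cons, List.prod_cons, map_mul, hev, Finsupp.sum, Finset.sum_mul]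
      refine Finset.sum_congr rfl fun i _ => ?_
      rw [map_mul, MvPolynomial.eval_X, mul_assoc]
    simp only [h1]
    rw [integral_finsetSum _ fun i _ => (integrable_eval_mvPolynomial _).const_mul _]
    simp only [integral_const_mul, integral_eval_X_mul]
    simp only [hdL, map_sum, map_mul, MvPolynomial.eval_C]
    have h2 : ∀ i ∈ (v q).support, v q i * ∫ ω, ∑ j : Fin L.length, v (L.get j) i *
        MvPolynomial.eval ω ((L.eraseIdx j).map ℓ).prod ∂(gaussianSpace I) =
        ∑ j : Fin L.length, v q i * v (L.get j) i *
          wick (fun q q' => (v q).sum fun i a => a * v q' i) (L.eraseIdx j) := by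
      intro i _
      rw [integral_finsetSum _ fun j _ => (integrable_eval_mvPolynomial _).const_mul _,
        Finset.mul_sum]
      refine Finset.sum_congr rfl fun j _ => ?_
      rw [integral_const_mul, ← ih _ ?_ (L.eraseIdx j) rfl]
      · simp only [hev', mul_assoc]
      · rw [← hn, List.length_eraseIdx_of_lt j.2, List.length_cons]
        omega
    rw [Finset.sum_congr rfl h2, Finset.sum_comm]
    refine Finset.sum_congr rfl fun j _ => ?_
    rw [Finsupp.sum, Finset.sum_mul]

theorem integrable_prod_linear {ι : Type*} (v : ι → I →₀ ℝ) (L : List ι) :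
    Integrable (fun ω => (L.map fun q => (v q).sum fun i a => a * ω i).prod) (gaussianSpace I) := by
  refine (integrable_eval_mvPolynomial (L.map fun q => (v q).sum fun i a =>
    MvPolynomial.C a * MvPolynomial.X i).prod).congr (Eventually.of_forall fun ω => ?_)
  simp only [map_list_prod, List.map_map]
  congr 1
  refine List.map_congr_left fun q _ => ?_
  simp [Finsupp.sum]

/-- There is a centered Gaussian process with a given covariance, and its moments are given by
Wick's formula. -/
theorem exists_isGaussianProcess {ι : Type} [Countable ι] [Nonempty ι] {K : ι → ι → ℝ}
    (hsymm : ∀ i j, K i j = K j i)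
    (hpos : ∀ x : ι →₀ ℝ, 0 ≤ x.sum fun i a => x.sum fun j b => a * b * K i j) :
    ∃ (Ω : Type) (_ : MeasurableSpace Ω) (P : Measure Ω) (_ : IsProbabilityMeasure P)
      (ξ : ι → Ω → ℝ), IsGaussianProcess ξ P ∧ ∀ L : List ι,
        Integrable (fun ω => (L.map fun q => ξ q ω).prod) P ∧
        ∫ ω, (L.map fun q => ξ q ω).prod ∂P = wick K L := by
  obtain ⟨I, v, hv⟩ := exists_finsupp_gram hsymm hpos
  refine ⟨I → ℝ, inferInstance, gaussianSpace I, inferInstance,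
    fun q ω => (v q).sum fun i a => a * ω i, ?_, fun L => ⟨integrable_prod_linear v L, ?_⟩⟩
  · refine isGaussianProcess_gaussianSpace.of_isGaussianProcess fun q => ?_
    refine ⟨(v q).support, ∑ i : (v q).support, v q i •
      ContinuousLinearMap.proj (R := ℝ) (φ := fun _ : (v q).support => ℝ) i, fun ω => ?_⟩
    rw [Finsupp.sum, ← Finset.sum_coe_sort]
    simp
  · rw [integral_prod_linear]
    congr 1
    funext q q'
    exact hv q q'

end Gaussian

/-! ### Formal properties of sums over pairings. -/

section WickLemmas

variable {R ι : Type*} [CommRing R]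

theorem wick_singleton (K : ι → ι → R) (q : ι) : wick K [q] = 0 := by
  rw [wick]; rfl

theorem wick_pair (K : ι → ι → R) (q q' : ι) : wick K [q, q'] = K q q' := by
  rw [wick]
  refine (Fin.sum_univ_one (fun i : Fin 1 => K q ([q'].get i) * wick K ([q'].eraseIdx i))).trans ?_
  simp [wick]

/-- Only values of the kernel in the order of the list occur. This matters because the limiting
contraction is identified with a covariance for pairs ordered by level only. -/
theorem wick_congr {K K' : ι → ι → R} : ∀ {L : List ι},
    L.Pairwise (fun q q' => K q q' = K' q q') → wick K L = wick K' L := by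
  intro L
  induction hn : L.length using Nat.strong_induction_on generalizing L with
  | _ n ih =>
  intro hL
  cases L with
  | nil => simp [wick]
  | cons q L =>
    rw [wick, wick]
    rw [List.pairwise_cons] at hL
    refine Finset.sum_congr rfl fun i _ => ?_
    rw [hL.1 _ (List.get_mem L i), ih _ ?_ rfl (hL.2.sublist (List.eraseIdx_sublist L i))]
    rw [← hn, List.length_eraseIdx_of_lt i.2, List.length_cons]
    omega

theorem map_wick {R' : Type*} [CommRing R'] (π : R →+* R') (K : ι → ι → R) : ∀ L : List ι,
    π (wick K L) = wick (fun q q' => π (K q q')) L := by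
  intro L
  induction hn : L.length using Nat.strong_induction_on generalizing L with
  | _ n ih =>
  cases L with
  | nil => simp [wick]
  | cons q L =>
    rw [wick, wick, map_sum]
    refine Finset.sum_congr rfl fun i _ => ?_
    rw [map_mul, ih _ ?_ _ rfl]
    rw [← hn, List.length_eraseIdx_of_lt i.2, List.length_cons]
    omega

theorem wick_map {ι' : Type*} (g : ι' → ι) (K : ι → ι → R) : ∀ L : List ι',
    wick K (L.map g) = wick (fun q q' => K (g q) (g q')) L := by
  intro L
  induction hn : L.length using Nat.strong_induction_on generalizing L with
  | _ n ih =>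
  cases L with
  | nil => simp [wick]
  | cons q L =>
    rw [List.map_cons, wick, wick]
    refine Fintype.sum_equiv (finCongr (List.length_map g)) _ _ fun i => ?_
    rw [← ih _ ?_ (L.eraseIdx (finCongr (List.length_map g) i)) rfl]
    · simp [List.eraseIdx_map]
    · rw [← hn, List.length_eraseIdx_of_lt (finCongr (List.length_map g) i).2, List.length_cons]
      omega

end WickLemmas

/-! ### Limits of the Taylor coefficients of the logarithm -/

section Coefficients

theorem foldr_replicate {α β : Type*} (f : α → β → β) (b : β) (x : α) (k : ℕ) :
    (List.replicate k x).foldr f b = (f x)^[k] b := by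
  induction k with
  | zero => rfl
  | succ k ih => rw [List.replicate_succ, List.foldr_cons, ih, Function.iterate_succ_apply']

theorem symmCoeff_one {M : ℕ} (f : (Fin M → ℂ) → ℂ) (k : Fin 1 → ℕ) :
    symmCoeff f 1 k = ((k 0).factorial : ℂ)⁻¹ * (partialDeriv 0)^[k 0] f 1 := by
  simp [symmCoeff, List.finRange_succ, foldr_replicate]

theorem symmCoeff_two {M : ℕ} (f : (Fin M → ℂ) → ℂ) (k : Fin 2 → ℕ) :
    symmCoeff f 2 k = (((k 0).factorial : ℂ) * ((k 1).factorial : ℂ))⁻¹ *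
      (partialDeriv 0)^[k 0] ((partialDeriv 1)^[k 1] f) 1 := by
  simp [symmCoeff, List.finRange_succ, foldr_replicate, Fin.prod_univ_two]

theorem three_le_card_toFinset {r : ℕ} (hr : 3 ≤ r) {k : Fin r → ℕ} (hk : ∀ j, 1 ≤ k j) :
    3 ≤ ((List.finRange r).flatMap fun j => List.replicate (k j) (j : ℕ)).toFinset.card := by
  have h : Finset.range r ⊆
      ((List.finRange r).flatMap fun j => List.replicate (k j) (j : ℕ)).toFinset := by
    intro i hi
    have hi' := Finset.mem_range.1 hi
    rw [List.mem_toFinset, List.mem_flatMap]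
    exact ⟨⟨i, hi'⟩, List.mem_finRange _,
      List.mem_replicate.2 ⟨Nat.one_le_iff_ne_zero.1 (hk _), rfl⟩⟩
  have h2 := Finset.card_le_card h
  rw [Finset.card_range] at h2
  exact hr.trans h2

variable {ρ : ∀ N : ℕ, PMF (Signature N)} {c : ℕ → ℝ} {d : ℕ → ℕ → ℝ}

/-- Partial derivatives commute, and the limit does not depend on the choice of the two indices. -/
theorem IsAppropriate.symm (happ : IsAppropriate (fun N => schurGen (ρ N)) c d)
    {k l : ℕ} (hk : 1 ≤ k) (hl : 1 ≤ l) : d k l = d l k := by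
  have h1 := happ.two_indices 0 1 k l (by simp) hk hl
  have h2 := happ.two_indices 1 0 l k (by simp) hl hk
  refine Complex.ofReal_injective (tendsto_nhds_unique h1 (h2.congr' ?_))
  filter_upwards [eventually_ge_atTop 1] with N hN
  have h3 := (foldr_perm (happ.log_analytic N hN)
    (List.perm_append_comm (l₁ := List.replicate l 1) (l₂ := List.replicate k 0))).eq_of_nhds
  simpa [List.foldr_append, foldr_replicate] using h3

theorem IsAppropriate.tendsto_symmCoeff_one
    (happ : IsAppropriate (fun N => schurGen (ρ N)) c d) {k : Fin 1 → ℕ} (hk : 1 ≤ k 0) :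
    Tendsto (fun N : ℕ => (N : ℂ)⁻¹ * symmCoeff (logGen (ρ N)) 1 k) atTop
      (𝓝 (((k 0).factorial : ℂ)⁻¹ * (c (k 0) : ℂ))) := by
  refine ((happ.one_index 0 (k 0) hk).const_mul (((k 0).factorial : ℂ)⁻¹)).congr fun N => ?_
  rw [symmCoeff_one, div_eq_mul_inv]
  change _ * ((partialDeriv 0)^[k 0] (logGen (ρ N)) 1 * _) = _
  ring

theorem IsAppropriate.tendsto_symmCoeff_two
    (happ : IsAppropriate (fun N => schurGen (ρ N)) c d) {k : Fin 2 → ℕ} (hk : ∀ j, 1 ≤ k j) :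
    Tendsto (fun N : ℕ => symmCoeff (logGen (ρ N)) 2 k) atTop
      (𝓝 ((((k 0).factorial : ℂ) * ((k 1).factorial : ℂ))⁻¹ * (d (k 0) (k 1) : ℂ))) := by
  refine ((happ.two_indices 0 1 (k 0) (k 1) (by simp) (hk 0) (hk 1)).const_mul
    ((((k 0).factorial : ℂ) * ((k 1).factorial : ℂ))⁻¹)).congr fun N => ?_
  rw [symmCoeff_two]
  rfl

theorem IsAppropriate.tendsto_symmCoeff_many
    (happ : IsAppropriate (fun N => schurGen (ρ N)) c d) {r : ℕ} (hr : 3 ≤ r) {k : Fin r → ℕ}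
    (hk : ∀ j, 1 ≤ k j) :
    Tendsto (fun N : ℕ => symmCoeff (logGen (ρ N)) r k) atTop (𝓝 0) := by
  have h := (happ.many_indices _ (three_le_card_toFinset hr hk)).const_mul
    (∏ j, ((k j).factorial : ℂ))⁻¹
  rw [mul_zero] at h
  exact h

end Coefficients

/-! ### Polynomials in power sums of low degree -/

section LowDegree

variable {C : Type*} [CommRing C]

theorem monoSymm_one (k : Fin 1 → ℕ) : monoSymm C 1 k = MvPolynomial.X (k 0 - 1) := by
  simp [monoSymm]

/-- The correction is linear in the power sums, so it does not contribute to second derivatives. -/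
theorem monoSymm_two (k : Fin 2 → ℕ) : monoSymm C 2 k =
    MvPolynomial.X (k 0 - 1) * MvPolynomial.X (k 1 - 1) - MvPolynomial.X (k 1 + k 0 - 1) := by
  rw [monoSymm, monoSymm_one]
  simp [monoSymm_one]

/-- The derivative of a linear combination of power sums. -/
def linSymbol (K : ℕ) (u : ℕ → C) : Polynomial C :=
  ∑ k ∈ Finset.Icc 1 K, Polynomial.C ((k : C) * u k) * Polynomial.X ^ (k - 1)

theorem linSymbol_map {C' : Type*} [CommRing C'] (π : C →+* C') (K : ℕ) (u : ℕ → C) :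
    (linSymbol K u).map π = linSymbol K fun k => π (u k) := by
  simp [linSymbol, Polynomial.map_sum]

theorem coeff_linSymbol (K : ℕ) (u : ℕ → C) {i : ℕ} (hi : i < K) :
    (linSymbol K u).coeff i = ((i : C) + 1) * u (i + 1) := by
  simp only [linSymbol, Polynomial.finsetSum_coeff, Polynomial.coeff_C_mul_X_pow]
  rw [Finset.sum_eq_single (i + 1)]
  · simp
  · intro k hk hne
    have := Finset.mem_Icc.1 hk
    rw [if_neg (by omega)]
  · intro h
    exact absurd (Finset.mem_Icc.2 ⟨by omega, hi⟩) h

variable [Algebra ℂ C]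

theorem psumRep_congr {K : ℕ} {φ ψ : ∀ r, (Fin r → ℕ) → C}
    (h : ∀ r k, (∀ j, 1 ≤ k j) → φ r k = ψ r k) : psumRep K φ = psumRep K ψ := by
  refine Finset.sum_congr rfl fun r _ => ?_
  congr 1
  refine Finset.sum_congr rfl fun k hk => ?_
  rw [h r k fun j => (Finset.mem_Icc.1 (Fintype.mem_piFinset.1 hk j)).1]

theorem psumRep_add (K : ℕ) (φ ψ : ∀ r, (Fin r → ℕ) → C) :
    psumRep K (fun r k => φ r k + ψ r k) = psumRep K φ + psumRep K ψ := by
  simp only [psumRep, map_add, add_mul, Finset.sum_add_distrib, smul_add]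

theorem psumRep_eq_of_forall_ne {K r : ℕ} (hr : r ≤ K) {φ : ∀ r, (Fin r → ℕ) → C}
    (h : ∀ r', r' ≠ r → ∀ k, φ r' k = 0) : psumRep K φ = ((r.factorial : ℂ)⁻¹) •
      ∑ k ∈ Fintype.piFinset fun _ : Fin r => Finset.Icc 1 K,
        MvPolynomial.C (φ r k) * monoSymm C r k := by
  rw [psumRep, Finset.sum_eq_single r]
  · intro r' _ hr'
    simp [h r' hr']
  · intro h'
    exact absurd (Finset.mem_range.2 (Nat.lt_succ_of_le hr)) h'

/-- The part of the logarithm with a single index is linear in the power sums; its derivative is a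
polynomial in `z` with scalar coefficients, the `f` of the first order expansion. -/
theorem totalDeriv_psumRep_linear {K : ℕ} (hK : 1 ≤ K) {φ : ∀ r, (Fin r → ℕ) → C}
    (h : ∀ r, r ≠ 1 → ∀ k, φ r k = 0) : totalDeriv C (Polynomial.C (psumRep K φ)) =
      (linSymbol K fun k => φ 1 fun _ => k).map MvPolynomial.C := by
  have h1 : psumRep K φ = ∑ k ∈ Finset.Icc 1 K,
      MvPolynomial.C (φ 1 fun _ => k) * MvPolynomial.X (k - 1) := by
    rw [psumRep_eq_of_forall_ne hK h, Nat.factorial_one, Nat.cast_one, inv_one, one_smul]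
    refine Finset.sum_bij' (fun k _ => k 0) (fun k _ _ => k) ?_ ?_ ?_ ?_ ?_
    · intro k hk; exact Fintype.mem_piFinset.1 hk 0
    · intro k hk; exact Fintype.mem_piFinset.2 fun _ => hk
    · intro k _; funext j; rw [Subsingleton.elim j 0]
    · intro k _; rfl
    · intro k _
      rw [monoSymm_one, show (fun _ => k 0) = k from funext fun j => by rw [Subsingleton.elim j 0]]
  rw [h1, map_sum, map_sum, linSymbol, Polynomial.map_sum]
  refine Finset.sum_congr rfl fun k hk => ?_
  obtain ⟨k, rfl⟩ := Nat.exists_eq_add_of_le' (Finset.mem_Icc.1 hk).1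
  rw [map_mul, totalDeriv_C_C_mul, totalDeriv_C_X, Nat.add_sub_cancel]
  simp only [Polynomial.map_mul, Polynomial.map_C, Polynomial.map_pow, Polynomial.map_X, map_mul,
    map_add, map_natCast, map_one, Nat.cast_add, Nat.cast_one, Polynomial.map_add,
    Polynomial.map_natCast, Polynomial.map_one]
  ring

/-- The second derivatives of a combination of products of two power sums. -/
theorem pderiv_pderiv_psumRep_quadratic {K : ℕ} (hK : 2 ≤ K) {φ : ∀ r, (Fin r → ℕ) → C}
    (h : ∀ r, r ≠ 2 → ∀ k, φ r k = 0) : ∃ s : ℕ → ℕ → C,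
      (∀ i j, MvPolynomial.pderiv i (MvPolynomial.pderiv j (psumRep K φ)) =
        MvPolynomial.C (s i j)) ∧
      ∀ i j, i < K → j < K → (2 : ℂ) • s i j = φ 2 ![i + 1, j + 1] + φ 2 ![j + 1, i + 1] := by
  classical
  have h0 : psumRep K φ = MvPolynomial.C (algebraMap ℂ C 2⁻¹) *
      ∑ k ∈ Fintype.piFinset fun _ : Fin 2 => Finset.Icc 1 K,
        MvPolynomial.C (φ 2 k) * monoSymm C 2 k := by
    rw [psumRep_eq_of_forall_ne hK h, Algebra.smul_def]
    rfl
  have h1 : ∀ i j (k : Fin 2 → ℕ), MvPolynomial.pderiv i (MvPolynomial.pderiv j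
      (monoSymm C 2 k)) = MvPolynomial.C ((if k 0 - 1 = i ∧ k 1 - 1 = j then 1 else 0) +
        (if k 0 - 1 = j ∧ k 1 - 1 = i then 1 else 0)) := by
    intro i j k
    have hX : ∀ i j : ℕ, MvPolynomial.pderiv i (MvPolynomial.X j : MvPolynomial ℕ C) =
        MvPolynomial.C (if j = i then 1 else 0) := by
      intro i j
      rw [MvPolynomial.pderiv_X, Pi.single_apply]
      split_ifs <;> simp_all
    rw [monoSymm_two, map_sub, hX, Derivation.leibniz, hX, hX, map_sub, map_add, smul_eq_mul,
      smul_eq_mul, mul_comm (MvPolynomial.X (k 0 - 1)), mul_comm (MvPolynomial.X (k 1 - 1)),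
      MvPolynomial.pderiv_C_mul, MvPolynomial.pderiv_C_mul, MvPolynomial.pderiv_C, hX, hX, sub_zero,
      ← map_mul, ← map_mul, ← map_add]
    congr 1
    split_ifs <;> simp_all
  refine ⟨fun i j => algebraMap ℂ C 2⁻¹ * ∑ k ∈ Fintype.piFinset fun _ : Fin 2 => Finset.Icc 1 K,
    φ 2 k * ((if k 0 - 1 = i ∧ k 1 - 1 = j then 1 else 0) +
      (if k 0 - 1 = j ∧ k 1 - 1 = i then 1 else 0)), fun i j => ?_, fun i j hi hj => ?_⟩
  · rw [h0, MvPolynomial.pderiv_C_mul, MvPolynomial.pderiv_C_mul, map_sum, map_sum]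
    simp only [MvPolynomial.pderiv_C_mul, h1, map_mul, map_sum]
  · have h2 : ∀ i j, i < K → j < K → ∑ k ∈ Fintype.piFinset fun _ : Fin 2 => Finset.Icc 1 K,
        φ 2 k * (if k 0 - 1 = i ∧ k 1 - 1 = j then 1 else 0) = φ 2 ![i + 1, j + 1] := by
      intro i j hi hj
      rw [Finset.sum_eq_single ![i + 1, j + 1]]
      · simp
      · intro k hk hne
        rw [if_neg, mul_zero]
        rintro ⟨rfl, rfl⟩
        refine hne (funext fun l => ?_)
        have h3 := fun l => (Finset.mem_Icc.1 (Fintype.mem_piFinset.1 hk l)).1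
        fin_cases l
        · simpa using (Nat.sub_add_cancel (h3 0)).symm
        · simpa using (Nat.sub_add_cancel (h3 1)).symm
      · intro h'
        refine absurd (Fintype.mem_piFinset.2 fun l => ?_) h'
        rw [Finset.mem_Icc]
        fin_cases l
        · simp; omega
        · simp; omega
    rw [Algebra.smul_def, ← mul_assoc, ← map_mul, mul_inv_cancel₀ two_ne_zero, map_one, one_mul]
    simp only [mul_add, Finset.sum_add_distrib]
    rw [h2 i j hi hj]
    congr 1
    rw [← h2 j i hj hi]

end LowDegree

/-! ### Asymptotics of the moments -/

section Asymptotics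

open scoped Classical in
/-- The sequence as an element of the algebra of convergent sequences, if it converges. -/
def toSeq (u : ℕ → ℂ) : convSeq := if h : ∃ l, Tendsto u atTop (𝓝 l) then ⟨u, h⟩ else 0

theorem seqEval_toSeq {u : ℕ → ℂ} {l : ℂ} (h : Tendsto u atTop (𝓝 l)) (N : ℕ) :
    seqEval N (toSeq u) = u N := by
  rw [toSeq, dif_pos ⟨l, h⟩]; rfl

theorem seqLim_toSeq {u : ℕ → ℂ} {l : ℂ} (h : Tendsto u atTop (𝓝 l)) : seqLim (toSeq u) = l := by
  rw [toSeq, dif_pos ⟨l, h⟩]; exact seqLim_mkSeq h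

/-- The limit of the symbol of the operator of a power sum of order `k`. -/
def limSymbol (c : ℕ → ℝ) (μ : ℝ) (k : ℕ) : PowerSeries ℂ :=
  ((1 + PowerSeries.X) * (PowerSeries.C (μ : ℂ) +
    PowerSeries.X * PowerSeries.mk fun i => (c (i + 1) : ℂ) / (i.factorial : ℂ))) ^ k

/-- In the symbol `f` occurs with a factor `z`, so agreement of `f` with the limiting series below
degree `K` determines the coefficients up to degree `K` inclusive. -/
theorem coeff_symbolPoly_eq_coeff_limSymbol {c : ℕ → ℝ} {f : Polynomial ℂ} {K : ℕ}
    (hf : ∀ i < K, f.coeff i = (c (i + 1) : ℂ) / (i.factorial : ℂ)) (μ : ℝ) (k : ℕ) {m : ℕ}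
    (hm : m ≤ K) : (symbolPoly (μ : ℂ) f k).coeff m = PowerSeries.coeff m (limSymbol c μ k) := by
  have h1 : (PowerSeries.X : PowerSeries ℂ) ^ (K + 1) ∣
      (symbolPoly (μ : ℂ) f k : PowerSeries ℂ) - limSymbol c μ k := by
    rw [symbolPoly, limSymbol]
    push_cast
    refine dvd_trans ?_ (sub_dvd_pow_sub_pow _ _ k)
    have h2 : (PowerSeries.X : PowerSeries ℂ) ^ K ∣ (f : PowerSeries ℂ) -
        PowerSeries.mk fun i => (c (i + 1) : ℂ) / (i.factorial : ℂ) := by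
      refine PowerSeries.X_pow_dvd_iff.2 fun i hi => ?_
      rw [map_sub, Polynomial.coeff_coe, hf i hi, PowerSeries.coeff_mk, sub_self]
    obtain ⟨g, hg⟩ := h2
    refine ⟨(1 + PowerSeries.X) * g, ?_⟩
    linear_combination (1 + PowerSeries.X) * PowerSeries.X * hg
  have h2 := PowerSeries.X_pow_dvd_iff.1 h1 m (Nat.lt_succ_of_le hm)
  rw [map_sub, Polynomial.coeff_coe] at h2
  exact sub_eq_zero.1 h2

/-- The limiting covariance. -/
def limCov (c : ℕ → ℝ) (d : ℕ → ℕ → ℝ) (μ₁ μ₂ : ℝ) (k₁ k₂ : ℕ) : ℂ :=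
  ∑ j ∈ Finset.range k₁, ((j : ℂ) + 1) * PowerSeries.coeff (k₁ - 1 - j) (limSymbol c μ₁ k₁) *
    (PowerSeries.coeff (j + 1 + k₂) (limSymbol c μ₂ k₂) +
      ∑ i ∈ Finset.range k₂, ((i : ℂ) + 1) *
        PowerSeries.coeff (k₂ - 1 - i) (limSymbol c μ₂ k₂) *
        ((((j + 1).factorial : ℂ) * ((i + 1).factorial : ℂ))⁻¹ * (d (j + 1) (i + 1) : ℂ)))

variable (ρ : ∀ N : ℕ, PMF (Signature N))

/-- The coefficients of the part of the logarithm that is linear in the power sums. -/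
def linRep (r : ℕ) (k : Fin r → ℕ) : convSeq :=
  if r = 1 then toSeq fun N => (N : ℂ)⁻¹ * symmCoeff (logGen (ρ N)) r k else 0

/-- The coefficients of the part of the logarithm that is nonlinear in the power sums. -/
def nonlinRep (r : ℕ) (k : Fin r → ℕ) : convSeq :=
  if 2 ≤ r then toSeq fun N => symmCoeff (logGen (ρ N)) r k else 0

/-- The limits of the coefficients of the nonlinear part of the logarithm. -/
def quadLim (d : ℕ → ℕ → ℝ) : ∀ r : ℕ, (Fin r → ℕ) → ℂ
  | 2, k => (((k 0).factorial : ℂ) * ((k 1).factorial : ℂ))⁻¹ * (d (k 0) (k 1) : ℂ)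
  | _, _ => 0

theorem quadLim_of_ne (d : ℕ → ℕ → ℝ) {r : ℕ} (hr : r ≠ 2) (k : Fin r → ℕ) : quadLim d r k = 0 := by
  match r, hr, k with
  | 0, _, _ => rfl
  | 1, _, _ => rfl
  | (r + 3), _, _ => rfl

variable {ρ} {c : ℕ → ℝ} {d : ℕ → ℕ → ℝ}

theorem IsAppropriate.tendsto_symmCoeff (happ : IsAppropriate (fun N => schurGen (ρ N)) c d)
    {r : ℕ} (hr : 2 ≤ r) {k : Fin r → ℕ} (hk : ∀ j, 1 ≤ k j) :
    Tendsto (fun N : ℕ => symmCoeff (logGen (ρ N)) r k) atTop (𝓝 (quadLim d r k)) := by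
  rcases hr.eq_or_lt with rfl | hr
  · exact happ.tendsto_symmCoeff_two hk
  · rw [quadLim_of_ne d hr.ne']
    exact happ.tendsto_symmCoeff_many hr hk

theorem seqEval_linRep (happ : IsAppropriate (fun N => schurGen (ρ N)) c d) (N : ℕ)
    {k : Fin 1 → ℕ} (hk : 1 ≤ k 0) :
    seqEval N (linRep ρ 1 k) = (N : ℂ)⁻¹ * symmCoeff (logGen (ρ N)) 1 k := by
  rw [linRep, if_pos rfl, seqEval_toSeq (happ.tendsto_symmCoeff_one hk)]

theorem seqLim_linRep (happ : IsAppropriate (fun N => schurGen (ρ N)) c d)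
    {k : Fin 1 → ℕ} (hk : 1 ≤ k 0) :
    seqLim (linRep ρ 1 k) = ((k 0).factorial : ℂ)⁻¹ * (c (k 0) : ℂ) := by
  rw [linRep, if_pos rfl, seqLim_toSeq (happ.tendsto_symmCoeff_one hk)]

theorem seqEval_nonlinRep (happ : IsAppropriate (fun N => schurGen (ρ N)) c d) (N : ℕ)
    {r : ℕ} (hr : 2 ≤ r) {k : Fin r → ℕ} (hk : ∀ j, 1 ≤ k j) :
    seqEval N (nonlinRep ρ r k) = symmCoeff (logGen (ρ N)) r k := by
  rw [nonlinRep, if_pos hr, seqEval_toSeq (happ.tendsto_symmCoeff hr hk)]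

theorem seqLim_nonlinRep (happ : IsAppropriate (fun N => schurGen (ρ N)) c d)
    {r : ℕ} {k : Fin r → ℕ} (hk : ∀ j, 1 ≤ k j) :
    seqLim (nonlinRep ρ r k) = quadLim d r k := by
  by_cases hr : 2 ≤ r
  · rw [nonlinRep, if_pos hr, seqLim_toSeq (happ.tendsto_symmCoeff hr hk)]
  · rw [nonlinRep, if_neg hr, map_zero, quadLim_of_ne d (by omega)]

theorem tendsto_natCast_inv : Tendsto (fun N : ℕ => ((N : ℂ))⁻¹) atTop (𝓝 0) :=
  tendsto_inv_atTop_nhds_zero_nat (𝕜 := ℂ)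

/-- The terms with one index grow like `N` and those with several stay bounded. Dividing the
logarithm by `N` therefore leaves a factor `1/N` in front of the nonlinear part. The term without
indices is `log S (1) = 0`. -/
theorem map_seqEval_logRep (happ : IsAppropriate (fun N => schurGen (ρ N)) c d) (N K : ℕ) :
    MvPolynomial.map (seqEval N : convSeq →+* ℂ) (psumRep K (linRep ρ) +
      MvPolynomial.C (toSeq fun N => (N : ℂ)⁻¹) * psumRep K (nonlinRep ρ)) =
      MvPolynomial.C ((N : ℂ)⁻¹) * logPoly (ρ N) K := by
  rw [map_add, map_mul, psumRep_map, psumRep_map, MvPolynomial.map_C, logPoly]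
  rw [show (seqEval N : convSeq →+* ℂ) (toSeq fun N => (N : ℂ)⁻¹) = (N : ℂ)⁻¹ from
    seqEval_toSeq tendsto_natCast_inv N, ← psumRep_mul, ← psumRep_mul, ← psumRep_add]
  refine psumRep_congr fun r k hk => ?_
  match r, k, hk with
  | 0, k, _ =>
    rw [linRep, nonlinRep, if_neg (by simp), if_neg (by simp)]
    simp [symmCoeff, logGen_one]
  | 1, k, hk =>
    rw [seqEval_linRep happ N (hk 0), nonlinRep, if_neg (by simp)]
    simp
  | (r + 2), k, hk =>
    rw [seqEval_nonlinRep happ N (by omega) hk, linRep, if_neg (by omega)]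
    simp

theorem tendsto_levelSize_div {n : ℕ} {a : Fin (n + 1) → ℝ} (ha : ∀ t, 0 < a t) (t : Fin (n + 1)) :
    Tendsto (fun N : ℕ => (N : ℂ)⁻¹ * (levelSize a N t : ℂ)) atTop (𝓝 (a t : ℂ)) := by
  have h := (tendsto_nat_floor_mul_div_atTop (ha t).le).comp (tendsto_natCast_atTop_atTop (R := ℝ))
  refine ((Complex.continuous_ofReal.tendsto _).comp h).congr fun N => ?_
  simp only [Function.comp, levelSize]
  push_cast
  rw [div_eq_inv_mul]

/-- The limiting moments of the centered power sums. -/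
theorem tendsto_constantCoeff_foldr_centeredPow
    (happ : IsAppropriate (fun N => schurGen (ρ N)) c d) {n : ℕ} {a : Fin (n + 1) → ℝ}
    (ha : ∀ t, 0 < a t) (L : List (Fin (n + 1) × ℕ)) {K : ℕ} (hK2 : 2 ≤ K)
    (hK : 2 * (L.map Prod.snd).sum < K) :
    Tendsto (fun N : ℕ => MvPolynomial.constantCoeff (L.foldr (fun q => centeredPow 1
        (levelSize a N q.1 : ℂ) (totalDeriv ℂ (Polynomial.C (logPoly (ρ N) K))) q.2) 1) /
        (N : ℂ) ^ (L.map Prod.snd).sum) atTop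
      (𝓝 (wick (fun q q' => limCov c d (a q.1) (a q'.1) q.2 q'.2) L)) := by
  set tA : convSeq := toSeq fun N => (N : ℂ)⁻¹ with htA
  set μA : Fin (n + 1) × ℕ → convSeq := fun q =>
    toSeq fun N => (N : ℂ)⁻¹ * (levelSize a N q.1 : ℂ) with hμA
  -- Capping the orders at `K` gives one bound `B` valid for all indices; the orders occurring in
  -- `L` are below `K` and so are unchanged.
  set k : Fin (n + 1) × ℕ → ℕ := fun q => min q.2 K with hk
  set f : Polynomial convSeq := linSymbol K fun k => linRep ρ 1 fun _ => k with hf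
  set P : MvPolynomial ℕ convSeq := psumRep K (nonlinRep ρ) with hP
  set W := totalDeriv convSeq (Polynomial.C (psumRep K (linRep ρ) + MvPolynomial.C tA * P)) with hW
  set B := K + K * f.natDegree with hB
  have hkL : ∀ q ∈ L, q.2 ≤ (L.map Prod.snd).sum := fun q hq =>
    List.single_le_sum (by simp) _ (List.mem_map_of_mem hq)
  have hkeq : ∀ q ∈ L, k q = q.2 := fun q hq => min_eq_left (by have := hkL q hq; omega)
  have hW2 : W = f.map MvPolynomial.C + Polynomial.C (MvPolynomial.C tA) *
      totalDeriv convSeq (Polynomial.C P) := by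
    rw [hW, map_add, map_add, map_mul, totalDeriv_C_C_mul,
      totalDeriv_psumRep_linear (by omega) fun r hr k => by rw [linRep, if_neg hr]]
  -- Over the ring of convergent sequences all `N` are treated at once: the coefficients of the
  -- remainder `r` are convergent sequences, so the remainder is negligible after division by the
  -- leading power of `N`.
  obtain ⟨r, hr⟩ := exists_foldr_centeredPow_eq tA μA k f P (B := B)
    (fun i => Nat.add_le_add (min_le_right _ _) (Nat.mul_le_mul_right _ (min_le_right _ _))) hW2 L
  set X := L.foldr (fun i => centeredOp B (symbolPoly (μA i) f (k i)) P (k i)) 1 with hX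
  have hlim : seqLim (MvPolynomial.constantCoeff X) =
      wick (fun q q' => limCov c d (a q.1) (a q'.1) q.2 q'.2) L := by
    have hf' : ∀ i < K, (f.map (seqLim : convSeq →+* ℂ)).coeff i =
        (c (i + 1) : ℂ) / (i.factorial : ℂ) := by
      intro i hi
      rw [hf, linSymbol_map, coeff_linSymbol _ _ hi]
      rw [show (seqLim : convSeq →+* ℂ) (linRep ρ 1 fun _ => i + 1) = _ from
        seqLim_linRep happ (by simp), Nat.factorial_succ]
      push_cast
      have h1 : (i : ℂ) + 1 ≠ 0 := by exact_mod_cast i.succ_ne_zero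
      have h2 : (i.factorial : ℂ) ≠ 0 := by exact_mod_cast i.factorial_ne_zero
      field_simp
    have hP' : MvPolynomial.map (seqLim : convSeq →+* ℂ) P = psumRep K (quadLim d) := by
      rw [hP, psumRep_map]
      exact psumRep_congr fun r k hk => seqLim_nonlinRep happ hk
    -- In the limit the terms with three or more distinct indices are gone, so the second
    -- derivatives of `P` are scalars, as Wick's formula requires.
    obtain ⟨s, hs1, hs2⟩ := pderiv_pderiv_psumRep_quadratic hK2
      (φ := quadLim d) fun r hr k => quadLim_of_ne d hr k
    have hs3 : ∀ i j, i < K → j < K → s i j =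
        ((((i + 1).factorial : ℂ) * ((j + 1).factorial : ℂ))⁻¹ * (d (i + 1) (j + 1) : ℂ)) := by
      intro i j hi hj
      have h := hs2 i j hi hj
      simp only [quadLim, Matrix.cons_val_zero, Matrix.cons_val_one, smul_eq_mul] at h
      rw [happ.symm (k := j + 1) (l := i + 1) (by omega) (by omega),
        mul_comm ((j + 1).factorial : ℂ)] at h
      linear_combination h / 2
    have h1 : seqLim (MvPolynomial.constantCoeff X) = MvPolynomial.constantCoeff
        (MvPolynomial.map (seqLim : convSeq →+* ℂ) X) := by
      rw [MvPolynomial.constantCoeff_map]; rfl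
    rw [h1, hX, foldr_centeredOp_map, hP', constantCoeff_foldr_centeredOp _ hs1
      (fun i => (min_le_right _ _).trans (Nat.le_add_right _ _))]
    refine wick_congr (List.pairwise_of_forall_mem_list fun q hq q' hq' => ?_)
    have hμ : ∀ q, (seqLim : convSeq →+* ℂ) (μA q) = (a q.1 : ℂ) := fun q =>
      seqLim_toSeq (tendsto_levelSize_div ha q.1)
    have hc : ∀ q ∈ L, ∀ m ≤ K, ((symbolPoly (μA q) f (min q.2 K)).map
        (seqLim : convSeq →+* ℂ)).coeff m = PowerSeries.coeff m (limSymbol c (a q.1) q.2) := by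
      intro q hq m hm
      rw [symbolPoly_map, hμ, coeff_symbolPoly_eq_coeff_limSymbol hf' _ _ hm]
      rw [show min q.2 K = q.2 from hkeq q hq]
    have hq1 := hkL q hq
    have hq1' := hkL q' hq'
    have hq2 : min q.2 K = q.2 := hkeq q hq
    have hq2' : min q'.2 K = q'.2 := hkeq q' hq'
    have hcq := hc q hq
    have hcq' := hc q' hq'
    rw [limCov]
    simp only [hk, hq2, hq2'] at hcq hcq' ⊢
    refine Finset.sum_congr rfl fun j hj => ?_
    have hj' := Finset.mem_range.1 hj
    rw [hcq _ (by omega), hcq' _ (by omega)]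
    refine congrArg₂ (· * ·) rfl (congrArg₂ (· + ·) rfl (Finset.sum_congr rfl fun i hi => ?_))
    have hi' := Finset.mem_range.1 hi
    rw [hs3 j i (by omega) (by omega), hcq' _ (by omega)]
  -- Rescaling by `1/N` costs `N` to the power `∑ (k + 1)`, while the leading term carries `N` to
  -- the power minus the length of `L`; the quotient is the normalization `∑ k`.
  have hmain : ∀ N : ℕ, 1 ≤ N → seqEval N (MvPolynomial.constantCoeff X) +
      (N : ℂ)⁻¹ * seqEval N (MvPolynomial.constantCoeff r) =
      MvPolynomial.constantCoeff (L.foldr (fun q => centeredPow 1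
        (levelSize a N q.1 : ℂ) (totalDeriv ℂ (Polynomial.C (logPoly (ρ N) K))) q.2) 1) /
        (N : ℂ) ^ (L.map Prod.snd).sum := by
    intro N hN
    have hN0 : (N : ℂ) ≠ 0 := by exact_mod_cast (by omega : N ≠ 0)
    have hμ : ∀ q, seqEval N (μA q) = (N : ℂ)⁻¹ * (levelSize a N q.1 : ℂ) := fun q =>
      seqEval_toSeq (tendsto_levelSize_div ha q.1) N
    have ht : seqEval N tA = (N : ℂ)⁻¹ := seqEval_toSeq tendsto_natCast_inv N
    have h1 : MvPolynomial.constantCoeff (MvPolynomial.map (seqEval N : convSeq →+* ℂ)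
        (L.foldr (fun i => centeredPow tA (μA i) W (k i)) 1)) =
        ((N : ℂ)⁻¹) ^ L.length * seqEval N (MvPolynomial.constantCoeff X) +
        ((N : ℂ)⁻¹) ^ (L.length + 1) * seqEval N (MvPolynomial.constantCoeff r) := by
      rw [hr, MvPolynomial.constantCoeff_map, ← ht]
      simp
    rw [foldr_centeredPow_map, hW, totalDeriv_map, Polynomial.map_C, ht] at h1
    have h2 := map_seqEval_logRep happ N K
    rw [← htA, ← hP] at h2
    rw [h2, map_mul, totalDeriv_C_C_mul] at h1
    simp only [hμ] at h1
    have h3 := foldr_centeredPow_scale ((N : ℂ)⁻¹) 1 (fun q => (levelSize a N q.1 : ℂ)) k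
      (totalDeriv ℂ (Polynomial.C (logPoly (ρ N) K))) L
    rw [mul_one] at h3
    rw [h3, map_mul, MvPolynomial.constantCoeff_C] at h1
    have h4 : L.foldr (fun q => centeredPow 1 (levelSize a N q.1 : ℂ)
        (totalDeriv ℂ (Polynomial.C (logPoly (ρ N) K))) (k q)) 1 =
        L.foldr (fun q => centeredPow 1 (levelSize a N q.1 : ℂ)
        (totalDeriv ℂ (Polynomial.C (logPoly (ρ N) K))) q.2) 1 :=
      List.foldr_ext _ _ _ fun q hq g => by rw [hkeq q hq]
    have h5 : (L.map fun q => k q + 1).sum = (L.map Prod.snd).sum + L.length := by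
      rw [List.map_congr_left (g := fun q => q.2 + 1) fun q hq => by rw [hkeq q hq]]
      simp [List.sum_map_add]
    rw [h4, h5, pow_add, pow_succ _ L.length] at h1
    have h6 : ((N : ℂ)⁻¹) ^ L.length ≠ 0 := pow_ne_zero _ (inv_ne_zero hN0)
    rw [div_eq_mul_inv, ← inv_pow]
    refine mul_left_cancel₀ h6 ?_
    linear_combination -h1
  have h7 := (tendsto_seqEval (MvPolynomial.constantCoeff X)).add
    (tendsto_natCast_inv.mul (tendsto_seqEval (MvPolynomial.constantCoeff r)))
  rw [zero_mul, add_zero, hlim] at h7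
  refine h7.congr' ?_
  filter_upwards [eventually_ge_atTop 1] with N hN using hmain N hN

theorem levelSize_last {n : ℕ} {a : Fin (n + 1) → ℝ} (ha : a (Fin.last n) = 1) (N : ℕ) :
    levelSize a N (Fin.last n) = N := by
  rw [levelSize, ha, one_mul, Nat.floor_natCast]

/-- Products of centered power sums are integrable. -/
theorem integrable_prod_powerSum_sub (hρ : ∀ N, 1 ≤ N → HasSchurGen (ρ N))
    (happ : IsAppropriate (fun N => schurGen (ρ N)) c d) {n : ℕ} {a : Fin (n + 1) → ℝ}
    (ha_mono : Monotone a) (ha_last : a (Fin.last n) = 1) (L : List (Fin (n + 1) × ℕ)) (N : ℕ) :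
    Integrable (fun ω : Config a N => (L.map fun q => powerSum q.2 (ω q.1) -
      ∫ η, powerSum q.2 (η q.1) ∂(projMeasure ρ a N)).prod) (projMeasure ρ a N) := by
  rcases Nat.eq_zero_or_pos N with rfl | hN
  -- Nothing is assumed for `N = 0`, but then all signatures are empty and the configuration space
  -- is a single point.
  · have hs : ∀ t, Subsingleton (Signature (levelSize a 0 t)) := by
      intro t
      have h0 : levelSize a 0 t = 0 := by simp [levelSize]
      rw [h0]
      exact ⟨fun l l' => Subtype.ext (funext fun i => i.elim0)⟩
    have := isProbabilityMeasure_projMeasure ρ ha_mono 0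
    have : Finite (Config a 0) := Finite.of_subsingleton
    exact Integrable.of_finite
  · have hM : 1 ≤ levelSize a N (Fin.last n) := by rwa [levelSize_last ha_last]
    exact (integral_prod_powerSum_sub ha_mono (hρ _ hM) (happ.log_analytic _ hM) L
      (Nat.lt_succ_self _)).1

/-- The limits of the mixed moments of the centered power sums. -/
theorem tendsto_integral_prod_powerSum_sub (hρ : ∀ N, 1 ≤ N → HasSchurGen (ρ N))
    (happ : IsAppropriate (fun N => schurGen (ρ N)) c d) {n : ℕ} {a : Fin (n + 1) → ℝ}
    (ha_pos : ∀ t, 0 < a t) (ha_mono : Monotone a) (ha_last : a (Fin.last n) = 1)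
    (L : List (Fin (n + 1) × ℕ)) :
    Tendsto (fun N : ℕ => ((∫ ω, (L.map fun q => powerSum q.2 (ω q.1) -
      ∫ η, powerSum q.2 (η q.1) ∂(projMeasure ρ a N)).prod ∂(projMeasure ρ a N) : ℝ) : ℂ) /
        (N : ℂ) ^ (L.map Prod.snd).sum) atTop
      (𝓝 (wick (fun q q' => limCov c d (a q.1) (a q'.1) q.2 q'.2) (levelSort L))) := by
  have hsum : ((levelSort L).map Prod.snd).sum = (L.map Prod.snd).sum :=
    ((levelSort_perm L).map _).sum_eq
  have h := tendsto_constantCoeff_foldr_centeredPow happ ha_pos (levelSort L)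
    (K := 2 * (L.map Prod.snd).sum + 2) (by omega) (by omega)
  rw [hsum] at h
  refine h.congr' ?_
  filter_upwards [eventually_ge_atTop 1] with N hN
  have hM : 1 ≤ levelSize a N (Fin.last n) := by rwa [levelSize_last ha_last]
  have h1 := (integral_prod_powerSum_sub ha_mono (hρ _ hM) (happ.log_analytic _ hM) L
    (K := 2 * (L.map Prod.snd).sum + 2) (by omega)).2
  rw [levelSize_last ha_last] at h1
  rw [h1]

end Asymptotics

/-! ### Termwise integration of Laurent series -/

section Laurent

theorem circleIntegral_zpow {R : ℝ} (hR : R ≠ 0) (p : ℤ) : (∮ z in C(0, R), z ^ p) =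
    if p = -1 then 2 * (Real.pi : ℂ) * Complex.I else 0 := by
  split_ifs with h
  · simpa [h] using circleIntegral.integral_sub_center_inv 0 hR
  · simpa using circleIntegral.integral_sub_zpow_of_ne h 0 0 R

/-- Termwise integration, dominated by the absolute sums on the circle; only the exponent `-1`
contributes. -/
theorem hasSum_circleIntegral {T : Type*} [Countable T] {A : T → ℂ} {p : T → ℤ} {R : ℝ} (hR : 0 < R)
    (hs : Summable fun t => ‖A t‖ * R ^ p t) {f : ℂ → ℂ}
    (hf : ∀ z : ℂ, ‖z‖ = R → HasSum (fun t => A t * z ^ p t) (f z)) :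
    HasSum (fun t => A t * if p t = -1 then 2 * (Real.pi : ℂ) * Complex.I else 0)
      (∮ z in C(0, R), f z) := by
  have h1 : ∀ θ, ‖circleMap 0 R θ‖ = R := fun θ => by simp [abs_of_pos hR]
  have h0 : ∀ θ, circleMap 0 R θ ≠ 0 := fun θ => circleMap_ne_center hR.ne'
  have h2 : ∀ t, (∮ z in C(0, R), A t * z ^ p t) =
      A t * if p t = -1 then 2 * (Real.pi : ℂ) * Complex.I else 0 := fun t => by
    rw [circleIntegral.integral_const_mul, circleIntegral_zpow hR.ne']
  simp only [← h2, circleIntegral]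
  refine intervalIntegral.hasSum_integral_of_dominated_convergence
    (fun t _ => R * (‖A t‖ * R ^ p t)) (fun t => ?_) (fun t => ?_) ?_ ?_ ?_
  · refine Continuous.aestronglyMeasurable ?_
    simp only [deriv_circleMap, smul_eq_mul]
    refine ((continuous_circleMap 0 R).mul continuous_const).mul (continuous_const.mul ?_)
    exact (continuous_circleMap 0 R).zpow₀ _ fun θ => Or.inl (h0 θ)
  · refine ae_of_all _ fun θ _ => le_of_eq ?_
    rw [norm_smul, norm_mul, norm_zpow, h1, deriv_circleMap, norm_mul, h1, Complex.norm_I, mul_one]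
  · exact ae_of_all _ fun θ _ => hs.mul_left R
  · exact intervalIntegrable_const
  · exact ae_of_all _ fun θ _ => (hf _ (h1 θ)).const_smul _

/-- Absolutely convergent expansions on a torus. -/
structure HasLaurent {T : Type*} (R S : ℝ) (f : ℂ → ℂ → ℂ) (A : T → ℂ) (p q : T → ℤ) : Prop where
  summable : Summable fun t => ‖A t‖ * R ^ p t * S ^ q t
  hasSum : ∀ z w : ℂ, ‖z‖ = R → ‖w‖ = S → HasSum (fun t => A t * z ^ p t * w ^ q t) (f z w)

namespace HasLaurent

variable {T T' : Type*} {R S : ℝ} {f g : ℂ → ℂ → ℂ} {A : T → ℂ} {A' : T' → ℂ} {p q : T → ℤ}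
  {p' q' : T' → ℤ}

/-- The normalized double integral picks the terms with exponents `(-1, -1)`. The expansion may be
indexed by any countable type, so products of expansions need not be collected by exponent. -/
theorem hasSum_integral [Countable T] (h : HasLaurent R S f A p q) (hR : 0 < R) (hS : 0 < S) :
    HasSum (fun t => if p t = -1 ∧ q t = -1 then A t else 0)
      (((2 * (Real.pi : ℂ) * Complex.I) ^ 2)⁻¹ * ∮ z in C(0, R), ∮ w in C(0, S), f z w) := by
  set τ : ℂ := 2 * (Real.pi : ℂ) * Complex.I with hτ
  have hτ0 : τ ≠ 0 := Complex.two_pi_I_ne_zero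
  have h1 : ∀ z : ℂ, ‖z‖ = R → HasSum (fun t => (A t * if q t = -1 then τ else 0) * z ^ p t)
      (∮ w in C(0, S), f z w) := by
    intro z hz
    have h2 := hasSum_circleIntegral (A := fun t => A t * z ^ p t) (p := q) (f := f z) hS
      (by simpa only [norm_mul, norm_zpow, hz] using h.summable) fun w hw => h.hasSum z w hz hw
    refine h2.congr_fun fun t => ?_
    ring
  have h3 := hasSum_circleIntegral hR (Summable.of_nonneg_of_le (fun t => by positivity) (fun t => ?_)
    (h.summable.mul_left (‖τ‖ * S))) h1
  · refine (h3.mul_left (τ ^ 2)⁻¹).congr_fun fun t => ?_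
    by_cases hp : p t = -1 <;> by_cases hq : q t = -1 <;> simp [hp, hq]
    rw [← hτ]
    field_simp
  · split_ifs with hq
    · rw [hq, norm_mul, zpow_neg_one]
      refine le_of_eq ?_
      field_simp
    · rw [mul_zero, norm_zero, zero_mul]
      positivity

theorem summable_norm (h : HasLaurent R S f A p q) {z w : ℂ} (hz : ‖z‖ = R) (hw : ‖w‖ = S) :
    Summable fun t => ‖A t * z ^ p t * w ^ q t‖ := by
  simpa only [norm_mul, norm_zpow, hz, hw] using h.summable

theorem mul (h : HasLaurent R S f A p q) (h' : HasLaurent R S g A' p' q') (hR : 0 < R)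
    (hS : 0 < S) : HasLaurent R S (fun z w => f z w * g z w) (fun t : T × T' => A t.1 * A' t.2)
      (fun t => p t.1 + p' t.2) (fun t => q t.1 + q' t.2) := by
  constructor
  · have h0 : (0 : T → ℝ) ≤ fun t => ‖A t‖ * R ^ p t * S ^ q t := fun t => by
      show (0 : ℝ) ≤ ‖A t‖ * R ^ p t * S ^ q t
      positivity
    have h0' : (0 : T' → ℝ) ≤ fun t => ‖A' t‖ * R ^ p' t * S ^ q' t := fun t => by
      show (0 : ℝ) ≤ ‖A' t‖ * R ^ p' t * S ^ q' t
      positivity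
    have h1 := h.summable.mul_of_nonneg h'.summable h0 h0'
    have h2 : ∀ t : T × T', ‖A t.1 * A' t.2‖ * R ^ (p t.1 + p' t.2) * S ^ (q t.1 + q' t.2) =
        ‖A t.1‖ * R ^ p t.1 * S ^ q t.1 * (‖A' t.2‖ * R ^ p' t.2 * S ^ q' t.2) := fun t => by
      rw [norm_mul, zpow_add₀ hR.ne', zpow_add₀ hS.ne']
      ring
    simp only [h2]
    exact h1
  · intro z w hz hw
    have hz0 : z ≠ 0 := by rw [← norm_pos_iff, hz]; exact hR
    have hw0 : w ≠ 0 := by rw [← norm_pos_iff, hw]; exact hS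
    have h1 : Summable fun t : T × T' => (A t.1 * z ^ p t.1 * w ^ q t.1) *
        (A' t.2 * z ^ p' t.2 * w ^ q' t.2) :=
      summable_mul_of_summable_norm (f := fun t => A t * z ^ p t * w ^ q t)
        (g := fun t => A' t * z ^ p' t * w ^ q' t) (h.summable_norm hz hw) (h'.summable_norm hz hw)
    have h2 := (h.hasSum z w hz hw).mul (h'.hasSum z w hz hw) h1
    have h3 : ∀ t : T × T', A t.1 * A' t.2 * z ^ (p t.1 + p' t.2) * w ^ (q t.1 + q' t.2) =
        A t.1 * z ^ p t.1 * w ^ q t.1 * (A' t.2 * z ^ p' t.2 * w ^ q' t.2) := fun t => by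
      rw [zpow_add₀ hz0, zpow_add₀ hw0]
      ring
    simp only [h3]
    exact h2

theorem add (h : HasLaurent R S f A p q) (h' : HasLaurent R S g A' p' q') :
    HasLaurent R S (fun z w => f z w + g z w) (Sum.elim A A') (Sum.elim p p') (Sum.elim q q') :=
  ⟨Summable.sum _ h.summable h'.summable, fun z w hz hw =>
    HasSum.sum (f := fun t => Sum.elim A A' t * z ^ Sum.elim p p' t * w ^ Sum.elim q q' t)
      (h.hasSum z w hz hw) (h'.hasSum z w hz hw)⟩

end HasLaurent

/-- The kernel `1 / (z - w)^2`. -/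
theorem hasLaurent_inv_sq {R S : ℝ} (hR : 0 < R) (hRS : R < S) :
    HasLaurent R S (fun z w => 1 / (z - w) ^ 2) (fun j : ℕ => (j : ℂ) + 1) (fun j => (j : ℤ))
      (fun j => -(j : ℤ) - 2) := by
  have hS : 0 < S := hR.trans hRS
  -- The expansion is `w⁻² ∑ (j+1) (z/w)^j`, convergent because `|z| < |w|`. This is where the
  -- nesting of the two contours enters.
  have key : ∀ z w : ℂ, ‖z‖ = R → ‖w‖ = S → (fun j : ℕ => ((j : ℂ) + 1) * z ^ (j : ℤ) *
      w ^ (-(j : ℤ) - 2)) = fun j : ℕ => ((j + 1).choose 1 : ℂ) * (z / w) ^ j * (w ^ 2)⁻¹ := by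
    intro z w hz hw
    have hw0 : w ≠ 0 := by rw [← norm_pos_iff, hw]; exact hS
    funext j
    rw [zpow_sub₀ hw0, zpow_neg, zpow_natCast, zpow_natCast, Nat.choose_one_right, div_pow]
    norm_cast
    push_cast
    field_simp
  have hlt : ∀ z w : ℂ, ‖z‖ = R → ‖w‖ = S → ‖z / w‖ < 1 := by
    intro z w hz hw
    rw [norm_div, hz, hw]
    exact (div_lt_one hS).2 hRS
  constructor
  · have h1 : ‖(R : ℂ)‖ = R := by simp [abs_of_pos hR]
    have h2 : ‖(S : ℂ)‖ = S := by simp [abs_of_pos hS]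
    have h3 := ((hasSum_choose_mul_geometric_of_norm_lt_one 1 (hlt _ _ h1 h2)).mul_right
      (((S : ℂ)) ^ 2)⁻¹).summable
    rw [← key _ _ h1 h2] at h3
    simpa only [norm_mul, norm_zpow, h1, h2] using h3.norm
  · intro z w hz hw
    have hw0 : w ≠ 0 := by rw [← norm_pos_iff, hw]; exact hS
    have hzw : z - w ≠ 0 := by
      intro h
      rw [sub_eq_zero.1 h] at hz
      exact hRS.ne (hz.symm.trans hw)
    have h1 : 1 / (z - w) ^ 2 = 1 / (1 - z / w) ^ (1 + 1) * (w ^ 2)⁻¹ := by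
      have h2 : w - z ≠ 0 := by rw [← neg_sub]; exact neg_ne_zero.2 hzw
      rw [show 1 - z / w = (w - z) / w by field_simp, ← neg_sub w z, div_pow]
      field_simp
      ring
    rw [key z w hz hw, h1]
    exact (hasSum_choose_mul_geometric_of_norm_lt_one 1 (hlt z w hz hw)).mul_right _

/-- Absolutely convergent expansions on a disc. -/
structure HasExpansion (R : ℝ) (f : ℂ → ℂ) (φ : PowerSeries ℂ) : Prop where
  summable : Summable fun m => ‖PowerSeries.coeff m φ‖ * R ^ m
  hasSum : ∀ z : ℂ, ‖z‖ = R → HasSum (fun m => PowerSeries.coeff m φ * z ^ m) (f z)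

namespace HasExpansion

variable {R : ℝ} {f g : ℂ → ℂ} {φ ψ : PowerSeries ℂ}

theorem of_finite (S : Finset ℕ) (h : ∀ m ∉ S, PowerSeries.coeff m φ = 0)
    (hf : ∀ z, f z = ∑ m ∈ S, PowerSeries.coeff m φ * z ^ m) : HasExpansion R f φ :=
  ⟨summable_of_ne_finset_zero (s := S) fun m hm => by simp [h m hm], fun z _ => by
    rw [hf]; exact hasSum_sum_of_ne_finset_zero fun m hm => by simp [h m hm]⟩

theorem const (μ : ℂ) : HasExpansion R (fun _ => μ) (PowerSeries.C μ) :=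
  of_finite {0} (fun m hm => by
    rw [PowerSeries.coeff_C, if_neg (by simpa using hm)]) fun z => by simp

theorem id : HasExpansion R (fun z => z) PowerSeries.X :=
  of_finite {1} (fun m hm => by simpa [PowerSeries.coeff_X] using hm) fun z => by simp

theorem add (h : HasExpansion R f φ) (h' : HasExpansion R g ψ) (hR : 0 < R) :
    HasExpansion R (fun z => f z + g z) (φ + ψ) := by
  constructor
  · refine Summable.of_nonneg_of_le (fun m => by positivity) (fun m => ?_)
      (h.summable.add h'.summable)
    rw [map_add, ← add_mul]
    gcongr
    exact norm_add_le _ _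
  · intro z hz
    simpa only [map_add, add_mul] using (h.hasSum z hz).add (h'.hasSum z hz)

theorem mul (h : HasExpansion R f φ) (h' : HasExpansion R g ψ) (hR : 0 < R) :
    HasExpansion R (fun z => f z * g z) (φ * ψ) := by
  have key : ∀ z : ℂ, (fun m => PowerSeries.coeff m (φ * ψ) * z ^ m) = fun m =>
      ∑ kl ∈ Finset.HasAntidiagonal.antidiagonal m, (PowerSeries.coeff kl.1 φ * z ^ kl.1) *
        (PowerSeries.coeff kl.2 ψ * z ^ kl.2) := by
    intro z
    funext m
    rw [PowerSeries.coeff_mul, Finset.sum_mul]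
    refine Finset.sum_congr rfl fun kl hkl => ?_
    rw [← Finset.HasAntidiagonal.mem_antidiagonal.1 hkl, pow_add]
    ring
  have h1 : ∀ z : ℂ, ‖z‖ = R → Summable fun m => ‖PowerSeries.coeff m φ * z ^ m‖ := by
    intro z hz
    simpa only [norm_mul, norm_pow, hz] using h.summable
  have h2 : ∀ z : ℂ, ‖z‖ = R → Summable fun m => ‖PowerSeries.coeff m ψ * z ^ m‖ := by
    intro z hz
    simpa only [norm_mul, norm_pow, hz] using h'.summable
  have h3 : ∀ z : ℂ, ‖z‖ = R → Summable fun m => ‖PowerSeries.coeff m (φ * ψ) * z ^ m‖ := by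
    intro z hz
    have h4 := summable_norm_sum_mul_antidiagonal_of_summable_norm (h1 z hz) (h2 z hz)
    refine h4.congr fun m => ?_
    rw [← congrFun (key z) m]
  constructor
  · have h5 : ‖(R : ℂ)‖ = R := by simp [abs_of_pos hR]
    simpa only [norm_mul, norm_pow, h5] using h3 R h5
  · intro z hz
    rw [← (h.hasSum z hz).tsum_eq, ← (h'.hasSum z hz).tsum_eq,
      tsum_mul_tsum_eq_tsum_sum_antidiagonal_of_summable_norm (h1 z hz) (h2 z hz), ← key]
    exact (h3 z hz).of_norm.hasSum

theorem pow (h : HasExpansion R f φ) (hR : 0 < R) (k : ℕ) :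
    HasExpansion R (fun z => f z ^ k) (φ ^ k) := by
  induction k with
  | zero => simpa using const (R := R) 1
  | succ k ih => simpa only [pow_succ] using ih.mul h hR

end HasExpansion

variable {c : ℕ → ℝ}

theorem hasExpansion_limitF {R : ℝ} (hR : 0 < R)
    (hs : Summable fun k : ℕ => (c (k + 1) : ℂ) / (k.factorial : ℂ) * (R : ℂ) ^ k) :
    HasExpansion R (fun z => limitF c (1 + z))
      (PowerSeries.mk fun i => (c (i + 1) : ℂ) / (i.factorial : ℂ)) := by
  have h1 : ∀ z : ℂ, ‖z‖ = R → Summable fun k : ℕ =>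
      ‖(c (k + 1) : ℂ) / (k.factorial : ℂ) * z ^ k‖ := by
    intro z hz
    refine hs.norm.congr fun k => ?_
    rw [norm_mul, norm_mul, norm_pow, norm_pow, hz]
    simp [abs_of_pos hR]
  have h5 : ‖(R : ℂ)‖ = R := by simp [abs_of_pos hR]
  constructor
  · simp only [PowerSeries.coeff_mk]
    simpa only [norm_mul, norm_pow, h5] using h1 R h5
  · intro z hz
    simp only [PowerSeries.coeff_mk, limitF, add_sub_cancel_left]
    exact (h1 z hz).of_norm.hasSum

/-- The powers of `a (1 / z + 1 + (1 + z) F (1 + z) / a)`. -/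
theorem hasExpansion_limSymbol {R : ℝ} (hR : 0 < R)
    (hs : Summable fun k : ℕ => (c (k + 1) : ℂ) / (k.factorial : ℂ) * (R : ℂ) ^ k) (μ : ℝ) (k : ℕ) :
    HasExpansion R (fun z => ((1 + z) * (μ + z * limitF c (1 + z))) ^ k) (limSymbol c μ k) := by
  have h1 := HasExpansion.const (R := R) 1
  rw [map_one] at h1
  exact ((h1.add .id hR).mul ((HasExpansion.const (μ : ℂ)).add
    (HasExpansion.id.mul (hasExpansion_limitF hR hs) hR) hR) hR).pow hR k

/-- Extracting `a^k` and the pole `z^k` leaves the function whose Taylor coefficients are those of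
`limSymbol`. -/
theorem symbol_eq {a : ℝ} (ha : a ≠ 0) (k : ℕ) {z : ℂ} (hz : z ≠ 0) (y : ℂ) :
    (1 / z + 1 + (1 + z) * y / (a : ℂ)) ^ k =
      ((a : ℂ) ^ k)⁻¹ * ((1 + z) * (a + z * y)) ^ k * z ^ (-(k : ℤ)) := by
  have ha' : (a : ℂ) ≠ 0 := by exact_mod_cast ha
  rw [zpow_neg, zpow_natCast, ← inv_pow, ← inv_pow, ← mul_pow, ← mul_pow]
  congr 1
  field_simp

theorem hasLaurent_symbol_left {R S : ℝ} (hR : 0 < R)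
    (hs : Summable fun k : ℕ => (c (k + 1) : ℂ) / (k.factorial : ℂ) * (R : ℂ) ^ k) {a : ℝ}
    (ha : a ≠ 0) (k : ℕ) :
    HasLaurent R S (fun z _ => (1 / z + 1 + (1 + z) * limitF c (1 + z) / (a : ℂ)) ^ k)
      (fun m : ℕ => ((a : ℂ) ^ k)⁻¹ * PowerSeries.coeff m (limSymbol c a k))
      (fun m => (m : ℤ) - k) (fun _ => 0) := by
  have h := hasExpansion_limSymbol hR hs a k
  constructor
  · refine (h.summable.mul_left (‖((a : ℂ) ^ k)⁻¹‖ * R ^ (-(k : ℤ)))).congr fun m => ?_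
    rw [sub_eq_add_neg, zpow_add₀ hR.ne', zpow_natCast, norm_mul, zpow_zero]
    ring
  · intro z w hz _
    have hz0 : z ≠ 0 := by rw [← norm_pos_iff, hz]; exact hR
    rw [symbol_eq ha k hz0]
    refine (((h.hasSum z hz).mul_left (((a : ℂ) ^ k)⁻¹)).mul_right (z ^ (-(k : ℤ)))).congr_fun
      fun m => ?_
    rw [sub_eq_add_neg, zpow_add₀ hz0, zpow_natCast, zpow_zero]
    ring

theorem HasLaurent.swap {T : Type*} {R S : ℝ} {f : ℂ → ℂ → ℂ} {A : T → ℂ} {p q : T → ℤ}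
    (h : HasLaurent R S f A p q) : HasLaurent S R (fun z w => f w z) A q p :=
  ⟨h.summable.congr fun t => by ring, fun z w hz hw =>
    (h.hasSum w z hw hz).congr_fun fun t => by ring⟩

theorem hasLaurent_limitG {d : ℕ → ℕ → ℝ} {R S : ℝ} (hR : 0 < R) (hS : 0 < S)
    (hs : Summable fun m : ℕ × ℕ => (d (m.1 + 1) (m.2 + 1) : ℂ) /
      ((m.1.factorial : ℂ) * (m.2.factorial : ℂ)) * (R : ℂ) ^ m.1 * (S : ℂ) ^ m.2) :
    HasLaurent R S (fun z w => limitG d (1 + z) (1 + w))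
      (fun m : ℕ × ℕ => (d (m.1 + 1) (m.2 + 1) : ℂ) /
        ((m.1.factorial : ℂ) * (m.2.factorial : ℂ))) (fun m => (m.1 : ℤ)) (fun m => (m.2 : ℤ)) := by
  have h1 : ‖(R : ℂ)‖ = R := by simp [abs_of_pos hR]
  have h2 : ‖(S : ℂ)‖ = S := by simp [abs_of_pos hS]
  simp only [← zpow_natCast] at hs
  have h3 := hs.norm
  simp only [norm_mul, norm_zpow, h1, h2] at h3
  refine ⟨h3, fun z w hz hw => ?_⟩
  simp only [limitG, add_sub_cancel_left, ← zpow_natCast]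
  refine Summable.hasSum (Summable.of_norm ?_)
  simpa only [norm_mul, norm_zpow, hz, hw] using h3

theorem hasSum_of_forall_exists {T U : Type*} (s : Finset U) {e : U → T}
    (he : Function.Injective e) {f : T → ℂ} (h : ∀ t, f t ≠ 0 → ∃ u ∈ s, e u = t) {v : U → ℂ}
    (hv : ∀ u ∈ s, f (e u) = v u) : HasSum f (∑ u ∈ s, v u) := by
  classical
  rw [← Finset.sum_congr rfl hv, ← Finset.sum_image (f := f) (s := s) (g := e) he.injOn]
  refine hasSum_sum_of_ne_finset_zero fun t ht => ?_
  by_contra h0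
  obtain ⟨u, hu, rfl⟩ := h t h0
  exact ht (Finset.mem_image_of_mem e hu)

/-- The condition that both exponents be `-1` leaves finitely many terms. The kernel `1 / (z-w)²`
yields the contractions of derivatives with linear forms, and `G` yields those with the second
derivatives of `P`. -/
theorem covIntegral_eq_limCov {d : ℕ → ℕ → ℝ} {ε : ℝ} (hε : 0 < ε)
    (hs₁ : Summable fun k : ℕ => (c (k + 1) : ℂ) / (k.factorial : ℂ) * (ε : ℂ) ^ k)
    (hs₂ : Summable fun k : ℕ => (c (k + 1) : ℂ) / (k.factorial : ℂ) * ((2 * ε : ℝ) : ℂ) ^ k)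
    (hs : Summable fun m : ℕ × ℕ => (d (m.1 + 1) (m.2 + 1) : ℂ) /
      ((m.1.factorial : ℂ) * (m.2.factorial : ℂ)) * (ε : ℂ) ^ m.1 * ((2 * ε : ℝ) : ℂ) ^ m.2)
    {a₁ a₂ : ℝ} (ha₁ : a₁ ≠ 0) (ha₂ : a₂ ≠ 0) (k₁ k₂ : ℕ) :
    covIntegral (limitF c) (limitQ d) ε a₁ a₂ k₁ k₂ = limCov c d a₁ a₂ k₁ k₂ := by
  have hε2 : 0 < 2 * ε := by positivity
  have h12 := (hasLaurent_symbol_left (S := 2 * ε) hε hs₁ ha₁ k₁).mul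
    (hasLaurent_symbol_left (S := ε) hε2 hs₂ ha₂ k₂).swap hε hε2
  have hsum := ((h12.mul (hasLaurent_limitG hε hε2 hs) hε hε2).add
    (h12.mul (hasLaurent_inv_sq hε (by linarith)) hε hε2)).hasSum_integral hε hε2
  simp only [← mul_add] at hsum
  have hΦ : ((a₁ : ℂ) ^ k₁ ≠ 0) ∧ ((a₂ : ℂ) ^ k₂ ≠ 0) := by
    constructor <;> exact pow_ne_zero _ (by exact_mod_cast ‹_›)
  set φ₁ := limSymbol c a₁ k₁ with hφ₁
  set φ₂ := limSymbol c a₂ k₂ with hφ₂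
  set α₁ := ((a₁ : ℂ) ^ k₁)⁻¹ with hα₁
  set α₂ := ((a₂ : ℂ) ^ k₂)⁻¹ with hα₂
  -- For `G` the exponents `(j, i)` of its term force the coefficients `k₁ - 1 - j` and `k₂ - 1 - i`
  -- of the two symbols.
  have h3 := hasSum_of_forall_exists (Finset.range k₁ ×ˢ Finset.range k₂)
    (e := fun u => ((k₁ - 1 - u.1, k₂ - 1 - u.2), u))
    (f := fun t : (ℕ × ℕ) × (ℕ × ℕ) => if (t.1.1 : ℤ) - k₁ + 0 + t.2.1 = -1 ∧
      0 + ((t.1.2 : ℤ) - k₂) + t.2.2 = -1 then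
      α₁ * PowerSeries.coeff t.1.1 φ₁ * (α₂ * PowerSeries.coeff t.1.2 φ₂) *
        ((d (t.2.1 + 1) (t.2.2 + 1) : ℂ) / ((t.2.1.factorial : ℂ) * (t.2.2.factorial : ℂ))) else 0)
    (fun u v h => (Prod.mk.inj h).2) (fun t ht => by
      have ht' : (t.1.1 : ℤ) - k₁ + 0 + t.2.1 = -1 ∧ 0 + ((t.1.2 : ℤ) - k₂) + t.2.2 = -1 := by
        by_contra h0
        exact ht (if_neg h0)
      obtain ⟨⟨m₁, m₂⟩, j, i⟩ := t
      simp only at ht'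
      refine ⟨(j, i), Finset.mem_product.2 ⟨Finset.mem_range.2 ?_, Finset.mem_range.2 ?_⟩, ?_⟩
      · simp only; omega
      · simp only; omega
      · simp only [Prod.mk.injEq, and_true]
        omega)
    (v := fun u => α₁ * PowerSeries.coeff (k₁ - 1 - u.1) φ₁ *
      (α₂ * PowerSeries.coeff (k₂ - 1 - u.2) φ₂) *
        ((d (u.1 + 1) (u.2 + 1) : ℂ) / ((u.1.factorial : ℂ) * (u.2.factorial : ℂ))))
    (fun u hu => if_pos (by
      have h1 := Finset.mem_range.1 (Finset.mem_product.1 hu).1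
      have h2 := Finset.mem_range.1 (Finset.mem_product.1 hu).2
      simp only
      omega))
  -- For the kernel `1 / (z-w)²` the single index `j` forces the coefficients `k₁ - 1 - j` and `j +
  -- 1 + k₂`.
  have h4 := hasSum_of_forall_exists (Finset.range k₁) (e := fun j => ((k₁ - 1 - j, j + 1 + k₂), j))
    (f := fun t : (ℕ × ℕ) × ℕ => if (t.1.1 : ℤ) - k₁ + 0 + t.2 = -1 ∧
      0 + ((t.1.2 : ℤ) - k₂) + (-(t.2 : ℤ) - 2) = -1 then
      α₁ * PowerSeries.coeff t.1.1 φ₁ * (α₂ * PowerSeries.coeff t.1.2 φ₂) * ((t.2 : ℂ) + 1) else 0)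
    (fun u v h => (Prod.mk.inj h).2) (fun t ht => by
      have ht' : (t.1.1 : ℤ) - k₁ + 0 + t.2 = -1 ∧
          0 + ((t.1.2 : ℤ) - k₂) + (-(t.2 : ℤ) - 2) = -1 := by
        by_contra h0
        exact ht (if_neg h0)
      obtain ⟨⟨m₁, m₂⟩, j⟩ := t
      simp only at ht'
      refine ⟨j, Finset.mem_range.2 (by omega), ?_⟩
      simp only [Prod.mk.injEq, and_true]
      omega)
    (v := fun j => α₁ * PowerSeries.coeff (k₁ - 1 - j) φ₁ *
      (α₂ * PowerSeries.coeff (j + 1 + k₂) φ₂) * ((j : ℂ) + 1))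
    (fun u hu => if_pos (by
      have h1 := Finset.mem_range.1 hu
      simp only
      omega))
  have h5 := hsum.unique (HasSum.sum h3 h4)
  have h6 : covIntegral (limitF c) (limitQ d) ε a₁ a₂ k₁ k₂ = (a₁ : ℂ) ^ k₁ * (a₂ : ℂ) ^ k₂ *
      (((2 * (Real.pi : ℂ) * Complex.I) ^ 2)⁻¹ * ∮ z in C(0, ε), ∮ w in C(0, 2 * ε),
      (1 / z + 1 + (1 + z) * limitF c (1 + z) / (a₁ : ℂ)) ^ k₁ *
        (1 / w + 1 + (1 + w) * limitF c (1 + w) / (a₂ : ℂ)) ^ k₂ *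
        (limitG d (1 + z) (1 + w) + 1 / (z - w) ^ 2)) := by
    rw [covIntegral, div_eq_mul_inv, mul_assoc]
    rfl
  have h7 : (a₁ : ℂ) ^ k₁ * α₁ = 1 := mul_inv_cancel₀ hΦ.1
  have h8 : (a₂ : ℂ) ^ k₂ * α₂ = 1 := mul_inv_cancel₀ hΦ.2
  rw [h6, h5, limCov, Finset.sum_product, ← Finset.sum_add_distrib, Finset.mul_sum]
  refine Finset.sum_congr rfl fun j _ => ?_
  rw [mul_add, Finset.mul_sum, mul_add (((j : ℂ) + 1) * _), Finset.mul_sum, add_comm]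
  simp only [← hφ₁, ← hφ₂]
  refine congrArg₂ (· + ·) ?_ (Finset.sum_congr rfl fun i _ => ?_)
  · linear_combination (PowerSeries.coeff (k₁ - 1 - j) φ₁ * PowerSeries.coeff (j + 1 + k₂) φ₂ *
      ((j : ℂ) + 1)) * (h7 * ((a₂ : ℂ) ^ k₂ * α₂) + h8)
  · have hj1 : (j : ℂ) + 1 ≠ 0 := by exact_mod_cast j.succ_ne_zero
    have hi1 : (i : ℂ) + 1 ≠ 0 := by exact_mod_cast i.succ_ne_zero
    have hj2 : (j.factorial : ℂ) ≠ 0 := by exact_mod_cast j.factorial_ne_zero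
    have hi2 : (i.factorial : ℂ) ≠ 0 := by exact_mod_cast i.factorial_ne_zero
    have h10 : ((j : ℂ) + 1) * ((i : ℂ) + 1) *
        (((j + 1).factorial : ℂ) * ((i + 1).factorial : ℂ))⁻¹ =
        ((j.factorial : ℂ) * (i.factorial : ℂ))⁻¹ := by
      rw [Nat.factorial_succ, Nat.factorial_succ]
      push_cast
      field_simp
    rw [div_eq_mul_inv]
    linear_combination (PowerSeries.coeff (k₁ - 1 - j) φ₁ * PowerSeries.coeff (k₂ - 1 - i) φ₂ *
      (d (j + 1) (i + 1) : ℂ)) * (((j.factorial : ℂ) * (i.factorial : ℂ))⁻¹ *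
        (h7 * ((a₂ : ℂ) ^ k₂ * α₂) + h8) - h10)

/-- For small radii, the contour integral is the limiting covariance. -/
theorem eventually_covIntegral_eq_limCov {f : ∀ N : ℕ, (Fin N → ℂ) → ℂ} {d : ℕ → ℕ → ℝ}
    (happ : IsAppropriate f c d) : ∀ᶠ ε : ℝ in 𝓝[>] 0, ∀ (a₁ a₂ : ℝ) (k₁ k₂ : ℕ), 0 < a₁ → 0 < a₂ →
      covIntegral (limitF c) (limitQ d) ε a₁ a₂ k₁ k₂ = limCov c d a₁ a₂ k₁ k₂ := by
  obtain ⟨r, hr, h1⟩ := happ.summable_one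
  obtain ⟨s, hs, h2⟩ := happ.summable_two
  -- The larger radius `2ε` has to stay inside the discs of convergence of both series.
  have h3 : Set.Ioo (0 : ℝ) (min r s / 2) ∈ 𝓝[>] (0 : ℝ) :=
    Ioo_mem_nhdsGT (by positivity)
  filter_upwards [h3] with ε hε a₁ a₂ k₁ k₂ ha₁ ha₂
  have hε0 := hε.1
  have hεr : 2 * ε < r := by linarith [hε.2, min_le_left r s]
  have hεs : 2 * ε < s := by linarith [hε.2, min_le_right r s]
  have hn : ∀ x : ℝ, 0 < x → ‖(1 + (x : ℂ)) - 1‖ = x := fun x hx => by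
    rw [add_sub_cancel_left, Complex.norm_real, Real.norm_of_nonneg hx.le]
  refine covIntegral_eq_limCov hε0 ?_ ?_ ?_ ha₁.ne' ha₂.ne' k₁ k₂
  · simpa only [add_sub_cancel_left] using h1 (1 + (ε : ℂ)) (by rw [hn _ hε0]; linarith)
  · simpa only [add_sub_cancel_left] using h1 (1 + ((2 * ε : ℝ) : ℂ))
      (by rw [hn _ (by positivity)]; linarith)
  · simpa only [add_sub_cancel_left] using h2 (1 + (ε : ℂ)) (1 + ((2 * ε : ℝ) : ℂ))
      (by rw [hn _ hε0]; linarith) (by rw [hn _ (by positivity)]; linarith)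

end Laurent

/-! ### Gaussian limit of the fluctuations -/

section Fluctuations

theorem levelSort_map {n : ℕ} {β γ : Type*} {g : Fin (n + 1) × β → Fin (n + 1) × γ}
    (hg : ∀ q, (g q).1 = q.1) (L : List (Fin (n + 1) × β)) :
    levelSort (L.map g) = (levelSort L).map g := by
  simp only [levelSort, List.map_flatMap, List.filter_map, Function.comp_def, hg]

theorem levelSort_eq_self_of_forall {n : ℕ} {β : Type*} {L : List (Fin (n + 1) × β)}
    {t : Fin (n + 1)} (h : ∀ q ∈ L, q.1 = t) : levelSort L = L := by
  have h1 : ∀ s : Fin (n + 1), (L.filter fun q => q.1 = s) = if s = t then L else [] := by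
    intro s
    split_ifs with hs
    · exact List.filter_eq_self.2 fun q hq => by simp [h q hq, hs]
    · refine List.filter_eq_nil_iff.2 fun q hq => ?_
      rw [h q hq]
      simpa using Ne.symm hs
  have h2 : ∀ l : List (Fin (n + 1)), l.Nodup →
      (l.flatMap fun s => if s = t then L else []) = if t ∈ l then L else [] := by
    intro l hl
    induction l with
    | nil => simp
    | cons s l ih =>
      rw [List.nodup_cons] at hl
      rw [List.flatMap_cons, ih hl.2]
      by_cases hs : s = t
      · subst hs
        simp [hl.1]
      · simp [hs, Ne.symm hs]
  rw [levelSort, funext h1, h2 _ (List.nodup_finRange _), if_pos (List.mem_finRange t)]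

/-- Two indices on the same level keep their order, so both orders of such a pair are available; the
symmetry of the limiting covariance on one level rests on this. -/
theorem levelSort_pair {n : ℕ} {β : Type*} {q q' : Fin (n + 1) × β} (h : q.1 ≤ q'.1) :
    levelSort [q, q'] = [q, q'] := by
  rcases h.eq_or_lt with h | h
  · exact levelSort_eq_self_of_forall (t := q'.1) (by simp [h])
  · have h1 := levelSort_perm [q, q']
    have h2 := levelSort_pairwise [q, q']
    obtain ⟨x, y, hxy⟩ := List.length_eq_two.1 h1.length_eq
    rw [hxy] at h1 h2 ⊢
    have h3 : x.1 ≤ y.1 := List.rel_of_pairwise_cons h2 (by simp)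
    have h4 : q = x ∨ q = y := by simpa using h1.mem_iff.2 (show q ∈ [q, q'] by simp)
    have h5 : q' = x ∨ q' = y := by simpa using h1.mem_iff.2 (show q' ∈ [q, q'] by simp)
    rcases h4 with rfl | rfl <;> rcases h5 with rfl | rfl
    · exact absurd h (lt_irrefl _)
    · rfl
    · exact absurd h3 (not_le.2 h)
    · exact absurd h (lt_irrefl _)

variable {ρ : ∀ N : ℕ, PMF (Signature N)} {c : ℕ → ℝ} {d : ℕ → ℕ → ℝ} {n : ℕ}
  {a : Fin (n + 1) → ℝ}

theorem prod_fluctuation (L : List (Fin (n + 1) × ℕ+)) (N : ℕ) (ω : Config a N) :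
    (L.map fun q => fluctuation ρ a N q ω).prod =
      ((L.map (Prod.map id PNat.val)).map fun q => powerSum q.2 (ω q.1) -
        ∫ η, powerSum q.2 (η q.1) ∂(projMeasure ρ a N)).prod /
        (N : ℝ) ^ ((L.map (Prod.map id PNat.val)).map Prod.snd).sum := by
  induction L with
  | nil => simp
  | cons q L ih =>
    rw [List.map_cons, List.prod_cons, ih, fluctuation]
    simp only [List.map_cons, List.prod_cons, List.sum_cons, pow_add]
    rw [div_mul_div_comm]
    rfl

/-- The limit of the covariances of the fluctuations. -/
def covLim (c : ℕ → ℝ) (d : ℕ → ℕ → ℝ) (a : Fin (n + 1) → ℝ) (q q' : Fin (n + 1) × ℕ+) : ℝ :=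
  if q.1 ≤ q'.1 then (limCov c d (a q.1) (a q'.1) q.2 q'.2).re
  else (limCov c d (a q'.1) (a q.1) q'.2 q.2).re

theorem integrable_prod_fluctuation (hρ : ∀ N, 1 ≤ N → HasSchurGen (ρ N))
    (happ : IsAppropriate (fun N => schurGen (ρ N)) c d) (ha_mono : Monotone a)
    (ha_last : a (Fin.last n) = 1) (L : List (Fin (n + 1) × ℕ+)) (N : ℕ) :
    Integrable (fun ω => (L.map fun q => fluctuation ρ a N q ω).prod) (projMeasure ρ a N) := by
  simp only [prod_fluctuation]
  exact (integrable_prod_powerSum_sub hρ happ ha_mono ha_last _ N).div_const _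

theorem tendsto_integral_prod_fluctuation_complex (hρ : ∀ N, 1 ≤ N → HasSchurGen (ρ N))
    (happ : IsAppropriate (fun N => schurGen (ρ N)) c d) (ha_pos : ∀ t, 0 < a t)
    (ha_mono : Monotone a) (ha_last : a (Fin.last n) = 1) (L : List (Fin (n + 1) × ℕ+)) :
    Tendsto (fun N => ((∫ ω, (L.map fun q => fluctuation ρ a N q ω).prod ∂(projMeasure ρ a N) : ℝ) :
      ℂ)) atTop (𝓝 (wick (fun q q' : Fin (n + 1) × ℕ+ => limCov c d (a q.1) (a q'.1) q.2 q'.2)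
        (levelSort L))) := by
  have h := tendsto_integral_prod_powerSum_sub hρ happ ha_pos ha_mono ha_last
    (L.map (Prod.map id PNat.val))
  rw [levelSort_map (g := Prod.map id PNat.val) (fun q => rfl), wick_map] at h
  refine h.congr fun N => ?_
  simp only [prod_fluctuation]
  rw [integral_div]
  push_cast
  rfl

theorem tendsto_integral_mul_fluctuation (hρ : ∀ N, 1 ≤ N → HasSchurGen (ρ N))
    (happ : IsAppropriate (fun N => schurGen (ρ N)) c d) (ha_pos : ∀ t, 0 < a t)
    (ha_mono : Monotone a) (ha_last : a (Fin.last n) = 1) {q q' : Fin (n + 1) × ℕ+}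
    (h : q.1 ≤ q'.1) :
    Tendsto (fun N => ((∫ ω, fluctuation ρ a N q ω * fluctuation ρ a N q' ω
      ∂(projMeasure ρ a N) : ℝ) : ℂ)) atTop (𝓝 (limCov c d (a q.1) (a q'.1) q.2 q'.2)) := by
  have h1 := tendsto_integral_prod_fluctuation_complex hρ happ ha_pos ha_mono ha_last [q, q']
  rw [levelSort_pair h, wick_pair] at h1
  simpa using h1

/-- For ordered levels the contraction is a limit of real covariances, so its imaginary part
vanishes. -/
theorem ofReal_covLim (hρ : ∀ N, 1 ≤ N → HasSchurGen (ρ N))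
    (happ : IsAppropriate (fun N => schurGen (ρ N)) c d) (ha_pos : ∀ t, 0 < a t)
    (ha_mono : Monotone a) (ha_last : a (Fin.last n) = 1) {q q' : Fin (n + 1) × ℕ+}
    (h : q.1 ≤ q'.1) : (covLim c d a q q' : ℂ) = limCov c d (a q.1) (a q'.1) q.2 q'.2 := by
  have h1 := tendsto_integral_mul_fluctuation hρ happ ha_pos ha_mono ha_last h
  have h2 := (Complex.continuous_im.tendsto _).comp h1
  simp only [Function.comp_def, Complex.ofReal_im] at h2
  rw [covLim, if_pos h]
  exact Complex.ext rfl (tendsto_nhds_unique tendsto_const_nhds h2)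

/-- For distinct levels symmetry is built into `covLim`. On one level both orders of the pair give
limits of the same sequence of covariances. -/
theorem covLim_comm (hρ : ∀ N, 1 ≤ N → HasSchurGen (ρ N))
    (happ : IsAppropriate (fun N => schurGen (ρ N)) c d) (ha_pos : ∀ t, 0 < a t)
    (ha_mono : Monotone a) (ha_last : a (Fin.last n) = 1) (q q' : Fin (n + 1) × ℕ+) :
    covLim c d a q q' = covLim c d a q' q := by
  rcases lt_trichotomy q.1 q'.1 with h | h | h
  · rw [covLim, covLim, if_pos h.le, if_neg (not_le.2 h)]
  · have h1 := tendsto_integral_mul_fluctuation hρ happ ha_pos ha_mono ha_last h.le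
    have h2 := tendsto_integral_mul_fluctuation hρ happ ha_pos ha_mono ha_last h.ge
    rw [covLim, covLim, if_pos h.le, if_pos h.ge]
    refine congrArg Complex.re (tendsto_nhds_unique h1 (h2.congr fun N => ?_))
    simp only [mul_comm]
  · rw [covLim, covLim, if_pos h.le, if_neg (not_le.2 h)]

theorem tendsto_integral_mul_fluctuation_covLim (hρ : ∀ N, 1 ≤ N → HasSchurGen (ρ N))
    (happ : IsAppropriate (fun N => schurGen (ρ N)) c d) (ha_pos : ∀ t, 0 < a t)
    (ha_mono : Monotone a) (ha_last : a (Fin.last n) = 1) (q q' : Fin (n + 1) × ℕ+) :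
    Tendsto (fun N => ∫ ω, fluctuation ρ a N q ω * fluctuation ρ a N q' ω ∂(projMeasure ρ a N))
      atTop (𝓝 (covLim c d a q q')) := by
  wlog h : q.1 ≤ q'.1 generalizing q q'
  · rw [covLim_comm hρ happ ha_pos ha_mono ha_last]
    refine (this q' q (not_le.1 h).le).congr fun N => ?_
    simp only [mul_comm]
  · have h1 := tendsto_integral_mul_fluctuation hρ happ ha_pos ha_mono ha_last h
    rw [← ofReal_covLim hρ happ ha_pos ha_mono ha_last h] at h1
    exact (Complex.continuous_re.tendsto _).comp h1

/-- In the sorted list every pair is ordered by level, so there the complex contraction may be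
replaced by the real symmetric kernel. -/
theorem tendsto_integral_prod_fluctuation (hρ : ∀ N, 1 ≤ N → HasSchurGen (ρ N))
    (happ : IsAppropriate (fun N => schurGen (ρ N)) c d) (ha_pos : ∀ t, 0 < a t)
    (ha_mono : Monotone a) (ha_last : a (Fin.last n) = 1) (L : List (Fin (n + 1) × ℕ+)) :
    Tendsto (fun N => ∫ ω, (L.map fun q => fluctuation ρ a N q ω).prod ∂(projMeasure ρ a N)) atTop
      (𝓝 (wick (covLim c d a) (levelSort L))) := by
  have h := tendsto_integral_prod_fluctuation_complex hρ happ ha_pos ha_mono ha_last L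
  rw [← wick_congr ((levelSort_pairwise L).imp fun {q q'} hq =>
    ofReal_covLim hρ happ ha_pos ha_mono ha_last hq)] at h
  have h1 := map_wick Complex.ofRealHom (covLim c d a) (levelSort L)
  simp only [Complex.ofRealHom_eq_coe] at h1
  rw [← h1] at h
  exact (Complex.continuous_re.tendsto _).comp h

/-- The quadratic form is a limit of second moments of linear combinations of the fluctuations. -/
theorem covLim_nonneg (hρ : ∀ N, 1 ≤ N → HasSchurGen (ρ N))
    (happ : IsAppropriate (fun N => schurGen (ρ N)) c d) (ha_pos : ∀ t, 0 < a t)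
    (ha_mono : Monotone a) (ha_last : a (Fin.last n) = 1) (x : Fin (n + 1) × ℕ+ →₀ ℝ) :
    0 ≤ x.sum fun q r => x.sum fun q' r' => r * r' * covLim c d a q q' := by
  have h : Tendsto (fun N => ∑ q ∈ x.support, ∑ q' ∈ x.support, x q * x q' *
      ∫ ω, fluctuation ρ a N q ω * fluctuation ρ a N q' ω ∂(projMeasure ρ a N)) atTop
      (𝓝 (x.sum fun q r => x.sum fun q' r' => r * r' * covLim c d a q q')) :=
    tendsto_finsetSum _ fun q _ => tendsto_finsetSum _ fun q' _ =>
      (tendsto_integral_mul_fluctuation_covLim hρ happ ha_pos ha_mono ha_last q q').const_mul _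
  refine ge_of_tendsto' h fun N => ?_
  have hi : ∀ q q', Integrable (fun ω => fluctuation ρ a N q ω * fluctuation ρ a N q' ω)
      (projMeasure ρ a N) := fun q q' => by
    simpa using integrable_prod_fluctuation hρ happ ha_mono ha_last [q, q'] N
  have h1 : ∑ q ∈ x.support, ∑ q' ∈ x.support, x q * x q' *
      ∫ ω, fluctuation ρ a N q ω * fluctuation ρ a N q' ω ∂(projMeasure ρ a N) =
      ∫ ω, (∑ q ∈ x.support, x q * fluctuation ρ a N q ω) ^ 2 ∂(projMeasure ρ a N) := by
    simp only [sq, Finset.sum_mul_sum]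
    rw [integral_finsetSum _ fun q _ => integrable_finsetSum _ fun q' _ =>
      ((hi q q').const_mul (x q * x q')).congr (Eventually.of_forall fun ω => by ring)]
    refine Finset.sum_congr rfl fun q _ => ?_
    rw [integral_finsetSum _ fun q' _ =>
      ((hi q q').const_mul (x q * x q')).congr (Eventually.of_forall fun ω => by ring)]
    refine Finset.sum_congr rfl fun q' _ => ?_
    rw [← integral_const_mul]
    exact integral_congr_ae (Eventually.of_forall fun ω => by ring)
  rw [h1]
  exact integral_nonneg fun ω => sq_nonneg _

theorem cov_powerSum (t₁ t₂ : Fin (n + 1)) (k₁ k₂ : ℕ+) (N : ℕ) :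
    cov[fun ω => powerSum k₁ (ω t₁), fun ω => powerSum k₂ (ω t₂); projMeasure ρ a N] /
      (N : ℝ) ^ ((k₁ : ℕ) + (k₂ : ℕ)) = ∫ ω, fluctuation ρ a N (t₁, k₁) ω *
        fluctuation ρ a N (t₂, k₂) ω ∂(projMeasure ρ a N) := by
  rw [covariance, ← integral_div]
  refine integral_congr_ae (Eventually.of_forall fun ω => ?_)
  simp only [fluctuation]
  rw [div_mul_div_comm, pow_add]

end Fluctuations

end SchurCLT

end

theorem theorem2p4 (ρ : ∀ N : ℕ, PMF (Signature N))
    (hρ : ∀ N, 1 ≤ N → HasSchurGen (ρ N))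
    (c : ℕ → ℝ) (d : ℕ → ℕ → ℝ) (happ : IsAppropriate (fun N => schurGen (ρ N)) c d)
    (n : ℕ) (a : Fin (n + 1) → ℝ) (ha_pos : ∀ t, 0 < a t) (ha_mono : Monotone a)
    (ha_last : a (Fin.last n) = 1) :
    (∀ N ω, 0 ≤ configProb ρ a N ω) ∧ (∀ N, IsProbabilityMeasure (projMeasure ρ a N)) ∧
    ∃ (Ω : Type) (_ : MeasurableSpace Ω) (P : Measure Ω) (_ : IsProbabilityMeasure P)
      (ξ : Fin (n + 1) × ℕ+ → Ω → ℝ),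
      IsGaussianProcess ξ P ∧
      (∀ q, ∫ ω, ξ q ω ∂P = 0) ∧
      ConvergesInMoments (projMeasure ρ a) (fluctuation ρ a) P ξ ∧
      ∀ᶠ ε : ℝ in 𝓝[>] 0, ∀ (t₁ t₂ : Fin (n + 1)) (k₁ k₂ : ℕ+), t₁ ≤ t₂ →
        Tendsto (fun N : ℕ =>
            ((cov[fun ω => powerSum k₁ (ω t₁), fun ω => powerSum k₂ (ω t₂); projMeasure ρ a N] /
              (N : ℝ) ^ ((k₁ : ℕ) + (k₂ : ℕ)) : ℝ) : ℂ))
          atTop (𝓝 (covIntegral (limitF c) (limitQ d) ε (a t₁) (a t₂) k₁ k₂)) ∧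
        ((cov[ξ (t₁, k₁), ξ (t₂, k₂); P] : ℝ) : ℂ) =
          covIntegral (limitF c) (limitQ d) ε (a t₁) (a t₂) k₁ k₂ := by
  refine ⟨configProb_nonneg ρ ha_mono, isProbabilityMeasure_projMeasure ρ ha_mono, ?_⟩
  obtain ⟨Ω, mΩ, P, hP, ξ, hξ, hmom⟩ := exists_isGaussianProcess
    (covLim_comm hρ happ ha_pos ha_mono ha_last) (covLim_nonneg hρ happ ha_pos ha_mono ha_last)
  have hmean : ∀ q, ∫ ω, ξ q ω ∂P = 0 := fun q => by
    have h := (hmom [q]).2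
    rw [wick_singleton] at h
    simpa using h
  refine ⟨Ω, mΩ, P, hP, ξ, hξ, hmean, fun s q => ⟨fun N => ?_, ?_, ?_⟩, ?_⟩
  · simpa [List.map_ofFn, List.prod_ofFn, Function.comp_def] using
      integrable_prod_fluctuation hρ happ ha_mono ha_last (List.ofFn q) N
  · simpa [List.map_ofFn, List.prod_ofFn, Function.comp_def] using (hmom (List.ofFn q)).1
  · have h := tendsto_integral_prod_fluctuation hρ happ ha_pos ha_mono ha_last (List.ofFn q)
    rw [← (hmom _).2] at h
    -- The limit is a sum over pairings of the sorted list, hence a Gaussian moment of that list;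
    -- the product itself does not depend on the order.
    have h1 : ∀ ω, ((levelSort (List.ofFn q)).map fun q => ξ q ω).prod =
        ((List.ofFn q).map fun q => ξ q ω).prod := fun ω =>
      ((levelSort_perm (List.ofFn q)).map _).prod_eq
    simp only [h1] at h
    simpa [List.map_ofFn, List.prod_ofFn, Function.comp_def] using h
  · filter_upwards [eventually_covIntegral_eq_limCov happ] with ε hε t₁ t₂ k₁ k₂ ht
    rw [hε _ _ _ _ (ha_pos t₁) (ha_pos t₂)]
    refine ⟨?_, ?_⟩
    · simp only [cov_powerSum]
      exact tendsto_integral_mul_fluctuation hρ happ ha_pos ha_mono ha_last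
        (q := (t₁, k₁)) (q' := (t₂, k₂)) ht
    · have h := (hmom [(t₁, k₁), (t₂, k₂)]).2
      rw [wick_pair] at h
      rw [← ofReal_covLim hρ happ ha_pos ha_mono ha_last (q := (t₁, k₁)) (q' := (t₂, k₂)) ht, ← h,
        covariance, hmean, hmean]
      simp
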